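/- Let $R$ be a normal noetherian domain. A finitely generated $R$-module is reflexive if the canonical map to its $R$-bidual is an isomorphism. A ring $R$ is Gorenstein if it has finite injective dimension over itself. Assume $R$ is Gorenstein and let $M$ be a finitely generated reflexive $R$-module such that $\Lambda=\operatorname{End}_R(M)$ is a non-commutative crepant resolution (NCCR) of $R$: that is, $\Lambda$ is a reflexive $R$-module which is Azumaya in codimension one, $\Lambda$ has finite global dimension, and $\Lambda$ is a maximal Cohen-Macaulay $R$-module. If $\dim R\le 3$, then the following hold. (1) $\operatorname{Ext}^i_\Lambda(M,M)=0$ for all $i>0$. (2) Assume moreover that $R$ is a finitely generated algebra over an algebraically closed field $k$ of characteristic zero, so that $X=\operatorname{Spec}R$ is an algebraic variety. Write $\mathcal D(\Lambda)=D^b(\operatorname{mod}\Lambda)$ and $\mathcal D(X)=D^b(\operatorname{mod}R)$. Then $\mathcal D(\Lambda)$ is a strongly crepant categorical resolution of $X$, with $\pi^*=M\otimes^L_R-:\operatorname{Perf}(X)\to\mathcal D(\Lambda)$ and with the $\operatorname{Perf}(X)$-action $A\otimes_X B=A\otimes^L_R B$. Explicitly: - $\mathcal D(\Lambda)$ is smooth: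 it is equivalent, as a $k$-linear triangulated category, to $\operatorname{Perf}(A)$ for a smooth $k$-algebra $A$ (i.e. $A$ is perfect over $A\otimes_k A^{\mathrm{op}}$), where $A$ is viewed as a DG-algebra in degree $0$. - There is an exact functor $\pi_*:\mathcal D(\Lambda)\to\mathcal D(X)$ with natural isomorphisms $\operatorname{Hom}_{\mathcal D(\Lambda)}(\pi^*A,B)\cong\operatorname{Hom}_{\mathcal D(X)}(A,\pi_*B)$ for $A\in\operatorname{Perf}(X)$, $B\in\mathcal D(\Lambda)$, and the unit $A\to\pi_*\pi^*A$ is an isomorphism for all $A\in\operatorname{Perf}(X)$. - The action makes $\mathcal D(\Lambda)$ a module category over the monoidal category $\operatorname{Perf}(X)$, it is exact in both arguments, and $\pi^*$ is $\operatorname{Perf}(X)$-linear. - There are objects $\operatorname{RHom}_{\mathcal D(\Lambda)/X}(B,C)\in\mathcal D(X)$, functorial in $B,C\in\mathcal D(\Lambda)$, with natural isomorphisms $\operatorname{Hom}_{\mathcal D(\Lambda)}(A\otimes_X B,C)\cong\operatorname{Hom}_{\mathcal D(X)}(A,\operatorname{RHom}_{\mathcal D(\Lambda)/X}(B,C))$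 for $A\in\operatorname{Perf}(X)$. - The identity functor is a relative Serre functor: there are isomorphisms $\operatorname{RHom}_R(\operatorname{RHom}_{\mathcal D(\Lambda)/X}(B,C),R)\cong\operatorname{RHom}_{\mathcal D(\Lambda)/X}(C,B)$, natural in $B,C\in\mathcal D(\Lambda)$. -/

import Mathlib

open CategoryTheory Limits MonoidalCategory

universe v w u

namespace NCCR

/-! ### Non-commutative crepant resolutions -/

/-- `R` is Gorenstein: it has finite injective dimension as a module over itself. -/
def IsGorenstein (R : Type u) [CommRing R] : Prop :=
  ∃ n : ℕ, HasInjectiveDimensionLE (ModuleCat.of R R) n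

/-- `A` has finite (left) global dimension. -/
def HasFiniteGlobalDimension (A : Type u) [Ring A] : Prop :=
  ∃ n : ℕ, ∀ X : ModuleCat.{u} A, HasProjectiveDimensionLE X n

/-- A maximal Cohen-Macaulay module over a noetherian ring `R`: a finitely generated module `N`
such that for every maximal ideal `m` the depth of `N_m` equals `dim R_m`, i.e. there is an
`N_m`-regular sequence in the maximal ideal of `R_m` of length `dim R_m`. -/
structure IsMaximalCohenMacaulay (R : Type u) [CommRing R] (N : Type u) [AddCommGroup N]
    [Module R N] : Prop where
  finite : Module.Finite R N
  exists_isRegular : ∀ (m : Ideal R) [m.IsMaximal],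
    ∃ rs : List (Localization.AtPrime m),
      (∀ r ∈ rs, r ∈ IsLocalRing.maximalIdeal (Localization.AtPrime m)) ∧
      RingTheory.Sequence.IsRegular (LocalizedModule m.primeCompl N) rs ∧
      ((rs.length : ℕ∞) : WithBot ℕ∞) = ringKrullDim (Localization.AtPrime m)

open scoped TensorProduct in
/-- A reflexive Azumaya algebra: an `R`-algebra which is a finitely generated reflexive `R`-module
and which is Azumaya in codimension one. -/
structure IsReflexiveAzumaya (R : Type u) [CommRing R] (Λ : Type u) [Ring Λ] [Algebra R Λ] :
    Prop where
  finite : Module.Finite R Λ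
  reflexive : Module.IsReflexive R Λ
  azumaya : ∀ (p : Ideal R) [p.IsPrime], p.height ≤ 1 →
    IsAzumaya (Localization.AtPrime p) (Localization.AtPrime p ⊗[R] Λ)

/-- A reflexive Azumaya algebra is trivial if it is of the form `End_R(M)` with `M` a (finitely
generated) reflexive `R`-module. -/
def IsTrivialReflexiveAzumaya (R : Type u) [CommRing R] (Λ : Type u) [Ring Λ] [Algebra R Λ] :
    Prop :=
  ∃ (M : Type u) (_ : AddCommGroup M) (_ : Module R M),
    Module.Finite R M ∧ Module.IsReflexive R M ∧ Nonempty (Λ ≃ₐ[R] Module.End R M)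

/-- `Λ` is a non-commutative crepant resolution of `R` (for `R` a normal noetherian domain). -/
structure IsNCCR (R : Type u) [CommRing R] (Λ : Type u) [Ring Λ] [Algebra R Λ] : Prop where
  gorenstein : IsGorenstein R
  reflexiveAzumaya : IsReflexiveAzumaya R Λ
  trivial : IsTrivialReflexiveAzumaya R Λ
  finiteGlobalDimension : HasFiniteGlobalDimension Λ
  maximalCohenMacaulay : IsMaximalCohenMacaulay R Λ

/-! ### Perfect complexes -/

/-- A strictly perfect complex: a bounded complex of finitely generated projective modules. -/
def IsStrictlyPerfect (A : Type u) [Ring A] : ObjectProperty (CochainComplex (ModuleCat.{u} A) ℤ) :=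
  fun K => (∀ n, Module.Finite A (K.X n) ∧ Module.Projective A (K.X n)) ∧
    (∃ a : ℤ, K.IsStrictlyGE a) ∧ ∃ b : ℤ, K.IsStrictlyLE b

theorem tensor_X_isZero {R : Type u} [CommRing R] (K L : CochainComplex (ModuleCat.{u} R) ℤ)
    (n : ℤ) (h : ∀ i j, i + j = n → IsZero (K.X i) ∨ IsZero (L.X j)) : IsZero ((K ⊗ L).X n) := by
  rw [IsZero.iff_id_eq_zero]
  refine HomologicalComplex.mapBifunctor.hom_ext (K₁ := K) (K₂ := L)
    (F := curriedTensor (ModuleCat.{u} R)) (c := .up ℤ) (fun i j hij => ?_)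
  refine IsZero.eq_of_src ?_ _ _
  rcases h i j hij with h | h
  · exact Functor.map_isZero ((curriedTensor (ModuleCat.{u} R)).flip.obj (L.X j)) h
  · exact Functor.map_isZero ((curriedTensor (ModuleCat.{u} R)).obj (K.X i)) h

theorem tensor_X_projective {R : Type u} [CommRing R] (K L : CochainComplex (ModuleCat.{u} R) ℤ)
    (hK : ∀ n, Module.Projective R (K.X n)) (hL : ∀ n, Module.Projective R (L.X n)) (n : ℤ) :
    Module.Projective R ((K ⊗ L).X n) := by
  rw [IsProjective.iff_projective]
  have (i j : ℤ) : Projective (K.X i ⊗ L.X j) := by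
    have := hK i
    have := hL j
    exact (IsProjective.iff_projective (TensorProduct R (K.X i) (L.X j))).1 inferInstance
  have (i j : ℤ) : Projective (((curriedTensor (ModuleCat.{u} R)).obj (K.X i)).obj (L.X j)) :=
    this i j
  refine ⟨fun f e _ => ⟨HomologicalComplex.mapBifunctorDesc (fun i j hij =>
    Projective.factorThru (HomologicalComplex.ιTensorObj K L i j n hij ≫ f) e), ?_⟩⟩
  refine HomologicalComplex.mapBifunctor.hom_ext (K₁ := K) (K₂ := L)
    (F := curriedTensor (ModuleCat.{u} R)) (c := .up ℤ) (fun i j hij => ?_)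
  rw [HomologicalComplex.ι_mapBifunctorDesc_assoc, Projective.factorThru_comp]

theorem tensor_X_finite {R : Type u} [CommRing R] (K L : CochainComplex (ModuleCat.{u} R) ℤ)
    (hK : ∀ n, Module.Finite R (K.X n)) (hL : ∀ n, Module.Finite R (L.X n))
    (a b : ℤ) [K.IsStrictlyGE a] [K.IsStrictlyLE b] (n : ℤ) :
    Module.Finite R ((K ⊗ L).X n) := by
  let f (i : ℤ) := HomologicalComplex.ιTensorObj K L i (n - i) n (by lia)
  let N : Submodule R ((K ⊗ L).X n) := ⨆ i ∈ Finset.Icc a b, LinearMap.range (f i).hom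
  have hN : N = ⊤ := by
    rw [← Submodule.ker_mkQ N, LinearMap.ker_eq_top]
    have : ModuleCat.ofHom N.mkQ = 0 := by
      refine HomologicalComplex.mapBifunctor.hom_ext (K₁ := K) (K₂ := L)
        (F := curriedTensor (ModuleCat.{u} R)) (c := .up ℤ) (fun i j hij => ?_)
      by_cases hi : i ∈ Finset.Icc a b
      · obtain rfl : j = n - i := by
          have : i + j = n := hij
          lia
        ext1
        rw [Limits.comp_zero]
        refine LinearMap.ext fun x => ?_
        refine (Submodule.Quotient.mk_eq_zero N).2 ?_
        exact (le_iSup₂_of_le (f := fun i (_ : i ∈ Finset.Icc a b) => LinearMap.range (f i).hom)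
          i hi le_rfl) ⟨x, rfl⟩
      · refine IsZero.eq_of_src (Functor.map_isZero
          ((curriedTensor (ModuleCat.{u} R)).flip.obj (L.X j)) ?_) _ _
        rw [Finset.mem_Icc, not_and_or, not_le, not_le] at hi
        rcases hi with hi | hi
        · exact K.isZero_of_isStrictlyGE a i hi
        · exact K.isZero_of_isStrictlyLE b i hi
    exact congrArg ModuleCat.Hom.hom this
  refine ⟨hN ▸ Submodule.fg_biSup _ _ fun i _ => ?_⟩
  have := hK i
  have := hL (n - i)
  have : Module.Finite R ↑(((curriedTensor (ModuleCat.{u} R)).obj (K.X i)).obj (L.X (n - i))) :=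
    inferInstanceAs (Module.Finite R (TensorProduct R (K.X i) (L.X (n - i))))
  have : Module.Finite R ↑(K.X i ⊗ L.X (n - i)) := this
  exact Module.Finite.iff_fg.1 (Module.Finite.range (f i).hom)

theorem single_isStrictlyPerfect (A : Type u) [Ring A] (P : ModuleCat.{u} A)
    [Module.Finite A P] [Module.Projective A P] :
    IsStrictlyPerfect A ((HomologicalComplex.single _ (.up ℤ) 0).obj P) := by
  refine ⟨fun n => ?_, ⟨0, inferInstance⟩, ⟨0, inferInstance⟩⟩
  by_cases h : n = 0
  · subst h
    let e := (HomologicalComplex.singleObjXSelf (.up ℤ) 0 P).toLinearEquiv.symm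
    exact ⟨Module.Finite.equiv e, Module.Projective.of_equiv e⟩
  · have := HomologicalComplex.isZero_single_obj_X (.up ℤ) 0 P n h
    have := ModuleCat.subsingleton_of_isZero this
    exact ⟨inferInstance, inferInstance⟩

instance (R : Type u) [CommRing R] : (IsStrictlyPerfect R).IsMonoidal where
  prop_unit := by
    have : Module.Finite R (𝟙_ (ModuleCat.{u} R)) := inferInstanceAs (Module.Finite R R)
    have : Module.Projective R (𝟙_ (ModuleCat.{u} R)) := inferInstanceAs (Module.Projective R R)
    exact single_isStrictlyPerfect R (𝟙_ (ModuleCat.{u} R))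
  prop_tensor K L := by
    rintro ⟨hK, ⟨a, _⟩, ⟨b, _⟩⟩ ⟨hL, ⟨a', _⟩, ⟨b', _⟩⟩
    refine ⟨fun n => ⟨tensor_X_finite K L (fun n => (hK n).1) (fun n => (hL n).1) a b n,
      tensor_X_projective K L (fun n => (hK n).2) (fun n => (hL n).2) n⟩, ⟨a + a', ?_⟩, ⟨b + b', ?_⟩⟩
    · rw [CochainComplex.isStrictlyGE_iff]
      intro n hn
      refine tensor_X_isZero K L n fun i j hij => ?_
      by_cases hi : i < a
      · exact .inl (K.isZero_of_isStrictlyGE a i hi)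
      · exact .inr (L.isZero_of_isStrictlyGE a' j (by lia))
    · rw [CochainComplex.isStrictlyLE_iff]
      intro n hn
      refine tensor_X_isZero K L n fun i j hij => ?_
      by_cases hi : b < i
      · exact .inl (K.isZero_of_isStrictlyLE b i hi)
      · exact .inr (L.isZero_of_isStrictlyLE b' j (by lia))

noncomputable instance hasDerivedCategoryModuleCat (A : Type u) [Ring A] :
    HasDerivedCategory.{u + 1} (ModuleCat.{u} A) :=
  HasDerivedCategory.standard _

/-- A perfect complex: an object of `D(A)` which is isomorphic to a strictly perfect complex. -/
def IsPerfect (A : Type u) [Ring A] : ObjectProperty (DerivedCategory (ModuleCat.{u} A)) :=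
  fun X => ∃ K, IsStrictlyPerfect A K ∧ Nonempty (X ≅ DerivedCategory.Q.obj K)

theorem IsStrictlyPerfect.shift {A : Type u} [Ring A] {K : CochainComplex (ModuleCat.{u} A) ℤ}
    (hK : IsStrictlyPerfect A K) (n : ℤ) : IsStrictlyPerfect A (K⟦n⟧) := by
  obtain ⟨h, ⟨a, _⟩, ⟨b, _⟩⟩ := hK
  exact ⟨fun i => h (i + n), ⟨a - n, K.isStrictlyGE_shift a n _ (by lia)⟩,
    ⟨b - n, K.isStrictlyLE_shift b n _ (by lia)⟩⟩

theorem IsStrictlyPerfect.isKProjective {A : Type u} [Ring A]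
    {K : CochainComplex (ModuleCat.{u} A) ℤ} (hK : IsStrictlyPerfect A K) : K.IsKProjective := by
  obtain ⟨h, -, ⟨b, _⟩⟩ := hK
  have (n : ℤ) : Projective (K.X n) := (IsProjective.iff_projective _).1 (h n).2
  exact CochainComplex.isKProjective_of_projective K b

theorem IsStrictlyPerfect.mappingCone {A : Type u} [Ring A]
    {K L : CochainComplex (ModuleCat.{u} A) ℤ} (f : K ⟶ L) (hK : IsStrictlyPerfect A K)
    (hL : IsStrictlyPerfect A L) : IsStrictlyPerfect A (CochainComplex.mappingCone f) := by
  obtain ⟨hK, ⟨a, _⟩, ⟨b, _⟩⟩ := hK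
  obtain ⟨hL, ⟨a', _⟩, ⟨b', _⟩⟩ := hL
  refine ⟨fun n => ?_, ⟨min (a - 1) a', ?_⟩, ⟨max b b', ?_⟩⟩
  · obtain ⟨_, _⟩ := hK (n + 1)
    obtain ⟨_, _⟩ := hL n
    have e₁ := HomologicalComplex.homotopyCofiber.XIsoBiprod f n (n + 1) rfl
    let e := (e₁ ≪≫ ModuleCat.biprodIsoProd _ _).toLinearEquiv.symm
    have h₁ : Module.Finite A (K.X (n + 1) × L.X n) := inferInstance
    have h₂ : Module.Projective A (K.X (n + 1) × L.X n) := inferInstance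
    exact ⟨Module.Finite.equiv e, Module.Projective.of_equiv e⟩
  · rw [CochainComplex.isStrictlyGE_iff]
    intro i hi
    rw [CochainComplex.mappingCone.isZero_X_iff]
    exact ⟨K.isZero_of_isStrictlyGE a _ (by lia), L.isZero_of_isStrictlyGE a' _ (by lia)⟩
  · rw [CochainComplex.isStrictlyLE_iff]
    intro i hi
    rw [CochainComplex.mappingCone.isZero_X_iff]
    exact ⟨K.isZero_of_isStrictlyLE b _ (by lia), L.isZero_of_isStrictlyLE b' _ (by lia)⟩

theorem IsPerfect.shift {A : Type u} [Ring A] {X : DerivedCategory (ModuleCat.{u} A)}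
    (hX : IsPerfect A X) (n : ℤ) : IsPerfect A (X⟦n⟧) := by
  obtain ⟨K, hK, ⟨e⟩⟩ := hX
  exact ⟨K⟦n⟧, hK.shift n, ⟨(shiftFunctor _ n).mapIso e ≪≫
    (DerivedCategory.Q.commShiftIso n).symm.app K⟩⟩

instance (A : Type u) [Ring A] : (IsPerfect A).IsClosedUnderIsomorphisms where
  of_iso e := by
    rintro ⟨K, hK, ⟨e'⟩⟩
    exact ⟨K, hK, ⟨e.symm ≪≫ e'⟩⟩

instance (A : Type u) [Ring A] : (IsPerfect A).IsTriangulated where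
  exists_zero := ⟨_, Functor.map_isZero DerivedCategory.Q (Functor.map_isZero
      (HomologicalComplex.single (ModuleCat.{u} A) (.up ℤ) 0) (isZero_zero _)),
    ⟨_, by
      have := ModuleCat.subsingleton_of_isZero (isZero_zero (ModuleCat.{u} A))
      exact single_isStrictlyPerfect A _, ⟨Iso.refl _⟩⟩⟩
  isStableUnderShiftBy n := ⟨fun _ hX => hX.shift n⟩
  ext₂' T hT := by
    rintro ⟨K, hK, ⟨e₁⟩⟩ ⟨L, hL, ⟨e₃⟩⟩
    refine ObjectProperty.le_isoClosure _ _ ?_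
    have := hL.isKProjective
    let e₁' : T.obj₁⟦(1 : ℤ)⟧ ≅ DerivedCategory.Q.obj (K⟦(1 : ℤ)⟧) :=
      (shiftFunctor _ (1 : ℤ)).mapIso e₁ ≪≫ (DerivedCategory.Q.commShiftIso (1 : ℤ)).symm.app K
    let q := DerivedCategory.quotientCompQhIso (ModuleCat.{u} A)
    obtain ⟨g, hg⟩ := (CochainComplex.IsKProjective.Qh_map_bijective L
      ((HomotopyCategory.quotient _ _).obj (K⟦(1 : ℤ)⟧))).surjective
      (q.hom.app L ≫ (e₃.inv ≫ T.mor₃ ≫ e₁'.hom) ≫ q.inv.app _)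
    obtain ⟨f, rfl⟩ := (HomotopyCategory.quotient _ _).map_surjective g
    have hf : DerivedCategory.Q.map f = e₃.inv ≫ T.mor₃ ≫ e₁'.hom := by
      rw [← cancel_epi (q.hom.app L), ← cancel_mono (q.inv.app _), Category.assoc, Category.assoc]
      refine Eq.trans ?_ hg
      simp [q]
    have hT' := Pretriangulated.rot_of_distTriang _ (Pretriangulated.rot_of_distTriang _ hT)
    let e := Pretriangulated.isoTriangleOfIso₁₂ _ _ hT'
      (DerivedCategory.mappingCone_triangle_distinguished f) e₃ e₁' (by
        change T.mor₃ ≫ e₁'.hom = e₃.hom ≫ DerivedCategory.Q.map f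
        simp [hf])
    have h2 : IsPerfect A (T.obj₂⟦(1 : ℤ)⟧) :=
      ⟨_, hL.mappingCone f (hK.shift 1), ⟨Pretriangulated.Triangle.π₃.mapIso e⟩⟩
    exact (IsPerfect A).prop_of_iso ((shiftEquiv _ (1 : ℤ)).unitIso.symm.app T.obj₂)
      (h2.shift (-1))

/-! ### The bounded derived category of finitely generated modules -/

/-- All cohomology modules are finitely generated. -/
def HasFiniteCohomology (A : Type u) [Ring A] :
    ObjectProperty (DerivedCategory (ModuleCat.{u} A)) :=
  fun X => ∀ n, Module.Finite A ((DerivedCategory.homologyFunctor (ModuleCat.{u} A) n).obj X)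

instance (A : Type u) [Ring A] : (HasFiniteCohomology A).IsClosedUnderIsomorphisms where
  of_iso e h n := by
    have := h n
    exact Module.Finite.equiv
      ((DerivedCategory.homologyFunctor (ModuleCat.{u} A) n).mapIso e).toLinearEquiv

instance (A : Type u) [Ring A] [IsNoetherianRing A] : (HasFiniteCohomology A).IsTriangulated where
  exists_zero := ⟨_, isZero_zero (DerivedCategory (ModuleCat.{u} A)), fun n => by
    have := ModuleCat.subsingleton_of_isZero (Functor.map_isZero
      (DerivedCategory.homologyFunctor (ModuleCat.{u} A) n) (isZero_zero _))
    infer_instance⟩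
  isStableUnderShiftBy n := ⟨fun X hX i => by
    have : Module.Finite A
      ↑(((DerivedCategory.homologyFunctor (ModuleCat.{u} A) 0).shift (i + n)).obj X) := hX (i + n)
    exact Module.Finite.equiv (((DerivedCategory.homologyFunctor (ModuleCat.{u} A) 0).shiftIso
      n i (i + n) (by lia)).app X).toLinearEquiv.symm⟩
  ext₂' T hT h₁ h₃ := ObjectProperty.le_isoClosure _ _ fun n => by
    have := h₁ n
    have := h₃ n
    have hex := (ShortComplex.ShortExact.moduleCat_exact_iff_function_exact _).1
      (DerivedCategory.HomologySequence.exact₂ T hT n)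
    have := isNoetherian_of_range_eq_ker _ _ (LinearMap.exact_iff.1 hex).symm
    exact Module.IsNoetherian.finite A _


/-- Complexes with bounded and finitely generated cohomology. -/
def IsBoundedCoherent (A : Type u) [Ring A] :
    ObjectProperty (DerivedCategory (ModuleCat.{u} A)) :=
  DerivedCategory.TStructure.t.bounded ⊓ HasFiniteCohomology A

instance (A : Type u) [Ring A] [IsNoetherianRing A] : (IsBoundedCoherent A).IsTriangulated :=
  inferInstanceAs (DerivedCategory.TStructure.t.bounded ⊓ HasFiniteCohomology A).IsTriangulated

/-- For `A` noetherian: the category `D^b(mod A)`, realized as the full subcategory of `D(A)` of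
the complexes with bounded and finitely generated cohomology. -/
abbrev DbMod (A : Type u) [Ring A] := (IsBoundedCoherent A).FullSubcategory

/-- The category of perfect complexes, a full triangulated subcategory of `D(A)`. -/
abbrev Perf (A : Type u) [Ring A] := (IsPerfect A).FullSubcategory

/-- The category of strictly perfect complexes with the morphisms of complexes. For `A` commutative
it is a monoidal category (tensor product of complexes), and `Perf A` is its localization at the
quasi-isomorphisms. -/
abbrev StrictPerf (A : Type u) [Ring A] := (IsStrictlyPerfect A).FullSubcategory

/-- The localization functor from strictly perfect complexes to `Perf A`. -/
noncomputable def StrictPerf.toPerf (A : Type u) [Ring A] : StrictPerf A ⥤ Perf A :=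
  (IsPerfect A).lift ((IsStrictlyPerfect A).ι ⋙ DerivedCategory.Q)
    (fun K => ⟨_, K.property, ⟨Iso.refl _⟩⟩)

section Tensor
open scoped TensorProduct

variable (R : Type u) [CommRing R] (Λ : Type u) [Ring Λ] [Algebra R Λ]

/-- The `R`-module underlying a module over an `R`-algebra. -/
@[reducible]
def restrictedModule (V : ModuleCat.{u} Λ) : Module R V := Module.restrictScalars R Λ V

attribute [local instance] restrictedModule

theorem restrictedModule_isScalarTower (V : ModuleCat.{u} Λ) : IsScalarTower R Λ V :=
  IsScalarTower.restrictScalars R Λ V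

attribute [local instance] restrictedModule_isScalarTower

/-- For an `R`-algebra `Λ`, the bifunctor which sends an `R`-module `N` and a `Λ`-module `V` to the
`Λ`-module `N ⊗_R V` (written as `V ⊗[R] N`, with `Λ` acting through `V`). -/
noncomputable def tensorBifunctor : ModuleCat.{u} R ⥤ ModuleCat.{u} Λ ⥤ ModuleCat.{u} Λ where
  obj N :=
    { obj V := ModuleCat.of Λ (V ⊗[R] N)
      map f := ModuleCat.ofHom (TensorProduct.AlgebraTensorModule.map f.hom LinearMap.id)
      map_id V := by ext1; exact TensorProduct.AlgebraTensorModule.map_id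
      map_comp f g := by
        ext1
        exact TensorProduct.AlgebraTensorModule.map_comp g.hom f.hom LinearMap.id LinearMap.id }
  map g :=
    { app V := ModuleCat.ofHom (TensorProduct.AlgebraTensorModule.map LinearMap.id g.hom)
      naturality V W f := by
        ext1
        refine (TensorProduct.AlgebraTensorModule.map_comp _ _ _ _).symm.trans ?_
        exact (TensorProduct.AlgebraTensorModule.map_comp f.hom LinearMap.id LinearMap.id g.hom) }
  map_id N := by
    ext V : 3
    exact TensorProduct.AlgebraTensorModule.map_id
  map_comp f g := by
    ext V : 3
    exact TensorProduct.AlgebraTensorModule.map_comp LinearMap.id LinearMap.id g.hom f.hom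

instance : (tensorBifunctor R Λ).Additive where
  map_add {N N' f g} := by
    ext V : 3
    exact TensorProduct.AlgebraTensorModule.map_add_right _ _ _

instance (N : ModuleCat.{u} R) : ((tensorBifunctor R Λ).obj N).Additive where
  map_add {V V' f g} := by
    ext : 1
    exact TensorProduct.AlgebraTensorModule.map_add_left _ _ _

end Tensor

/-- The functor `P ↦ Hom_R(P, R)` on complexes of `R`-modules. -/
noncomputable def dualComplex (R : Type u) [CommRing R] :
    (CochainComplex (ModuleCat.{u} R) ℤ)ᵒᵖ ⥤ CochainComplex (ModuleCat.{u} R) ℤ :=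
  (CochainComplex.opEquivalence (ModuleCat.{u} R)).functor ⋙
    ((linearYoneda R (ModuleCat.{u} R)).obj (ModuleCat.of R R)).mapHomologicalComplex (.up ℤ)

/-- Complexes whose class in `D(A)` lies in `D^b(mod A)`. -/
abbrev BoundedCoherentComplex (A : Type u) [Ring A] :=
  ((IsBoundedCoherent A).inverseImage
    (DerivedCategory.Q (C := ModuleCat.{u} A))).FullSubcategory

/-- The class in `D^b(mod A)` of a complex with bounded and finitely generated cohomology. -/
noncomputable def DbMod.ofComplex (A : Type u) [Ring A] : BoundedCoherentComplex A ⥤ DbMod A :=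
  (IsBoundedCoherent A).lift (ObjectProperty.ι _ ⋙ DerivedCategory.Q) (fun K => K.property)

/-- Bounded above complexes of projective modules. -/
def IsBoundedAboveProjective (A : Type u) [Ring A] : ObjectProperty (BoundedCoherentComplex A) :=
  fun P => (∃ d : ℤ, P.obj.IsStrictlyLE d) ∧ ∀ n, Module.Projective A (P.obj.X n)

/-- `F` is the functor `RHom_R(-, R)` on `D^b(mod R)`: on bounded above complexes of projective
modules it is given by `P ↦ Hom_R(P, R)`. Since every object of `D^b(mod R)` is represented by such
a complex and all morphisms between them come from morphisms of complexes, this determines `F` up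
to a unique isomorphism. -/
def IsDerivedDual (R : Type u) [CommRing R]
    (F : (DbMod R)ᵒᵖ ⥤ DerivedCategory (ModuleCat.{u} R)) : Prop :=
  Nonempty (((IsBoundedAboveProjective R).ι ⋙ DbMod.ofComplex R).op ⋙ F ≅
    ((IsBoundedAboveProjective R).ι ⋙ ObjectProperty.ι _).op ⋙ dualComplex R ⋙ DerivedCategory.Q)

/-! ### Smooth triangulated categories -/

open scoped TensorProduct in
/-- A `k`-algebra `A` is (homologically) smooth if `A` is perfect as a module over `A ⊗ Aᵒᵖ`. -/
def IsSmoothAlgebra (k : Type v) [Field k] (A : Type u) [Ring A] [Algebra k A] : Prop :=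
  letI : Module (A ⊗[k] Aᵐᵒᵖ) A := TensorProduct.Algebra.module
  IsPerfect (A ⊗[k] Aᵐᵒᵖ)
    ((DerivedCategory.singleFunctor (ModuleCat.{u} (A ⊗[k] Aᵐᵒᵖ)) 0).obj
      (ModuleCat.of (A ⊗[k] Aᵐᵒᵖ) A))

section Triangulated

variable (k : Type v) [Field k] (R : Type u) [CommRing R] [IsNoetherianRing R] [Algebra k R]
  (D : Type w) [Category.{w} D] [HasZeroObject D] [HasShift D ℤ] [Preadditive D] [Linear k D]
  [∀ n : ℤ, (shiftFunctor D n).Additive] [Pretriangulated D]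

/-- The triangulated category `D` is equivalent to the category of perfect modules over a smooth
algebra `A`. Here `A` is an ordinary algebra, i.e. a DG-algebra concentrated in degree zero, so that
this implies smoothness of `D` in the sense of DG-algebras. -/
def IsSmoothTriangulated : Prop :=
  ∃ (A : Type u) (_ : Ring A) (_ : Algebra k A), IsSmoothAlgebra k A ∧
    ∃ (E : D ≌ Perf A) (_ : E.functor.CommShift ℤ),
      E.functor.IsTriangulated ∧ E.functor.Linear k

/-- A categorical resolution of `D^b(coh X)` for `X = Spec R`: a smooth triangulated category `D`
with exact functors `π^* : Perf(X) → D` and `π_* : D → D^b(coh X)` which are adjoint, and such that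
the unit `A → π_* π^* A` is an isomorphism for `A` in `Perf(X)`. -/
structure CategoricalResolution where
  smooth : IsSmoothTriangulated.{v, w, u} k D
  pullback : Perf R ⥤ D
  pullbackCommShift : pullback.CommShift ℤ
  pullback_isTriangulated : pullback.IsTriangulated
  pullback_linear : pullback.Linear k
  pushforward : D ⥤ DbMod R
  pushforwardCommShift : pushforward.CommShift ℤ
  pushforward_isTriangulated : pushforward.IsTriangulated
  pushforward_linear : pushforward.Linear k
  adj (A : Perf R) (B : D) : (pullback.obj A ⟶ B) ≃ (A.obj ⟶ (pushforward.obj B).obj)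
  adj_naturality_left {A A' : Perf R} {B : D} (f : A' ⟶ A) (g : pullback.obj A ⟶ B) :
    adj A' B (pullback.map f ≫ g) = f.hom ≫ adj A B g
  adj_naturality_right {A : Perf R} {B B' : D} (g : pullback.obj A ⟶ B) (h : B ⟶ B') :
    adj A B' (g ≫ h) = adj A B g ≫ (pushforward.map h).hom
  isIso_unit (A : Perf R) : IsIso (adj A (pullback.obj A) (𝟙 _))

open scoped MonoidalLeftAction in
/-- A `Perf(X)`-module structure on `D`, for `X = Spec R`, together with the relative Hom
`RHom_{D/X}`. An action of the monoidal category `Perf(X)` is the same as an action of the monoidal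
category of strictly perfect complexes which inverts quasi-isomorphisms; the latter is part of
`exact_left`. -/
structure PerfModule where
  action : MonoidalLeftAction (StrictPerf R) D
  /-- `A ↦ A ⊗ B` comes from an exact functor on `Perf(X)`. -/
  exact_left (B : D) : ∃ (F : Perf R ⥤ D) (_ : F.CommShift ℤ), F.IsTriangulated ∧ F.Linear k ∧
    Nonempty (StrictPerf.toPerf R ⋙ F ≅ MonoidalLeftAction.actionRight (StrictPerf R) B)
  /-- `B ↦ A ⊗ B` is exact. -/
  exact_right (A : StrictPerf R) : ∃ _ : (MonoidalLeftAction.actionLeft D A).CommShift ℤ,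
    (MonoidalLeftAction.actionLeft D A).IsTriangulated ∧
    (MonoidalLeftAction.actionLeft D A).Linear k
  /-- The functor `RHom_{D/X}(-,-)`. -/
  rhom : Dᵒᵖ ⥤ D ⥤ DbMod R
  /-- `RHom_{D/X}(B,-)` is right adjoint to `A ↦ A ⊗ B`. -/
  homEquiv (A : StrictPerf R) (B C : D) :
    (A ⊙ₗ B ⟶ C) ≃ (((StrictPerf.toPerf R).obj A).obj ⟶ ((rhom.obj (.op B)).obj C).obj)
  homEquiv_naturality_left {A A' : StrictPerf R} {B C : D} (f : A' ⟶ A) (g : A ⊙ₗ B ⟶ C) :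
    homEquiv A' B C (f ⊵ₗ B ≫ g) = ((StrictPerf.toPerf R).map f).hom ≫ homEquiv A B C g
  homEquiv_naturality_middle {A : StrictPerf R} {B B' C : D} (f : B' ⟶ B) (g : A ⊙ₗ B ⟶ C) :
    homEquiv A B' C (A ⊴ₗ f ≫ g) = homEquiv A B C g ≫ ((rhom.map f.op).app C).hom
  homEquiv_naturality_right {A : StrictPerf R} {B C C' : D} (g : A ⊙ₗ B ⟶ C) (h : C ⟶ C') :
    homEquiv A B C' (g ≫ h) = homEquiv A B C g ≫ ((rhom.obj (.op B)).map h).hom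

variable {k R D} in
/-- The autoequivalence `S` is a relative Serre functor for `D/X`: there are isomorphisms
`RHom_X(RHom_{D/X}(B, C), O_X) ≅ RHom_{D/X}(C, S B)`, natural in `B` and `C`. -/
def PerfModule.IsRelativeSerreFunctor (T : PerfModule k R D) (S : D ≌ D) : Prop :=
  ∃ F : (DbMod R)ᵒᵖ ⥤ DerivedCategory (ModuleCat.{u} R), IsDerivedDual R F ∧
    ∃ e : ∀ B C : D, F.obj (.op ((T.rhom.obj (.op B)).obj C)) ≅
        ((T.rhom.obj (.op C)).obj (S.functor.obj B)).obj,
      (∀ (B B' C : D) (f : B ⟶ B'),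
        F.map ((T.rhom.map f.op).app C).op ≫ (e B' C).hom =
          (e B C).hom ≫ ((T.rhom.obj (.op C)).map (S.functor.map f)).hom) ∧
      (∀ (B C C' : D) (g : C ⟶ C'),
        F.map ((T.rhom.obj (.op B)).map g).op ≫ (e B C).hom =
          (e B C').hom ≫ ((T.rhom.map g.op).app (S.functor.obj B)).hom)

/-- A strongly crepant categorical resolution `(D, π_*, π^*, ⊗_X)` of `X = Spec R`: a categorical
resolution with a `Perf(X)`-module structure such that the identity is a relative Serre functor and
such that `π^*` is linear for the action of `Perf(X)`. -/
structure StronglyCrepantCategoricalResolution extends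
    CategoricalResolution.{v, w, u} k R D, PerfModule k R D where
  crepant : toPerfModule.IsRelativeSerreFunctor (CategoryTheory.Equivalence.refl (C := D))
  pullbackLeftLinear :
    letI := action
    (StrictPerf.toPerf R ⋙ pullback).LeftLinear (StrictPerf R)

end Triangulated

section Standard

variable {k : Type v} [Field k] {R : Type u} [CommRing R] [IsNoetherianRing R] [Algebra k R]
  {Λ : Type u} [Ring Λ] [IsNoetherianRing Λ] [Algebra k Λ] [Algebra R Λ]

/-- The functor `π^*` is `N ↦ M ⊗^L_R N`. -/
def CategoricalResolution.IsDerivedTensor (S : CategoricalResolution.{v, u + 1, u} k R (DbMod Λ))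
    (M : ModuleCat.{u} Λ) : Prop :=
  Nonempty (StrictPerf.toPerf R ⋙ S.pullback ⋙ (IsBoundedCoherent Λ).ι ≅
    (IsStrictlyPerfect R).ι ⋙
      ((tensorBifunctor R Λ).flip.obj M).mapHomologicalComplex (.up ℤ) ⋙ DerivedCategory.Q)

/-- The action of `Perf(X)` on `D^b(mod Λ)` is `(A, B) ↦ A ⊗^L_R B`. -/
def PerfModule.IsDerivedTensor (T : PerfModule.{v, u + 1, u} k R (DbMod Λ)) : Prop :=
  letI := T.action
  Nonempty (MonoidalLeftAction.curriedAction (StrictPerf R) (DbMod Λ) ⋙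
      (Functor.whiskeringLeft _ _ _).obj (DbMod.ofComplex Λ) ⋙
      (Functor.whiskeringRight _ _ _).obj (IsBoundedCoherent Λ).ι ≅
    (IsStrictlyPerfect R).ι ⋙ (tensorBifunctor R Λ).map₂CochainComplex ⋙
      (Functor.whiskeringLeft _ _ _).obj (ObjectProperty.ι _) ⋙
      (Functor.whiskeringRight _ _ _).obj DerivedCategory.Q)

end Standard

instance isNoetherianRing_end {R M : Type u} [CommRing R] [IsNoetherianRing R] [AddCommGroup M]
    [Module R M] [Module.Finite R M] : IsNoetherianRing (Module.End R M) :=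
  isNoetherian_of_tower R inferInstance

end NCCR

set_option linter.unusedSectionVars false

/-! The central fact is that Λ = End_R(M) is a symmetric R-algebra. Over the fraction field of R an
endomorphism of M has a trace. Endomorphisms of a finite module are integral, so for normal R the
trace lies in R. On the rank one endomorphism x ↦ φ(x)m it takes the value φ(m), and reflexivity of
M turns this into the statement that (x, y) ↦ tr(xy) identifies Λ with Hom_R(Λ, R)
(`exists_symmetrizing_trace`). Rank one endomorphisms also show that an endomorphism commuting with
all of Λ is multiplication by an element of R, so End_Λ(M) = R. Finally, Λ is maximal Cohen-Macaulay
and R is Gorenstein, hence Ext^i_R(Λ, R) = 0 for i > 0. The local input is `exists_depth`: over a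
local ring A of finite injective dimension no Ext(X, A) with X finite survives above the depth of A.

Part (1). By symmetry and the vanishing of Ext_R(Λ, R), Ext^i_Λ(N, Λ) is detected by Ext^i_R(N, R)
for i > 0 (`exists_ext_trace`). A reflexive module is a second syzygy, so Ext^{i+1}_R(M, R) embeds
into some Ext^{i+3}_R(C, R), which dies at all primes of height less than i+3. In dimension at most
three this gives Ext^i_Λ(M, Λ) = 0 for i ≥ 2, while Ext^1_Λ(M, Λ) dies at primes of height less than
three. Finite global dimension replaces Λ by every finite module in the first statement, so M has a
resolution 0 → Q → P → M → 0 by finite projectives. An associated prime p of Ext^1_Λ(M, M) must then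
have height three. In 0 → R → Hom(P, M) → Hom(Q, M) → Ext^1(M, M) → 0 the ring has depth three at p
and the two middle terms have depth at least two, so no nonzero element of Ext^1(M, M) is killed by
p (`eq_zero_of_smul_eq_zero`).

Part (2), the categories. Finite global dimension gives D^b(mod Λ) = Perf(Λ)
(`isPerfect_eq_isBoundedCoherent`). Strictly perfect complexes are K-projective, so both are the
homotopy category `HoPerf Λ`, and all structure can be built from honest complexes: the action is
the total tensor product, RHom is the Hom complex, and their adjunction is currying. It is then
transported along the equivalence `resolve`. The pushforward is RHom_Λ(M, -). The objects at which
the unit A → RHom_Λ(M, A ⊗ M) is an isomorphism form a thick subcategory, so only A = R matters,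
where the claim is Ext^i_Λ(M, M) = 0 for i > 0 and End_Λ(M) = R (`quasiIso_unit`).

Part (2), crepancy. For strictly perfect P and Q the pairing (f, g) ↦ supertrace of fg, built from
tr by the Hattori-Stallings trace, is an isomorphism of complexes from Hom(Q, P) to the R-dual of
Hom(P, Q). The terms of Hom(P, Q) are R-summands of powers of Λ, which have no higher Ext into R, so
this naive dual is the derived dual (`isIso_serreHom`). Naturality in P comes from cyclicity of the
trace.

Part (2), smoothness. It suffices to bound the projective dimension of Λ as a bimodule by the global
dimension g of Λ. Since the enveloping algebra is finite over the noetherian ring R ⊗ R, it is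
enough to show Ext^{g+1}(Λ, S) = 0 for simple bimodules S. By the Nullstellensatz such an S is
finite dimensional, and as k is algebraically closed S ≅ Hom_k(X, Y) for Λ-modules X and Y. Morally
Ext^i(Λ, Hom_k(X, Y)) is Ext^i_Λ(X, Y), and it vanishes beyond the projective dimension of X
(`isSmoothAlgebra`). -/

namespace NCCR

/-! ### Action of complexes on complexes through total tensor products -/

section ComplexAction
open HomologicalComplex

variable {C D : Type*} [Category* C] [Category* D] [MonoidalCategory C] [Preadditive C]
  [Preadditive D] [HasZeroObject C] [HasZeroObject D]
  [(curriedTensor C).Additive] [∀ X : C, ((curriedTensor C).obj X).Additive]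
  [∀ (X₁ X₂ : GradedObject ℤ C), GradedObject.HasTensor X₁ X₂]
  [∀ X₁, PreservesColimit (Functor.empty.{0} C) ((curriedTensor C).obj X₁)]
  [∀ X₂, PreservesColimit (Functor.empty.{0} C) ((curriedTensor C).flip.obj X₂)]
  [∀ (X₁ X₂ X₃ X₄ : GradedObject ℤ C), GradedObject.HasTensor₄ObjExt X₁ X₂ X₃ X₄]
  [∀ (X₁ X₂ X₃ : GradedObject ℤ C), GradedObject.HasGoodTensor₁₂Tensor X₁ X₂ X₃]
  [∀ (X₁ X₂ X₃ : GradedObject ℤ C), GradedObject.HasGoodTensorTensor₂₃ X₁ X₂ X₃]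
  [∀ X (J : Type), PreservesColimitsOfShape (Discrete J) ((curriedTensor C).flip.obj X)]

/-- The data of an additive action of `C` on `D` through a bifunctor `T`. -/
structure BifunctorAction (T : C ⥤ D ⥤ D) where
  assoc : bifunctorComp₁₂ (curriedTensor C) T ≅ bifunctorComp₂₃ T T
  unit : T.obj (𝟙_ C) ≅ 𝟭 D
  pentagon (X Y Z : C) (V : D) :
    (T.map (α_ X Y Z).hom).app V ≫ ((assoc.hom.app X).app (Y ⊗ Z)).app V ≫
      (T.obj X).map (((assoc.hom.app Y).app Z).app V) =
    ((assoc.hom.app (X ⊗ Y)).app Z).app V ≫ ((assoc.hom.app X).app Y).app ((T.obj Z).obj V)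
  leftUnit (X : C) (V : D) : (T.map (λ_ X).hom).app V =
    ((assoc.hom.app (𝟙_ C)).app X).app V ≫ unit.hom.app _
  rightUnit (X : C) (V : D) : (T.map (ρ_ X).hom).app V =
    ((assoc.hom.app X).app (𝟙_ C)).app V ≫ (T.obj X).map (unit.hom.app V)

variable {T : C ⥤ D ⥤ D} [T.Additive] [∀ X, (T.obj X).Additive]
  [∀ (K : CochainComplex C ℤ) (L : CochainComplex D ℤ), HasMapBifunctor K L T (.up ℤ)]
  [∀ X (J : Type), PreservesColimitsOfShape (Discrete J) (T.obj X)]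
  [∀ X (J : Type), PreservesColimitsOfShape (Discrete J) (T.flip.obj X)]
  (A : BifunctorAction T)

namespace BifunctorAction

/-- The inclusion of a summand in the total complex. -/
noncomputable abbrev inc (T : C ⥤ D ⥤ D) [T.Additive] [∀ X, (T.obj X).Additive]
    [∀ (K : CochainComplex C ℤ) (L : CochainComplex D ℤ), HasMapBifunctor K L T (.up ℤ)]
    (K : CochainComplex C ℤ) (L : CochainComplex D ℤ) (i j n : ℤ) (h : i + j = n) :
    (T.obj (K.X i)).obj (L.X j) ⟶ (mapBifunctor K L T (.up ℤ)).X n :=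
  ιMapBifunctor K L T (.up ℤ) i j n h

/-- Coproducts are preserved in each variable of `T`, so a threefold total complex may be formed
with either bracketing. This and the next instance make the associator available. -/
instance hasGood₁₂ (K₁ K₂ : CochainComplex C ℤ) (L : CochainComplex D ℤ) :
    HasGoodTrifunctor₁₂Obj (curriedTensor C) T K₁ K₂ L (.up ℤ) (.up ℤ) :=
  fun _ _ => inferInstance

instance hasGood₂₃ (K₁ K₂ : CochainComplex C ℤ) (L : CochainComplex D ℤ) :
    HasGoodTrifunctor₂₃Obj T T K₁ K₂ L (.up ℤ) (.up ℤ) (.up ℤ) :=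
  fun _ _ => inferInstance

/-- The associativity isomorphism for the action on complexes. -/
noncomputable def assocIso (K₁ K₂ : CochainComplex C ℤ) (L : CochainComplex D ℤ) :
    mapBifunctor (K₁ ⊗ K₂) L T (.up ℤ) ≅ mapBifunctor K₁ (mapBifunctor K₂ L T (.up ℤ)) T (.up ℤ) :=
  mapBifunctorAssociator A.assoc K₁ K₂ L (.up ℤ) (.up ℤ) (.up ℤ)

/-- The component of the associativity isomorphism. -/
noncomputable def assocApp (X Y : C) (V : D) :
    (T.obj (X ⊗ Y)).obj V ⟶ (T.obj X).obj ((T.obj Y).obj V) :=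
  ((A.assoc.hom.app X).app Y).app V

theorem assocApp_natural_left {X X' : C} (f : X ⟶ X') (Y : C) (V : D) :
    (T.map (f ▷ Y)).app V ≫ A.assocApp X' Y V = A.assocApp X Y V ≫ (T.map f).app _ :=
  congr_app (congr_app (A.assoc.hom.naturality f) Y) V

theorem assocApp_natural_middle (X : C) {Y Y' : C} (f : Y ⟶ Y') (V : D) :
    (T.map (X ◁ f)).app V ≫ A.assocApp X Y' V =
      A.assocApp X Y V ≫ (T.obj X).map ((T.map f).app V) :=
  congr_app ((A.assoc.hom.app X).naturality f) V

theorem assocApp_natural_right (X Y : C) {V V' : D} (f : V ⟶ V') :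
    (T.obj (X ⊗ Y)).map f ≫ A.assocApp X Y V' =
      A.assocApp X Y V ≫ (T.obj X).map ((T.obj Y).map f) :=
  ((A.assoc.hom.app X).app Y).naturality f

theorem assocApp_pentagon (X Y Z : C) (V : D) :
    (T.map (α_ X Y Z).hom).app V ≫ A.assocApp X (Y ⊗ Z) V ≫ (T.obj X).map (A.assocApp Y Z V) =
      A.assocApp (X ⊗ Y) Z V ≫ A.assocApp X Y ((T.obj Z).obj V) :=
  A.pentagon X Y Z V

theorem assocApp_natural_left_assoc {X X' : C} (f : X ⟶ X') (Y : C) (V : D) {Z : D} (z : _ ⟶ Z) :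
    (T.map (f ▷ Y)).app V ≫ A.assocApp X' Y V ≫ z = A.assocApp X Y V ≫ (T.map f).app _ ≫ z := by
  rw [← Category.assoc, assocApp_natural_left, Category.assoc]

theorem assocApp_natural_middle_assoc (X : C) {Y Y' : C} (f : Y ⟶ Y') (V : D) {Z : D}
    (z : _ ⟶ Z) : (T.map (X ◁ f)).app V ≫ A.assocApp X Y' V ≫ z =
      A.assocApp X Y V ≫ (T.obj X).map ((T.map f).app V) ≫ z := by
  rw [← Category.assoc, assocApp_natural_middle, Category.assoc]

theorem assocApp_natural_right_assoc (X Y : C) {V V' : D} (f : V ⟶ V') {Z : D} (z : _ ⟶ Z) :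
    (T.obj (X ⊗ Y)).map f ≫ A.assocApp X Y V' ≫ z =
      A.assocApp X Y V ≫ (T.obj X).map ((T.obj Y).map f) ≫ z := by
  rw [← Category.assoc, assocApp_natural_right, Category.assoc]

theorem assocApp_pentagon_assoc (X Y Z : C) (V : D) {W : D} (w : _ ⟶ W) :
    (T.map (α_ X Y Z).hom).app V ≫ A.assocApp X (Y ⊗ Z) V ≫ (T.obj X).map (A.assocApp Y Z V) ≫ w =
      A.assocApp (X ⊗ Y) Z V ≫ A.assocApp X Y ((T.obj Z).obj V) ≫ w := by
  have := A.assocApp_pentagon X Y Z V =≫ w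
  simpa only [Category.assoc] using this

/-- The associator has no signs on summands. Every coherence law below is reduced by this formula to
the corresponding law for `T` itself. -/
theorem ι_assocIso_hom (K₁ K₂ : CochainComplex C ℤ) (L : CochainComplex D ℤ)
    (i₁ i₂ i₃ i₁₂ i₂₃ j : ℤ) (h₁₂ : i₁ + i₂ = i₁₂) (h₂₃ : i₂ + i₃ = i₂₃) (h : i₁₂ + i₃ = j)
    (h' : i₁ + i₂₃ = j) :
    (T.map (ιTensorObj K₁ K₂ i₁ i₂ i₁₂ h₁₂)).app (L.X i₃) ≫ inc T (K₁ ⊗ K₂) L i₁₂ i₃ j h ≫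
      (A.assocIso K₁ K₂ L).hom.f j =
    A.assocApp _ _ _ ≫ (T.obj (K₁.X i₁)).map (inc T K₂ L i₂ i₃ i₂₃ h₂₃) ≫
      inc T K₁ (mapBifunctor K₂ L T (.up ℤ)) i₁ i₂₃ j h' := by
  have hr : ComplexShape.r (.up ℤ) (.up ℤ) (.up ℤ) (.up ℤ) (.up ℤ) (i₁, i₂, i₃) = j := by
    change i₁ + i₂ + i₃ = j
    lia
  have := ι_mapBifunctorAssociatorX_hom A.assoc K₁ K₂ L (.up ℤ) (.up ℤ) (.up ℤ) i₁ i₂ i₃ j hr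
  rw [mapBifunctor₁₂.ι_eq _ _ _ _ _ _ _ _ _ _ i₁₂ _ h₁₂ h,
    mapBifunctor₂₃.ι_eq _ _ _ _ _ _ _ _ _ _ _ i₂₃ _ h₂₃ h', Category.assoc] at this
  exact this

theorem ι_assocIso_hom_assoc (K₁ K₂ : CochainComplex C ℤ) (L : CochainComplex D ℤ)
    (i₁ i₂ i₃ i₁₂ i₂₃ j : ℤ) (h₁₂ : i₁ + i₂ = i₁₂) (h₂₃ : i₂ + i₃ = i₂₃) (h : i₁₂ + i₃ = j)
    (h' : i₁ + i₂₃ = j) {Z : D} (z : _ ⟶ Z) :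
    (T.map (ιTensorObj K₁ K₂ i₁ i₂ i₁₂ h₁₂)).app (L.X i₃) ≫ inc T (K₁ ⊗ K₂) L i₁₂ i₃ j h ≫
      (A.assocIso K₁ K₂ L).hom.f j ≫ z =
    A.assocApp _ _ _ ≫ (T.obj (K₁.X i₁)).map (inc T K₂ L i₂ i₃ i₂₃ h₂₃) ≫
      inc T K₁ (mapBifunctor K₂ L T (.up ℤ)) i₁ i₂₃ j h' ≫ z := by
  have := A.ι_assocIso_hom K₁ K₂ L i₁ i₂ i₃ i₁₂ i₂₃ j h₁₂ h₂₃ h h' =≫ z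
  simpa only [Category.assoc] using this

theorem hom_ext₁₂ {K₁ K₂ : CochainComplex C ℤ} {L : CochainComplex D ℤ} {j : ℤ} {Z : D}
    {f g : (mapBifunctor (K₁ ⊗ K₂) L T (.up ℤ)).X j ⟶ Z}
    (hfg : ∀ (i₁ i₂ i₃ i₁₂ : ℤ) (h₁₂ : i₁ + i₂ = i₁₂) (h : i₁₂ + i₃ = j),
      (T.map (ιTensorObj K₁ K₂ i₁ i₂ i₁₂ h₁₂)).app (L.X i₃) ≫ inc T (K₁ ⊗ K₂) L i₁₂ i₃ j h ≫ f =
      (T.map (ιTensorObj K₁ K₂ i₁ i₂ i₁₂ h₁₂)).app (L.X i₃) ≫ inc T (K₁ ⊗ K₂) L i₁₂ i₃ j h ≫ g) :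
    f = g := by
  refine mapBifunctor₁₂.hom_ext (F₁₂ := curriedTensor C) (G := T) (K₁ := K₁) (K₂ := K₂) (K₃ := L)
    (c₁₂ := .up ℤ) (fun i₁ i₂ i₃ h => ?_)
  rw [mapBifunctor₁₂.ι_eq _ _ _ _ _ _ _ _ _ _ (i₁ + i₂) _ rfl h, Category.assoc, Category.assoc]
  exact hfg i₁ i₂ i₃ _ rfl h

section Single
variable (T) in
/-- The total complex with first entry concentrated in degree zero. -/
noncomputable def singleLeftX (X : C) (L : CochainComplex D ℤ) (n : ℤ) :
    (T.obj X).obj (L.X n) ≅ (mapBifunctor ((single C (.up ℤ) 0).obj X) L T (.up ℤ)).X n where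
  hom := (T.map (singleObjXSelf (.up ℤ) 0 X).inv).app _ ≫ inc T _ L 0 n n (zero_add n)
  -- The value 0 for i ≠ 0 is harmless, since those summands are zero objects.
  inv := mapBifunctorDesc (fun i j h => if hi : i = 0 then
    (T.map (singleObjXIsoOfEq (.up ℤ) 0 X i hi).hom).app (L.X j) ≫
      (T.obj X).map (L.XIsoOfEq (by subst hi; exact (zero_add j).symm.trans h)).hom else 0)
  hom_inv_id := by
    rw [Category.assoc, ι_mapBifunctorDesc, dif_pos rfl, ← NatTrans.comp_app_assoc, ← T.map_comp]
    simp [singleObjXSelf]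
  inv_hom_id := by
    refine mapBifunctor.hom_ext (fun i j h => ?_)
    rw [ι_mapBifunctorDesc_assoc]
    by_cases hi : i = 0
    · subst hi
      obtain rfl : j = n := (zero_add j).symm.trans h
      rw [dif_pos rfl, Category.comp_id, XIsoOfEq_rfl, Iso.refl_hom, CategoryTheory.Functor.map_id,
        Category.comp_id, ← NatTrans.comp_app_assoc, ← T.map_comp]
      simp [singleObjXSelf]
    · refine IsZero.eq_of_src ?_ _ _
      exact Functor.map_isZero (T.flip.obj (L.X j)) (isZero_single_obj_X (.up ℤ) 0 X i hi)

theorem singleLeftX_comm (X : C) (L : CochainComplex D ℤ) (n m : ℤ) (h : (ComplexShape.up ℤ).Rel n m) :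
    (singleLeftX T X L n).hom ≫ (mapBifunctor ((single C (.up ℤ) 0).obj X) L T (.up ℤ)).d n m =
      (T.obj X).map (L.d n m) ≫ (singleLeftX T X L m).hom := by
  have h1 : mapBifunctor.d₁ ((single C (.up ℤ) 0).obj X) L T (.up ℤ) 0 n m = 0 := by
    rw [mapBifunctor.d₁_eq' _ _ _ _ (show (ComplexShape.up ℤ).Rel 0 1 from rfl), single_obj_d,
      Functor.map_zero, zero_app, zero_comp, smul_zero]
  have h2 := mapBifunctor.d₂_eq ((single C (.up ℤ) 0).obj X) L T (.up ℤ) 0 h m (zero_add m)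
  simp only [singleLeftX, inc, Category.assoc, mapBifunctor.d_eq, Preadditive.comp_add,
    mapBifunctor.ι_D₁, mapBifunctor.ι_D₂, h1, h2, comp_zero, zero_add]
  -- The Koszul sign of the second differential is (-1)^0, the first entry having degree 0.
  have : ComplexShape.ε₂ (.up ℤ) (.up ℤ) (.up ℤ) ((0 : ℤ), n) = 1 := ComplexShape.ε_zero _
  rw [this, one_smul, NatTrans.naturality_assoc]

variable (T) in
/-- The total complex with first entry concentrated in degree zero. -/
noncomputable def singleLeft (X : C) (L : CochainComplex D ℤ) :
    ((T.obj X).mapHomologicalComplex (.up ℤ)).obj L ≅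
      mapBifunctor ((single C (.up ℤ) 0).obj X) L T (.up ℤ) :=
  Hom.isoOfComponents (singleLeftX T X L) (singleLeftX_comm X L)

variable (T) in
/-- The total complex with second entry concentrated in degree zero. -/
noncomputable def singleRightX (K : CochainComplex C ℤ) (V : D) (n : ℤ) :
    (T.obj (K.X n)).obj V ≅ (mapBifunctor K ((single D (.up ℤ) 0).obj V) T (.up ℤ)).X n where
  hom := (T.obj (K.X n)).map (singleObjXSelf (.up ℤ) 0 V).inv ≫ inc T K _ n 0 n (add_zero n)
  inv := mapBifunctorDesc (fun i j h => if hj : j = 0 then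
    (T.obj (K.X i)).map (singleObjXIsoOfEq (.up ℤ) 0 V j hj).hom ≫
      (T.map (K.XIsoOfEq (by subst hj; exact (add_zero i).symm.trans h)).hom).app V else 0)
  hom_inv_id := by
    rw [Category.assoc, ι_mapBifunctorDesc, dif_pos rfl, ← Functor.map_comp_assoc]
    simp [singleObjXSelf]
  inv_hom_id := by
    refine mapBifunctor.hom_ext (fun i j h => ?_)
    rw [ι_mapBifunctorDesc_assoc]
    by_cases hj : j = 0
    · subst hj
      obtain rfl : i = n := (add_zero i).symm.trans h
      rw [dif_pos rfl, Category.comp_id, XIsoOfEq_rfl, Iso.refl_hom, CategoryTheory.Functor.map_id,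
        NatTrans.id_app, Category.comp_id, ← Functor.map_comp_assoc]
      simp [singleObjXSelf]
    · refine IsZero.eq_of_src ?_ _ _
      exact Functor.map_isZero (T.obj (K.X i)) (isZero_single_obj_X (.up ℤ) 0 V j hj)

theorem singleRightX_comm (K : CochainComplex C ℤ) (V : D) (n m : ℤ) (h : (ComplexShape.up ℤ).Rel n m) :
    (singleRightX T K V n).hom ≫ (mapBifunctor K ((single D (.up ℤ) 0).obj V) T (.up ℤ)).d n m =
      (T.map (K.d n m)).app V ≫ (singleRightX T K V m).hom := by
  have h1 : mapBifunctor.d₂ K ((single D (.up ℤ) 0).obj V) T (.up ℤ) n 0 m = 0 := by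
    rw [mapBifunctor.d₂_eq' _ _ _ _ _ (show (ComplexShape.up ℤ).Rel 0 1 from rfl), single_obj_d,
      Functor.map_zero, zero_comp, smul_zero]
  have h2 := mapBifunctor.d₁_eq K ((single D (.up ℤ) 0).obj V) T (.up ℤ) h 0 m (add_zero m)
  simp only [singleRightX, inc, Category.assoc, mapBifunctor.d_eq, Preadditive.comp_add,
    mapBifunctor.ι_D₁, mapBifunctor.ι_D₂, h1, h2, comp_zero, add_zero]
  have : ComplexShape.ε₁ (.up ℤ) (.up ℤ) (.up ℤ) (n, (0 : ℤ)) = 1 := rfl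
  rw [this, one_smul, NatTrans.naturality_assoc]

variable (T) in
/-- The total complex with second entry concentrated in degree zero. -/
noncomputable def singleRight (K : CochainComplex C ℤ) (V : D) :
    ((T.flip.obj V).mapHomologicalComplex (.up ℤ)).obj K ≅
      mapBifunctor K ((single D (.up ℤ) 0).obj V) T (.up ℤ) :=
  Hom.isoOfComponents (singleRightX T K V) (singleRightX_comm K V)

end Single

/-- The unit isomorphism for the action on complexes. -/
noncomputable def unitIso (L : CochainComplex D ℤ) :
    mapBifunctor (𝟙_ (CochainComplex C ℤ)) L T (.up ℤ) ≅ L :=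
  (singleLeft T (𝟙_ C) L).symm ≪≫ (NatIso.mapHomologicalComplex A.unit (.up ℤ)).app L ≪≫
    (Functor.mapHomologicalComplexIdIso _ _).app L

theorem ι_unitIso_hom (L : CochainComplex D ℤ) (n : ℤ) :
    (T.map (singleObjXSelf (.up ℤ) 0 (𝟙_ C)).inv).app _ ≫
      inc T (𝟙_ (CochainComplex C ℤ)) L 0 n n (zero_add n) ≫ (A.unitIso L).hom.f n =
    A.unit.hom.app (L.X n) := by
  have : (singleLeftX T (𝟙_ C) L n).hom ≫ (A.unitIso L).hom.f n = A.unit.hom.app (L.X n) := by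
    have h1 : (A.unitIso L).hom.f n = (singleLeftX T (𝟙_ C) L n).inv ≫ A.unit.hom.app (L.X n) ≫
      𝟙 _ := rfl
    rw [h1, Category.comp_id, Iso.hom_inv_id_assoc]
  rw [← this, ← Category.assoc]
  rfl

theorem unit_hom_ext {L : CochainComplex D ℤ} {n : ℤ} {Z : D}
    {f g : (mapBifunctor (𝟙_ (CochainComplex C ℤ)) L T (.up ℤ)).X n ⟶ Z}
    (h : (T.map (singleObjXSelf (.up ℤ) 0 (𝟙_ C)).inv).app _ ≫
      inc T (𝟙_ (CochainComplex C ℤ)) L 0 n n (zero_add n) ≫ f =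
      (T.map (singleObjXSelf (.up ℤ) 0 (𝟙_ C)).inv).app _ ≫
      inc T (𝟙_ (CochainComplex C ℤ)) L 0 n n (zero_add n) ≫ g) : f = g := by
  rw [← cancel_epi (singleLeftX T (𝟙_ C) L n).hom]
  simp only [singleLeftX, Category.assoc]
  exact h

theorem ι_associator_hom (K₁ K₂ K₃ : CochainComplex C ℤ)
    (i₁ i₂ i₃ i₁₂ i₂₃ j : ℤ) (h₁₂ : i₁ + i₂ = i₁₂) (h₂₃ : i₂ + i₃ = i₂₃) (h : i₁₂ + i₃ = j)
    (h' : i₁ + i₂₃ = j) :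
    ιTensorObj K₁ K₂ i₁ i₂ i₁₂ h₁₂ ▷ K₃.X i₃ ≫ ιTensorObj (K₁ ⊗ K₂) K₃ i₁₂ i₃ j h ≫
      (α_ K₁ K₂ K₃).hom.f j =
    (α_ _ _ _).hom ≫ K₁.X i₁ ◁ ιTensorObj K₂ K₃ i₂ i₃ i₂₃ h₂₃ ≫
      ιTensorObj K₁ (K₂ ⊗ K₃) i₁ i₂₃ j h' := by
  have hr : ComplexShape.r (.up ℤ) (.up ℤ) (.up ℤ) (.up ℤ) (.up ℤ) (i₁, i₂, i₃) = j := by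
    change i₁ + i₂ + i₃ = j
    lia
  have := ι_mapBifunctorAssociatorX_hom (curriedAssociatorNatIso C) K₁ K₂ K₃
    (.up ℤ) (.up ℤ) (.up ℤ) i₁ i₂ i₃ j hr
  rw [mapBifunctor₁₂.ι_eq _ _ _ _ _ _ _ _ _ _ i₁₂ _ h₁₂ h,
    mapBifunctor₂₃.ι_eq _ _ _ _ _ _ _ _ _ _ _ i₂₃ _ h₂₃ h', Category.assoc] at this
  exact this

theorem ι_leftUnitor_hom (K : CochainComplex C ℤ) (n : ℤ) :
    (singleObjXSelf (.up ℤ) 0 (𝟙_ C)).inv ▷ K.X n ≫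
      ιTensorObj (𝟙_ (CochainComplex C ℤ)) K 0 n n (zero_add n) ≫ (λ_ K).hom.f n =
    (λ_ (K.X n)).hom := by
  rw [← cancel_epi (λ_ (K.X n)).inv, Iso.inv_hom_id]
  have := leftUnitor'_inv K n
  have h2 : (λ_ K).inv.f n ≫ (λ_ K).hom.f n = 𝟙 _ := by
    rw [← comp_f, Iso.inv_hom_id]; rfl
  rw [← h2]
  refine Eq.trans ?_ (congrArg (· ≫ (λ_ K).hom.f n) this.symm)
  simp only [Category.assoc]
  rfl

theorem ι_rightUnitor_hom (K : CochainComplex C ℤ) (n : ℤ) :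
    K.X n ◁ (singleObjXSelf (.up ℤ) 0 (𝟙_ C)).inv ≫
      ιTensorObj K (𝟙_ (CochainComplex C ℤ)) n 0 n (add_zero n) ≫ (ρ_ K).hom.f n =
    (ρ_ (K.X n)).hom := by
  rw [← cancel_epi (ρ_ (K.X n)).inv, Iso.inv_hom_id]
  have := rightUnitor'_inv K n
  have h2 : (ρ_ K).inv.f n ≫ (ρ_ K).hom.f n = 𝟙 _ := by
    rw [← comp_f, Iso.inv_hom_id]; rfl
  rw [← h2]
  refine Eq.trans ?_ (congrArg (· ≫ (ρ_ K).hom.f n) this.symm)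
  simp only [Category.assoc]
  rfl

/-- A functor preserving coproducts sends the coproduct presenting a degree of K₁ ⊗ K₂ to a
coproduct. It is needed once, to reach the fourfold summands in the pentagon. -/
theorem map_tensor_hom_ext {E : Type*} [Category* E] (Φ : C ⥤ E)
    [∀ (J : Type), PreservesColimitsOfShape (Discrete J) Φ] {K₁ K₂ : CochainComplex C ℤ} {n : ℤ}
    {Z : E} {f g : Φ.obj ((K₁ ⊗ K₂).X n) ⟶ Z}
    (h : ∀ i j (hij : i + j = n), Φ.map (ιTensorObj K₁ K₂ i j n hij) ≫ f =
      Φ.map (ιTensorObj K₁ K₂ i j n hij) ≫ g) : f = g := by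
  have hc := isColimitOfPreserves Φ (GradedObject.isColimitCofanMapObj
    (((GradedObject.mapBifunctor (curriedTensor C) ℤ ℤ).obj K₁.X).obj K₂.X)
    (ComplexShape.π (.up ℤ) (.up ℤ) (.up ℤ)) n)
  refine hc.hom_ext (fun ⟨⟨⟨i, j⟩, hij⟩⟩ => ?_)
  exact h i j hij

theorem ι_map {K K' : CochainComplex C ℤ} {L L' : CochainComplex D ℤ} (f : K ⟶ K') (g : L ⟶ L')
    (i j n : ℤ) (h : i + j = n) :
    inc T K L i j n h ≫ (mapBifunctorMap f g T (.up ℤ)).f n =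
      (T.map (f.f i)).app _ ≫ (T.obj _).map (g.f j) ≫ inc T K' L' i j n h :=
  ι_mapBifunctorMap f g T (.up ℤ) i j n h

theorem ι_map_assoc {K K' : CochainComplex C ℤ} {L L' : CochainComplex D ℤ} (f : K ⟶ K')
    (g : L ⟶ L') (i j n : ℤ) (h : i + j = n) {Z : D} (z : _ ⟶ Z) :
    inc T K L i j n h ≫ (mapBifunctorMap f g T (.up ℤ)).f n ≫ z =
      (T.map (f.f i)).app _ ≫ (T.obj _).map (g.f j) ≫ inc T K' L' i j n h ≫ z := by
  have := ι_map (T := T) f g i j n h =≫ z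
  simpa only [Category.assoc] using this

theorem ι_tensorHom {K K' L L' : CochainComplex C ℤ} (f : K ⟶ K') (g : L ⟶ L')
    (i j n : ℤ) (h : i + j = n) :
    ιTensorObj K L i j n h ≫ (f ⊗ₘ g).f n = (f.f i ⊗ₘ g.f j) ≫ ιTensorObj K' L' i j n h := by
  rw [MonoidalCategory.tensorHom_def (f.f i), Category.assoc]
  exact ι_mapBifunctorMap f g (curriedTensor C) (.up ℤ) i j n h

theorem assocIso_naturality {K₁ K₁' K₂ K₂' : CochainComplex C ℤ} {L L' : CochainComplex D ℤ}
    (f : K₁ ⟶ K₁') (g : K₂ ⟶ K₂') (h : L ⟶ L') :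
    mapBifunctorMap (f ⊗ₘ g) h T (.up ℤ) ≫ (A.assocIso K₁' K₂' L').hom =
      (A.assocIso K₁ K₂ L).hom ≫ mapBifunctorMap f (mapBifunctorMap g h T (.up ℤ)) T (.up ℤ) := by
  ext j : 1
  refine hom_ext₁₂ (fun i₁ i₂ i₃ i₁₂ h₁₂ hj => ?_)
  rw [comp_f, comp_f, A.ι_assocIso_hom_assoc K₁ K₂ L i₁ i₂ i₃ i₁₂ _ j h₁₂ rfl hj (by lia), ι_map,
    ι_map_assoc, ← NatTrans.comp_app_assoc, ← T.map_comp, ι_tensorHom,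
    T.map_comp, NatTrans.comp_app_assoc, ← NatTrans.naturality_assoc,
    A.ι_assocIso_hom K₁' K₂' L' i₁ i₂ i₃ i₁₂ _ j h₁₂ rfl hj (by lia),
    MonoidalCategory.tensorHom_def, T.map_comp, NatTrans.comp_app_assoc]
  rw [NatTrans.naturality_assoc (T.map (f.f i₁)) (inc T K₂ L i₂ i₃ _ rfl),
    ← Functor.map_comp_assoc (T.obj (K₁'.X i₁)), ι_map,
    (A.assocApp_natural_right_assoc _ _ (h.f i₃)),
    (A.assocApp_natural_middle_assoc _ (g.f i₂)),
    (A.assocApp_natural_left_assoc (f.f i₁))]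
  simp only [Functor.map_comp, Category.assoc]

/-- On the summand indexed by four degrees both composites become the two sides of `A.pentagon`,
followed by the same inclusions. -/
theorem assocIso_pentagon (K₁ K₂ K₃ : CochainComplex C ℤ) (L : CochainComplex D ℤ) :
    mapBifunctorMap (α_ K₁ K₂ K₃).hom (𝟙 L) T (.up ℤ) ≫ (A.assocIso K₁ (K₂ ⊗ K₃) L).hom ≫
      mapBifunctorMap (𝟙 K₁) (A.assocIso K₂ K₃ L).hom T (.up ℤ) =
    (A.assocIso (K₁ ⊗ K₂) K₃ L).hom ≫
      (A.assocIso K₁ K₂ (mapBifunctor K₃ L T (.up ℤ))).hom := by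
  ext j : 1
  refine hom_ext₁₂ (fun i₁₂ i₃ i₄ i₁₂₃ h₁₂₃ hj => ?_)
  -- The extensionality lemma just applied treats K₁ ⊗ K₂ as one factor; here it is split in turn.
  refine map_tensor_hom_ext ((curriedTensor C).flip.obj (K₃.X i₃) ⋙ T.flip.obj (L.X i₄))
    (fun i₁ i₂ h₁₂ => ?_)
  change (T.map (_ ▷ K₃.X i₃)).app _ ≫ _ = (T.map (_ ▷ K₃.X i₃)).app _ ≫ _
  rw [comp_f, comp_f, comp_f, ι_map_assoc, id_f, CategoryTheory.Functor.map_id, Category.id_comp,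
    ← NatTrans.comp_app_assoc, ← NatTrans.comp_app_assoc, ← T.map_comp, ← T.map_comp, Category.assoc,
    ι_associator_hom K₁ K₂ K₃ i₁ i₂ i₃ i₁₂ _ i₁₂₃ h₁₂ rfl h₁₂₃ (by lia),
    T.map_comp, T.map_comp, NatTrans.comp_app_assoc, NatTrans.comp_app_assoc,
    A.ι_assocIso_hom_assoc K₁ (K₂ ⊗ K₃) L i₁ (i₂ + i₃) i₄ i₁₂₃ (i₂ + (i₃ + i₄)) j (by lia)
      (by lia) hj (by lia)]
  erw [A.assocApp_natural_middle_assoc (K₁.X i₁)]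
  rw [ι_map, id_f, CategoryTheory.Functor.map_id, NatTrans.id_app, Category.id_comp,
    ← Functor.map_comp_assoc, ← Functor.map_comp_assoc, Category.assoc,
    A.ι_assocIso_hom K₂ K₃ L i₂ i₃ i₄ (i₂ + i₃) (i₃ + i₄) _ rfl rfl (by lia) rfl]
  rw [A.ι_assocIso_hom_assoc (K₁ ⊗ K₂) K₃ L i₁₂ i₃ i₄ i₁₂₃ _ j h₁₂₃ rfl hj (by lia)]
  erw [A.assocApp_natural_left_assoc, ← NatTrans.naturality_assoc]
  rw [A.ι_assocIso_hom K₁ K₂ (mapBifunctor K₃ L T (.up ℤ)) i₁ i₂ (i₃ + i₄) i₁₂ _ j h₁₂ rfl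
      (by lia) (by lia), (A.assocApp_natural_right_assoc),
      ← A.assocApp_pentagon_assoc (K₁.X i₁) (K₂.X i₂) (K₃.X i₃)]
  simp only [Functor.map_comp, Category.assoc]

theorem assocIso_leftUnit (K : CochainComplex C ℤ) (L : CochainComplex D ℤ) :
    mapBifunctorMap (λ_ K).hom (𝟙 L) T (.up ℤ) =
      (A.assocIso (𝟙_ _) K L).hom ≫ (A.unitIso (mapBifunctor K L T (.up ℤ))).hom := by
  ext j : 1
  refine hom_ext₁₂ (fun i₁ i₂ i₃ i₁₂ h₁₂ hj => ?_)
  -- The unit complex is concentrated in degree 0, so all other summands vanish.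
  by_cases hi : i₁ = 0
  · subst hi
    obtain rfl : i₁₂ = i₂ := by lia
    have hs : IsIso ((T.map ((singleObjXSelf (.up ℤ) 0 (𝟙_ C)).inv ▷ (K.X i₁₂))).app (L.X i₃)) := by
      infer_instance
    rw [← cancel_epi ((T.map ((singleObjXSelf (.up ℤ) 0 (𝟙_ C)).inv ▷ (K.X i₁₂))).app (L.X i₃))]
    rw [comp_f, A.ι_assocIso_hom_assoc (𝟙_ _) K L 0 i₁₂ i₃ i₁₂ j j h₁₂ hj hj (by lia), ι_map, id_f,
      CategoryTheory.Functor.map_id, Category.id_comp, ← NatTrans.comp_app_assoc,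
      ← NatTrans.comp_app_assoc, ← T.map_comp, ← T.map_comp, Category.assoc,
      ι_leftUnitor_hom]
    erw [A.assocApp_natural_left_assoc, ← NatTrans.naturality_assoc]
    rw [A.ι_unitIso_hom, A.unit.hom.naturality, Functor.id_map]
    exact (A.leftUnit _ _ =≫ _).trans (Category.assoc _ _ _)
  · refine IsZero.eq_of_src ?_ _ _
    exact Functor.map_isZero ((curriedTensor C).flip.obj (K.X i₂) ⋙ T.flip.obj (L.X i₃))
      (isZero_single_obj_X (.up ℤ) 0 (𝟙_ C) i₁ hi)

theorem assocIso_rightUnit (K : CochainComplex C ℤ) (L : CochainComplex D ℤ) :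
    mapBifunctorMap (ρ_ K).hom (𝟙 L) T (.up ℤ) =
      (A.assocIso K (𝟙_ _) L).hom ≫ mapBifunctorMap (𝟙 K) (A.unitIso L).hom T (.up ℤ) := by
  ext j : 1
  refine hom_ext₁₂ (fun i₁ i₂ i₃ i₁₂ h₁₂ hj => ?_)
  by_cases hi : i₂ = 0
  · subst hi
    obtain rfl : i₁₂ = i₁ := by lia
    have hs : IsIso ((T.map ((K.X i₁₂) ◁ (singleObjXSelf (.up ℤ) 0 (𝟙_ C)).inv)).app (L.X i₃)) := by
      infer_instance
    rw [← cancel_epi ((T.map ((K.X i₁₂) ◁ (singleObjXSelf (.up ℤ) 0 (𝟙_ C)).inv)).app (L.X i₃))]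
    rw [comp_f, A.ι_assocIso_hom_assoc K (𝟙_ _) L i₁₂ 0 i₃ i₁₂ i₃ j h₁₂ (zero_add _) hj hj, ι_map,
      id_f, CategoryTheory.Functor.map_id, Category.id_comp, ← NatTrans.comp_app_assoc,
      ← NatTrans.comp_app_assoc, ← T.map_comp, ← T.map_comp, Category.assoc,
      ι_rightUnitor_hom]
    erw [A.assocApp_natural_middle_assoc]
    rw [ι_map, id_f, CategoryTheory.Functor.map_id, NatTrans.id_app, Category.id_comp, ← Functor.map_comp_assoc,
      ← Functor.map_comp_assoc, Category.assoc, A.ι_unitIso_hom]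
    exact (A.rightUnit _ _ =≫ _).trans (Category.assoc _ _ _)
  · refine IsZero.eq_of_src ?_ _ _
    exact Functor.map_isZero ((curriedTensor C).obj (K.X i₁) ⋙ T.flip.obj (L.X i₃))
      (isZero_single_obj_X (.up ℤ) 0 (𝟙_ C) i₂ hi)

theorem unitIso_naturality {L L' : CochainComplex D ℤ} (f : L ⟶ L') :
    (A.unitIso L).hom ≫ f = mapBifunctorMap (𝟙 _) f T (.up ℤ) ≫ (A.unitIso L').hom := by
  ext n : 1
  refine unit_hom_ext ?_
  rw [comp_f, comp_f, ι_map_assoc, id_f, CategoryTheory.Functor.map_id, NatTrans.id_app,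
    Category.id_comp]
  erw [← NatTrans.naturality_assoc]
  rw [A.ι_unitIso_hom, A.unit.hom.naturality,
    ← A.ι_unitIso_hom L n, Functor.id_map, Category.assoc, Category.assoc]

end BifunctorAction
end ComplexAction

/-! ### Descent to homotopy categories and a criterion for exactness -/

section Descend
open HomologicalComplex

variable {C D : Type*} [Category* C] [Category* D] [Preadditive C] [Preadditive D]

/-- A functor between categories of complexes which preserves homotopic morphisms. -/
class PreservesHomotopy (Φ : CochainComplex C ℤ ⥤ CochainComplex D ℤ) : Prop where
  nonempty {K L : CochainComplex C ℤ} {f g : K ⟶ L} (h : Homotopy f g) :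
    Nonempty (Homotopy (Φ.map f) (Φ.map g))

variable (Φ : CochainComplex C ℤ ⥤ CochainComplex D ℤ) [PreservesHomotopy Φ]

/-- The functor between homotopy categories induced by a functor between categories of complexes. -/
def descend : HomotopyCategory C (.up ℤ) ⥤ HomotopyCategory D (.up ℤ) :=
  CategoryTheory.Quotient.lift _ (Φ ⋙ HomotopyCategory.quotient D (.up ℤ))
    (fun _ _ _ _ ⟨h⟩ => (PreservesHomotopy.nonempty (Φ := Φ) h).elim
      fun h' => HomotopyCategory.eq_of_homotopy _ _ h')

/-- The induced functor is compatible with the quotient functors. -/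
def descendFactors : HomotopyCategory.quotient C (.up ℤ) ⋙ descend Φ ≅
    Φ ⋙ HomotopyCategory.quotient D (.up ℤ) :=
  CategoryTheory.Quotient.lift.isLift _ _ _

noncomputable instance [Φ.CommShift ℤ] : (descend Φ).CommShift ℤ :=
  Quotient.liftCommShift _ _ _ _

instance [Φ.CommShift ℤ] : NatTrans.CommShift (descendFactors Φ).hom ℤ :=
  Quotient.liftCommShift_compatibility _ _ _ _

instance {k : Type*} [Ring k] [Linear k C] [Linear k D] [Φ.Linear k] : (descend Φ).Linear k :=
  have := Functor.linear_of_iso k (descendFactors Φ).symm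
  (HomotopyCategory.quotient C (.up ℤ)).linear_of_full_essSurj_comp (descend Φ)

/-- The data of a degreewise splitting of `f`, `g` whose connecting morphism is `φ`. -/
structure SplitData {X₁ X₂ X₃ : CochainComplex C ℤ} (f : X₁ ⟶ X₂) (g : X₂ ⟶ X₃)
    (φ : X₃ ⟶ X₁⟦(1 : ℤ)⟧) where
  r (n : ℤ) : X₂.X n ⟶ X₁.X n
  s (n : ℤ) : X₃.X n ⟶ X₂.X n
  f_r (n : ℤ) : f.f n ≫ r n = 𝟙 _
  s_g (n : ℤ) : s n ≫ g.f n = 𝟙 _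
  id (n : ℤ) : r n ≫ f.f n + g.f n ≫ s n = 𝟙 _
  hom (n : ℤ) : φ.f n = s n ≫ X₂.d n (n + 1) ≫ r (n + 1)

/-- Sandwiching the identity r f + g s = 1 between s and r yields sr + sr = sr. -/
theorem SplitData.s_r {X₁ X₂ X₃ : CochainComplex C ℤ} {f : X₁ ⟶ X₂} {g : X₂ ⟶ X₃}
    {φ : X₃ ⟶ X₁⟦(1 : ℤ)⟧} (σ : SplitData f g φ) (n : ℤ) : σ.s n ≫ σ.r n = 0 := by
  have h := σ.s n ≫= (σ.id n =≫ σ.r n)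
  simp only [Preadditive.add_comp, Preadditive.comp_add, Category.assoc, σ.f_r, Category.comp_id,
    Category.id_comp, reassoc_of% (σ.s_g n)] at h
  exact add_eq_left.1 h

/-- Up to isomorphism the distinguished triangles are those of degreewise split sequences, with
connecting map s d r. It is therefore enough that `Φ` carries such splittings to such splittings,
the connecting maps agreeing after the shift isomorphism. -/
theorem descend_isTriangulated [HasZeroObject C] [HasBinaryBiproducts C] [HasZeroObject D]
    [HasBinaryBiproducts D] [Φ.CommShift ℤ] [Φ.Additive]
    (h : ∀ {X₁ X₂ X₃ : CochainComplex C ℤ} (f : X₁ ⟶ X₂) (g : X₂ ⟶ X₃) (φ : X₃ ⟶ X₁⟦(1 : ℤ)⟧),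
      SplitData f g φ →
        Nonempty (SplitData (Φ.map f) (Φ.map g) (Φ.map φ ≫ (Φ.commShiftIso (1 : ℤ)).hom.app X₁))) :
    (descend Φ).IsTriangulated where
  map_distinguished T hT := by
    rw [HomotopyCategory.distinguished_iff_iso_trianglehOfDegreewiseSplit] at hT ⊢
    obtain ⟨S, σ, ⟨e⟩⟩ := hT
    obtain ⟨d⟩ := h S.f S.g (CochainComplex.homOfDegreewiseSplit S σ)
      { r n := (σ n).r
        s n := (σ n).s
        f_r n := (σ n).f_r
        s_g n := (σ n).s_g
        id n := (σ n).id
        hom n := CochainComplex.homOfDegreewiseSplit_f S σ n }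
    let σ' (n : ℤ) : ((S.map Φ).map (eval D _ n)).Splitting :=
      { r := d.r n, s := d.s n, f_r := d.f_r n, s_g := d.s_g n, id := d.id n }
    have h' : Φ.map (CochainComplex.homOfDegreewiseSplit S σ) ≫
        (Φ.commShiftIso (1 : ℤ)).hom.app S.X₁ =
        CochainComplex.homOfDegreewiseSplit (S.map Φ) σ' := by
      ext n : 1
      exact (d.hom n).trans (CochainComplex.homOfDegreewiseSplit_f (S.map Φ) σ' n).symm
    refine ⟨S.map Φ, σ', ⟨(descend Φ).mapTriangle.mapIso e ≪≫
      ((Functor.mapTriangleCompIso _ _).symm.app _) ≪≫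
      (Functor.mapTriangleIso (descendFactors Φ)).app _ ≪≫
      (Functor.mapTriangleCompIso _ _).app _ ≪≫
      (HomotopyCategory.quotient D (.up ℤ)).mapTriangle.mapIso (eqToIso ?_)⟩⟩
    exact congrArg (Pretriangulated.Triangle.mk (Φ.map S.f) (Φ.map S.g)) h'

end Descend

/-! ### Total complexes of a bifunctor: additivity, linearity and exactness in each variable -/

section Bifunctor
open HomologicalComplex
variable {C₁ C₂ D : Type*} [Category* C₁] [Category* C₂] [Category* D] [Preadditive C₁]
  [Preadditive C₂] [Preadditive D] (T : C₁ ⥤ C₂ ⥤ D) [T.Additive] [∀ X, (T.obj X).Additive]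
  [∀ (K : CochainComplex C₁ ℤ) (L : CochainComplex C₂ ℤ), HasMapBifunctor K L T (.up ℤ)]

instance (K : CochainComplex C₁ ℤ) : PreservesHomotopy (T.map₂CochainComplex.obj K) where
  nonempty h := ⟨mapBifunctorMapHomotopy₂ (𝟙 K) h T _⟩

instance (L : CochainComplex C₂ ℤ) : PreservesHomotopy (T.map₂CochainComplex.flip.obj L) where
  nonempty h := ⟨mapBifunctorMapHomotopy₁ h (𝟙 L) T _⟩

variable {T} in
/-- The map between total complexes in degree `n` induced by morphisms in each degree. -/
noncomputable def gradedMap {K K' : CochainComplex C₁ ℤ} {L L' : CochainComplex C₂ ℤ}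
    (f : ∀ i, K.X i ⟶ K'.X i) (g : ∀ j, L.X j ⟶ L'.X j) (n : ℤ) :
    (mapBifunctor K L T (.up ℤ)).X n ⟶ (mapBifunctor K' L' T (.up ℤ)).X n :=
  mapBifunctorDesc (fun i j h => (T.map (f i)).app _ ≫ (T.obj _).map (g j) ≫
    ιMapBifunctor K' L' T (.up ℤ) i j n h)

variable {T} in
@[simp]
theorem ι_gradedMap {K K' : CochainComplex C₁ ℤ} {L L' : CochainComplex C₂ ℤ}
    (f : ∀ i, K.X i ⟶ K'.X i) (g : ∀ j, L.X j ⟶ L'.X j) (i j n : ℤ) (h : i + j = n) :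
    ιMapBifunctor K L T (.up ℤ) i j n h ≫ gradedMap f g n =
      (T.map (f i)).app _ ≫ (T.obj _).map (g j) ≫ ιMapBifunctor K' L' T (.up ℤ) i j n h :=
  ι_mapBifunctorDesc _ _ _ _

variable {T} in
@[simp]
theorem ι_gradedMap_assoc {K K' : CochainComplex C₁ ℤ} {L L' : CochainComplex C₂ ℤ}
    (f : ∀ i, K.X i ⟶ K'.X i) (g : ∀ j, L.X j ⟶ L'.X j) (i j n : ℤ) (h : i + j = n) {Z : D}
    (z : _ ⟶ Z) :
    ιMapBifunctor K L T (.up ℤ) i j n h ≫ gradedMap f g n ≫ z =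
      (T.map (f i)).app _ ≫ (T.obj _).map (g j) ≫ ιMapBifunctor K' L' T (.up ℤ) i j n h ≫ z := by
  rw [← Category.assoc, ι_gradedMap, Category.assoc, Category.assoc]

theorem mapBifunctorMap_f {K K' : CochainComplex C₁ ℤ} {L L' : CochainComplex C₂ ℤ}
    (f : K ⟶ K') (g : L ⟶ L') (n : ℤ) :
    (mapBifunctorMap f g T (.up ℤ)).f n = gradedMap f.f g.f n := by
  refine mapBifunctor.hom_ext (fun i j h => ?_)
  exact (ι_mapBifunctorMap f g T (.up ℤ) i j n h).trans (ι_gradedMap _ _ _ _ _ h).symm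

variable {T} in
theorem gradedMap_comp {K K' K'' : CochainComplex C₁ ℤ} {L L' L'' : CochainComplex C₂ ℤ}
    (f : ∀ i, K.X i ⟶ K'.X i) (g : ∀ j, L.X j ⟶ L'.X j) (f' : ∀ i, K'.X i ⟶ K''.X i)
    (g' : ∀ j, L'.X j ⟶ L''.X j) (n : ℤ) :
    gradedMap (T := T) f g n ≫ gradedMap f' g' n =
      gradedMap (fun i => f i ≫ f' i) (fun j => g j ≫ g' j) n := by
  refine mapBifunctor.hom_ext (fun i j h => ?_)
  rw [ι_gradedMap_assoc _ _ _ _ _ h, ι_gradedMap _ _ _ _ _ h, ι_gradedMap _ _ _ _ _ h,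
    T.map_comp, NatTrans.comp_app, Functor.map_comp, Category.assoc, Category.assoc,
    NatTrans.naturality_assoc]

theorem gradedMap_id (K : CochainComplex C₁ ℤ) (L : CochainComplex C₂ ℤ) (n : ℤ) :
    gradedMap (T := T) (fun i => 𝟙 (K.X i)) (fun j => 𝟙 (L.X j)) n = 𝟙 _ := by
  refine mapBifunctor.hom_ext (fun i j h => ?_)
  rw [ι_gradedMap _ _ _ _ _ h, T.map_id, NatTrans.id_app, CategoryTheory.Functor.map_id,
    Category.id_comp, Category.id_comp, Category.comp_id]

theorem gradedMap_add_right {K K' : CochainComplex C₁ ℤ} {L L' : CochainComplex C₂ ℤ}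
    (f : ∀ i, K.X i ⟶ K'.X i) (g g' : ∀ j, L.X j ⟶ L'.X j) (n : ℤ) :
    gradedMap (T := T) f (fun j => g j + g' j) n = gradedMap f g n + gradedMap f g' n := by
  refine mapBifunctor.hom_ext (fun i j h => ?_)
  rw [Preadditive.comp_add, ι_gradedMap _ _ _ _ _ h, ι_gradedMap _ _ _ _ _ h,
    ι_gradedMap _ _ _ _ _ h, Functor.map_add, Preadditive.add_comp, Preadditive.comp_add]

theorem gradedMap_add_left {K K' : CochainComplex C₁ ℤ} {L L' : CochainComplex C₂ ℤ}
    (f f' : ∀ i, K.X i ⟶ K'.X i) (g : ∀ j, L.X j ⟶ L'.X j) (n : ℤ) :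
    gradedMap (T := T) (fun i => f i + f' i) g n = gradedMap f g n + gradedMap f' g n := by
  refine mapBifunctor.hom_ext (fun i j h => ?_)
  rw [Preadditive.comp_add, ι_gradedMap _ _ _ _ _ h, ι_gradedMap _ _ _ _ _ h,
    ι_gradedMap _ _ _ _ _ h, T.map_add, NatTrans.app_add, Preadditive.add_comp]

variable {T} in
theorem gradedMap_comp_eq_id {K K' : CochainComplex C₁ ℤ} {L L' : CochainComplex C₂ ℤ}
    {f : ∀ i, K.X i ⟶ K'.X i} {g : ∀ j, L.X j ⟶ L'.X j} {f' : ∀ i, K'.X i ⟶ K.X i}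
    {g' : ∀ j, L'.X j ⟶ L.X j} (hf : ∀ i, f i ≫ f' i = 𝟙 _) (hg : ∀ j, g j ≫ g' j = 𝟙 _) (n : ℤ) :
    gradedMap (T := T) f g n ≫ gradedMap f' g' n = 𝟙 _ := by
  rw [gradedMap_comp]
  simp only [hf, hg]
  exact gradedMap_id T K L n

instance (K : CochainComplex C₁ ℤ) : (T.map₂CochainComplex.obj K).Additive where
  map_add {L L' f g} := by
    ext n : 1
    refine (mapBifunctorMap_f T (𝟙 K) (f + g) n).trans ?_
    refine (gradedMap_add_right T _ _ _ n).trans ?_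
    exact congrArg₂ _ (mapBifunctorMap_f T (𝟙 K) f n).symm (mapBifunctorMap_f T (𝟙 K) g n).symm

instance (L : CochainComplex C₂ ℤ) : (T.map₂CochainComplex.flip.obj L).Additive where
  map_add {K K' f g} := by
    ext n : 1
    refine (mapBifunctorMap_f T (f + g) (𝟙 L) n).trans ?_
    refine (gradedMap_add_left T _ _ _ n).trans ?_
    exact congrArg₂ _ (mapBifunctorMap_f T f (𝟙 L) n).symm (mapBifunctorMap_f T g (𝟙 L) n).symm

section Linear

variable {k : Type*} [Ring k] [Linear k C₁] [Linear k C₂] [Linear k D]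

instance (K : CochainComplex C₁ ℤ) [∀ X, (T.obj X).Linear k] :
    (T.map₂CochainComplex.obj K).Linear k where
  map_smul {L L'} f c := by
    ext n : 1
    refine (mapBifunctorMap_f T (𝟙 K) (c • f) n).trans ?_
    refine Eq.trans ?_ (congrArg (c • ·) (mapBifunctorMap_f T (𝟙 K) f n).symm)
    refine mapBifunctor.hom_ext (fun i j h => ?_)
    refine (ι_gradedMap _ _ _ _ _ h).trans (Eq.trans ?_ (Linear.comp_smul _ _ _ _ _ _).symm)
    refine Eq.trans ?_ (congrArg (c • ·) (ι_gradedMap _ _ _ _ _ h).symm)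
    simp

instance (L : CochainComplex C₂ ℤ) [T.Linear k] :
    (T.map₂CochainComplex.flip.obj L).Linear k where
  map_smul {K K'} f c := by
    ext n : 1
    refine (mapBifunctorMap_f T (c • f) (𝟙 L) n).trans ?_
    refine Eq.trans ?_ (congrArg (c • ·) (mapBifunctorMap_f T f (𝟙 L) n).symm)
    refine mapBifunctor.hom_ext (fun i j h => ?_)
    refine (ι_gradedMap _ _ _ _ _ h).trans (Eq.trans ?_ (Linear.comp_smul _ _ _ _ _ _).symm)
    refine Eq.trans ?_ (congrArg (c • ·) (ι_gradedMap _ _ _ _ _ h).symm)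
    simp

end Linear

theorem ι_mapBifunctor_d (K : CochainComplex C₁ ℤ) (L : CochainComplex C₂ ℤ) (i j n : ℤ)
    (h : i + j = n) :
    ιMapBifunctor K L T (.up ℤ) i j n h ≫ (mapBifunctor K L T (.up ℤ)).d n (n + 1) =
      (T.map (K.d i (i + 1))).app _ ≫ ιMapBifunctor K L T (.up ℤ) (i + 1) j (n + 1)
          (show i + 1 + j = n + 1 by lia) +
        i.negOnePow • (T.obj _).map (L.d j (j + 1)) ≫ ιMapBifunctor K L T (.up ℤ) i (j + 1) (n + 1)
          (show i + (j + 1) = n + 1 by lia) := by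
  rw [mapBifunctor.d_eq, Preadditive.comp_add, mapBifunctor.ι_D₁, mapBifunctor.ι_D₂,
    mapBifunctor.d₁_eq _ _ _ _ (show (ComplexShape.up ℤ).Rel i (i + 1) from rfl) _ _
      (show i + 1 + j = n + 1 by lia),
    mapBifunctor.d₂_eq _ _ _ _ _ (show (ComplexShape.up ℤ).Rel j (j + 1) from rfl) _
      (show i + (j + 1) = n + 1 by lia)]
  congr 1
  exact one_smul _ _

/-- The splittings r and s are not chain maps, which is why families of morphisms are tensored. In
the connecting map s d r on the summand (i, j), the part of d coming from K contributes s r = 0, and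
the other part carries the sign (-1)^i, which is the sign of the shift isomorphism in the second
variable. -/
theorem descend_map₂_isTriangulated [HasZeroObject C₂] [HasBinaryBiproducts C₂] [HasZeroObject D]
    [HasBinaryBiproducts D] (K : CochainComplex C₁ ℤ) :
    (descend (T.map₂CochainComplex.obj K)).IsTriangulated := by
  refine descend_isTriangulated _ (fun {X₁ X₂ X₃} f g φ σ => ⟨
    { r := gradedMap (T := T) (fun _ => 𝟙 _) σ.r
      s := gradedMap (T := T) (fun _ => 𝟙 _) σ.s
      f_r := fun n => ?_
      s_g := fun n => ?_
      id := fun n => ?_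
      hom := fun n => ?_ }⟩)
  · exact (congrArg (· ≫ _) (mapBifunctorMap_f T (𝟙 K) f n)).trans
      (gradedMap_comp_eq_id (fun _ => Category.comp_id _) σ.f_r n)
  · exact (congrArg (_ ≫ ·) (mapBifunctorMap_f T (𝟙 K) g n)).trans
      (gradedMap_comp_eq_id (fun _ => Category.comp_id _) σ.s_g n)
  · refine (congrArg₂ (fun u v => _ ≫ u + v ≫ _) (mapBifunctorMap_f T (𝟙 K) f n)
      (mapBifunctorMap_f T (𝟙 K) g n)).trans ?_
    refine (congrArg₂ (· + ·) (gradedMap_comp ..) (gradedMap_comp ..)).trans ?_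
    simp only [id_f, Category.comp_id]
    refine (gradedMap_add_right ..).symm.trans ?_
    simp only [σ.id]
    exact gradedMap_id T K X₂ n
  · refine mapBifunctor.hom_ext (fun i j h => ?_)
    change _ ≫ (mapBifunctorMap (𝟙 K) φ T (.up ℤ)).f n ≫
      (CochainComplex.mapBifunctorShift₂Iso K X₁ T 1).hom.f n = _ ≫ gradedMap _ _ n ≫
        (mapBifunctor K X₂ T (.up ℤ)).d n (n + 1) ≫ gradedMap _ _ (n + 1)
    rw [ι_mapBifunctorMap_assoc, CochainComplex.ι_mapBifunctorShift₂Iso_hom_f _ _ _ _ i j n h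
      (j + 1) (n + 1) rfl rfl, ι_gradedMap_assoc _ _ _ _ _ h]
    have := reassoc_of% ι_mapBifunctor_d T K X₂ i j n h
    rw [this, Preadditive.add_comp, Category.assoc, ι_gradedMap, Linear.units_smul_comp,
      Category.assoc, ι_gradedMap]
    have e1 := (T.obj (K.X i)).congr_map (σ.hom j)
    have e2 := (T.obj (K.X (i + 1))).congr_map (σ.s_r j)
    simp only [Functor.map_comp, Functor.map_zero] at e2
    simp [reassoc_of% e2]
    erw [CategoryTheory.Functor.map_id, Category.id_comp, Category.comp_id, e1]
    simp
    exact (Linear.comp_units_smul _ _ _).trans (by simp only [Category.assoc])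

/-- Here the signed part of the differential is the one killed by s r = 0, and the shift isomorphism
in the first variable has no sign. -/
theorem descend_map₂_flip_isTriangulated [HasZeroObject C₁] [HasBinaryBiproducts C₁]
    [HasZeroObject D] [HasBinaryBiproducts D] (L : CochainComplex C₂ ℤ) :
    (descend (T.map₂CochainComplex.flip.obj L)).IsTriangulated := by
  refine descend_isTriangulated _ (fun {X₁ X₂ X₃} f g φ σ => ⟨
    { r := gradedMap (T := T) σ.r (fun _ => 𝟙 _)
      s := gradedMap (T := T) σ.s (fun _ => 𝟙 _)
      f_r := fun n => ?_
      s_g := fun n => ?_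
      id := fun n => ?_
      hom := fun n => ?_ }⟩)
  · exact (congrArg (· ≫ _) (mapBifunctorMap_f T f (𝟙 L) n)).trans
      (gradedMap_comp_eq_id σ.f_r (fun _ => Category.comp_id _) n)
  · exact (congrArg (_ ≫ ·) (mapBifunctorMap_f T g (𝟙 L) n)).trans
      (gradedMap_comp_eq_id σ.s_g (fun _ => Category.comp_id _) n)
  · refine (congrArg₂ (fun u v => _ ≫ u + v ≫ _) (mapBifunctorMap_f T f (𝟙 L) n)
      (mapBifunctorMap_f T g (𝟙 L) n)).trans ?_
    refine (congrArg₂ (· + ·) (gradedMap_comp ..) (gradedMap_comp ..)).trans ?_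
    simp only [id_f, Category.comp_id]
    refine (gradedMap_add_left ..).symm.trans ?_
    simp only [σ.id]
    exact gradedMap_id T X₂ L n
  · refine mapBifunctor.hom_ext (fun i j h => ?_)
    change _ ≫ (mapBifunctorMap φ (𝟙 L) T (.up ℤ)).f n ≫
      (CochainComplex.mapBifunctorShift₁Iso X₁ L T 1).hom.f n = _ ≫ gradedMap _ _ n ≫
        (mapBifunctor X₂ L T (.up ℤ)).d n (n + 1) ≫ gradedMap _ _ (n + 1)
    rw [ι_mapBifunctorMap_assoc, CochainComplex.ι_mapBifunctorShift₁Iso_hom_f _ _ _ _ i j n h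
      (i + 1) (n + 1) rfl rfl, ι_gradedMap_assoc _ _ _ _ _ h]
    have := reassoc_of% ι_mapBifunctor_d T X₂ L i j n h
    rw [this, Preadditive.add_comp, Category.assoc, ι_gradedMap, Linear.units_smul_comp,
      Category.assoc, ι_gradedMap]
    have e1 := congr_app (T.congr_map (σ.hom i)) (L.X j)
    have e2 := congr_app (T.congr_map (σ.s_r i)) (L.X j)
    simp only [Functor.map_comp, Functor.map_zero, NatTrans.comp_app, zero_app] at e2
    simp [reassoc_of% e2]
    erw [Category.id_comp, T.map_id, NatTrans.id_app, Category.id_comp, Category.comp_id, e1]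
    simp

end Bifunctor

/-! ### The monoidal action on complexes -/

section HomotopyAction
open HomologicalComplex

variable {C D : Type*} [Category* C] [Category* D] [MonoidalCategory C] [Preadditive C]
  [Preadditive D] [HasZeroObject C] [HasZeroObject D]
  [(curriedTensor C).Additive] [∀ X : C, ((curriedTensor C).obj X).Additive]
  [∀ (X₁ X₂ : GradedObject ℤ C), GradedObject.HasTensor X₁ X₂]
  [∀ X₁, PreservesColimit (Functor.empty.{0} C) ((curriedTensor C).obj X₁)]
  [∀ X₂, PreservesColimit (Functor.empty.{0} C) ((curriedTensor C).flip.obj X₂)]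
  [∀ (X₁ X₂ X₃ X₄ : GradedObject ℤ C), GradedObject.HasTensor₄ObjExt X₁ X₂ X₃ X₄]
  [∀ (X₁ X₂ X₃ : GradedObject ℤ C), GradedObject.HasGoodTensor₁₂Tensor X₁ X₂ X₃]
  [∀ (X₁ X₂ X₃ : GradedObject ℤ C), GradedObject.HasGoodTensorTensor₂₃ X₁ X₂ X₃]
  [∀ X (J : Type), PreservesColimitsOfShape (Discrete J) ((curriedTensor C).flip.obj X)]
  {T : C ⥤ D ⥤ D} [T.Additive] [∀ X, (T.obj X).Additive]
  [∀ (K : CochainComplex C ℤ) (L : CochainComplex D ℤ), HasMapBifunctor K L T (.up ℤ)]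
  [∀ X (J : Type), PreservesColimitsOfShape (Discrete J) (T.obj X)]
  [∀ X (J : Type), PreservesColimitsOfShape (Discrete J) (T.flip.obj X)]
  (A : BifunctorAction T)

theorem mapBifunctorMap_comp {C₁ C₂ E : Type*} [Category* C₁] [Category* C₂] [Category* E]
    [Preadditive C₁] [Preadditive C₂] [Preadditive E] (T : C₁ ⥤ C₂ ⥤ E) [T.Additive]
    [∀ X, (T.obj X).Additive]
    [∀ (K : CochainComplex C₁ ℤ) (L : CochainComplex C₂ ℤ), HasMapBifunctor K L T (.up ℤ)]
    {K K' K'' : CochainComplex C₁ ℤ} {L L' L'' : CochainComplex C₂ ℤ}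
    (f : K ⟶ K') (f' : K' ⟶ K'') (g : L ⟶ L') (g' : L' ⟶ L'') :
    mapBifunctorMap (f ≫ f') (g ≫ g') T (.up ℤ) =
      mapBifunctorMap f g T (.up ℤ) ≫ mapBifunctorMap f' g' T (.up ℤ) := by
  ext n : 1
  rw [comp_f, mapBifunctorMap_f, mapBifunctorMap_f, mapBifunctorMap_f, gradedMap_comp]
  rfl

theorem mapBifunctorMap_id {C₁ C₂ E : Type*} [Category* C₁] [Category* C₂] [Category* E]
    [Preadditive C₁] [Preadditive C₂] [Preadditive E] (T : C₁ ⥤ C₂ ⥤ E) [T.Additive]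
    [∀ X, (T.obj X).Additive]
    [∀ (K : CochainComplex C₁ ℤ) (L : CochainComplex C₂ ℤ), HasMapBifunctor K L T (.up ℤ)]
    (K : CochainComplex C₁ ℤ) (L : CochainComplex C₂ ℤ) :
    mapBifunctorMap (𝟙 K) (𝟙 L) T (.up ℤ) = 𝟙 _ := by
  ext n : 1
  rw [mapBifunctorMap_f]
  exact gradedMap_id T K L n

open MonoidalLeftAction

/-- The action on complexes given by the total complex. -/
@[reducible]
noncomputable def BifunctorAction.complexAction :
    MonoidalLeftAction (CochainComplex C ℤ) (CochainComplex D ℤ) where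
  actionObj K L := mapBifunctor K L T (.up ℤ)
  actionHomLeft f L := mapBifunctorMap f (𝟙 L) T (.up ℤ)
  actionHomRight K _ _ g := mapBifunctorMap (𝟙 K) g T (.up ℤ)
  actionHom f g := mapBifunctorMap f g T (.up ℤ)
  actionAssocIso K₁ K₂ L := A.assocIso K₁ K₂ L
  actionUnitIso L := A.unitIso L
  actionHom_def f g := by
    rw [← mapBifunctorMap_comp, Category.comp_id, Category.id_comp]
  actionHomRight_id K L := mapBifunctorMap_id T K L
  id_actionHomLeft K L := mapBifunctorMap_id T K L
  actionHom_comp f f' g g' := mapBifunctorMap_comp T f f' g g'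
  actionAssocIso_hom_naturality f g h := A.assocIso_naturality f g h
  actionUnitIso_hom_naturality f := A.unitIso_naturality f
  whiskerLeft_actionHomLeft K _ _ f L := by
    have := A.assocIso_naturality (𝟙 K) f (𝟙 L)
    rw [MonoidalCategory.id_tensorHom] at this
    rw [← reassoc_of% this, Iso.hom_inv_id, Category.comp_id]
  whiskerRight_actionHomLeft K f L := by
    have := A.assocIso_naturality f (𝟙 K) (𝟙 L)
    rw [MonoidalCategory.tensorHom_id, mapBifunctorMap_id] at this
    rw [← reassoc_of% this, Iso.hom_inv_id, Category.comp_id]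
  associator_actionHom K₁ K₂ K₃ L := A.assocIso_pentagon K₁ K₂ K₃ L
  leftUnitor_actionHom K L := A.assocIso_leftUnit K L
  rightUnitor_actionHom K L := A.assocIso_rightUnit K L

end HomotopyAction

/-! ### Actions on quotient categories -/

section QuotientAction

open MonoidalLeftAction

variable {M E : Type*} [Category* M] [MonoidalCategory M] [Category* E] [MonoidalLeftAction M E]
  (r : HomRel E)
  (h : ∀ (K : M) ⦃X Y : E⦄ (f g : X ⟶ Y), r f g → r (K ⊴ₗ f) (K ⊴ₗ g))

/-- The action on a quotient category. -/
@[reducible]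
def quotientActionStruct : MonoidalLeftActionStruct M (CategoryTheory.Quotient r) where
  actionObj K X := ⟨K ⊙ₗ X.as⟩
  actionHomLeft f X := (Quotient.functor r).map (f ⊵ₗ X.as)
  actionHomRight K _ _ g := (CategoryTheory.Quotient.lift r (actionLeft E K ⋙ Quotient.functor r)
    (fun _ _ _ _ hfg => CategoryTheory.Quotient.sound _ (h K _ _ hfg))).map g
  actionAssocIso K₁ K₂ X := (Quotient.functor r).mapIso (αₗ K₁ K₂ X.as)
  actionUnitIso X := (Quotient.functor r).mapIso (λₗ[M] X.as)

theorem quotientActionStruct_actionHom {K K' : M} (f : K ⟶ K') {X Y : E} (g : X ⟶ Y) :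
    letI := quotientActionStruct r h
    MonoidalLeftActionStruct.actionHom (C := M) (D := CategoryTheory.Quotient r) f ((Quotient.functor r).map g) =
      (Quotient.functor r).map (f ⊙ₗₘ g) := by
  rw [actionHom_def, Functor.map_comp]
  rfl

/-- The action on a quotient category. -/
@[reducible]
def quotientAction : MonoidalLeftAction M (CategoryTheory.Quotient r) :=
  letI := quotientActionStruct r h
  let q := Quotient.functor r
  { actionHom_def := fun _ _ => rfl
    actionHomRight_id := fun K X => congrArg q.map (actionHomRight_id K X.as)
    id_actionHomLeft := fun K X => congrArg q.map (id_actionHomLeft K X.as)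
    actionHom_comp := by
      rintro K K' K'' ⟨X⟩ ⟨X'⟩ ⟨X''⟩ f f' ⟨g⟩ ⟨g'⟩
      refine (quotientActionStruct_actionHom r h (f ≫ f') (g ≫ g')).trans ?_
      rw [actionHom_comp, Functor.map_comp]
      exact congrArg₂ _ (quotientActionStruct_actionHom r h f g).symm
        (quotientActionStruct_actionHom r h f' g').symm
    actionAssocIso_hom_naturality := by
      rintro K₁ K₂ K₃ K₄ ⟨X⟩ ⟨X'⟩ f g ⟨u⟩
      refine (congrArg (· ≫ _) (quotientActionStruct_actionHom r h (f ⊗ₘ g) u)).trans ?_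
      refine (q.map_comp _ _).symm.trans ((congrArg q.map
        (actionAssocIso_hom_naturality f g u)).trans ((q.map_comp _ _).trans ?_))
      refine congrArg (_ ≫ ·) ?_
      refine (quotientActionStruct_actionHom r h f (g ⊙ₗₘ u)).symm.trans ?_
      exact congrArg (MonoidalLeftActionStruct.actionHom f)
        (quotientActionStruct_actionHom r h g u).symm
    actionUnitIso_hom_naturality := by
      rintro ⟨X⟩ ⟨X'⟩ ⟨u⟩
      exact congrArg q.map (actionUnitIso_hom_naturality u)
    whiskerLeft_actionHomLeft := fun K _ _ f X => congrArg q.map (whiskerLeft_actionHomLeft K f X.as)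
    whiskerRight_actionHomLeft := fun K f X => congrArg q.map (whiskerRight_actionHomLeft K f X.as)
    associator_actionHom := fun K₁ K₂ K₃ X => congrArg q.map (associator_actionHom K₁ K₂ K₃ X.as)
    leftUnitor_actionHom := fun K X => congrArg q.map (leftUnitor_actionHom K X.as)
    rightUnitor_actionHom := fun K X => congrArg q.map (rightUnitor_actionHom K X.as) }

end QuotientAction

section HomotopyAction
open HomologicalComplex

variable {C D : Type*} [Category* C] [Category* D] [MonoidalCategory C] [Preadditive C]
  [Preadditive D] [HasZeroObject C] [HasZeroObject D]
  [(curriedTensor C).Additive] [∀ X : C, ((curriedTensor C).obj X).Additive]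
  [∀ (X₁ X₂ : GradedObject ℤ C), GradedObject.HasTensor X₁ X₂]
  [∀ X₁, PreservesColimit (Functor.empty.{0} C) ((curriedTensor C).obj X₁)]
  [∀ X₂, PreservesColimit (Functor.empty.{0} C) ((curriedTensor C).flip.obj X₂)]
  [∀ (X₁ X₂ X₃ X₄ : GradedObject ℤ C), GradedObject.HasTensor₄ObjExt X₁ X₂ X₃ X₄]
  [∀ (X₁ X₂ X₃ : GradedObject ℤ C), GradedObject.HasGoodTensor₁₂Tensor X₁ X₂ X₃]
  [∀ (X₁ X₂ X₃ : GradedObject ℤ C), GradedObject.HasGoodTensorTensor₂₃ X₁ X₂ X₃]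
  [∀ X (J : Type), PreservesColimitsOfShape (Discrete J) ((curriedTensor C).flip.obj X)]
  {T : C ⥤ D ⥤ D} [T.Additive] [∀ X, (T.obj X).Additive]
  [∀ (K : CochainComplex C ℤ) (L : CochainComplex D ℤ), HasMapBifunctor K L T (.up ℤ)]
  [∀ X (J : Type), PreservesColimitsOfShape (Discrete J) (T.obj X)]
  [∀ X (J : Type), PreservesColimitsOfShape (Discrete J) (T.flip.obj X)]
  (A : BifunctorAction T)

/-- The action on the homotopy category given by the total complex. -/
@[reducible]
noncomputable def BifunctorAction.homotopyAction :
    MonoidalLeftAction (CochainComplex C ℤ) (HomotopyCategory D (.up ℤ)) :=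
  letI := A.complexAction
  quotientAction (M := CochainComplex C ℤ) (homotopic D (.up ℤ))
    (fun K _ _ _ _ ⟨h⟩ => ⟨mapBifunctorMapHomotopy₂ (𝟙 K) h T _⟩)

end HomotopyAction

/-! ### Actions on full subcategories -/

section Restrict

open MonoidalLeftAction

variable {M E : Type*} [Category* M] [MonoidalCategory M] [Category* E] [MonoidalLeftAction M E]
  (P : ObjectProperty M) [P.IsMonoidal] (Q : ObjectProperty E)
  (h : ∀ (K : M) (X : E), P K → Q X → Q (K ⊙ₗ X))

/-- The induced action on full subcategories. -/
@[reducible]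
def restrictAction : MonoidalLeftAction P.FullSubcategory Q.FullSubcategory where
  actionObj K X := ⟨K.obj ⊙ₗ X.obj, h _ _ K.property X.property⟩
  actionHomLeft f X := Q.homMk (f.hom ⊵ₗ X.obj)
  actionHomRight K _ _ g := Q.homMk (K.obj ⊴ₗ g.hom)
  actionHom f g := Q.homMk (f.hom ⊙ₗₘ g.hom)
  actionAssocIso K₁ K₂ X := Q.isoMk (αₗ K₁.obj K₂.obj X.obj)
  actionUnitIso X := Q.isoMk (λₗ[M] X.obj)
  actionHom_def f g := by ext; exact actionHom_def f.hom g.hom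
  actionHomRight_id K X := by ext; exact actionHomRight_id K.obj X.obj
  id_actionHomLeft K X := by ext; exact id_actionHomLeft K.obj X.obj
  actionHom_comp f f' g g' := by ext; exact actionHom_comp f.hom f'.hom g.hom g'.hom
  actionAssocIso_hom_naturality f g u := by
    ext; exact actionAssocIso_hom_naturality f.hom g.hom u.hom
  actionUnitIso_hom_naturality f := by ext; exact actionUnitIso_hom_naturality f.hom
  whiskerLeft_actionHomLeft K _ _ f X := by
    ext; exact whiskerLeft_actionHomLeft K.obj f.hom X.obj
  whiskerRight_actionHomLeft K f X := by
    ext; exact whiskerRight_actionHomLeft K.obj f.hom X.obj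
  associator_actionHom K₁ K₂ K₃ X := by
    ext; exact associator_actionHom K₁.obj K₂.obj K₃.obj X.obj
  leftUnitor_actionHom K X := by ext; exact leftUnitor_actionHom K.obj X.obj
  rightUnitor_actionHom K X := by ext; exact rightUnitor_actionHom K.obj X.obj

end Restrict

/-! ### Transport of an action along an equivalence -/

section Transport

open MonoidalLeftAction

variable {M E E' : Type*} [Category* M] [MonoidalCategory M] [Category* E] [Category* E']
  [MonoidalLeftAction M E] (e : E' ≌ E)

/-- The unit of the equivalence `e.symm`, acted upon. -/
@[simps hom inv]
def transportIso (K : M) (Y : E) : K ⊙ₗ Y ≅ K ⊙ₗ e.functor.obj (e.inverse.obj Y) where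
  hom := K ⊴ₗ e.counitIso.inv.app Y
  inv := K ⊴ₗ e.counitIso.hom.app Y
  hom_inv_id := by
    refine (actionHomRight_comp K _ _).symm.trans ?_
    rw [Iso.inv_hom_id_app]
    exact actionHomRight_id _ _
  inv_hom_id := by
    refine (actionHomRight_comp K _ _).symm.trans ?_
    rw [Iso.hom_inv_id_app]
    exact actionHomRight_id _ _

theorem counitIso_inv_natural {X Y : E} (u : X ⟶ Y) :
    u ≫ e.counitIso.inv.app Y = e.counitIso.inv.app X ≫ e.functor.map (e.inverse.map u) :=
  e.counitIso.inv.naturality u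

theorem transportIso_natural {K K' : M} (f : K ⟶ K') {X Y : E} (u : X ⟶ Y) :
    (f ⊙ₗₘ u) ≫ (transportIso e K' Y).hom =
      (transportIso e K X).hom ≫ (f ⊙ₗₘ e.functor.map (e.inverse.map u)) := by
  rw [transportIso_hom, transportIso_hom]
  erw [← id_actionHom K, ← id_actionHom K', ← actionHom_comp, ← actionHom_comp, Category.id_comp,
    Category.comp_id, counitIso_inv_natural]

theorem transportIso_natural_right (K : M) {X Y : E} (u : X ⟶ Y) :
    K ⊴ₗ u ≫ (transportIso e K Y).hom =
      (transportIso e K X).hom ≫ K ⊴ₗ e.functor.map (e.inverse.map u) := by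
  have := transportIso_natural e (𝟙 K) u
  rwa [id_actionHom, id_actionHom] at this

theorem transportIso_natural_left {K K' : M} (f : K ⟶ K') (X : E) :
    f ⊵ₗ X ≫ (transportIso e K' X).hom =
      (transportIso e K X).hom ≫ f ⊵ₗ e.functor.obj (e.inverse.obj X) := by
  have := transportIso_natural e f (𝟙 X)
  rwa [CategoryTheory.Functor.map_id, CategoryTheory.Functor.map_id, actionHom_id,
    actionHom_id] at this

/-- The action transported along an equivalence of categories. -/
@[reducible]
def transportAction : MonoidalLeftAction M E' where
  actionObj K X := e.inverse.obj (K ⊙ₗ e.functor.obj X)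
  actionHomLeft f X := e.inverse.map (f ⊵ₗ e.functor.obj X)
  actionHomRight K _ _ g := e.inverse.map (K ⊴ₗ e.functor.map g)
  actionHom f g := e.inverse.map (f ⊙ₗₘ e.functor.map g)
  actionAssocIso K₁ K₂ X := e.inverse.mapIso (αₗ K₁ K₂ (e.functor.obj X) ≪≫ transportIso e K₁ _)
  actionUnitIso X := e.inverse.mapIso (λₗ[M] (e.functor.obj X)) ≪≫ e.unitIso.symm.app X
  actionHom_def f g := by rw [actionHom_def, Functor.map_comp]
  actionHomRight_id K X := by simp
  id_actionHomLeft K X := by simp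
  actionHom_comp f f' g g' := by rw [Functor.map_comp, actionHom_comp, Functor.map_comp]
  actionAssocIso_hom_naturality f g u := by
    rw [Functor.mapIso_hom, Functor.mapIso_hom, ← Functor.map_comp, ← Functor.map_comp,
      Iso.trans_hom, Iso.trans_hom, Category.assoc, actionAssocIso_hom_naturality_assoc,
      transportIso_natural]
  actionUnitIso_hom_naturality f := by
    have := actionUnitIso_hom_naturality (C := M) (e.functor.map f)
    simp only [Iso.trans_hom, Functor.mapIso_hom, Category.assoc, Iso.app_hom, Iso.symm_hom]
    rw [← Functor.map_comp_assoc, ← this, Functor.map_comp_assoc]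
    exact congrArg (_ ≫ ·) (e.unitIso.inv.naturality f).symm
  whiskerLeft_actionHomLeft K _ _ f X := by
    rw [← Category.assoc, Iso.eq_comp_inv, Functor.mapIso_hom,
      Functor.mapIso_hom, ← Functor.map_comp, ← Functor.map_comp,
      Iso.trans_hom, Iso.trans_hom, whiskerLeft_actionHomLeft, Category.assoc, Category.assoc,
      Category.assoc, Iso.inv_hom_id_assoc, transportIso_natural_right]
  whiskerRight_actionHomLeft K f X := by
    rw [← Category.assoc, Iso.eq_comp_inv, Functor.mapIso_hom,
      Functor.mapIso_hom, ← Functor.map_comp, ← Functor.map_comp,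
      Iso.trans_hom, Iso.trans_hom, whiskerRight_actionHomLeft, Category.assoc, Category.assoc,
      Category.assoc, Iso.inv_hom_id_assoc, transportIso_natural_left]
  associator_actionHom K₁ K₂ K₃ X := by
    rw [Functor.mapIso_hom, Functor.mapIso_hom, Functor.mapIso_hom, Functor.mapIso_hom,
      ← Functor.map_comp, ← Functor.map_comp, ← Functor.map_comp, Iso.trans_hom, Iso.trans_hom,
      Iso.trans_hom, Iso.trans_hom, Category.assoc, ← transportIso_natural_right,
      actionHomRight_comp, Category.assoc, associator_actionHom_assoc, Category.assoc,
      transportIso_hom (K := K₁ ⊗ K₂), transportIso_hom (K := K₂)]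
    congr 2
    -- What remains is naturality of the associator in its last variable, along the inverse of the
    -- counit.
    have := actionAssocIso_hom_naturality (𝟙 K₁) (𝟙 K₂)
      (e.counitIso.inv.app (K₃ ⊙ₗ e.functor.obj X))
    rw [MonoidalCategory.id_tensorHom_id, id_actionHom, id_actionHom, id_actionHom] at this
    rw [← Category.assoc, ← Category.assoc]
    exact congrArg (· ≫ _) this.symm
  leftUnitor_actionHom K X := by
    have h1 := actionUnitIso_hom_naturality (C := M)
      (e.counitIso.inv.app (K ⊙ₗ e.functor.obj X))
    have h2 : e.inverse.map (e.counitIso.inv.app (K ⊙ₗ e.functor.obj X)) ≫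
      e.unitIso.inv.app (e.inverse.obj (K ⊙ₗ e.functor.obj X)) = 𝟙 _ := by simp
    rw [Functor.mapIso_hom, Iso.trans_hom, Iso.trans_hom, Functor.mapIso_hom, transportIso_hom,
      ← Functor.map_comp_assoc, Category.assoc, leftUnitor_actionHom]
    refine Eq.trans ?_ (congrArg (fun z => e.inverse.map (_ ≫ z) ≫ _) h1)
    rw [← Category.assoc, Functor.map_comp _ (_ ≫ _), Category.assoc]
    refine ((Category.comp_id _).symm.trans (congrArg (_ ≫ ·) h2.symm))
  rightUnitor_actionHom K X := by
    rw [Functor.mapIso_hom, ← Functor.map_comp, Iso.trans_hom, Iso.trans_hom, Functor.mapIso_hom,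
      rightUnitor_actionHom, e.functor.map_comp, actionHomRight_comp, Category.assoc,
      ← reassoc_of% (transportIso_natural_right e K (λₗ[M] (e.functor.obj X)).hom)]
    -- This is a triangle identity of the equivalence, acted upon by `K`.
    have : (transportIso e K (e.functor.obj X)).hom ≫
      K ⊴ₗ e.functor.map ((e.unitIso.symm.app X).hom) = 𝟙 _ := by
      rw [transportIso_hom]
      refine (actionHomRight_comp K _ _).symm.trans ?_
      refine (congrArg (K ⊴ₗ ·) ?_).trans (actionHomRight_id _ _)
      simp
    rw [this, Category.comp_id]

end Transport

/-! ### R-modules acting on Λ-modules by the tensor product -/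

section TensorAction
open scoped TensorProduct
open HomologicalComplex

noncomputable instance preservesColimitsOfShape_restrictScalars_discrete {R S : Type u} [Ring R]
    [Ring S] (f : R →+* S) (J : Type) :
    PreservesColimitsOfShape (Discrete J) (ModuleCat.restrictScalars.{u} f) where
  preservesColimit := inferInstance

attribute [local instance] restrictedModule restrictedModule_isScalarTower

variable (R : Type u) [CommRing R] (Λ : Type u) [Ring Λ] [Algebra R Λ]

/-- The restriction of scalars of `V ⊗_R N`. -/
noncomputable def tensorBifunctorRestrictScalars (N : ModuleCat.{u} R) (V : ModuleCat.{u} Λ) :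
    (ModuleCat.restrictScalars.{u} (algebraMap R Λ)).obj (((tensorBifunctor R Λ).obj N).obj V) ≅
      (ModuleCat.restrictScalars.{u} (algebraMap R Λ)).obj V ⊗ N :=
  LinearEquiv.toModuleIso
    { toFun := id
      invFun := id
      map_add' := fun _ _ => rfl
      map_smul' := fun r (x : V ⊗[R] N) => algebraMap_smul Λ r x
      left_inv := fun _ => rfl
      right_inv := fun _ => rfl }

/-- After restriction of scalars to R the functor is an ordinary tensor product, which preserves
coproducts, and restriction of scalars reflects them. -/
instance (N : ModuleCat.{u} R) (J : Type) :
    PreservesColimitsOfShape (Discrete J) ((tensorBifunctor R Λ).obj N) := by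
  let e : (tensorBifunctor R Λ).obj N ⋙ ModuleCat.restrictScalars.{u} (algebraMap R Λ) ≅
      ModuleCat.restrictScalars.{u} (algebraMap R Λ) ⋙ tensorRight N :=
    NatIso.ofComponents (fun V => tensorBifunctorRestrictScalars R Λ N V) (fun f => rfl)
  have := preservesColimitsOfShape_restrictScalars_discrete (algebraMap R Λ) J
  have : PreservesColimitsOfShape (Discrete J)
      (ModuleCat.restrictScalars.{u} (algebraMap R Λ) ⋙ tensorRight N) := inferInstance
  have := preservesColimitsOfShape_of_natIso (J := Discrete J) e.symm
  have : ReflectsColimitsOfShape (Discrete J) (ModuleCat.restrictScalars.{u} (algebraMap R Λ)) :=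
    reflectsColimitsOfShape_of_reflectsIsomorphisms
  exact preservesColimitsOfShape_of_reflects_of_preserves _
    (ModuleCat.restrictScalars.{u} (algebraMap R Λ))

instance (V : ModuleCat.{u} Λ) (J : Type) :
    PreservesColimitsOfShape (Discrete J) ((tensorBifunctor R Λ).flip.obj V) := by
  let e : (tensorBifunctor R Λ).flip.obj V ⋙ ModuleCat.restrictScalars.{u} (algebraMap R Λ) ≅
      tensorLeft ((ModuleCat.restrictScalars.{u} (algebraMap R Λ)).obj V) :=
    NatIso.ofComponents (fun N => tensorBifunctorRestrictScalars R Λ N V) (fun f => rfl)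
  have := preservesColimitsOfShape_restrictScalars_discrete (algebraMap R Λ) J
  have := preservesColimitsOfShape_of_natIso (J := Discrete J) e.symm
  have : ReflectsColimitsOfShape (Discrete J) (ModuleCat.restrictScalars.{u} (algebraMap R Λ)) :=
    reflectsColimitsOfShape_of_reflectsIsomorphisms
  exact preservesColimitsOfShape_of_reflects_of_preserves _
    (ModuleCat.restrictScalars.{u} (algebraMap R Λ))

/-- The associativity isomorphism `(N ⊗ N') ⊗ V ≅ N ⊗ (N' ⊗ V)`. -/
noncomputable def tensorAssoc (N N' : ModuleCat.{u} R) (V : ModuleCat.{u} Λ) :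
    ((tensorBifunctor R Λ).obj (N ⊗ N')).obj V ≅
      ((tensorBifunctor R Λ).obj N).obj (((tensorBifunctor R Λ).obj N').obj V) :=
  LinearEquiv.toModuleIso (((TensorProduct.AlgebraTensorModule.congr (LinearEquiv.refl Λ V)
      (TensorProduct.comm R N N')).trans
    (TensorProduct.AlgebraTensorModule.assoc R R Λ V N' N).symm :
    V ⊗[R] (N ⊗[R] N') ≃ₗ[Λ] (V ⊗[R] N') ⊗[R] N))

/-- The unit isomorphism `R ⊗ V ≅ V`. -/
noncomputable def tensorUnit (V : ModuleCat.{u} Λ) :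
    ((tensorBifunctor R Λ).obj (𝟙_ _)).obj V ≅ V :=
  LinearEquiv.toModuleIso (TensorProduct.AlgebraTensorModule.rid R Λ V)

theorem tensorBifunctor_hom_ext {N : ModuleCat.{u} R} {V W : ModuleCat.{u} Λ}
    {f g : ((tensorBifunctor R Λ).obj N).obj V ⟶ W}
    (h : ∀ (v : V) (n : N), f.hom (v ⊗ₜ[R] n) = g.hom (v ⊗ₜ[R] n)) : f = g := by
  ext1
  exact TensorProduct.AlgebraTensorModule.ext (M := V) (N := N) (P := W) h

theorem tensorBifunctor_hom_ext₃ {N N' : ModuleCat.{u} R} {V W : ModuleCat.{u} Λ}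
    {f g : ((tensorBifunctor R Λ).obj (N ⊗ N')).obj V ⟶ W}
    (h : ∀ (v : V) (n : N) (n' : N'), f.hom (v ⊗ₜ[R] (n ⊗ₜ[R] n')) =
      g.hom (v ⊗ₜ[R] (n ⊗ₜ[R] n'))) : f = g := by
  rw [← cancel_epi (tensorAssoc R Λ N N' V).inv]
  exact tensorBifunctor_hom_ext R Λ (N := N) (V := ((tensorBifunctor R Λ).obj N').obj V)
    fun x n => by
      let e := ((TensorProduct.AlgebraTensorModule.mk R Λ (V ⊗[R] N') N).flip n)
      have : ((tensorAssoc R Λ N N' V).inv ≫ f).hom ∘ₗ e =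
          ((tensorAssoc R Λ N N' V).inv ≫ g).hom ∘ₗ e :=
        TensorProduct.AlgebraTensorModule.ext fun v n' => h v n n'
      exact LinearMap.congr_fun this x

theorem tensorBifunctor_hom_ext₄ {N N' N'' : ModuleCat.{u} R} {V W : ModuleCat.{u} Λ}
    {f g : ((tensorBifunctor R Λ).obj ((N ⊗ N') ⊗ N'')).obj V ⟶ W}
    (h : ∀ (v : V) (n : N) (n' : N') (n'' : N''), f.hom (v ⊗ₜ[R] ((n ⊗ₜ[R] n') ⊗ₜ[R] n'')) =
      g.hom (v ⊗ₜ[R] ((n ⊗ₜ[R] n') ⊗ₜ[R] n''))) : f = g := by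
  rw [← cancel_epi (tensorAssoc R Λ (N ⊗ N') N'' V).inv]
  exact tensorBifunctor_hom_ext₃ R Λ (N := N) (N' := N')
    (V := ((tensorBifunctor R Λ).obj N'').obj V) fun x n n' => by
      let e := ((TensorProduct.AlgebraTensorModule.mk R Λ (V ⊗[R] N'') (N ⊗[R] N')).flip
        (n ⊗ₜ n'))
      have : ((tensorAssoc R Λ (N ⊗ N') N'' V).inv ≫ f).hom ∘ₗ e =
          ((tensorAssoc R Λ (N ⊗ N') N'' V).inv ≫ g).hom ∘ₗ e :=
        TensorProduct.AlgebraTensorModule.ext fun v n'' => h v n n' n''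
      exact LinearMap.congr_fun this x

/-- The action of `R`-modules on `Λ`-modules. -/
noncomputable def tensorAction : BifunctorAction (tensorBifunctor R Λ) where
  assoc := NatIso.ofComponents (fun N => NatIso.ofComponents (fun N' =>
    NatIso.ofComponents (fun V => tensorAssoc R Λ N N' V)
      (fun f => tensorBifunctor_hom_ext₃ R Λ fun _ _ _ => rfl))
      (fun f => by ext V : 2; exact tensorBifunctor_hom_ext₃ R Λ fun _ _ _ => rfl))
      (fun f => by ext N' V : 4; exact tensorBifunctor_hom_ext₃ R Λ fun _ _ _ => rfl)
  unit := NatIso.ofComponents (fun V => tensorUnit R Λ V)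
    (fun f => tensorBifunctor_hom_ext R Λ fun v r =>
      (LinearMap.map_smul_of_tower f.hom r v).symm)
  pentagon X Y Z V := tensorBifunctor_hom_ext₄ R Λ fun _ _ _ _ => rfl
  leftUnit X V := tensorBifunctor_hom_ext₃ R Λ fun v r x =>
    (TensorProduct.smul_tmul r v x).symm
  rightUnit X V := tensorBifunctor_hom_ext₃ R Λ fun v x r =>
    (TensorProduct.smul_tmul r v x).symm

section Linear

variable (k : Type v) [Field k] [Algebra k R] [Algebra k Λ]

instance (N : ModuleCat.{u} R) : ((tensorBifunctor R Λ).obj N).Linear k where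
  map_smul _ _ := tensorBifunctor_hom_ext R Λ fun _ _ => rfl

/-- The field acts on V ⊗ N through V, whereas the scalar here multiplies a map in the variable N.
It is moved across the tensor sign as an element of R, which uses that the two k-structures are
compatible. -/
instance [IsScalarTower k R Λ] : (tensorBifunctor R Λ).Linear k where
  map_smul {N N'} f c := by
    ext V : 2
    refine tensorBifunctor_hom_ext R Λ fun v n => ?_
    have h : algebraMap k Λ c = algebraMap R Λ (algebraMap k R c) :=
      IsScalarTower.algebraMap_apply k R Λ c
    let := Module.restrictScalars k R N'
    have := IsScalarTower.restrictScalars k R N'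
    let := Module.restrictScalars k Λ V
    have := IsScalarTower.restrictScalars k Λ V
    have h₁ : (algebraMap k R c) • v = (algebraMap k Λ c) • v :=
      (algebraMap_smul Λ (algebraMap k R c) v).symm.trans (by rw [h])
    have h₂ := congrArg (fun v => v ⊗ₜ[R] f.hom n) h₁
    refine Eq.trans ?_ h₂
    refine Eq.trans ?_ (TensorProduct.smul_tmul (algebraMap k R c) v (f.hom n)).symm
    exact congrArg (fun n => v ⊗ₜ[R] n) (algebra_compatible_smul R c (f.hom n))

end Linear

end TensorAction

/-! ### Strictly perfect complexes up to homotopy -/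

section HomotopyPerfect
open HomologicalComplex Pretriangulated

variable (A : Type u) [Ring A]

/-- The strictly perfect complexes, as objects of the homotopy category. -/
def homotopyPerfect : ObjectProperty (HomotopyCategory (ModuleCat.{u} A) (.up ℤ)) :=
  fun X => IsStrictlyPerfect A X.as

variable {A} in
theorem homotopyCategory_shift_eq (X : HomotopyCategory (ModuleCat.{u} A) (.up ℤ)) (n : ℤ) :
    X⟦n⟧ = (HomotopyCategory.quotient _ _).obj
      ((X.as : CochainComplex (ModuleCat.{u} A) ℤ)⟦n⟧) := by
  with_unfolding_all rfl

/-- The third map of a triangle lifts to a chain map between strictly perfect complexes, and its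
cone, shifted back by one, represents the middle object. -/
instance : (homotopyPerfect A).IsTriangulated where
  exists_zero := ⟨(HomotopyCategory.quotient _ _).obj
      ((HomologicalComplex.single (ModuleCat.{u} A) (.up ℤ) 0).obj (ModuleCat.of A PUnit)),
    Functor.map_isZero _ (Functor.map_isZero _ (ModuleCat.isZero_of_subsingleton _)), by
      exact single_isStrictlyPerfect A _⟩
  isStableUnderShiftBy n := ⟨fun X hX => by
    change IsStrictlyPerfect A (X⟦n⟧).as
    rw [homotopyCategory_shift_eq]
    exact IsStrictlyPerfect.shift (K := X.as) hX n⟩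
  ext₂' T hT h₁ h₃ := by
    let c : _ ≅ T.obj₁⟦(1 : ℤ)⟧ :=
      ((HomotopyCategory.quotient (ModuleCat.{u} A) (.up ℤ)).commShiftIso (1 : ℤ)).app T.obj₁.as
    obtain ⟨f, hf⟩ := (HomotopyCategory.quotient (ModuleCat.{u} A) (.up ℤ)).map_surjective
      (X := T.obj₃.as) (Y := T.obj₁.as⟦(1 : ℤ)⟧) (T.mor₃ ≫ c.inv)
    have hT' := rot_of_distTriang _ (rot_of_distTriang _ hT)
    let e := isoTriangleOfIso₁₂ _ _ hT'
      (HomotopyCategory.mappingCone_triangleh_distinguished f) (Iso.refl _) c.symm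
      (hf.symm.trans (Category.id_comp _).symm)
    refine ⟨(HomotopyCategory.quotient _ _).obj ((CochainComplex.mappingCone f)⟦(-1 : ℤ)⟧),
      (IsStrictlyPerfect.mappingCone f h₃ (IsStrictlyPerfect.shift h₁ 1)).shift (-1), ⟨?_⟩⟩
    exact (shiftEquiv _ (1 : ℤ)).unitIso.app T.obj₂ ≪≫
      (shiftFunctor _ (-1 : ℤ)).mapIso (Triangle.π₃.mapIso e) ≪≫
      ((HomotopyCategory.quotient (ModuleCat.{u} A) (.up ℤ)).commShiftIso (-1 : ℤ)).symm.app _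

variable {A}

/-- Projectivity of the quotient terms splits the sequence in each degree. -/
theorem triangleh_of_shortExact {S : ShortComplex (CochainComplex (ModuleCat.{u} A) ℤ)}
    (hS : S.ShortExact) (h : ∀ n, Module.Projective A (S.X₃.X n)) :
    ∃ φ, Triangle.mk ((HomotopyCategory.quotient _ (.up ℤ)).map S.f)
      ((HomotopyCategory.quotient _ (.up ℤ)).map S.g) φ ∈ distTriang _ := by
  have h' (n : ℤ) : (S.map (eval _ _ n)).ShortExact := hS.map_of_exact (eval _ _ n)
  have (n : ℤ) : Projective (S.map (eval (ModuleCat.{u} A) (.up ℤ) n)).X₃ :=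
    (IsProjective.iff_projective _).1 (h n)
  exact ⟨_, (HomotopyCategory.distinguished_iff_iso_trianglehOfDegreewiseSplit _).2
    ⟨S, fun n => (h' n).splittingOfProjective, ⟨Iso.refl _⟩⟩⟩

variable (P : ObjectProperty (HomotopyCategory (ModuleCat.{u} A) (.up ℤ))) [P.IsTriangulated]
  [P.IsClosedUnderIsomorphisms]

/-- Brutal truncation: the top term is a subcomplex concentrated in one degree, and the quotient by
it is strictly perfect with one term fewer. -/
theorem IsStrictlyPerfect.induction
    (hP : ∀ (X : ModuleCat.{u} A) [Module.Finite A X] [Module.Projective A X],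
      P ((HomotopyCategory.quotient _ _).obj ((single _ (.up ℤ) 0).obj X)))
    {K : CochainComplex (ModuleCat.{u} A) ℤ} (hK : IsStrictlyPerfect A K) :
    P ((HomotopyCategory.quotient _ _).obj K) := by
  obtain ⟨h, ⟨a, ha⟩, ⟨b, hb⟩⟩ := hK
  -- `n` is the number of degrees in the interval from a to a + n - 1 that may be nonzero, so n = 0
  -- means that the complex is zero.
  obtain ⟨n, hn⟩ : ∃ n : ℕ, b ≤ a + n - 1 := ⟨(b - a + 1).toNat, by lia⟩
  have hP' (X : ModuleCat.{u} A) [Module.Finite A X] [Module.Projective A X] (n : ℤ) :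
      P ((HomotopyCategory.quotient _ _).obj ((single _ (.up ℤ) n).obj X)) :=
    P.prop_of_iso (((HomotopyCategory.quotient (ModuleCat.{u} A) (.up ℤ)).commShiftIso
        (-n)).symm.app _ ≪≫ (HomotopyCategory.quotient _ _).mapIso
      (((CochainComplex.singleFunctors (ModuleCat.{u} A)).shiftIso (-n) n 0 (by lia)).app X))
      (P.le_shift (-n) _ (hP X))
  have hb' := K.isStrictlyLE_of_le b _ hn
  clear hb hn b
  induction n generalizing K with
  | zero =>
    refine P.prop_of_isZero ?_
    refine Functor.map_isZero _ ?_
    rw [IsZero.iff_id_eq_zero]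
    ext i : 1
    refine IsZero.eq_of_src ?_ _ _
    by_cases hi : i < a
    · exact K.isZero_of_isStrictlyGE a i hi
    · exact K.isZero_of_isStrictlyLE (a + (0 : ℕ) - 1) i (by lia)
  | succ n ih =>
    set b : ℤ := a + n with hb
    have hb'' : K.IsStrictlyLE b := K.isStrictlyLE_of_le (a + (n + 1 : ℕ) - 1) b (by push_cast; lia)
    -- The inclusion of the top term is a chain map because the next term is zero.
    let ι : (single _ (.up ℤ) b).obj (K.X b) ⟶ K :=
      mkHomFromSingle (𝟙 _) (fun j hj => (K.isZero_of_isStrictlyLE b j (by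
        have : b + 1 = j := hj
        lia)).eq_of_tgt _ _)
    have hι (n : ℤ) (hn : n ≠ b) : IsZero (((single (ModuleCat.{u} A) (.up ℤ) b).obj (K.X b)).X n) :=
      isZero_single_obj_X _ _ _ _ hn
    have hιb : IsIso (ι.f b) := by
      rw [mkHomFromSingle_f]
      infer_instance
    have : Mono ι := by
      have (n : ℤ) : Mono (ι.f n) := by
        by_cases hn : n = b
        · subst hn; infer_instance
        · exact ⟨fun _ _ _ => (hι n hn).eq_of_tgt _ _⟩
      exact HomologicalComplex.mono_of_mono_f ι inferInstance
    let S := ShortComplex.mk ι (cokernel.π ι) (cokernel.condition ι)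
    have hS : S.ShortExact := { exact := ShortComplex.exact_cokernel ι }
    have hS' (n : ℤ) : (S.map (eval _ _ n)).ShortExact := hS.map_of_exact (eval _ _ n)
    have hSb : IsZero ((cokernel ι).X b) := by
      have := (hS' b).epi_g
      have h0 : (cokernel.π ι).f b = 0 := by
        rw [← cancel_epi (ι.f b), comp_zero]
        exact (S.map (eval _ _ b)).zero
      have : Epi ((cokernel.π ι).f b) := this
      exact IsZero.of_epi_eq_zero _ h0
    have hSn (n : ℤ) (hn : n ≠ b) : IsIso ((cokernel.π ι).f n) :=
      (hS' n).isIso_g_iff.2 (hι n hn)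
    have hc (n : ℤ) : Module.Finite A ((cokernel ι).X n) ∧
        Module.Projective A ((cokernel ι).X n) := by
      by_cases hn : n = b
      · subst hn
        have := ModuleCat.subsingleton_of_isZero hSb
        exact ⟨inferInstance, inferInstance⟩
      · have := hSn n hn
        have := h n
        let e := (asIso ((cokernel.π ι).f n)).toLinearEquiv
        have := this.1
        have := (h n).2
        exact ⟨Module.Finite.equiv e, Module.Projective.of_equiv e⟩
    obtain ⟨φ, hφ⟩ := triangleh_of_shortExact hS (fun n => (hc n).2)
    refine P.ext_of_isTriangulatedClosed₂ _ hφ ?_ ?_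
    · have := (h b).1
      have := (h b).2
      exact hP' _ _
    · refine ih hc ?_ ?_
      · rw [CochainComplex.isStrictlyGE_iff]
        intro i hi
        by_cases hib : i = b
        · subst hib; exact hSb
        · have := hSn i hib
          exact (K.isZero_of_isStrictlyGE a i hi).of_iso (asIso ((cokernel.π ι).f i)).symm
      · rw [CochainComplex.isStrictlyLE_iff]
        intro i hi
        by_cases hib : i = b
        · subst hib; exact hSb
        · have := hSn i hib
          exact (K.isZero_of_isStrictlyLE b i (by lia)).of_iso (asIso ((cokernel.π ι).f i)).symm

/-- With retracts at hand the free module of rank one is enough: extensions give finite free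
modules, and a finite projective is a retract of one. -/
theorem IsStrictlyPerfect.induction' [P.IsStableUnderRetracts]
    (hP : P ((HomotopyCategory.quotient _ _).obj ((single _ (.up ℤ) 0).obj (ModuleCat.of A A))))
    {K : CochainComplex (ModuleCat.{u} A) ℤ} (hK : IsStrictlyPerfect A K) :
    P ((HomotopyCategory.quotient _ _).obj K) := by
  have hfree (n : ℕ) : P ((HomotopyCategory.quotient _ _).obj
      ((single _ (.up ℤ) 0).obj (ModuleCat.of A (Fin n → A)))) := by
    induction n with
    | zero =>
      refine P.prop_of_isZero ?_
      refine Functor.map_isZero _ (Functor.map_isZero _ ?_)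
      exact ModuleCat.isZero_of_subsingleton _
    | succ n ih =>
      let e : (A × (Fin n → A)) ≃ₗ[A] (Fin (n + 1) → A) := Fin.consLinearEquiv A (fun _ => A)
      refine P.prop_of_iso ((HomotopyCategory.quotient _ _).mapIso
        ((single _ (.up ℤ) 0).mapIso e.toModuleIso)) ?_
      let S : ShortComplex (ModuleCat.{u} A) := ShortComplex.mk
        (ModuleCat.ofHom (LinearMap.inl A A (Fin n → A)))
        (ModuleCat.ofHom (LinearMap.snd A A (Fin n → A))) (by ext1; exact LinearMap.snd_comp_inl ..)
      have hS : S.ShortExact :=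
        { exact := (ShortComplex.ShortExact.moduleCat_exact_iff_function_exact _).2
            Function.Exact.inl_snd
          mono_f := (ModuleCat.mono_iff_injective _).2 LinearMap.inl_injective
          epi_g := (ModuleCat.epi_iff_surjective _).2 LinearMap.snd_surjective }
      obtain ⟨φ, hφ⟩ := triangleh_of_shortExact (hS.map_of_exact (single _ (.up ℤ) 0))
        (fun i => ((single_isStrictlyPerfect A (ModuleCat.of A (Fin n → A))).1 i).2)
      exact P.ext_of_isTriangulatedClosed₂ _ hφ hP ih
  refine IsStrictlyPerfect.induction P (fun X _ _ => ?_) hK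
  obtain ⟨n, f, g, -, -, h⟩ := Module.Finite.exists_comp_eq_id_of_projective A X
  refine P.prop_of_retract ?_ (hfree n)
  exact Retract.map ⟨ModuleCat.ofHom g, ModuleCat.ofHom f, by ext1; exact h⟩
    (single _ (.up ℤ) 0 ⋙ HomotopyCategory.quotient _ _)

/-! ### Bounded coherent complexes -/

theorem isBoundedCoherent_Q_obj [IsNoetherianRing A] (K : CochainComplex (ModuleCat.{u} A) ℤ)
    (a b : ℤ) [K.IsStrictlyGE a] [K.IsStrictlyLE b] (h : ∀ n, Module.Finite A (K.X n)) :
    IsBoundedCoherent A (DerivedCategory.Q.obj K) := by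
  refine ⟨⟨⟨a, (inferInstance : (DerivedCategory.Q.obj K).IsGE a)⟩,
    ⟨b, (inferInstance : (DerivedCategory.Q.obj K).IsLE b)⟩⟩, fun n => ?_⟩
  have e := (DerivedCategory.homologyFunctorFactors (ModuleCat.{u} A) n).app K
  have := h n
  have : IsNoetherian A (K.X n) := isNoetherian_of_isNoetherianRing_of_finite A _
  have : IsNoetherian A (K.cycles n) := isNoetherian_of_injective (K.iCycles n).hom
    ((ModuleCat.mono_iff_injective _).1 inferInstance)
  have : Module.Finite A (K.homology n) := Module.Finite.of_surjective (K.homologyπ n).hom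
    ((ModuleCat.epi_iff_surjective _).1 inferInstance)
  have : Module.Finite A ((homologyFunctor (ModuleCat.{u} A) (.up ℤ) n).obj K) := this
  exact Module.Finite.equiv e.toLinearEquiv.symm

theorem isPerfect_le_isBoundedCoherent [IsNoetherianRing A] : IsPerfect A ≤ IsBoundedCoherent A := by
  rintro X ⟨K, ⟨h, ⟨a, _⟩, ⟨b, _⟩⟩, ⟨e⟩⟩
  have := isBoundedCoherent_Q_obj K a b (fun n => (h n).1)
  exact ⟨DerivedCategory.TStructure.t.bounded.prop_of_iso e.symm this.1,
    (HasFiniteCohomology A).prop_of_iso e.symm this.2⟩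

instance [IsNoetherianRing A] : (IsBoundedCoherent A).IsClosedUnderIsomorphisms where
  of_iso e h := ⟨DerivedCategory.TStructure.t.bounded.prop_of_iso e h.1,
    (HasFiniteCohomology A).prop_of_iso e h.2⟩

/-! ### The homotopy category of strictly perfect complexes -/

variable (A)

/-- The homotopy category of strictly perfect complexes. -/
abbrev HoPerf := (homotopyPerfect A).FullSubcategory

/-- The functor from strictly perfect complexes to their homotopy category. -/
def StrictPerf.toHoPerf : StrictPerf A ⥤ HoPerf A :=
  (homotopyPerfect A).lift ((IsStrictlyPerfect A).ι ⋙ HomotopyCategory.quotient _ _)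
    (fun K => K.property)

variable {A}

/-- Strictly perfect complexes are K-projective. This is what permits all later constructions to be
made with homotopy classes of chain maps instead of fractions. -/
theorem HoPerf.Qh_map_bijective (X : HoPerf A) (Y : HomotopyCategory (ModuleCat.{u} A) (.up ℤ)) :
    Function.Bijective (DerivedCategory.Qh.map : (X.obj ⟶ Y) → _) :=
  have := IsStrictlyPerfect.isKProjective (K := X.obj.as) X.property
  CochainComplex.IsKProjective.Qh_map_bijective X.obj.as Y

theorem HoPerf.isPerfect (X : HoPerf A) : IsPerfect A (DerivedCategory.Qh.obj X.obj) :=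
  ⟨X.obj.as, X.property, ⟨(DerivedCategory.quotientCompQhIso (ModuleCat.{u} A)).app X.obj.as⟩⟩

/-! ### The equivalence with perfect objects; `Q` is either `IsPerfect` or `IsBoundedCoherent` -/

section Realize

variable (Q : ObjectProperty (DerivedCategory (ModuleCat.{u} A))) [Q.IsTriangulated]
  (hQ : IsPerfect A = Q)

/-- The functor from the homotopy category of strictly perfect complexes to a full subcategory of
the derived category. -/
noncomputable def realize (hQ : IsPerfect A = Q) : HoPerf A ⥤ Q.FullSubcategory :=
  Q.lift ((homotopyPerfect A).ι ⋙ DerivedCategory.Qh) (fun X => hQ ▸ X.isPerfect)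

noncomputable instance : (realize Q hQ).CommShift ℤ :=
  inferInstanceAs ((Q.lift _ _).CommShift ℤ)

instance : (realize Q hQ).IsTriangulated :=
  inferInstanceAs (Q.lift _ _).IsTriangulated

instance (k : Type v) [Field k] [Algebra k A] : (realize Q hQ).Linear k where
  map_smul f c := by
    ext
    exact Functor.map_smul (R := k) DerivedCategory.Qh c f.hom

instance : (realize Q hQ).Full where
  map_surjective {X Y} f := by
    obtain ⟨g, hg⟩ := (X.Qh_map_bijective Y.obj).surjective f.hom
    exact ⟨ObjectProperty.homMk g, by ext; exact hg⟩

instance : (realize Q hQ).Faithful where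
  map_injective {X Y} f g h := by
    ext
    exact (X.Qh_map_bijective Y.obj).injective (congrArg (·.hom) h)

instance : (realize Q hQ).EssSurj where
  mem_essImage X := by
    obtain ⟨K, hK, ⟨e⟩⟩ : IsPerfect A X.obj := hQ ▸ X.property
    exact ⟨⟨(HomotopyCategory.quotient _ _).obj K, hK⟩, ⟨Q.isoMk
      ((DerivedCategory.quotientCompQhIso (ModuleCat.{u} A)).app K ≪≫ e.symm)⟩⟩

instance : (realize Q hQ).IsEquivalence where

/-- Full subcategories of the derived category, consisting of the perfect complexes, are equivalent
to the homotopy category of strictly perfect complexes. -/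
noncomputable def resolve : Q.FullSubcategory ≌ HoPerf A := (realize Q hQ).asEquivalence.symm

noncomputable instance : (resolve Q hQ).inverse.CommShift ℤ :=
  inferInstanceAs ((realize Q hQ).CommShift ℤ)

instance : (resolve Q hQ).inverse.IsTriangulated :=
  inferInstanceAs (realize Q hQ).IsTriangulated

noncomputable instance : (resolve Q hQ).functor.CommShift ℤ :=
  (resolve Q hQ).commShiftFunctor ℤ

instance : (resolve Q hQ).CommShift ℤ := (resolve Q hQ).commShift_of_inverse ℤ

instance : (resolve Q hQ).IsTriangulated := .mk'' _ inferInstance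

instance (k : Type v) [Field k] [Algebra k A] : (resolve Q hQ).inverse.Linear k :=
  inferInstanceAs ((realize Q hQ).Linear k)

instance (k : Type v) [Field k] [Algebra k A] : (resolve Q hQ).functor.Linear k :=
  have : (resolve Q hQ).symm.functor.Linear k := inferInstanceAs ((resolve Q hQ).inverse.Linear k)
  (resolve Q hQ).symm.inverseLinear k

/-- Strictly perfect complexes as objects of the derived category. -/
noncomputable def toHoPerfRealize :
    StrictPerf.toHoPerf A ⋙ realize (IsPerfect A) rfl ≅ StrictPerf.toPerf A :=
  NatIso.ofComponents (fun K => (IsPerfect A).isoMk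
    ((DerivedCategory.quotientCompQhIso (ModuleCat.{u} A)).app K.obj)) (fun f => by
      ext
      exact (DerivedCategory.quotientCompQhIso (ModuleCat.{u} A)).hom.naturality f.hom)

/-- Strictly perfect complexes as objects of the homotopy category. -/
noncomputable def toPerfResolve :
    StrictPerf.toPerf A ⋙ (resolve (IsPerfect A) rfl).functor ≅ StrictPerf.toHoPerf A :=
  Functor.isoWhiskerRight toHoPerfRealize.symm _ ≪≫ Functor.associator _ _ _ ≪≫
    Functor.isoWhiskerLeft _ (resolve (IsPerfect A) rfl).counitIso ≪≫ Functor.rightUnitor _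

end Realize

end HomotopyPerfect

/-! ### Adjunctions and homotopies passed to homotopy categories -/

section DescendAdjunction

variable {C D : Type*} [Category* C] [Category* D] [Preadditive C] [Preadditive D]

/-- The natural transformation between induced functors on homotopy categories. -/
def descendNatTrans {Φ Φ' : CochainComplex C ℤ ⥤ CochainComplex D ℤ} [PreservesHomotopy Φ]
    [PreservesHomotopy Φ'] (τ : Φ ⟶ Φ') : descend Φ ⟶ descend Φ' where
  app X := (HomotopyCategory.quotient D (.up ℤ)).map (τ.app X.as)
  naturality X Y f := by
    obtain ⟨f, rfl⟩ := (HomotopyCategory.quotient C (.up ℤ)).map_surjective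
      (X := X.as) (Y := Y.as) f
    refine ((HomotopyCategory.quotient D (.up ℤ)).map_comp _ _).symm.trans ?_
    rw [τ.naturality]
    exact (HomotopyCategory.quotient D (.up ℤ)).map_comp _ _

variable {Φ : CochainComplex C ℤ ⥤ CochainComplex D ℤ} {Ψ : CochainComplex D ℤ ⥤ CochainComplex C ℤ}
  [PreservesHomotopy Φ] [PreservesHomotopy Ψ]

/-- The adjunction between homotopy categories induced by an adjunction between categories of
complexes. -/
def descendAdjunction (adj : Φ ⊣ Ψ) : descend Φ ⊣ descend Ψ where
  unit :=
    { app X := (HomotopyCategory.quotient C (.up ℤ)).map (adj.unit.app X.as)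
      naturality X Y f := by
        obtain ⟨f, rfl⟩ := (HomotopyCategory.quotient C (.up ℤ)).map_surjective
          (X := X.as) (Y := Y.as) f
        refine ((HomotopyCategory.quotient C (.up ℤ)).map_comp _ _).symm.trans ?_
        refine (congrArg _ (adj.unit.naturality f)).trans ?_
        exact (HomotopyCategory.quotient C (.up ℤ)).map_comp _ _ }
  counit :=
    { app X := (HomotopyCategory.quotient D (.up ℤ)).map (adj.counit.app X.as)
      naturality X Y f := by
        obtain ⟨f, rfl⟩ := (HomotopyCategory.quotient D (.up ℤ)).map_surjective
          (X := X.as) (Y := Y.as) f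
        refine ((HomotopyCategory.quotient D (.up ℤ)).map_comp _ _).symm.trans ?_
        refine (congrArg _ (adj.counit.naturality f)).trans ?_
        exact (HomotopyCategory.quotient D (.up ℤ)).map_comp _ _ }
  left_triangle_components X :=
    ((HomotopyCategory.quotient D (.up ℤ)).map_comp _ _).symm.trans
      ((congrArg _ (adj.left_triangle_components X.as)).trans
        (CategoryTheory.Functor.map_id _ _))
  right_triangle_components X :=
    ((HomotopyCategory.quotient C (.up ℤ)).map_comp _ _).symm.trans
      ((congrArg _ (adj.right_triangle_components X.as)).trans
        (CategoryTheory.Functor.map_id _ _))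

theorem descendAdjunction_homEquiv (adj : Φ ⊣ Ψ) {X : CochainComplex C ℤ} {Y : CochainComplex D ℤ}
    (f : Φ.obj X ⟶ Y) :
    (descendAdjunction adj).homEquiv ((HomotopyCategory.quotient C (.up ℤ)).obj X)
      ((HomotopyCategory.quotient D (.up ℤ)).obj Y) ((HomotopyCategory.quotient D (.up ℤ)).map f) =
      (HomotopyCategory.quotient C (.up ℤ)).map (adj.homEquiv X Y f) := by
  rw [Adjunction.homEquiv_apply adj]
  exact ((descendAdjunction adj).homEquiv_apply _ _ _).trans
    ((HomotopyCategory.quotient C (.up ℤ)).map_comp _ _).symm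

/-- A homotopy given by a family of morphisms of degree `-1`. -/
def homotopyOfFamily {K L : CochainComplex C ℤ} {f g : K ⟶ L}
    (s : ∀ i j : ℤ, j + 1 = i → (K.X i ⟶ L.X j))
    (comm : ∀ i, f.f i = K.d i (i + 1) ≫ s (i + 1) i rfl +
      s i (i - 1) (sub_add_cancel i 1) ≫ L.d (i - 1) i + g.f i) : Homotopy f g where
  hom i j := if h : j + 1 = i then s i j h else 0
  zero i j h := dif_neg h
  comm i := by
    rw [dNext_eq _ (show (ComplexShape.up ℤ).Rel i (i + 1) by simp),
      prevD_eq _ (show (ComplexShape.up ℤ).Rel (i - 1) i by simp), dif_pos rfl,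
      dif_pos (by lia), comm]

-- This is the Leibniz rule for z composed with the homotopy, viewed as a cochain of degree -1 whose
-- coboundary is f - g.
open CochainComplex.HomComplex in
theorem comp_ofHom_eq_of_homotopy {P Q Q' : CochainComplex C ℤ} {f g : Q ⟶ Q'} (h : Homotopy f g)
    {i : ℤ} (z : Cochain P Q i) :
    z.comp (Cochain.ofHom f) (add_zero i) =
      (δ i (i + 1) z).comp (Cochain.ofHomotopy h) (by lia) +
      δ (i - 1) i (z.comp (Cochain.ofHomotopy h) (by lia)) +
      z.comp (Cochain.ofHom g) (add_zero i) := by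
  have h₁ := δ_comp z (Cochain.ofHomotopy h) (show i + -1 = i - 1 by lia) (i + 1) 0 i
    (by lia) rfl (by lia)
  rw [δ_ofHomotopy, Cochain.comp_sub, Int.negOnePow_neg, Int.negOnePow_one, Units.neg_smul,
    one_smul] at h₁
  rw [h₁]
  abel

-- Again the Leibniz rule, with the homotopy on the left. Composing with it becomes a contraction
-- only after multiplication by (-1)^i on cochains of degree i.
open CochainComplex.HomComplex in
theorem ofHom_comp_eq_of_homotopy {P P' Q : CochainComplex C ℤ} {f g : P' ⟶ P} (h : Homotopy f g)
    {i : ℤ} (z : Cochain P Q i) :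
    (Cochain.ofHom f).comp z (zero_add i) =
      (i + 1).negOnePow • (Cochain.ofHomotopy h).comp (δ i (i + 1) z) (by lia) +
      δ (i - 1) i (i.negOnePow • (Cochain.ofHomotopy h).comp z (by lia)) +
      (Cochain.ofHom g).comp z (zero_add i) := by
  have h₁ := δ_comp (Cochain.ofHomotopy h) z (show -1 + i = i - 1 by lia) 0 (i + 1) i
    (by lia) (by lia) rfl
  rw [δ_ofHomotopy, Cochain.sub_comp] at h₁
  rw [δ_units_smul, h₁, Int.negOnePow_succ, smul_add, smul_smul, Int.units_mul_self, one_smul,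
    Units.neg_smul]
  abel

end DescendAdjunction

/-! ### The Hom complex over R and its adjunction with the tensor product -/

section HomComplex
open HomologicalComplex CochainComplex.HomComplex

attribute [local instance] restrictedModule restrictedModule_isScalarTower

variable (R : Type u) [CommRing R] (Λ : Type u) [Ring Λ] [Algebra R Λ]

/-- Modules over an `R`-algebra form an `R`-linear category. -/
@[reducible]
noncomputable def algebraLinear : Linear R (ModuleCat.{u} Λ) where
  homModule _ _ := inferInstance

attribute [local instance] algebraLinear

section Curry
open scoped TensorProduct

/-- Currying for morphisms from `V ⊗ N`. -/
noncomputable def tensorHomEquiv (N : ModuleCat.{u} R) (V W : ModuleCat.{u} Λ) :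
    (((tensorBifunctor R Λ).obj N).obj V ⟶ W) ≃ (N →ₗ[R] (V ⟶ W)) where
  toFun f :=
    { toFun n := ModuleCat.ofHom (f.hom ∘ₗ (TensorProduct.AlgebraTensorModule.mk R Λ V N).flip n)
      map_add' n n' := by
        ext v
        exact (congrArg f.hom (TensorProduct.tmul_add v n n')).trans (map_add f.hom _ _)
      map_smul' r n := by
        ext v
        exact (congrArg f.hom (TensorProduct.tmul_smul r v n)).trans
          (LinearMap.map_smul_of_tower f.hom r _) }
  invFun g := ModuleCat.ofHom (TensorProduct.AlgebraTensorModule.lift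
    { toFun v :=
        { toFun n := (g n).hom v
          map_add' n n' := by rw [map_add]; rfl
          map_smul' r n := by rw [map_smul]; rfl }
      map_add' v v' := by ext n; exact map_add (g n).hom v v'
      map_smul' l v := by ext n; exact map_smul (g n).hom l v })
  left_inv f := tensorBifunctor_hom_ext R Λ fun v n => rfl
  right_inv g := by
    ext n v
    rfl

variable {R Λ}

theorem tensorHomEquiv_comp {N : ModuleCat.{u} R} {V W W' : ModuleCat.{u} Λ}
    (f : ((tensorBifunctor R Λ).obj N).obj V ⟶ W) (g : W ⟶ W') (n : N) :
    tensorHomEquiv R Λ N V W' (f ≫ g) n = tensorHomEquiv R Λ N V W f n ≫ g := rfl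

theorem tensorHomEquiv_map_comp {N : ModuleCat.{u} R} {V V' W : ModuleCat.{u} Λ} (g : V' ⟶ V)
    (f : ((tensorBifunctor R Λ).obj N).obj V ⟶ W) (n : N) :
    tensorHomEquiv R Λ N V' W (((tensorBifunctor R Λ).obj N).map g ≫ f) n =
      g ≫ tensorHomEquiv R Λ N V W f n := rfl

theorem tensorHomEquiv_map_app_comp {N N' : ModuleCat.{u} R} {V W : ModuleCat.{u} Λ} (g : N' ⟶ N)
    (f : ((tensorBifunctor R Λ).obj N).obj V ⟶ W) (n : N') :
    tensorHomEquiv R Λ N' V W (((tensorBifunctor R Λ).map g).app V ≫ f) n =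
      tensorHomEquiv R Λ N V W f (g.hom n) := rfl

theorem tensorHomEquiv_add {N : ModuleCat.{u} R} {V W : ModuleCat.{u} Λ}
    (f g : ((tensorBifunctor R Λ).obj N).obj V ⟶ W) (n : N) :
    tensorHomEquiv R Λ N V W (f + g) n =
      tensorHomEquiv R Λ N V W f n + tensorHomEquiv R Λ N V W g n := rfl

theorem tensorHomEquiv_units_smul {N : ModuleCat.{u} R} {V W : ModuleCat.{u} Λ}
    (c : ℤˣ) (f : ((tensorBifunctor R Λ).obj N).obj V ⟶ W) (n : N) :
    tensorHomEquiv R Λ N V W (c • f) n = c • tensorHomEquiv R Λ N V W f n := by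
  rcases Int.units_eq_one_or c with rfl | rfl
  · rw [one_smul, one_smul]
  · rw [Units.neg_smul, one_smul, Units.neg_smul, one_smul]
    rfl

end Curry

variable {Λ}

/-- The complex of `R`-modules of morphisms between complexes of modules over an `R`-algebra. -/
noncomputable def homComplex (P Q : CochainComplex (ModuleCat.{u} Λ) ℤ) :
    CochainComplex (ModuleCat.{u} R) ℤ where
  X n := ModuleCat.of R (Cochain P Q n)
  d n m := ModuleCat.ofHom (δ_hom R P Q n m)
  shape n m h := by
    ext z : 2
    exact δ_shape n m h z
  d_comp_d' n m l _ _ := by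
    ext z : 2
    exact δ_δ n m l z

/-- The functor `Hom(P, -)` from complexes of `Λ`-modules to complexes of `R`-modules. -/
noncomputable def homFunctor (P : CochainComplex (ModuleCat.{u} Λ) ℤ) :
    CochainComplex (ModuleCat.{u} Λ) ℤ ⥤ CochainComplex (ModuleCat.{u} R) ℤ where
  obj Q := homComplex R P Q
  map {Q Q'} g :=
    { f n := ModuleCat.ofHom
        { toFun (z : Cochain P Q n) := z.comp (Cochain.ofHom g) (add_zero n)
          map_add' _ _ := Cochain.add_comp _ _ _ _
          map_smul' _ _ := Cochain.smul_comp _ _ _ _ }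
      comm' n m _ := by
        ext z : 2
        exact δ_comp_ofHom z g m }
  map_id Q := by
    ext n z : 4
    exact Cochain.comp_id z
  map_comp f g := by
    ext n z : 4
    refine (congrArg (fun w => Cochain.comp z w (add_zero n)) (Cochain.ofHom_comp f g)).trans ?_
    exact (Cochain.comp_assoc_of_third_is_zero_cochain _ _ _ _).symm

instance (k : Type v) [Field k] [Algebra k R] [Algebra k Λ] [IsScalarTower k R Λ]
    (P : CochainComplex (ModuleCat.{u} Λ) ℤ) : (homFunctor R P).Linear k where
  map_smul {Q Q'} f c := by
    ext n z : 4
    refine Cochain.ext _ _ fun p q hpq => ?_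
    refine (Cochain.comp_v z (Cochain.ofHom (c • f)) (add_zero n) p q q hpq (add_zero q)).trans ?_
    refine Eq.trans ?_ (congrArg (algebraMap k R c • ·)
      (Cochain.comp_v z (Cochain.ofHom f) (add_zero n) p q q hpq (add_zero q))).symm
    rw [Cochain.ofHom_v, Cochain.ofHom_v]
    ext x
    change algebraMap k Λ c • (f.f q).hom ((z.v p q hpq).hom x) =
      algebraMap R Λ (algebraMap k R c) • (f.f q).hom ((z.v p q hpq).hom x)
    rw [← IsScalarTower.algebraMap_apply]

instance (P : CochainComplex (ModuleCat.{u} Λ) ℤ) : PreservesHomotopy (homFunctor R P) where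
  nonempty {Q Q' f g} h := ⟨homotopyOfFamily
    (fun i j hij => ModuleCat.ofHom
      { toFun (z : Cochain P Q i) := (z.comp (Cochain.ofHomotopy h) (by lia) : Cochain P Q' j)
        map_add' _ _ := Cochain.add_comp _ _ _ _
        map_smul' _ _ := Cochain.smul_comp _ _ _ _ })
    (fun i => by
        ext z : 2
        exact comp_ofHom_eq_of_homotopy h z)⟩

variable {R} in
/-- The natural transformation `Hom(P, -) ⟶ Hom(P', -)` induced by `P' ⟶ P`. -/
noncomputable def homFunctorMap {P P' : CochainComplex (ModuleCat.{u} Λ) ℤ} (f : P' ⟶ P) :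
    homFunctor R P ⟶ homFunctor R P' where
  app Q :=
    { f n := ModuleCat.ofHom
        { toFun (z : Cochain P Q n) := (Cochain.ofHom f).comp z (zero_add n)
          map_add' _ _ := Cochain.comp_add _ _ _ _
          map_smul' _ _ := Cochain.comp_smul _ _ _ _ }
      comm' n m _ := by
        ext z : 2
        exact δ_ofHom_comp f z m }
  naturality Q Q' g := by
    ext n z : 4
    exact (Cochain.comp_assoc_of_third_is_zero_cochain (Cochain.ofHom f) (z : Cochain P Q n)
      (Cochain.ofHom g) (zero_add n)).symm

theorem homFunctorMap_id (P : CochainComplex (ModuleCat.{u} Λ) ℤ) :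
    homFunctorMap (R := R) (𝟙 P) = 𝟙 _ := by
  ext Q n z : 6
  exact Cochain.id_comp (z : Cochain P Q n)

theorem homFunctorMap_comp {P P' P'' : CochainComplex (ModuleCat.{u} Λ) ℤ} (f : P'' ⟶ P')
    (g : P' ⟶ P) : homFunctorMap (R := R) (f ≫ g) = homFunctorMap g ≫ homFunctorMap f := by
  ext Q n z : 6
  refine (congrArg (fun w => Cochain.comp w z (zero_add n)) (Cochain.ofHom_comp f g)).trans ?_
  exact Cochain.comp_assoc_of_first_is_zero_cochain _ _ _ _

theorem homFunctorMap_homotopy {P P' : CochainComplex (ModuleCat.{u} Λ) ℤ} {f g : P' ⟶ P}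
    (h : Homotopy f g) (Q : CochainComplex (ModuleCat.{u} Λ) ℤ) :
    Nonempty (Homotopy ((homFunctorMap (R := R) f).app Q) ((homFunctorMap g).app Q)) :=
  ⟨homotopyOfFamily
    (fun i j hij => ModuleCat.ofHom
      { toFun (z : Cochain P Q i) :=
          (i.negOnePow • (Cochain.ofHomotopy h).comp z (by lia) : Cochain P' Q j)
        map_add' _ _ := by rw [Cochain.comp_add, smul_add]
        map_smul' _ _ := by rw [Cochain.comp_smul, smul_comm]; rfl })
    (fun i => by
        ext z : 2
        exact ofHom_comp_eq_of_homotopy h z)⟩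

section Adjunction

variable {R} {K : CochainComplex (ModuleCat.{u} R) ℤ} {P Q : CochainComplex (ModuleCat.{u} Λ) ℤ}

theorem ι_comp_d (φ : mapBifunctor K P (tensorBifunctor R Λ) (.up ℤ) ⟶ Q) (i j n : ℤ)
    (h : i + j = n) :
    (ιMapBifunctor K P (tensorBifunctor R Λ) (.up ℤ) i j n h ≫ φ.f n) ≫ Q.d n (n + 1) =
      ((tensorBifunctor R Λ).map (K.d i (i + 1))).app (P.X j) ≫
        ιMapBifunctor K P (tensorBifunctor R Λ) (.up ℤ) (i + 1) j (n + 1)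
          (show i + 1 + j = n + 1 by lia) ≫ φ.f (n + 1) +
      i.negOnePow • ((tensorBifunctor R Λ).obj (K.X i)).map (P.d j (j + 1)) ≫
        ιMapBifunctor K P (tensorBifunctor R Λ) (.up ℤ) i (j + 1) (n + 1)
          (show i + (j + 1) = n + 1 by lia) ≫ φ.f (n + 1) := by
  rw [Category.assoc, φ.comm, ← Category.assoc, ι_mapBifunctor_d, Preadditive.add_comp,
    Category.assoc, Linear.units_smul_comp, Category.assoc]

/-- Currying for morphisms of complexes from `K ⊗ P`, in degree `i`. -/
noncomputable def curryCochain (φ : mapBifunctor K P (tensorBifunctor R Λ) (.up ℤ) ⟶ Q) (i : ℤ) :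
    K.X i →ₗ[R] Cochain P Q i where
  toFun a := Cochain.mk fun p q hpq =>
    tensorHomEquiv R Λ _ _ _ (ιMapBifunctor K P (tensorBifunctor R Λ) (.up ℤ) i p q
      (show i + p = q by lia) ≫ φ.f q) a
  map_add' a b := Cochain.ext _ _ fun p q hpq => map_add _ a b
  map_smul' r a := Cochain.ext _ _ fun p q hpq => map_smul _ r a

theorem curryCochain_v (φ : mapBifunctor K P (tensorBifunctor R Λ) (.up ℤ) ⟶ Q) (i : ℤ) (a : K.X i)
    (p q : ℤ) (hpq : p + i = q) :
    (curryCochain φ i a).v p q hpq =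
      tensorHomEquiv R Λ _ _ _ (ιMapBifunctor K P (tensorBifunctor R Λ) (.up ℤ) i p q
        (show i + p = q by lia) ≫ φ.f q) a := rfl

/-- Read on a summand, compatibility of φ with differentials is an identity of two terms plus one
term with sign (-1)^i. The differential of the Hom complex has the opposite sign there, so that term
cancels. -/
theorem δ_curryCochain (φ : mapBifunctor K P (tensorBifunctor R Λ) (.up ℤ) ⟶ Q) (i : ℤ) (a : K.X i) :
    δ i (i + 1) (curryCochain φ i a) = curryCochain φ (i + 1) ((K.d i (i + 1)).hom a) := by
  refine Cochain.ext _ _ fun p q hpq => ?_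
  obtain rfl : q = i + p + 1 := by lia
  rw [δ_v i (i + 1) rfl _ p _ hpq (i + p) (p + 1) (by lia) rfl, curryCochain_v, curryCochain_v,
    curryCochain_v, ← tensorHomEquiv_comp, ι_comp_d, tensorHomEquiv_add, tensorHomEquiv_map_app_comp,
    tensorHomEquiv_units_smul, tensorHomEquiv_map_comp, Int.negOnePow_succ, Units.neg_smul]
  exact add_neg_cancel_right _ _

/-- Currying for morphisms of complexes from `K ⊗ P`. -/
noncomputable def curryHom (φ : mapBifunctor K P (tensorBifunctor R Λ) (.up ℤ) ⟶ Q) :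
    K ⟶ homComplex R P Q where
  f i := ModuleCat.ofHom (curryCochain φ i)
  comm' i j hij := by
    obtain rfl : i + 1 = j := hij
    ext a : 2
    exact δ_curryCochain φ i a

/-- The value of a morphism to the complex of morphisms, as a family of linear maps. -/
noncomputable def evalHom (ψ : K ⟶ homComplex R P Q) (i p q : ℤ) (hpq : p + i = q) :
    K.X i →ₗ[R] (P.X p ⟶ Q.X q) where
  toFun a := Cochain.v ((ψ.f i).hom a) p q hpq
  map_add' a b := by rw [map_add]; rfl
  map_smul' r a := by rw [map_smul]; rfl

/-- The same identity as for currying, read backwards; it is what makes the uncurried family a chain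
map. -/
theorem evalHom_d (ψ : K ⟶ homComplex R P Q) (i p n : ℤ) (a : K.X i) (h : p + i = n) :
    evalHom ψ i p n h a ≫ Q.d n (n + 1) =
      evalHom ψ (i + 1) p (n + 1) (by lia) ((K.d i (i + 1)).hom a) +
        i.negOnePow • P.d p (p + 1) ≫ evalHom ψ i (p + 1) (n + 1) (by lia) a := by
  let z : Cochain P Q i := (ψ.f i).hom a
  let z' : Cochain P Q (i + 1) := (ψ.f (i + 1)).hom ((K.d i (i + 1)).hom a)
  have h₁ : δ i (i + 1) z = z' :=
    LinearMap.congr_fun (congrArg ModuleCat.Hom.hom (ψ.comm i (i + 1))) a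
  have h₂ := (δ_v i (i + 1) rfl z p (n + 1) (by lia) n (p + 1) (by lia) rfl).symm.trans
    (Cochain.congr_v h₁ p (n + 1) (by lia))
  rw [Int.negOnePow_succ, Units.neg_smul, ← sub_eq_add_neg, sub_eq_iff_eq_add] at h₂
  exact h₂

/-- Uncurrying for morphisms of complexes. -/
noncomputable def uncurryHom (ψ : K ⟶ homComplex R P Q) :
    mapBifunctor K P (tensorBifunctor R Λ) (.up ℤ) ⟶ Q where
  f n := mapBifunctorDesc fun i p h => (tensorHomEquiv R Λ _ _ _).symm
    (evalHom ψ i p n (by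
      have : i + p = n := h
      lia))
  comm' n m hnm := by
    obtain rfl : n + 1 = m := hnm
    refine mapBifunctor.hom_ext fun i j h => ?_
    have h' : i + j = n := h
    rw [← Category.assoc, ι_mapBifunctorDesc, ← Category.assoc, ι_mapBifunctor_d,
      Preadditive.add_comp, Category.assoc, ι_mapBifunctorDesc, Linear.units_smul_comp,
      Category.assoc, ι_mapBifunctorDesc]
    refine (tensorHomEquiv R Λ _ _ _).injective (LinearMap.ext fun a => ?_)
    rw [tensorHomEquiv_comp, tensorHomEquiv_add, tensorHomEquiv_map_app_comp,
      tensorHomEquiv_units_smul, tensorHomEquiv_map_comp, Equiv.apply_symm_apply,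
      Equiv.apply_symm_apply, Equiv.apply_symm_apply, evalHom_d]

theorem ι_uncurryHom (ψ : K ⟶ homComplex R P Q) (i j n : ℤ) (h : i + j = n) :
    ιMapBifunctor K P (tensorBifunctor R Λ) (.up ℤ) i j n h ≫ (uncurryHom ψ).f n =
      (tensorHomEquiv R Λ _ _ _).symm (evalHom ψ i j n (by lia)) := by
  rw [uncurryHom, ι_mapBifunctorDesc]

/-- Currying as an equivalence. -/
noncomputable def curryEquiv (K : CochainComplex (ModuleCat.{u} R) ℤ)
    (P Q : CochainComplex (ModuleCat.{u} Λ) ℤ) :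
    (mapBifunctor K P (tensorBifunctor R Λ) (.up ℤ) ⟶ Q) ≃ (K ⟶ homComplex R P Q) where
  toFun := curryHom
  invFun := uncurryHom
  left_inv φ := by
    ext n : 1
    refine mapBifunctor.hom_ext fun i j h => ?_
    exact (ι_uncurryHom _ i j n h).trans ((tensorHomEquiv R Λ _ _ _).symm_apply_eq.2 rfl)
  right_inv ψ := by
    ext i a : 3
    refine Cochain.ext _ _ fun p q hpq => ?_
    refine (curryCochain_v (uncurryHom ψ) i a p q hpq).trans ?_
    rw [ι_uncurryHom, Equiv.apply_symm_apply]
    rfl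

theorem curryHom_naturality_left {K' : CochainComplex (ModuleCat.{u} R) ℤ} (f : K' ⟶ K)
    (φ : mapBifunctor K P (tensorBifunctor R Λ) (.up ℤ) ⟶ Q) :
    curryHom (mapBifunctorMap f (𝟙 P) (tensorBifunctor R Λ) (.up ℤ) ≫ φ) = f ≫ curryHom φ := by
  ext i a : 3
  refine Cochain.ext _ _ fun p q hpq => ?_
  refine (curryCochain_v _ i a p q hpq).trans ?_
  rw [comp_f, ι_mapBifunctorMap_assoc, id_f, CategoryTheory.Functor.map_id, Category.id_comp,
    tensorHomEquiv_map_app_comp]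
  rfl

theorem curryHom_naturality_middle {P' : CochainComplex (ModuleCat.{u} Λ) ℤ} (f : P' ⟶ P)
    (φ : mapBifunctor K P (tensorBifunctor R Λ) (.up ℤ) ⟶ Q) :
    curryHom (mapBifunctorMap (𝟙 K) f (tensorBifunctor R Λ) (.up ℤ) ≫ φ) =
      curryHom φ ≫ (homFunctorMap f).app Q := by
  ext i a : 3
  refine Cochain.ext _ _ fun p q hpq => ?_
  refine (curryCochain_v _ i a p q hpq).trans ?_
  rw [comp_f, ι_mapBifunctorMap_assoc, id_f, CategoryTheory.Functor.map_id, NatTrans.id_app,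
    Category.id_comp, tensorHomEquiv_map_comp]
  refine Eq.trans ?_ (Cochain.comp_v (Cochain.ofHom f) (curryCochain φ i a) (zero_add i) p p q
    (add_zero p) hpq).symm
  rw [Cochain.ofHom_v]
  rfl

theorem curryHom_naturality_right {Q' : CochainComplex (ModuleCat.{u} Λ) ℤ}
    (φ : mapBifunctor K P (tensorBifunctor R Λ) (.up ℤ) ⟶ Q) (g : Q ⟶ Q') :
    curryHom (φ ≫ g) = curryHom φ ≫ (homFunctor R P).map g := by
  ext i a : 3
  refine Cochain.ext _ _ fun p q hpq => ?_
  refine (curryCochain_v _ i a p q hpq).trans ?_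
  rw [comp_f, ← Category.assoc, tensorHomEquiv_comp]
  refine Eq.trans ?_ (Cochain.comp_v (curryCochain φ i a) (Cochain.ofHom g) (add_zero i) p q q
    hpq (add_zero q)).symm
  rw [Cochain.ofHom_v]
  rfl

variable (R) in
/-- The adjunction between `- ⊗ P` and `Hom(P, -)`. -/
noncomputable def tensorHomAdjunction (P : CochainComplex (ModuleCat.{u} Λ) ℤ) :
    (tensorBifunctor R Λ).map₂CochainComplex.flip.obj P ⊣ homFunctor R P :=
  Adjunction.mkOfHomEquiv
    { homEquiv K Q := curryEquiv K P Q
      homEquiv_naturality_left_symm f ψ := by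
        refine (curryEquiv _ P _).symm_apply_eq.2 ?_
        refine Eq.trans ?_ (curryHom_naturality_left f _).symm
        exact congrArg (f ≫ ·) ((curryEquiv _ P _).apply_symm_apply ψ).symm
      homEquiv_naturality_right φ g := curryHom_naturality_right φ g }

theorem tensorHomAdjunction_homEquiv (φ : mapBifunctor K P (tensorBifunctor R Λ) (.up ℤ) ⟶ Q) :
    (tensorHomAdjunction R P).homEquiv K Q φ = curryHom φ :=
  DFunLike.congr_fun (congrFun (congrFun (Adjunction.mkOfHomEquiv_homEquiv _) K) Q) φ

end Adjunction

end HomComplex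

/-! ### Tensor products of strictly perfect complexes -/

section TensorPerfect
open HomologicalComplex
open scoped TensorProduct

attribute [local instance] restrictedModule restrictedModule_isScalarTower

variable {R : Type u} [CommRing R] {Λ : Type u} [Ring Λ] [Algebra R Λ]

theorem finite_tensorBifunctor (N : ModuleCat.{u} R) (V : ModuleCat.{u} Λ) [Module.Finite R N]
    [Module.Finite Λ V] : Module.Finite Λ (((tensorBifunctor R Λ).obj N).obj V) := by
  obtain ⟨n, f, hf⟩ := Module.Finite.exists_fin' R N
  have hf' := hf.comp (Finsupp.linearEquivFunOnFinite R R (Fin n)).surjective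
  let g : (Fin n →₀ R) →ₗ[R] N := f ∘ₗ (Finsupp.linearEquivFunOnFinite R R (Fin n)).toLinearMap
  have h : Function.Surjective
      (TensorProduct.AlgebraTensorModule.map (LinearMap.id (R := Λ) (M := V)) g) :=
    LinearMap.lTensor_surjective V hf'
  have : Module.Finite Λ (V ⊗[R] (Fin n →₀ R)) :=
    Module.Finite.equiv (TensorProduct.finsuppScalarRight R Λ V (Fin n)).symm
  exact Module.Finite.of_surjective _ h

theorem isZero_mapBifunctor_X (K : CochainComplex (ModuleCat.{u} R) ℤ)
    (L : CochainComplex (ModuleCat.{u} Λ) ℤ) (n : ℤ)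
    (h : ∀ i j, i + j = n → IsZero (K.X i) ∨ IsZero (L.X j)) :
    IsZero ((mapBifunctor K L (tensorBifunctor R Λ) (.up ℤ)).X n) := by
  rw [IsZero.iff_id_eq_zero]
  refine mapBifunctor.hom_ext (fun i j hij => ?_)
  refine IsZero.eq_of_src ?_ _ _
  rcases h i j hij with h | h
  · exact Functor.map_isZero ((tensorBifunctor R Λ).flip.obj (L.X j)) h
  · exact Functor.map_isZero ((tensorBifunctor R Λ).obj (K.X i)) h

theorem projective_mapBifunctor_X (K : CochainComplex (ModuleCat.{u} R) ℤ)
    (L : CochainComplex (ModuleCat.{u} Λ) ℤ)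
    (hK : ∀ n, Module.Projective R (K.X n)) (hL : ∀ n, Module.Projective Λ (L.X n)) (n : ℤ) :
    Module.Projective Λ ((mapBifunctor K L (tensorBifunctor R Λ) (.up ℤ)).X n) := by
  rw [IsProjective.iff_projective]
  have (i j : ℤ) : Projective (((tensorBifunctor R Λ).obj (K.X i)).obj (L.X j)) := by
    have := hK i
    have := hL j
    exact (IsProjective.iff_projective (L.X j ⊗[R] K.X i)).1 inferInstance
  refine ⟨fun f e _ => ⟨mapBifunctorDesc (fun i j hij =>
    Projective.factorThru (ιMapBifunctor K L (tensorBifunctor R Λ) (.up ℤ) i j n hij ≫ f) e), ?_⟩⟩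
  refine mapBifunctor.hom_ext (fun i j hij => ?_)
  rw [ι_mapBifunctorDesc_assoc, Projective.factorThru_comp]

/-- Boundedness of `K` leaves finitely many nonzero summands in each degree, so the total complex is
spanned by finitely many finite modules. -/
theorem finite_mapBifunctor_X (K : CochainComplex (ModuleCat.{u} R) ℤ)
    (L : CochainComplex (ModuleCat.{u} Λ) ℤ)
    (hK : ∀ n, Module.Finite R (K.X n)) (hL : ∀ n, Module.Finite Λ (L.X n))
    (a b : ℤ) [K.IsStrictlyGE a] [K.IsStrictlyLE b] (n : ℤ) :
    Module.Finite Λ ((mapBifunctor K L (tensorBifunctor R Λ) (.up ℤ)).X n) := by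
  let f (i : ℤ) := ιMapBifunctor K L (tensorBifunctor R Λ) (.up ℤ) i (n - i) n
    (show i + (n - i) = n by lia)
  let N : Submodule Λ ((mapBifunctor K L (tensorBifunctor R Λ) (.up ℤ)).X n) :=
    ⨆ i ∈ Finset.Icc a b, LinearMap.range (f i).hom
  have hN : N = ⊤ := by
    rw [← Submodule.ker_mkQ N, LinearMap.ker_eq_top]
    have : ModuleCat.ofHom N.mkQ = 0 := by
      refine mapBifunctor.hom_ext (fun i j hij => ?_)
      by_cases hi : i ∈ Finset.Icc a b
      · obtain rfl : j = n - i := by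
          have : i + j = n := hij
          lia
        ext1
        rw [Limits.comp_zero]
        refine LinearMap.ext fun x => ?_
        refine (Submodule.Quotient.mk_eq_zero N).2 ?_
        exact (le_iSup₂_of_le (f := fun i (_ : i ∈ Finset.Icc a b) => LinearMap.range (f i).hom)
          i hi le_rfl) ⟨x, rfl⟩
      · refine IsZero.eq_of_src (Functor.map_isZero
          ((tensorBifunctor R Λ).flip.obj (L.X j)) ?_) _ _
        rw [Finset.mem_Icc, not_and_or, not_le, not_le] at hi
        rcases hi with hi | hi
        · exact K.isZero_of_isStrictlyGE a i hi
        · exact K.isZero_of_isStrictlyLE b i hi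
    exact congrArg ModuleCat.Hom.hom this
  refine ⟨hN ▸ Submodule.fg_biSup _ _ fun i _ => ?_⟩
  have := hK i
  have := hL (n - i)
  have := finite_tensorBifunctor (K.X i) (L.X (n - i))
  exact Module.Finite.iff_fg.1 (Module.Finite.range (f i).hom)

theorem IsStrictlyPerfect.mapBifunctor {K : CochainComplex (ModuleCat.{u} R) ℤ}
    {L : CochainComplex (ModuleCat.{u} Λ) ℤ} (hK : IsStrictlyPerfect R K)
    (hL : IsStrictlyPerfect Λ L) :
    IsStrictlyPerfect Λ (HomologicalComplex.mapBifunctor K L (tensorBifunctor R Λ) (.up ℤ)) := by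
  obtain ⟨hK, ⟨a, _⟩, ⟨b, _⟩⟩ := hK
  obtain ⟨hL, ⟨a', _⟩, ⟨b', _⟩⟩ := hL
  refine ⟨fun n => ⟨finite_mapBifunctor_X K L (fun n => (hK n).1) (fun n => (hL n).1) a b n,
    projective_mapBifunctor_X K L (fun n => (hK n).2) (fun n => (hL n).2) n⟩,
    ⟨a + a', ?_⟩, ⟨b + b', ?_⟩⟩
  · rw [CochainComplex.isStrictlyGE_iff]
    intro n hn
    refine isZero_mapBifunctor_X K L n fun i j hij => ?_
    by_cases hi : i < a
    · exact .inl (K.isZero_of_isStrictlyGE a i hi)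
    · exact .inr (L.isZero_of_isStrictlyGE a' j (by lia))
  · rw [CochainComplex.isStrictlyLE_iff]
    intro n hn
    refine isZero_mapBifunctor_X K L n fun i j hij => ?_
    by_cases hi : b < i
    · exact .inl (K.isZero_of_isStrictlyLE b i hi)
    · exact .inr (L.isZero_of_isStrictlyLE b' j (by lia))

theorem homotopyPerfect_tensorRight (P : HoPerf Λ) (K : HoPerf R) :
    homotopyPerfect Λ (((homotopyPerfect R).ι ⋙
    descend ((tensorBifunctor R Λ).map₂CochainComplex.flip.obj P.obj.as)).obj K) :=
  IsStrictlyPerfect.mapBifunctor K.property P.property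

theorem homotopyPerfect_tensorLeft (K : StrictPerf R) (P : HoPerf Λ) :
    homotopyPerfect Λ (((homotopyPerfect Λ).ι ⋙
    descend ((tensorBifunctor R Λ).map₂CochainComplex.obj K.obj)).obj P) :=
  IsStrictlyPerfect.mapBifunctor K.property P.property

/-- The functor `- ⊗ P` between homotopy categories of strictly perfect complexes. -/
noncomputable def tensorRightPerf (R : Type u) [CommRing R] [Algebra R Λ] (P : HoPerf Λ) :
    HoPerf R ⥤ HoPerf Λ :=
  (homotopyPerfect Λ).lift _ (homotopyPerfect_tensorRight P)

/-- The functor `K ⊗ -` between homotopy categories of strictly perfect complexes. -/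
noncomputable def tensorLeftPerf (Λ : Type u) [Ring Λ] [Algebra R Λ] (K : StrictPerf R) :
    HoPerf Λ ⥤ HoPerf Λ :=
  (homotopyPerfect Λ).lift _ (homotopyPerfect_tensorLeft K)

instance (K : CochainComplex (ModuleCat.{u} R) ℤ) :
    (descend ((tensorBifunctor R Λ).map₂CochainComplex.obj K)).IsTriangulated :=
  descend_map₂_isTriangulated (tensorBifunctor R Λ) K

instance (L : CochainComplex (ModuleCat.{u} Λ) ℤ) :
    (descend ((tensorBifunctor R Λ).map₂CochainComplex.flip.obj L)).IsTriangulated :=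
  descend_map₂_flip_isTriangulated (tensorBifunctor R Λ) L

noncomputable instance (P : HoPerf Λ) : (tensorRightPerf R P).CommShift ℤ :=
  inferInstanceAs (((homotopyPerfect Λ).lift _ (homotopyPerfect_tensorRight P)).CommShift ℤ)

instance (P : HoPerf Λ) : (tensorRightPerf R P).IsTriangulated :=
  inferInstanceAs ((homotopyPerfect Λ).lift _ (homotopyPerfect_tensorRight P)).IsTriangulated

noncomputable instance (K : StrictPerf R) : (tensorLeftPerf Λ K).CommShift ℤ :=
  inferInstanceAs (((homotopyPerfect Λ).lift _ (homotopyPerfect_tensorLeft K)).CommShift ℤ)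

instance (K : StrictPerf R) : (tensorLeftPerf Λ K).IsTriangulated :=
  inferInstanceAs ((homotopyPerfect Λ).lift _ (homotopyPerfect_tensorLeft K)).IsTriangulated

section Linear

variable (k : Type v) [Field k] [Algebra k R] [Algebra k Λ]

instance (K : StrictPerf R) : (tensorLeftPerf Λ K).Linear k where
  map_smul f c := by
    ext
    exact Functor.map_smul (R := k)
      (descend ((tensorBifunctor R Λ).map₂CochainComplex.obj K.obj)) c f.hom

instance [IsScalarTower k R Λ] (P : HoPerf Λ) : (tensorRightPerf R P).Linear k where
  map_smul f c := by
    ext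
    exact Functor.map_smul (R := k)
      (descend ((tensorBifunctor R Λ).map₂CochainComplex.flip.obj P.obj.as)) c f.hom

end Linear

variable (R Λ) in
/-- The action of strictly perfect complexes of `R`-modules on the homotopy category of strictly
perfect complexes of `Λ`-modules. -/
@[reducible]
noncomputable def hoPerfAction : MonoidalLeftAction (StrictPerf R) (HoPerf Λ) :=
  letI := (tensorAction R Λ).homotopyAction
  restrictAction (IsStrictlyPerfect R) (homotopyPerfect Λ)
    (fun _ _ hK hL => IsStrictlyPerfect.mapBifunctor hK hL)

end TensorPerfect

/-! ### The Hom bifunctor on homotopy categories -/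

section RHom
open HomologicalComplex CochainComplex.HomComplex

attribute [local instance] restrictedModule restrictedModule_isScalarTower algebraLinear

variable (R : Type u) [CommRing R] {Λ : Type u} [Ring Λ] [Algebra R Λ]

/-- The bifunctor `Hom(-, -)` on homotopy categories. -/
noncomputable def homHomotopy : (HomotopyCategory (ModuleCat.{u} Λ) (.up ℤ))ᵒᵖ ⥤
    HomotopyCategory (ModuleCat.{u} Λ) (.up ℤ) ⥤ HomotopyCategory (ModuleCat.{u} R) (.up ℤ) where
  obj P := descend (homFunctor R P.unop.as)
  -- A representative of the homotopy class is chosen; homotopic representatives induce homotopic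
  -- maps, so functoriality holds in the homotopy category.
  map f := descendNatTrans (homFunctorMap (Quot.out f.unop))
  map_id P := by
    ext Q
    refine Eq.trans ?_ (congrArg (fun τ => (HomotopyCategory.quotient (ModuleCat.{u} R) _).map
      (NatTrans.app τ Q.as)) (homFunctorMap_id R P.unop.as))
    exact HomotopyCategory.eq_of_homotopy _ _ (homFunctorMap_homotopy R
      (HomotopyCategory.homotopyOfEq _ _ (by rw [HomotopyCategory.quotient_map_out]; rfl)) Q.as).some
  map_comp f g := by
    ext Q
    refine Eq.trans ?_ (congrArg (fun τ => (HomotopyCategory.quotient (ModuleCat.{u} R) _).map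
      (NatTrans.app τ Q.as)) (homFunctorMap_comp R (Quot.out g.unop) (Quot.out f.unop)))
    exact HomotopyCategory.eq_of_homotopy _ _ (homFunctorMap_homotopy R
      (HomotopyCategory.homotopyOfEq _ _ (by
        rw [HomotopyCategory.quotient_map_out_comp_out, HomotopyCategory.quotient_map_out]
        rfl)) Q.as).some

theorem homHomotopy_map_app {P P' : CochainComplex (ModuleCat.{u} Λ) ℤ} (f : P' ⟶ P)
    (Q : CochainComplex (ModuleCat.{u} Λ) ℤ) :
    ((homHomotopy R).map ((HomotopyCategory.quotient _ _).map f).op).app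
      ((HomotopyCategory.quotient _ _).obj Q) =
      (HomotopyCategory.quotient _ _).map ((homFunctorMap f).app Q) :=
  HomotopyCategory.eq_of_homotopy _ _ (homFunctorMap_homotopy R
    (HomotopyCategory.homotopyOfEq _ _ (HomotopyCategory.quotient_map_out _)) Q).some

end RHom

end NCCR

namespace NCCR

/-! ### Where a natural transformation of exact functors is invertible -/

section IsoTriangulated
open Pretriangulated

variable {C D : Type*} [Category* C] [Category* D] [HasZeroObject C] [HasZeroObject D]
  [Preadditive C] [Preadditive D] [HasShift C ℤ] [HasShift D ℤ]
  [∀ n : ℤ, (shiftFunctor C n).Additive] [∀ n : ℤ, (shiftFunctor D n).Additive]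
  [Pretriangulated C] [Pretriangulated D] {F G : C ⥤ D} [F.CommShift ℤ] [G.CommShift ℤ]

/-- The objects at which a natural transformation is an isomorphism. -/
def isIsoApp (τ : F ⟶ G) : ObjectProperty C := fun X => IsIso (τ.app X)

instance (τ : F ⟶ G) : (isIsoApp τ).IsStableUnderRetracts where
  of_retract {X Y} r (h : IsIso (τ.app Y)) := by
    let ρ : RetractArrow (τ.app X) (τ.app Y) :=
      { i := Arrow.homMk (F.map r.i) (G.map r.i) (τ.naturality r.i)
        r := Arrow.homMk (F.map r.r) (G.map r.r) (τ.naturality r.r)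
        retract := by
          ext
          · exact (F.map_comp _ _).symm.trans ((congrArg F.map r.retract).trans (F.map_id _))
          · exact (G.map_comp _ _).symm.trans ((congrArg G.map r.retract).trans (G.map_id _)) }
    exact (MorphismProperty.isomorphisms D).of_retract ρ h

instance (τ : F ⟶ G) : (isIsoApp τ).IsClosedUnderIsomorphisms := inferInstance

/-- The five lemma for triangles. Together with stability under retracts it reduces questions about
strictly perfect complexes to the ring itself. -/
instance [F.IsTriangulated] [G.IsTriangulated] (τ : F ⟶ G) [NatTrans.CommShift τ ℤ] :
    (isIsoApp τ).IsTriangulated where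
  exists_zero := by
    obtain ⟨Z, hZ⟩ := HasZeroObject.zero (C := C)
    exact ⟨Z, hZ, ⟨0, (F.map_isZero hZ).eq_of_src _ _, (G.map_isZero hZ).eq_of_src _ _⟩⟩
  isStableUnderShiftBy n := ⟨fun X (hX : IsIso (τ.app X)) => by
    change IsIso (τ.app (X⟦n⟧))
    rw [NatTrans.app_shift]
    infer_instance⟩
  ext₂' T hT h₁ h₃ := ObjectProperty.le_isoClosure _ _ <| by
    let φ : F.mapTriangle.obj T ⟶ G.mapTriangle.obj T :=
      { hom₁ := τ.app _
        hom₂ := τ.app _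
        hom₃ := τ.app _
        comm₁ := τ.naturality _
        comm₂ := τ.naturality _
        comm₃ := by
          change (F.map T.mor₃ ≫ _) ≫ _ = _ ≫ G.map T.mor₃ ≫ _
          exact (Category.assoc _ _ _).trans ((congrArg _ (NatTrans.shift_app_comm τ 1 T.obj₁)).trans
            ((Category.assoc _ _ _).symm.trans ((congrArg (· ≫ _) (τ.naturality T.mor₃)).trans
              (Category.assoc _ _ _)))) }
    exact isIso₂_of_isIso₁₃ φ (F.map_distinguished T hT) (G.map_distinguished T hT) h₁ h₃

end IsoTriangulated

/-! ### The functor RHom on strictly perfect complexes -/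

section RHom
open HomologicalComplex CochainComplex.HomComplex

attribute [local instance] restrictedModule restrictedModule_isScalarTower algebraLinear

variable (R : Type u) [CommRing R] {Λ : Type u} [Ring Λ] [Algebra R Λ]

theorem finite_hom [IsNoetherianRing R] [Module.Finite R Λ] (V W : ModuleCat.{u} Λ)
    [Module.Finite Λ V] [Module.Finite Λ W] : Module.Finite R (V ⟶ W) := by
  obtain ⟨n, f, hf⟩ := Module.Finite.exists_fin' Λ V
  have : Module.Finite R W := Module.Finite.trans Λ W
  let g : (V ⟶ W) →ₗ[R] (Fin n → W) :=
    { toFun φ i := φ.hom (f (Pi.single i 1))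
      map_add' _ _ := rfl
      map_smul' _ _ := rfl }
  refine Module.Finite.of_injective g fun φ ψ h => ?_
  ext v
  obtain ⟨v, rfl⟩ := hf v
  refine LinearMap.congr_fun (f := φ.hom ∘ₗ f) (g := ψ.hom ∘ₗ f) ?_ v
  exact LinearMap.pi_ext' fun i => LinearMap.ext_ring (congrFun h i)

/-- Only cochains of degrees from a' - b to b' - a can be nonzero, and a cochain is determined by
its finitely many components starting in degrees from a to b. -/
theorem homComplex_isBoundedCoherent [IsNoetherianRing R] [Module.Finite R Λ]
    {P Q : CochainComplex (ModuleCat.{u} Λ) ℤ} (hP : IsStrictlyPerfect Λ P)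
    (hQ : IsStrictlyPerfect Λ Q) :
    IsBoundedCoherent R (DerivedCategory.Q.obj (homComplex R P Q)) := by
  obtain ⟨hP, ⟨a, _⟩, ⟨b, _⟩⟩ := hP
  obtain ⟨hQ, ⟨a', _⟩, ⟨b', _⟩⟩ := hQ
  have hP' (p : ℤ) (h : p < a ∨ b < p) : IsZero (P.X p) := by
    rcases h with h | h
    · exact P.isZero_of_isStrictlyGE a p h
    · exact P.isZero_of_isStrictlyLE b p h
  have hQ' (p : ℤ) (h : p < a' ∨ b' < p) : IsZero (Q.X p) := by
    rcases h with h | h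
    · exact Q.isZero_of_isStrictlyGE a' p h
    · exact Q.isZero_of_isStrictlyLE b' p h
  have hz (n : ℤ) (h : ∀ p, (p < a ∨ b < p) ∨ (p + n < a' ∨ b' < p + n)) :
      IsZero ((homComplex R P Q).X n) := by
    have : Subsingleton (Cochain P Q n) := ⟨fun z z' => Cochain.ext _ _ fun p q hpq => by
      subst hpq
      rcases h p with h | h
      · exact (hP' p h).eq_of_src _ _
      · exact (hQ' _ h).eq_of_tgt _ _⟩
    exact ModuleCat.isZero_of_subsingleton (ModuleCat.of R (Cochain P Q n))
  have : (homComplex R P Q).IsStrictlyGE (a' - b) :=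
    (CochainComplex.isStrictlyGE_iff _ _).2 fun n hn => hz n fun p => by lia
  have : (homComplex R P Q).IsStrictlyLE (b' - a) :=
    (CochainComplex.isStrictlyLE_iff _ _).2 fun n hn => hz n fun p => by lia
  refine isBoundedCoherent_Q_obj _ (a' - b) (b' - a) fun n => ?_
  let g : Cochain P Q n →ₗ[R] ((p : Finset.Icc a b) → (P.X p ⟶ Q.X (p + n))) :=
    { toFun z p := z.v p (p + n) rfl
      map_add' _ _ := rfl
      map_smul' _ _ := rfl }
  have (p : ℤ) : Module.Finite R (P.X p ⟶ Q.X (p + n)) :=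
    have := (hP p).1
    have := (hQ (p + n)).1
    finite_hom R _ _
  refine Module.Finite.of_injective g fun z z' h => Cochain.ext _ _ fun p q hpq => ?_
  subst hpq
  by_cases hp : p ∈ Finset.Icc a b
  · exact congrFun h ⟨p, hp⟩
  · exact (hP' p (by rw [Finset.mem_Icc] at hp; lia)).eq_of_src _ _

variable (Λ) in
/-- The bifunctor `RHom` on the homotopy category of strictly perfect complexes. -/
noncomputable def rhomPerf [IsNoetherianRing R] [Module.Finite R Λ] :
    (HoPerf Λ)ᵒᵖ ⥤ HoPerf Λ ⥤ DbMod R where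
  obj P := (IsBoundedCoherent R).lift ((homotopyPerfect Λ).ι ⋙
      (homHomotopy R).obj (.op P.unop.obj) ⋙ DerivedCategory.Qh)
    (fun Q => homComplex_isBoundedCoherent R P.unop.property Q.property)
  map f :=
    { app Q := (IsBoundedCoherent R).homMk
        (DerivedCategory.Qh.map (((homHomotopy R).map f.unop.hom.op).app Q.obj))
      naturality Q Q' g := by
        ext
        exact (DerivedCategory.Qh.map_comp _ _).symm.trans
          ((congrArg _ (((homHomotopy R).map f.unop.hom.op).naturality g.hom)).trans
            (DerivedCategory.Qh.map_comp _ _)) }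
  map_id P := by
    ext Q
    exact (congrArg (fun τ => DerivedCategory.Qh.map (NatTrans.app τ Q.obj))
      ((homHomotopy R).map_id (.op P.unop.obj))).trans (DerivedCategory.Qh.map_id _)
  map_comp f g := by
    ext Q
    exact (congrArg (fun τ => DerivedCategory.Qh.map (NatTrans.app τ Q.obj))
      ((homHomotopy R).map_comp f.unop.hom.op g.unop.hom.op)).trans (DerivedCategory.Qh.map_comp _ _)

variable {R} [IsNoetherianRing R] [Module.Finite R Λ]

/-- The adjunction between the tensor product and `RHom`. -/
noncomputable def rhomPerfEquiv (X : HoPerf R) (P Q : HoPerf Λ) :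
    ((tensorRightPerf R P).obj X ⟶ Q) ≃
      (DerivedCategory.Qh.obj X.obj ⟶ (((rhomPerf R Λ).obj (.op P)).obj Q).obj) :=
  (ObjectProperty.fullyFaithfulι _).homEquiv.trans
    (((descendAdjunction (tensorHomAdjunction R P.obj.as)).homEquiv X.obj Q.obj).trans
      (Equiv.ofBijective _ (X.Qh_map_bijective _)))

theorem rhomPerfEquiv_apply {X : HoPerf R} {P Q : HoPerf Λ} (φ : (tensorRightPerf R P).obj X ⟶ Q) :
    rhomPerfEquiv X P Q φ = DerivedCategory.Qh.map
      ((descendAdjunction (tensorHomAdjunction R P.obj.as)).homEquiv X.obj Q.obj φ.hom) := rfl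

theorem rhomPerfEquiv_naturality_left {X X' : HoPerf R} {P Q : HoPerf Λ} (f : X' ⟶ X)
    (φ : (tensorRightPerf R P).obj X ⟶ Q) :
    rhomPerfEquiv X' P Q ((tensorRightPerf R P).map f ≫ φ) =
      DerivedCategory.Qh.map f.hom ≫ rhomPerfEquiv X P Q φ := by
  rw [rhomPerfEquiv_apply, rhomPerfEquiv_apply]
  refine (congrArg _ ((descendAdjunction (tensorHomAdjunction R P.obj.as)).homEquiv_naturality_left
    f.hom φ.hom)).trans ?_
  exact DerivedCategory.Qh.map_comp _ _

theorem rhomPerfEquiv_naturality_right {X : HoPerf R} {P Q Q' : HoPerf Λ}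
    (φ : (tensorRightPerf R P).obj X ⟶ Q) (g : Q ⟶ Q') :
    rhomPerfEquiv X P Q' (φ ≫ g) =
      rhomPerfEquiv X P Q φ ≫ (((rhomPerf R Λ).obj (.op P)).map g).hom := by
  rw [rhomPerfEquiv_apply, rhomPerfEquiv_apply]
  refine (congrArg _ ((descendAdjunction (tensorHomAdjunction R P.obj.as)).homEquiv_naturality_right
    φ.hom g.hom)).trans ?_
  exact DerivedCategory.Qh.map_comp _ _

/-- The variable `P` is a parameter of the adjunction, so naturality in it is not formal. It is
checked on chain maps representing the homotopy classes, where it is a property of currying. -/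
theorem homEquiv_naturality_middle (A : CochainComplex (ModuleCat.{u} R) ℤ)
    {P P' Q : CochainComplex (ModuleCat.{u} Λ) ℤ} (f : P' ⟶ P)
    (φ : mapBifunctor A P (tensorBifunctor R Λ) (.up ℤ) ⟶ Q) :
    (descendAdjunction (tensorHomAdjunction R P')).homEquiv
      ((HomotopyCategory.quotient _ _).obj A) ((HomotopyCategory.quotient _ _).obj Q)
      ((HomotopyCategory.quotient _ _).map
        (mapBifunctorMap (𝟙 A) f (tensorBifunctor R Λ) (.up ℤ) ≫ φ)) =
    (descendAdjunction (tensorHomAdjunction R P)).homEquiv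
      ((HomotopyCategory.quotient _ _).obj A) ((HomotopyCategory.quotient _ _).obj Q)
      ((HomotopyCategory.quotient _ _).map φ) ≫
      ((homHomotopy R).map ((HomotopyCategory.quotient _ _).map f).op).app
        ((HomotopyCategory.quotient _ _).obj Q) := by
  rw [homHomotopy_map_app]
  have h₁ (P'' : CochainComplex (ModuleCat.{u} Λ) ℤ)
      (φ : mapBifunctor A P'' (tensorBifunctor R Λ) (.up ℤ) ⟶ Q) :=
    (descendAdjunction_homEquiv (tensorHomAdjunction R P'') φ).trans
      (congrArg _ (tensorHomAdjunction_homEquiv φ))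
  exact (h₁ P' _).trans ((congrArg _ (curryHom_naturality_middle f φ)).trans
    ((Functor.map_comp _ _ _).trans (congrArg (· ≫ _) (h₁ P φ).symm)))

theorem rhomPerfEquiv_naturality_middle {A : StrictPerf R} {P P' Q : HoPerf Λ} (f : P' ⟶ P)
    (φ : (tensorLeftPerf Λ A).obj P ⟶ Q) :
    rhomPerfEquiv ((StrictPerf.toHoPerf R).obj A) P' Q
      ((tensorLeftPerf Λ A).map f ≫ φ : (tensorLeftPerf Λ A).obj P' ⟶ Q) =
      rhomPerfEquiv ((StrictPerf.toHoPerf R).obj A) P Q φ ≫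
        (((rhomPerf R Λ).map f.op).app Q).hom := by
  obtain ⟨f', hf⟩ := (HomotopyCategory.quotient _ _).map_surjective
    (X := P'.obj.as) (Y := P.obj.as) f.hom
  obtain ⟨φ', hφ⟩ := (HomotopyCategory.quotient _ _).map_surjective
    (X := mapBifunctor A.obj P.obj.as (tensorBifunctor R Λ) (.up ℤ)) (Y := Q.obj.as) φ.hom
  obtain rfl : f = (homotopyPerfect Λ).homMk ((HomotopyCategory.quotient _ _).map f') := by
    ext
    exact hf.symm
  obtain rfl : φ = (homotopyPerfect Λ).homMk ((HomotopyCategory.quotient _ _).map φ') := by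
    ext
    exact hφ.symm
  refine Eq.trans ?_ (DerivedCategory.Qh.map_comp
    ((descendAdjunction (tensorHomAdjunction R P.obj.as)).homEquiv
      ((HomotopyCategory.quotient _ _).obj A.obj) ((HomotopyCategory.quotient _ _).obj Q.obj.as)
      ((HomotopyCategory.quotient _ _).map φ'))
    (((homHomotopy R).map ((HomotopyCategory.quotient _ _).map f').op).app
      ((HomotopyCategory.quotient _ _).obj Q.obj.as)))
  refine (rhomPerfEquiv_apply (X := (StrictPerf.toHoPerf R).obj A) (P := P') _).trans ?_
  refine congrArg (fun z => (DerivedCategory.Qh (C := ModuleCat.{u} R)).map z) ?_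
  refine Eq.trans ?_ (homEquiv_naturality_middle A.obj f' φ')
  exact congrArg _ ((HomotopyCategory.quotient (ModuleCat.{u} Λ) (.up ℤ)).map_comp
    (mapBifunctorMap (𝟙 A.obj) f' (tensorBifunctor R Λ) (.up ℤ)) φ').symm

end RHom
end NCCR

/-! ### The module structure over perfect complexes -/

namespace NCCR
section RHom
open HomologicalComplex CochainComplex.HomComplex

attribute [local instance] restrictedModule restrictedModule_isScalarTower algebraLinear

variable {R : Type u} [CommRing R] {Λ : Type u} [Ring Λ] [Algebra R Λ]
variable [IsNoetherianRing R] [Module.Finite R Λ]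

theorem comp_eq_comp_of_square {C : Type*} [Category* C] {X X' Y Y' Z : C} {q' : X' ⟶ Y'}
    {q : X ⟶ Y} {f : X' ⟶ X} {g : Y' ⟶ Y} {z : Y ⟶ Z} {z' : Y' ⟶ Z} (h : f ≫ q = q' ≫ g)
    (hz : z' = g ≫ z) : q' ≫ z' = f ≫ q ≫ z := by
  rw [hz, ← Category.assoc, ← h, Category.assoc]

theorem comp_eq_comp_comp {C : Type*} [Category* C] {X Y Z W : C} (q : X ⟶ Y)
    {z : Y ⟶ Z} {z' : Y ⟶ W} {g : Z ⟶ W} (hz : z' = z ≫ g) : q ≫ z' = (q ≫ z) ≫ g := by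
  rw [hz, Category.assoc]

/-- The class of a strictly perfect complex in the derived category. -/
noncomputable def qhToHoPerfIso (A : StrictPerf R) :
    DerivedCategory.Qh.obj ((StrictPerf.toHoPerf R).obj A).obj ≅ ((StrictPerf.toPerf R).obj A).obj :=
  (DerivedCategory.quotientCompQhIso (ModuleCat.{u} R)).app A.obj

theorem qhToHoPerfIso_inv_naturality {A A' : StrictPerf R} (f : A' ⟶ A) :
    ((StrictPerf.toPerf R).map f).hom ≫ (qhToHoPerfIso A).inv =
      (qhToHoPerfIso A').inv ≫ DerivedCategory.Qh.map ((StrictPerf.toHoPerf R).map f).hom :=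
  (DerivedCategory.quotientCompQhIso (ModuleCat.{u} R)).inv.naturality f.hom

/-- The adjunction between the tensor product and `RHom`, on strictly perfect complexes. -/
noncomputable def rhomStrictEquiv (A : StrictPerf R) (P Q : HoPerf Λ) :
    ((tensorRightPerf R P).obj ((StrictPerf.toHoPerf R).obj A) ⟶ Q) ≃
      (((StrictPerf.toPerf R).obj A).obj ⟶ (((rhomPerf R Λ).obj (.op P)).obj Q).obj) :=
  (rhomPerfEquiv ((StrictPerf.toHoPerf R).obj A) P Q).trans
    (Iso.homFromEquiv (qhToHoPerfIso A))

theorem rhomStrictEquiv_naturality_left {A A' : StrictPerf R} {P Q : HoPerf Λ} (f : A' ⟶ A)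
    (φ : (tensorRightPerf R P).obj ((StrictPerf.toHoPerf R).obj A) ⟶ Q) :
    rhomStrictEquiv A' P Q ((tensorRightPerf R P).map ((StrictPerf.toHoPerf R).map f) ≫ φ) =
      ((StrictPerf.toPerf R).map f).hom ≫ rhomStrictEquiv A P Q φ := by
  exact comp_eq_comp_of_square (qhToHoPerfIso_inv_naturality f)
    (rhomPerfEquiv_naturality_left (P := P) ((StrictPerf.toHoPerf R).map f) φ)

theorem rhomStrictEquiv_naturality_middle {A : StrictPerf R} {P P' Q : HoPerf Λ} (f : P' ⟶ P)
    (φ : (tensorLeftPerf Λ A).obj P ⟶ Q) :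
    rhomStrictEquiv A P' Q ((tensorLeftPerf Λ A).map f ≫ φ : (tensorLeftPerf Λ A).obj P' ⟶ Q) =
      rhomStrictEquiv A P Q φ ≫ (((rhomPerf R Λ).map f.op).app Q).hom := by
  exact comp_eq_comp_comp (qhToHoPerfIso A).inv
    (rhomPerfEquiv_naturality_middle f φ)

theorem rhomStrictEquiv_naturality_right {A : StrictPerf R} {P Q Q' : HoPerf Λ}
    (φ : (tensorLeftPerf Λ A).obj P ⟶ Q) (g : Q ⟶ Q') :
    rhomStrictEquiv A P Q' (φ ≫ g) =
      rhomStrictEquiv A P Q φ ≫ (((rhomPerf R Λ).obj (.op P)).map g).hom := by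
  exact comp_eq_comp_comp (qhToHoPerfIso A).inv
    (rhomPerfEquiv_naturality_right (X := (StrictPerf.toHoPerf R).obj A) (P := P) φ g)

end RHom

section PerfModule

variable {k : Type v} [Field k] {R : Type u} [CommRing R] [IsNoetherianRing R] [Algebra k R]
  {Λ : Type u} [Ring Λ] [IsNoetherianRing Λ] [Algebra k Λ] [Algebra R Λ] [IsScalarTower k R Λ]
  [Module.Finite R Λ] (hΛ : IsPerfect Λ = IsBoundedCoherent Λ)

open scoped MonoidalLeftAction

/-- The action of strictly perfect complexes on the bounded derived category. -/
@[reducible]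
noncomputable def dbModAction : MonoidalLeftAction (StrictPerf R) (DbMod Λ) :=
  letI := hoPerfAction R Λ
  transportAction (resolve _ hΛ)

/-- The functor `- ⊗ B` on perfect complexes. -/
noncomputable def tensorRightDbMod (R : Type u) [CommRing R] [Algebra R Λ] (B : DbMod Λ) :
    Perf R ⥤ DbMod Λ :=
  (resolve (IsPerfect R) rfl).functor ⋙ tensorRightPerf R ((resolve _ hΛ).functor.obj B) ⋙
    (resolve _ hΛ).inverse

noncomputable instance (B : DbMod Λ) : (tensorRightDbMod hΛ R B).CommShift ℤ :=
  inferInstanceAs (((resolve (IsPerfect R) rfl).functor ⋙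
    tensorRightPerf R ((resolve _ hΛ).functor.obj B) ⋙ (resolve _ hΛ).inverse).CommShift ℤ)

instance (B : DbMod Λ) : (tensorRightDbMod hΛ R B).IsTriangulated :=
  inferInstanceAs ((resolve (IsPerfect R) rfl).functor ⋙
    tensorRightPerf R ((resolve _ hΛ).functor.obj B) ⋙ (resolve _ hΛ).inverse).IsTriangulated

instance (B : DbMod Λ) : (tensorRightDbMod hΛ R B).Linear k :=
  inferInstanceAs (((resolve (IsPerfect R) rfl).functor ⋙
    tensorRightPerf R ((resolve _ hΛ).functor.obj B) ⋙ (resolve _ hΛ).inverse).Linear k)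

/-- The functor `- ⊗ B` is given by the action. -/
noncomputable def toPerfTensorRightDbMod (B : DbMod Λ) :
    letI := dbModAction (R := R) hΛ
    StrictPerf.toPerf R ⋙ tensorRightDbMod hΛ R B ≅
      MonoidalLeftAction.actionRight (StrictPerf R) B :=
  (Functor.associator _ _ _).symm ≪≫ Functor.isoWhiskerRight toPerfResolve _

/-- The module structure on the bounded derived category. -/
noncomputable def perfModule : PerfModule k R (DbMod Λ) where
  action := dbModAction hΛ
  exact_left B := ⟨tensorRightDbMod hΛ R B, inferInstance, inferInstance, inferInstance,
    ⟨toPerfTensorRightDbMod hΛ B⟩⟩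
  exact_right A := ⟨inferInstanceAs (((resolve _ hΛ).functor ⋙ tensorLeftPerf Λ A ⋙
      (resolve _ hΛ).inverse).CommShift ℤ),
    inferInstanceAs ((resolve _ hΛ).functor ⋙ tensorLeftPerf Λ A ⋙
      (resolve _ hΛ).inverse).IsTriangulated,
    inferInstanceAs (((resolve _ hΛ).functor ⋙ tensorLeftPerf Λ A ⋙
      (resolve _ hΛ).inverse).Linear k)⟩
  rhom := (resolve _ hΛ).functor.op ⋙ rhomPerf R Λ ⋙
    (Functor.whiskeringLeft _ _ _).obj (resolve _ hΛ).functor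
  homEquiv A B C := ((resolve _ hΛ).symm.toAdjunction.homEquiv
      ((tensorRightPerf R ((resolve _ hΛ).functor.obj B)).obj ((StrictPerf.toHoPerf R).obj A)) C).trans
    (rhomStrictEquiv A ((resolve _ hΛ).functor.obj B) ((resolve _ hΛ).functor.obj C))
  homEquiv_naturality_left {A A' B C} f g :=
    (congrArg (rhomStrictEquiv A' _ _) ((resolve _ hΛ).symm.toAdjunction.homEquiv_naturality_left
      ((tensorRightPerf R ((resolve _ hΛ).functor.obj B)).map ((StrictPerf.toHoPerf R).map f))
        g)).trans (rhomStrictEquiv_naturality_left _ _)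
  homEquiv_naturality_middle {A B B' C} f g :=
    (congrArg (rhomStrictEquiv A _ _) ((resolve _ hΛ).symm.toAdjunction.homEquiv_naturality_left
      ((tensorLeftPerf Λ A).map ((resolve _ hΛ).functor.map f)) g)).trans
        (rhomStrictEquiv_naturality_middle _ _)
  homEquiv_naturality_right {A B C C'} g h :=
    (congrArg (rhomStrictEquiv A _ _)
      ((resolve _ hΛ).symm.toAdjunction.homEquiv_naturality_right g h)).trans
        (rhomStrictEquiv_naturality_right _ _)

end PerfModule

end NCCR

namespace NCCR

/-! ### From smoothness of Λ to smoothness of the triangulated category -/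

section Smooth

variable {A : Type u} [Ring A] (Q : ObjectProperty (DerivedCategory (ModuleCat.{u} A)))
  [Q.IsTriangulated] (hQ : IsPerfect A = Q)

/-- A full subcategory of the derived category consisting of the perfect complexes is equivalent to
the category of perfect complexes. -/
noncomputable def perfEquivalence : Q.FullSubcategory ≌ Perf A :=
  (resolve Q hQ).trans (resolve (IsPerfect A) rfl).symm

noncomputable instance : (perfEquivalence Q hQ).functor.CommShift ℤ :=
  inferInstanceAs (((resolve Q hQ).functor ⋙ (resolve (IsPerfect A) rfl).inverse).CommShift ℤ)

instance : (perfEquivalence Q hQ).functor.IsTriangulated :=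
  inferInstanceAs ((resolve Q hQ).functor ⋙ (resolve (IsPerfect A) rfl).inverse).IsTriangulated

instance (k : Type v) [Field k] [Algebra k A] : (perfEquivalence Q hQ).functor.Linear k :=
  inferInstanceAs (((resolve Q hQ).functor ⋙ (resolve (IsPerfect A) rfl).inverse).Linear k)

theorem isSmoothTriangulated_of_isPerfect_eq {A : Type u} [Ring A]
    (Q : ObjectProperty (DerivedCategory (ModuleCat.{u} A))) [Q.IsTriangulated]
    (hQ : IsPerfect A = Q) (k : Type v) [Field k] [Algebra k A]
    (hA : IsSmoothAlgebra k A) : IsSmoothTriangulated.{v, u + 1, u} k Q.FullSubcategory :=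
  ⟨A, inferInstance, inferInstance, hA, perfEquivalence Q hQ, inferInstance, inferInstance,
    inferInstance⟩

end Smooth

/-! ### The pushforward and the unit of the adjunction -/

section RHom
open HomologicalComplex CochainComplex.HomComplex

attribute [local instance] restrictedModule restrictedModule_isScalarTower algebraLinear

variable (R : Type u) [CommRing R] {Λ : Type u} [Ring Λ] [Algebra R Λ]

section
variable (P : CochainComplex (ModuleCat.{u} Λ) ℤ)

/-- The shift structure is defined by transport from the left adjoint, so that unit and counit
commute with shifts by construction and exactness of the right adjoint is automatic. -/
noncomputable instance : (descend (homFunctor R P)).CommShift ℤ :=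
  (descendAdjunction (tensorHomAdjunction R P)).rightAdjointCommShift ℤ

instance : (descendAdjunction (tensorHomAdjunction R P)).CommShift ℤ :=
  (descendAdjunction (tensorHomAdjunction R P)).commShift_of_leftAdjoint ℤ

instance : (descend (homFunctor R P)).IsTriangulated :=
  (descendAdjunction (tensorHomAdjunction R P)).isTriangulated_rightAdjoint

end

variable [IsNoetherianRing R] [Module.Finite R Λ]

theorem isBoundedCoherent_rhomPerf_obj (P Q : HoPerf Λ) : IsBoundedCoherent R
    (((homotopyPerfect Λ).ι ⋙ descend (homFunctor R P.obj.as) ⋙ DerivedCategory.Qh).obj Q) :=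
  homComplex_isBoundedCoherent R P.property Q.property

noncomputable instance (P : (HoPerf Λ)ᵒᵖ) : ((rhomPerf R Λ).obj P).CommShift ℤ :=
  inferInstanceAs (((IsBoundedCoherent R).lift _
    (isBoundedCoherent_rhomPerf_obj R P.unop)).CommShift ℤ)

instance (P : (HoPerf Λ)ᵒᵖ) : ((rhomPerf R Λ).obj P).IsTriangulated :=
  inferInstanceAs ((IsBoundedCoherent R).lift _
    (isBoundedCoherent_rhomPerf_obj R P.unop)).IsTriangulated

instance (k : Type v) [Field k] [Algebra k R] [Algebra k Λ] [IsScalarTower k R Λ]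
    (P : (HoPerf Λ)ᵒᵖ) : ((rhomPerf R Λ).obj P).Linear k where
  map_smul f c := by
    ext
    exact Functor.map_smul (R := k) (descend (homFunctor R P.unop.obj.as) ⋙ DerivedCategory.Qh)
      c f.hom

variable {R}

theorem rhomPerfEquiv_id (X : HoPerf R) (P : HoPerf Λ) :
    rhomPerfEquiv X P ((tensorRightPerf R P).obj X) (𝟙 _) = DerivedCategory.Qh.map
      ((descendAdjunction (tensorHomAdjunction R P.obj.as)).unit.app X.obj) :=
  (rhomPerfEquiv_apply _).trans (congrArg (fun z => DerivedCategory.Qh.map z)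
    ((descendAdjunction (tensorHomAdjunction R P.obj.as)).homEquiv_id X.obj))

/-- If the unit `N ⟶ Hom(P, N ⊗ P)` is a quasi-isomorphism for `N = R`, it is one for all strictly
perfect complexes. -/
theorem isIso_rhomPerfEquiv_id (P : HoPerf Λ)
    (h : QuasiIso ((tensorHomAdjunction R P.obj.as).unit.app
      ((HomologicalComplex.single _ (.up ℤ) 0).obj (ModuleCat.of R R)))) (X : HoPerf R) :
    IsIso (rhomPerfEquiv X P ((tensorRightPerf R P).obj X) (𝟙 _)) := by
  rw [rhomPerfEquiv_id]
  let τ := Functor.whiskerRight (descendAdjunction (tensorHomAdjunction R P.obj.as)).unit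
    (DerivedCategory.Qh (C := ModuleCat.{u} R))
  have : NatTrans.CommShift (descendAdjunction (tensorHomAdjunction R P.obj.as)).unit ℤ :=
    Adjunction.CommShift.commShift_unit
  have hP : isIsoApp τ ((HomotopyCategory.quotient _ _).obj
      ((HomologicalComplex.single _ (.up ℤ) 0).obj (ModuleCat.of R R))) := by
    have h₁ := (DerivedCategory.isIso_Q_map_iff_quasiIso (ModuleCat.{u} R) _).2 h
    exact (NatIso.isIso_map_iff (DerivedCategory.quotientCompQhIso (ModuleCat.{u} R)) _).2 h₁
  -- The objects at which the unit becomes invertible form a thick subcategory, and it contains the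
  -- ring.
  exact IsStrictlyPerfect.induction' (isIsoApp τ) hP X.property

variable {k : Type v} [Field k] [Algebra k R] [IsNoetherianRing Λ] [Algebra k Λ]
  [IsScalarTower k R Λ] (hΛ : IsPerfect Λ = IsBoundedCoherent Λ)

/-- The adjunction between `- ⊗ N` and `RHom(N, -)`. -/
noncomputable def tensorRightDbModEquiv (N : DbMod Λ) (A : Perf R) (B : DbMod Λ) :
    ((tensorRightDbMod hΛ R N).obj A ⟶ B) ≃ (A.obj ⟶
      (((rhomPerf R Λ).obj (.op ((resolve _ hΛ).functor.obj N))).obj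
        ((resolve _ hΛ).functor.obj B)).obj) :=
  ((resolve _ hΛ).symm.toAdjunction.homEquiv
    ((tensorRightPerf R ((resolve _ hΛ).functor.obj N)).obj
      ((resolve (IsPerfect R) rfl).functor.obj A)) B).trans
    ((rhomPerfEquiv ((resolve (IsPerfect R) rfl).functor.obj A) ((resolve _ hΛ).functor.obj N)
      ((resolve _ hΛ).functor.obj B)).trans
        (Iso.homFromEquiv ((IsPerfect R).ι.mapIso
          ((resolve (IsPerfect R) rfl).unitIso.app A)).symm))

/-- The categorical resolution given by an object `N` of the derived category such that
`R ⟶ RHom(N, N)` is an isomorphism. -/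
noncomputable def categoricalResolution (hsm : IsSmoothAlgebra k Λ) (N : DbMod Λ)
    (h : QuasiIso ((tensorHomAdjunction R ((resolve _ hΛ).functor.obj N).obj.as).unit.app
      ((HomologicalComplex.single _ (.up ℤ) 0).obj (ModuleCat.of R R)))) :
    CategoricalResolution.{v, u + 1, u} k R (DbMod Λ) where
  smooth := isSmoothTriangulated_of_isPerfect_eq _ hΛ k hsm
  pullback := tensorRightDbMod hΛ R N
  pullbackCommShift := inferInstance
  pullback_isTriangulated := inferInstance
  pullback_linear := inferInstance
  pushforward := (resolve _ hΛ).functor ⋙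
    (rhomPerf R Λ).obj (.op ((resolve _ hΛ).functor.obj N))
  pushforwardCommShift := inferInstance
  pushforward_isTriangulated := inferInstance
  pushforward_linear := inferInstance
  adj := tensorRightDbModEquiv hΛ N
  adj_naturality_left {A A' B} f g :=
    comp_eq_comp_of_square
      (congrArg (·.hom) ((resolve (IsPerfect R) rfl).unitIso.hom.naturality f))
      ((congrArg (rhomPerfEquiv _ _ _) ((resolve _ hΛ).symm.toAdjunction.homEquiv_naturality_left
        ((tensorRightPerf R ((resolve _ hΛ).functor.obj N)).map
          ((resolve (IsPerfect R) rfl).functor.map f)) g)).trans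
        (rhomPerfEquiv_naturality_left _ _))
  adj_naturality_right {A B B'} g h :=
    comp_eq_comp_comp ((resolve (IsPerfect R) rfl).unitIso.hom.app A).hom
      ((congrArg (rhomPerfEquiv _ _ _)
        ((resolve _ hΛ).symm.toAdjunction.homEquiv_naturality_right g h)).trans
        (rhomPerfEquiv_naturality_right (X := (resolve (IsPerfect R) rfl).functor.obj A) _ _))
  isIso_unit A := by
    have h₁ := isIso_rhomPerfEquiv_id ((resolve _ hΛ).functor.obj N) h
      ((resolve (IsPerfect R) rfl).functor.obj A)
    let i := (resolve _ hΛ).symm.unitIso.app ((tensorRightPerf R ((resolve _ hΛ).functor.obj N)).obj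
      ((resolve (IsPerfect R) rfl).functor.obj A))
    have h₂ := rhomPerfEquiv_naturality_right (X := (resolve (IsPerfect R) rfl).functor.obj A)
      (P := (resolve _ hΛ).functor.obj N) (𝟙 _) i.hom
    rw [Category.id_comp] at h₂
    have h₃ : IsIso (rhomPerfEquiv ((resolve (IsPerfect R) rfl).functor.obj A)
        ((resolve _ hΛ).functor.obj N) _ i.hom) := by
      rw [h₂]
      have : IsIso (((rhomPerf R Λ).obj (.op ((resolve _ hΛ).functor.obj N))).map i.hom).hom :=
        inferInstanceAs (IsIso ((IsBoundedCoherent R).ι.map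
          (((rhomPerf R Λ).obj (.op ((resolve _ hΛ).functor.obj N))).map i.hom)))
      infer_instance
    have h₄ : IsIso ((resolve (IsPerfect R) rfl).unitIso.hom.app A).hom :=
      inferInstanceAs (IsIso ((IsPerfect R).ι.map ((resolve (IsPerfect R) rfl).unitIso.hom.app A)))
    -- The image of the identity is the unit for `Perf R`, followed by the unit of the tensor-Hom
    -- adjunction and by the image of the unit of an equivalence; all three are invertible.
    have h₅ : tensorRightDbModEquiv hΛ N A ((tensorRightDbMod hΛ R N).obj A) (𝟙 _) =
        ((resolve (IsPerfect R) rfl).unitIso.hom.app A).hom ≫ rhomPerfEquiv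
          ((resolve (IsPerfect R) rfl).functor.obj A) ((resolve _ hΛ).functor.obj N) _ i.hom :=
      congrArg (fun z => ((resolve (IsPerfect R) rfl).unitIso.hom.app A).hom ≫ rhomPerfEquiv _ _ _ z)
        ((resolve _ hΛ).symm.toAdjunction.homEquiv_id _)
    rw [h₅]
    exact IsIso.comp_isIso' h₄ h₃

end RHom

end NCCR

namespace NCCR

/-! ### Linearity of the pullback -/

section LeftLinear
open MonoidalLeftAction
open scoped MonoidalLeftAction

variable {M D D' : Type*} [Category* M] [MonoidalCategory M] [Category* D] [Category* D']
  [MonoidalLeftAction M D] [MonoidalLeftAction M D']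

/-- A left linear structure given by isomorphisms. -/
@[reducible]
def leftLinearOfIso (F : D ⥤ D') (μ : ∀ (c : M) (d : D), c ⊙ₗ F.obj d ≅ F.obj (c ⊙ₗ d))
    (naturality_left : ∀ {c c' : M} (f : c ⟶ c') (d : D),
      f ⊵ₗ F.obj d ≫ (μ c' d).hom = (μ c d).hom ≫ F.map (f ⊵ₗ d))
    (naturality_right : ∀ (c : M) {d d' : D} (f : d ⟶ d'),
      c ⊴ₗ F.map f ≫ (μ c d').hom = (μ c d).hom ≫ F.map (c ⊴ₗ f))
    (associativity : ∀ (c c' : M) (d : D), (μ (c ⊗ c') d).hom ≫ F.map (αₗ c c' d).hom =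
      (αₗ c c' (F.obj d)).hom ≫ c ⊴ₗ (μ c' d).hom ≫ (μ c (c' ⊙ₗ d)).hom)
    (unitality : ∀ d : D, (λₗ[M] (F.obj d)).hom = (μ (𝟙_ M) d).hom ≫ F.map (λₗ[M] d).hom) :
    F.LeftLinear M where
  μₗ c d := (μ c d).hom
  μₗ_naturality_left := naturality_left
  μₗ_naturality_right := naturality_right
  μₗ_associativity := associativity
  μₗ_unitality := unitality
  δₗ c d := (μ c d).inv
  δₗ_naturality_left f d := by
    rw [Iso.comp_inv_eq, Category.assoc, naturality_left, Iso.inv_hom_id_assoc]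
  δₗ_naturality_right c _ _ f := by
    rw [Iso.comp_inv_eq, Category.assoc, naturality_right, Iso.inv_hom_id_assoc]
  δₗ_associativity c c' d := by
    rw [Iso.inv_comp_eq, ← Category.assoc, associativity, Category.assoc, Category.assoc,
      Iso.hom_inv_id_assoc, ← actionHomRight_comp, Iso.hom_inv_id, actionHomRight_id,
      Category.comp_id]
  δₗ_unitality_inv d := by
    rw [Iso.eq_comp_inv, Iso.inv_comp_eq, unitality, Category.assoc, ← F.map_comp, Iso.hom_inv_id,
      F.map_id, Category.comp_id]
  μₗ_comp_δₗ c d := (μ c d).hom_inv_id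
  δₗ_comp_μₗ c d := (μ c d).inv_hom_id

/-- The functor `c ↦ c ⊙ₗ d` is left linear. -/
@[reducible]
def leftLinearActionRight (d : D) : (actionRight M d).LeftLinear M :=
  leftLinearOfIso (actionRight M d) (fun c c' => (αₗ c c' d).symm)
    (fun {c₁ c₂} f c' => by
      change f ⊵ₗ (c' ⊙ₗ d) ≫ (αₗ c₂ c' d).inv = (αₗ c₁ c' d).inv ≫ (f ▷ c') ⊵ₗ d
      rw [whiskerRight_actionHomLeft, Iso.inv_hom_id_assoc])
    (fun c c₁ c₂ f => by
      change c ⊴ₗ (f ⊵ₗ d) ≫ (αₗ c c₂ d).inv = (αₗ c c₁ d).inv ≫ (c ◁ f) ⊵ₗ d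
      rw [whiskerLeft_actionHomLeft, Iso.inv_hom_id_assoc])
    (fun c₁ c₂ c₃ => by
      change (αₗ (c₁ ⊗ c₂) c₃ d).inv ≫ (α_ c₁ c₂ c₃).hom ⊵ₗ d = (αₗ c₁ c₂ (c₃ ⊙ₗ d)).hom ≫
        c₁ ⊴ₗ (αₗ c₂ c₃ d).inv ≫ (αₗ c₁ (c₂ ⊗ c₃) d).inv
      rw [Iso.inv_comp_eq, ← Category.assoc, ← associator_actionHom, Category.assoc, Category.assoc,
        ← actionHomRight_comp_assoc, Iso.hom_inv_id, actionHomRight_id, Category.id_comp,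
        Iso.hom_inv_id, Category.comp_id])
    (fun c => by
      change (λₗ[M] (c ⊙ₗ d)).hom = (αₗ (𝟙_ M) c d).inv ≫ (λ_ c).hom ⊵ₗ d
      rw [leftUnitor_actionHom, Iso.inv_hom_id_assoc])

/-- The action on isomorphisms. -/
@[simps]
def actionIsoRight (c : M) {d d' : D} (e : d ≅ d') : c ⊙ₗ d ≅ c ⊙ₗ d' where
  hom := c ⊴ₗ e.hom
  inv := c ⊴ₗ e.inv
  hom_inv_id := by rw [← actionHomRight_comp, Iso.hom_inv_id, actionHomRight_id]
  inv_hom_id := by rw [← actionHomRight_comp, Iso.inv_hom_id, actionHomRight_id]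

open Functor.LaxLeftLinear in
/-- Left linear structures are invariant under isomorphisms of functors. -/
@[reducible]
def leftLinearOfNatIso {F G : D ⥤ D'} [F.LeftLinear M] (e : F ≅ G) : G.LeftLinear M :=
  leftLinearOfIso _ (fun c d => actionIsoRight c (e.symm.app d) ≪≫
      Functor.LeftLinear.μₗIso F c d ≪≫ e.app _)
    (fun {c₁ c₂} f d => by
      simp only [Iso.trans_hom, actionIsoRight_hom, Iso.app_hom, Iso.symm_hom, Category.assoc]
      rw [← action_exchange_assoc, μₗ_naturality_left_assoc, e.hom.naturality])
    (fun c d₁ d₂ f => by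
      simp only [Iso.trans_hom, actionIsoRight_hom, Iso.app_hom, Iso.symm_hom, Category.assoc]
      rw [← actionHomRight_comp_assoc, e.inv.naturality, actionHomRight_comp_assoc,
        μₗ_naturality_right_assoc, e.hom.naturality])
    (fun c₁ c₂ d => by
      simp only [Iso.trans_hom, actionIsoRight_hom, Iso.app_hom, Iso.symm_hom, Category.assoc]
      rw [← actionHomRight_comp_assoc, Category.assoc, Category.assoc, Iso.hom_inv_id_app,
        ← e.hom.naturality, μₗ_associativity_assoc, Category.comp_id, actionHomRight_comp_assoc]
      have := actionAssocIso_hom_naturality (𝟙 c₁) (𝟙 c₂) (e.inv.app d)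
      rw [MonoidalCategory.id_tensorHom_id, id_actionHom, id_actionHom, id_actionHom] at this
      rw [reassoc_of% this])
    (fun d => by
      simp only [Iso.trans_hom, actionIsoRight_hom, Iso.app_hom, Iso.symm_hom, Category.assoc]
      rw [← e.hom.naturality, ← μₗ_unitality_assoc, ← actionUnitIso_hom_naturality_assoc,
        Iso.inv_hom_id_app, Category.comp_id])

end LeftLinear

section Pullback

variable {k : Type v} [Field k] {R : Type u} [CommRing R] [IsNoetherianRing R] [Algebra k R]
  {Λ : Type u} [Ring Λ] [IsNoetherianRing Λ] [Algebra k Λ] [Algebra R Λ] [IsScalarTower k R Λ]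
  [Module.Finite R Λ] (hΛ : IsPerfect Λ = IsBoundedCoherent Λ)

/-- The functor `- ⊗ N` is left linear. -/
@[reducible]
noncomputable def leftLinearTensorRight (N : DbMod Λ) :
    letI := dbModAction (R := R) hΛ
    (StrictPerf.toPerf R ⋙ tensorRightDbMod hΛ R N).LeftLinear (StrictPerf R) :=
  letI := dbModAction (R := R) hΛ
  letI := leftLinearActionRight (M := StrictPerf R) N
  leftLinearOfNatIso (toPerfTensorRightDbMod hΛ N).symm

end Pullback

end NCCR

namespace NCCR

/-! ### Tensoring with strictly perfect complexes preserves quasi-isomorphisms -/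

section Acyclic

instance {C D : Type*} [Category* C] [Category* D] (P : ObjectProperty D)
    [P.IsStableUnderRetracts] (F : C ⥤ D) : (P.inverseImage F).IsStableUnderRetracts where
  of_retract r h := P.prop_of_retract (r.map F) h

open HomologicalComplex

variable {R : Type u} [CommRing R] {Λ : Type u} [Ring Λ] [Algebra R Λ]

theorem acyclic_iff_isZero_Q {A : Type u} [Ring A] (K : CochainComplex (ModuleCat.{u} A) ℤ) :
    K.Acyclic ↔ IsZero (DerivedCategory.Q.obj K) := by
  refine ⟨fun h => ?_, fun h n => ?_⟩
  · obtain ⟨Z, hZ⟩ := HasZeroObject.zero (C := CochainComplex (ModuleCat.{u} A) ℤ)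
    have : QuasiIso (0 : K ⟶ Z) := by
      rw [quasiIso_iff]
      intro n
      rw [quasiIsoAt_iff_exactAt _ _ (h n), exactAt_iff_isZero_homology]
      exact Functor.map_isZero (homologyFunctor (ModuleCat.{u} A) (.up ℤ) n) hZ
    exact (Functor.map_isZero DerivedCategory.Q hZ).of_iso
      (asIso (DerivedCategory.Q.map (0 : K ⟶ Z)))
  · rw [exactAt_iff_isZero_homology]
    exact (Functor.map_isZero (DerivedCategory.homologyFunctor (ModuleCat.{u} A) n) h).of_iso
      ((DerivedCategory.homologyFunctorFactors (ModuleCat.{u} A) n).app K).symm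

theorem acyclic_iff_isZero_Qh {A : Type u} [Ring A]
    (X : HomotopyCategory (ModuleCat.{u} A) (.up ℤ)) :
    HomotopyCategory.subcategoryAcyclic _ X ↔ IsZero (DerivedCategory.Qh.obj X) :=
  (HomotopyCategory.quotient_obj_mem_subcategoryAcyclic_iff_acyclic X.as).trans
    ((acyclic_iff_isZero_Q X.as).trans
      ((DerivedCategory.quotientCompQhIso (ModuleCat.{u} A)).app X.as).symm.isZero_iff)

instance (A : Type u) [Ring A] :
    (HomotopyCategory.subcategoryAcyclic (ModuleCat.{u} A)).IsStableUnderRetracts where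
  of_retract r h := by
    rw [acyclic_iff_isZero_Qh] at h ⊢
    have r' := r.map DerivedCategory.Qh
    rw [IsZero.iff_id_eq_zero, ← r'.retract, h.eq_of_tgt r'.i 0, zero_comp]

/-- Tensor products of strictly perfect complexes and acyclic complexes are acyclic. -/
theorem IsStrictlyPerfect.acyclic_map₂ {K : CochainComplex (ModuleCat.{u} R) ℤ}
    (hK : IsStrictlyPerfect R K) (L : HomotopyCategory (ModuleCat.{u} Λ) (.up ℤ))
    (hL : IsZero (DerivedCategory.Qh.obj L)) : IsZero (DerivedCategory.Qh.obj
      ((descend ((tensorBifunctor R Λ).map₂CochainComplex.obj K)).obj L)) := by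
  rw [← acyclic_iff_isZero_Qh] at hL ⊢
  -- The condition on K is triangulated and closed under retracts, which reduces it to K = R, where
  -- the tensor product with L is L.
  refine IsStrictlyPerfect.induction' ((HomotopyCategory.subcategoryAcyclic _).inverseImage
    (descend ((tensorBifunctor R Λ).map₂CochainComplex.flip.obj L.as))) ?_ hK
  let := (tensorAction R Λ).homotopyAction
  exact (HomotopyCategory.subcategoryAcyclic _).prop_of_iso (MonoidalLeftAction.actionUnitIso
    (C := CochainComplex (ModuleCat.{u} R) ℤ) L).symm hL

/-- An exact functor carries the cone of f to a cone of F(f), and a map is a quasi-isomorphism when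
its cone is acyclic. -/
theorem isIso_Qh_map_of_acyclic {A B : Type u} [Ring A] [Ring B]
    (F : HomotopyCategory (ModuleCat.{u} A) (.up ℤ) ⥤ HomotopyCategory (ModuleCat.{u} B) (.up ℤ))
    [F.CommShift ℤ] [F.IsTriangulated] (hF : ∀ L, IsZero (DerivedCategory.Qh.obj L) →
      IsZero (DerivedCategory.Qh.obj (F.obj L)))
    {X Y : HomotopyCategory (ModuleCat.{u} A) (.up ℤ)} (f : X ⟶ Y)
    [IsIso (DerivedCategory.Qh.map f)] : IsIso (DerivedCategory.Qh.map (F.map f)) := by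
  obtain ⟨Z, g, h, hT⟩ := Pretriangulated.distinguished_cocone_triangle f
  have hZ := (Pretriangulated.Triangle.isZero₃_iff_isIso₁ _
    (DerivedCategory.Qh.map_distinguished _ hT)).2 (inferInstanceAs (IsIso (DerivedCategory.Qh.map f)))
  exact (Pretriangulated.Triangle.isZero₃_iff_isIso₁ _
    ((F ⋙ DerivedCategory.Qh).map_distinguished _ hT)).1 (hF Z hZ)

theorem isIso_Qh_map_descend_map₂ (K : StrictPerf R)
    {X Y : HomotopyCategory (ModuleCat.{u} Λ) (.up ℤ)} (f : X ⟶ Y)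
    [IsIso (DerivedCategory.Qh.map f)] : IsIso (DerivedCategory.Qh.map
      ((descend ((tensorBifunctor R Λ).map₂CochainComplex.obj K.obj)).map f)) :=
  isIso_Qh_map_of_acyclic _ (fun L hL => K.property.acyclic_map₂ L hL) f

end Acyclic

/-! ### Comparison with the derived tensor product -/

section DerivedTensor
open HomologicalComplex

variable {k : Type v} [Field k] {R : Type u} [CommRing R] [IsNoetherianRing R] [Algebra k R]
  {Λ : Type u} [Ring Λ] [IsNoetherianRing Λ] [Algebra k Λ] [Algebra R Λ] [IsScalarTower k R Λ]
  [Module.Finite R Λ] (hΛ : IsPerfect Λ = IsBoundedCoherent Λ)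

/-- The strictly perfect resolution of a complex, as an isomorphism in the derived category. -/
noncomputable def resolutionIso (L : BoundedCoherentComplex Λ) :
    DerivedCategory.Qh.obj ((resolve _ hΛ).functor.obj ((DbMod.ofComplex Λ).obj L)).obj ≅
      DerivedCategory.Qh.obj ((HomotopyCategory.quotient _ _).obj L.obj) :=
  (IsBoundedCoherent Λ).ι.mapIso
    ((resolve _ hΛ).unitIso.symm.app ((DbMod.ofComplex Λ).obj L)) ≪≫
      ((DerivedCategory.quotientCompQhIso (ModuleCat.{u} Λ)).app L.obj).symm

theorem resolutionIso_naturality {L L' : BoundedCoherentComplex Λ} (g : L ⟶ L') :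
    DerivedCategory.Qh.map ((resolve _ hΛ).functor.map ((DbMod.ofComplex Λ).map g)).hom ≫
      (resolutionIso hΛ L').hom = (resolutionIso hΛ L).hom ≫
        DerivedCategory.Qh.map ((HomotopyCategory.quotient _ _).map g.hom) := by
  have h₁ := congrArg (·.hom) ((resolve _ hΛ).unitIso.inv.naturality ((DbMod.ofComplex Λ).map g))
  have h₂ := (DerivedCategory.quotientCompQhIso (ModuleCat.{u} Λ)).inv.naturality g.hom
  exact (Category.assoc _ _ _).symm.trans ((congrArg (· ≫ _) h₁).trans
    ((Category.assoc _ _ _).trans ((congrArg (_ ≫ ·) h₂).trans (Category.assoc _ _ _).symm)))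

/-- The strictly perfect resolution of a complex. -/
noncomputable def resolutionMap (L : BoundedCoherentComplex Λ) :
    ((resolve _ hΛ).functor.obj ((DbMod.ofComplex Λ).obj L)).obj ⟶
      (HomotopyCategory.quotient _ _).obj L.obj :=
  ((HoPerf.Qh_map_bijective _ _).surjective (resolutionIso hΛ L).hom).choose

theorem Qh_map_resolutionMap (L : BoundedCoherentComplex Λ) :
    DerivedCategory.Qh.map (resolutionMap hΛ L) = (resolutionIso hΛ L).hom :=
  ((HoPerf.Qh_map_bijective _ _).surjective (resolutionIso hΛ L).hom).choose_spec

instance (L : BoundedCoherentComplex Λ) : IsIso (DerivedCategory.Qh.map (resolutionMap hΛ L)) := by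
  rw [Qh_map_resolutionMap]
  infer_instance

/-- Both sides start at a strictly perfect complex, so the equality may be tested in the derived
category. -/
theorem resolutionMap_naturality {L L' : BoundedCoherentComplex Λ} (g : L ⟶ L') :
    ((resolve _ hΛ).functor.map ((DbMod.ofComplex Λ).map g)).hom ≫ resolutionMap hΛ L' =
      resolutionMap hΛ L ≫ (HomotopyCategory.quotient _ _).map g.hom := by
  refine (HoPerf.Qh_map_bijective _ _).injective ?_
  rw [Functor.map_comp, Functor.map_comp, Qh_map_resolutionMap, Qh_map_resolutionMap]
  exact resolutionIso_naturality hΛ g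

/-- The tensor product of a strictly perfect complex and a complex agrees with the derived tensor
product. -/
noncomputable def tensorResolutionIso (K : StrictPerf R) (L : BoundedCoherentComplex Λ) :
    DerivedCategory.Qh.obj ((tensorLeftPerf Λ K).obj
      ((resolve _ hΛ).functor.obj ((DbMod.ofComplex Λ).obj L))).obj ≅
    DerivedCategory.Q.obj (mapBifunctor K.obj L.obj (tensorBifunctor R Λ) (.up ℤ)) :=
  have := isIso_Qh_map_descend_map₂ K (resolutionMap hΛ L)
  @asIso _ _ _ _ _ this ≪≫
    (DerivedCategory.quotientCompQhIso (ModuleCat.{u} Λ)).app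
      (mapBifunctor K.obj L.obj (tensorBifunctor R Λ) (.up ℤ))

theorem tensorResolutionIso_naturality_right (K : StrictPerf R) {L L' : BoundedCoherentComplex Λ}
    (g : L ⟶ L') : DerivedCategory.Qh.map ((tensorLeftPerf Λ K).map
      ((resolve _ hΛ).functor.map ((DbMod.ofComplex Λ).map g))).hom ≫
        (tensorResolutionIso hΛ K L').hom = (tensorResolutionIso hΛ K L).hom ≫
      DerivedCategory.Q.map (mapBifunctorMap (𝟙 K.obj) g.hom (tensorBifunctor R Λ) (.up ℤ)) := by
  have h₁ := congrArg (fun z => DerivedCategory.Qh.map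
    ((descend ((tensorBifunctor R Λ).map₂CochainComplex.obj K.obj)).map z))
      (resolutionMap_naturality hΛ g)
  have h₂ := (DerivedCategory.quotientCompQhIso (ModuleCat.{u} Λ)).hom.naturality
    (mapBifunctorMap (𝟙 K.obj) g.hom (tensorBifunctor R Λ) (.up ℤ))
  simp only [Functor.map_comp] at h₁
  exact (Category.assoc _ _ _).symm.trans ((congrArg (· ≫ _) h₁).trans
    ((Category.assoc _ _ _).trans ((congrArg (_ ≫ ·) h₂).trans (Category.assoc _ _ _).symm)))

theorem tensorResolutionIso_naturality_left {K K' : StrictPerf R} (f : K ⟶ K')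
    (L : BoundedCoherentComplex Λ) : DerivedCategory.Qh.map
      ((tensorRightPerf R ((resolve _ hΛ).functor.obj ((DbMod.ofComplex Λ).obj L))).map
        ((StrictPerf.toHoPerf R).map f)).hom ≫
        (tensorResolutionIso hΛ K' L).hom = (tensorResolutionIso hΛ K L).hom ≫
      DerivedCategory.Q.map (mapBifunctorMap f.hom (𝟙 L.obj) (tensorBifunctor R Λ) (.up ℤ)) := by
  have h₁ := congrArg (fun z => DerivedCategory.Qh.map z)
    ((descendNatTrans ((tensorBifunctor R Λ).map₂CochainComplex.map f.hom)).naturality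
      (resolutionMap hΛ L))
  have h₂ := (DerivedCategory.quotientCompQhIso (ModuleCat.{u} Λ)).hom.naturality
    (mapBifunctorMap f.hom (𝟙 L.obj) (tensorBifunctor R Λ) (.up ℤ))
  have h₃ := ((DerivedCategory.Qh.map_comp _ _).symm.trans h₁.symm).trans
    (DerivedCategory.Qh.map_comp _ _)
  exact (Category.assoc _ _ _).symm.trans ((congrArg (· ≫ _) h₃).trans
    ((Category.assoc _ _ _).trans ((congrArg (_ ≫ ·) h₂).trans (Category.assoc _ _ _).symm)))

/-- The action tensors K with a strictly perfect resolution of L. The resolution map stays a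
quasi-isomorphism after tensoring with the strictly perfect K, which gives the comparison with K ⊗
L, naturally in both. -/
theorem perfModule_isDerivedTensor :
    (perfModule (k := k) (R := R) hΛ).IsDerivedTensor := by
  let := dbModAction (R := R) hΛ
  exact ⟨NatIso.ofComponents (fun K => NatIso.ofComponents (fun L => tensorResolutionIso hΛ K L)
      (fun g => tensorResolutionIso_naturality_right hΛ K g))
    (fun f => by
      ext L
      exact tensorResolutionIso_naturality_left hΛ f L)⟩

/-- The functor `- ⊗ N` on perfect complexes is the derived tensor product. -/
noncomputable def tensorRightDbModIso (L : BoundedCoherentComplex Λ) :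
    StrictPerf.toPerf R ⋙ tensorRightDbMod hΛ R ((DbMod.ofComplex Λ).obj L) ⋙
      (IsBoundedCoherent Λ).ι ≅ (IsStrictlyPerfect R).ι ⋙
        (tensorBifunctor R Λ).map₂CochainComplex.flip.obj L.obj ⋙ DerivedCategory.Q :=
  (Functor.associator _ _ _).symm ≪≫ Functor.isoWhiskerRight
      (toPerfTensorRightDbMod (R := R) hΛ ((DbMod.ofComplex Λ).obj L)) (IsBoundedCoherent Λ).ι ≪≫
    NatIso.ofComponents (F := letI := dbModAction (R := R) hΛ
        MonoidalLeftAction.actionRight (StrictPerf R) ((DbMod.ofComplex Λ).obj L) ⋙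
          (IsBoundedCoherent Λ).ι)
      (G := (IsStrictlyPerfect R).ι ⋙
        (tensorBifunctor R Λ).map₂CochainComplex.flip.obj L.obj ⋙ DerivedCategory.Q)
      (fun K => tensorResolutionIso hΛ K L)
      (fun f => tensorResolutionIso_naturality_left hΛ f L)

theorem map_comp_singleRight_hom {K K' : CochainComplex (ModuleCat.{u} R) ℤ} (f : K ⟶ K')
    (V : ModuleCat.{u} Λ) :
    (((tensorBifunctor R Λ).flip.obj V).mapHomologicalComplex (.up ℤ)).map f ≫
      (BifunctorAction.singleRight (tensorBifunctor R Λ) K' V).hom =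
    (BifunctorAction.singleRight (tensorBifunctor R Λ) K V).hom ≫
      mapBifunctorMap f (𝟙 _) (tensorBifunctor R Λ) (.up ℤ) := by
  ext n : 1
  let T := tensorBifunctor R Λ
  let s := (singleObjXSelf (.up ℤ) 0 V).inv
  change (T.map (f.f n)).app V ≫ (T.obj (K'.X n)).map s ≫
      ιMapBifunctor K' _ T (.up ℤ) n 0 n (add_zero n) =
    ((T.obj (K.X n)).map s ≫ ιMapBifunctor K _ T (.up ℤ) n 0 n (add_zero n)) ≫
      (mapBifunctorMap f (𝟙 ((single _ (.up ℤ) 0).obj V)) T (.up ℤ)).f n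
  rw [Category.assoc, ι_mapBifunctorMap, id_f, CategoryTheory.Functor.map_id, Category.id_comp,
    NatTrans.naturality_assoc]

/-- The total tensor product with a module. -/
noncomputable def map₂SingleIso (V : ModuleCat.{u} Λ) :
    (tensorBifunctor R Λ).map₂CochainComplex.flip.obj
      ((HomologicalComplex.single _ (.up ℤ) 0).obj V) ≅
        ((tensorBifunctor R Λ).flip.obj V).mapHomologicalComplex (.up ℤ) :=
  (NatIso.ofComponents (fun K => BifunctorAction.singleRight (tensorBifunctor R Λ) K V)
    (fun f => map_comp_singleRight_hom f V)).symm

theorem isDerivedTensor_tensorRightDbMod (V : ModuleCat.{u} Λ)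
    (hV : ((IsBoundedCoherent Λ).inverseImage (DerivedCategory.Q (C := ModuleCat.{u} Λ)))
      ((HomologicalComplex.single _ (.up ℤ) 0).obj V)) :
    Nonempty (StrictPerf.toPerf R ⋙ tensorRightDbMod hΛ R ((DbMod.ofComplex Λ).obj ⟨_, hV⟩) ⋙
        (IsBoundedCoherent Λ).ι ≅ (IsStrictlyPerfect R).ι ⋙
      ((tensorBifunctor R Λ).flip.obj V).mapHomologicalComplex (.up ℤ) ⋙ DerivedCategory.Q) :=
  ⟨tensorRightDbModIso hΛ ⟨_, hV⟩ ≪≫ Functor.isoWhiskerLeft _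
    (Functor.isoWhiskerRight (map₂SingleIso V) _)⟩

end DerivedTensor
end NCCR

namespace NCCR

/-! ### Quasi-isomorphisms of complexes of modules via elements -/

section Elements

variable {A : Type u} [Ring A]

theorem exists_iCycles_eq (S : ShortComplex (ModuleCat.{u} A)) (x : S.X₂) (hx : S.g x = 0) :
    ∃ c : S.cycles, S.iCycles c = x :=
  ⟨S.moduleCatCyclesIso.inv ⟨x, hx⟩,
    ConcreteCategory.congr_hom S.moduleCatCyclesIso_inv_iCycles ⟨x, hx⟩⟩

theorem homologyπ_eq_zero_iff (S : ShortComplex (ModuleCat.{u} A)) (c : S.cycles) :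
    S.homologyπ c = 0 ↔ ∃ y : S.X₁, S.f y = S.iCycles c := by
  constructor
  · intro h
    have h₁ := ConcreteCategory.congr_hom S.π_moduleCatCyclesIso_hom c
    have h₂ : S.moduleCatLeftHomologyData.π (S.moduleCatCyclesIso.hom c) = 0 :=
      h₁.symm.trans ((congrArg S.moduleCatHomologyIso.hom h).trans (map_zero _))
    obtain ⟨y, hy⟩ := (Submodule.Quotient.mk_eq_zero _).1 h₂
    refine ⟨y, ?_⟩
    exact (congrArg Subtype.val hy).trans
      (ConcreteCategory.congr_hom S.moduleCatCyclesIso_hom_i c)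
  · rintro ⟨y, hy⟩
    have h : S.toCycles y = c := by
      have : Function.Injective S.iCycles := (ModuleCat.mono_iff_injective _).1 inferInstance
      exact this ((ConcreteCategory.congr_hom S.toCycles_i y).trans hy)
    rw [← h]
    exact ConcreteCategory.congr_hom S.toCycles_comp_homologyπ y

theorem quasiIso_of_elements {S S' : ShortComplex (ModuleCat.{u} A)} (φ : S ⟶ S')
    (hinj : ∀ x : S.X₂, S.g x = 0 → (∃ y, S'.f y = φ.τ₂ x) → ∃ y, S.f y = x)
    (hsurj : ∀ z : S'.X₂, S'.g z = 0 → ∃ x, S.g x = 0 ∧ ∃ y, z = φ.τ₂ x + S'.f y) :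
    ShortComplex.QuasiIso φ := by
  have hπ (S : ShortComplex (ModuleCat.{u} A)) : Function.Surjective S.homologyπ :=
    (ModuleCat.epi_iff_surjective _).1 inferInstance
  have hn (c : S.cycles) : ShortComplex.homologyMap φ (S.homologyπ c) =
      S'.homologyπ (ShortComplex.cyclesMap φ c) :=
    ConcreteCategory.congr_hom (ShortComplex.homologyπ_naturality φ) c
  have hi (c : S.cycles) : S'.iCycles (ShortComplex.cyclesMap φ c) = φ.τ₂ (S.iCycles c) :=
    ConcreteCategory.congr_hom (ShortComplex.cyclesMap_i φ) c
  have hg (S : ShortComplex (ModuleCat.{u} A)) (c : S.cycles) : S.g (S.iCycles c) = 0 :=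
    ConcreteCategory.congr_hom S.iCycles_g c
  rw [ShortComplex.quasiIso_iff, ConcreteCategory.isIso_iff_bijective]
  constructor
  · refine (injective_iff_map_eq_zero (ShortComplex.homologyMap φ).hom).2 fun x hx => ?_
    obtain ⟨c, rfl⟩ := hπ S x
    obtain ⟨y, hy⟩ := (homologyπ_eq_zero_iff S' _).1 ((hn c).symm.trans hx)
    exact (homologyπ_eq_zero_iff S c).2 (hinj _ (hg S c) ⟨y, hy.trans (hi c)⟩)
  · intro z
    obtain ⟨c, rfl⟩ := hπ S' z
    obtain ⟨x, hx, y, hy⟩ := hsurj _ (hg S' c)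
    obtain ⟨b, rfl⟩ := exists_iCycles_eq S x hx
    refine ⟨S.homologyπ b, (hn b).trans ?_⟩
    rw [← sub_eq_zero, ← map_sub, homologyπ_eq_zero_iff]
    exact ⟨-y, by rw [map_neg, map_sub, hi, hy, sub_add_cancel_left]⟩

theorem quasiIsoAt_of_elements {K L : CochainComplex (ModuleCat.{u} A) ℤ} (φ : K ⟶ L)
    (i j k : ℤ) (hij : i + 1 = j) (hjk : j + 1 = k)
    (hinj : ∀ x : K.X j, K.d j k x = 0 → (∃ y, L.d i j y = φ.f j x) → ∃ y, K.d i j y = x)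
    (hsurj : ∀ z : L.X j, L.d j k z = 0 → ∃ x, K.d j k x = 0 ∧ ∃ y, z = φ.f j x + L.d i j y) :
    QuasiIsoAt φ j :=
  (quasiIsoAt_iff' φ i j k (by rw [CochainComplex.prev]; lia) (by rw [CochainComplex.next]; lia)).2
    (quasiIso_of_elements _ hinj hsurj)

theorem exactAt_of_elements {K : CochainComplex (ModuleCat.{u} A) ℤ}
    (i j k : ℤ) (hij : i + 1 = j) (hjk : j + 1 = k)
    (h : ∀ x : K.X j, K.d j k x = 0 → ∃ y, K.d i j y = x) : K.ExactAt j :=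
  (K.exactAt_iff' i j k (by rw [CochainComplex.prev]; lia) (by rw [CochainComplex.next]; lia)).2
    ((ShortComplex.moduleCat_exact_iff _).2 h)

theorem quasiIso_of_comp_eq {K L L' : CochainComplex (ModuleCat.{u} A) ℤ} {a : K ⟶ L} {b : L ⟶ L'}
    {c : K ⟶ L'} (h : a ≫ b = c) (hb : IsIso b) (hc : QuasiIso c) : QuasiIso a := by
  subst h
  exact (quasiIso_iff_comp_right a b).1 hc

end Elements

/-! ### The unit at R: homothety and vanishing of self-extensions -/

section Unit
open HomologicalComplex CochainComplex.HomComplex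

attribute [local instance] restrictedModule restrictedModule_isScalarTower algebraLinear

variable {R : Type u} [CommRing R] {Λ : Type u} [Ring Λ] [Algebra R Λ]

/-- Makes the unit of the adjunction at R explicit: up to R ⊗ P ≅ P it is the homothety map. -/
theorem curryHom_unitIso_apply (P : CochainComplex (ModuleCat.{u} Λ) ℤ) (r : R) :
    ((curryHom (R := R) ((tensorAction R Λ).unitIso P).hom).f 0).hom
      ((singleObjXSelf (.up ℤ) 0 (ModuleCat.of R R)).inv r) = Cochain.ofHom (r • 𝟙 P) := by
  refine Cochain.ext _ _ fun p q hpq => ?_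
  obtain rfl : q = p := by lia
  refine (curryCochain_v _ 0 _ q q hpq).trans ?_
  rw [Cochain.ofHom_v]
  have h := (tensorAction R Λ).ι_unitIso_hom P q
  have h₁ := (tensorHomEquiv_map_app_comp
    (singleObjXSelf (.up ℤ) 0 (ModuleCat.of R R)).inv
    (ιMapBifunctor (𝟙_ (CochainComplex (ModuleCat.{u} R) ℤ)) P (tensorBifunctor R Λ) (.up ℤ) 0 q q
      (zero_add q) ≫ ((tensorAction R Λ).unitIso P).hom.f q)) r
  refine h₁.symm.trans ?_
  refine (congrArg (fun z => tensorHomEquiv R Λ (ModuleCat.of R R) (P.X q) (P.X q) z r) h).trans ?_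
  rfl

/-- Negative degrees vanish by the t-structure and positive degrees are Ext groups. -/
theorem subsingleton_shiftedHom {V : ModuleCat.{u} Λ} [HasExt.{w} (ModuleCat.{u} Λ)]
    (hV : ∀ i : ℕ, 0 < i → Subsingleton (Abelian.Ext.{w} V V i)) (n : ℤ) (hn : n ≠ 0) :
    Subsingleton ((DerivedCategory.singleFunctor (ModuleCat.{u} Λ) 0).obj V ⟶
      ((DerivedCategory.singleFunctor (ModuleCat.{u} Λ) 0).obj V)⟦n⟧) := by
  rcases lt_or_gt_of_ne hn with h | h
  · refine ⟨fun f g => ?_⟩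
    have := DerivedCategory.TStructure.t.isGE_shift
      ((DerivedCategory.singleFunctor (ModuleCat.{u} Λ) 0).obj V) 0 n (-n)
    rw [DerivedCategory.TStructure.t.zero f 0 (-n), DerivedCategory.TStructure.t.zero g 0 (-n)]
  · obtain ⟨m, rfl⟩ := Int.eq_ofNat_of_zero_le h.le
    have := hV m (by lia)
    exact Abelian.Ext.homEquiv.symm.subsingleton

section

variable (P : HoPerf Λ) {V : ModuleCat.{u} Λ}
  (e : DerivedCategory.Qh.obj P.obj ≅ (DerivedCategory.singleFunctor (ModuleCat.{u} Λ) 0).obj V)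

-- The cohomology of the Hom complex in degree n is the group of homotopy classes P → P[n]. As P is
-- strictly perfect, these are the maps V → V[n] in the derived category.
include e in
theorem exactAt_homComplex [HasExt.{w} (ModuleCat.{u} Λ)]
    (hV : ∀ i : ℕ, 0 < i → Subsingleton (Abelian.Ext.{w} V V i)) (n : ℤ) (hn : n ≠ 0) :
    (homComplex R P.obj.as P.obj.as).ExactAt n := by
  have h₀ := subsingleton_shiftedHom hV n hn
  have h₁ : Subsingleton (DerivedCategory.Qh.obj P.obj ⟶
      DerivedCategory.Qh.obj (P.obj⟦n⟧)) :=
    ((e.homCongr ((DerivedCategory.Qh.commShiftIso n).app P.obj ≪≫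
      (shiftFunctor _ n).mapIso e)).subsingleton_congr).2 h₀
  have h₂ : Subsingleton (P.obj ⟶ P.obj⟦n⟧) := (P.Qh_map_bijective _).injective.subsingleton
  have h₂' : Subsingleton ((HomotopyCategory.quotient _ (.up ℤ)).obj P.obj.as ⟶
      (HomotopyCategory.quotient _ (.up ℤ)).obj (P.obj.as⟦n⟧)) :=
    (((Iso.refl P.obj).homCongr
      (((HomotopyCategory.quotient _ (.up ℤ)).commShiftIso n).app P.obj.as)).subsingleton_congr).2 h₂
  have h₃ : Subsingleton (CohomologyClass P.obj.as P.obj.as n) :=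
    (CohomologyClass.toHom_bijective P.obj.as P.obj.as n).injective.subsingleton
  refine exactAt_of_elements (n - 1) n (n + 1) (by lia) rfl fun z hz => ?_
  let z' : Cocycle P.obj.as P.obj.as n := Cocycle.mk z (n + 1) rfl hz
  have h₄ := (CohomologyClass.mk_eq_zero_iff z').1 (Subsingleton.elim _ _)
  exact (mem_coboundaries_iff z' (n - 1) (by lia)).1 h₄

include e in
theorem exists_map_eq_smul_id
    (hV : Function.Surjective (fun r : R => r • 𝟙 V)) (f : P.obj ⟶ P.obj) :
    ∃ r : R, f = r • 𝟙 P.obj := by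
  obtain ⟨h, hh⟩ := (DerivedCategory.singleFunctor (ModuleCat.{u} Λ) 0).map_surjective
    (e.inv ≫ DerivedCategory.Qh.map f ≫ e.hom)
  obtain ⟨r, rfl⟩ := hV h
  refine ⟨r, (P.Qh_map_bijective _).injective ?_⟩
  rw [Functor.map_smul, CategoryTheory.Functor.map_id] at hh ⊢
  rw [← cancel_epi e.inv, ← cancel_mono e.hom, Category.assoc, ← hh, Linear.comp_smul,
    Linear.smul_comp, Category.comp_id, Iso.inv_hom_id]

include e in
theorem eq_zero_of_smul_id_eq_zero
    (hV : Function.Injective (fun r : R => r • 𝟙 V)) (r : R) (hr : r • 𝟙 P.obj = 0) : r = 0 := by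
  have h : r • 𝟙 (DerivedCategory.Qh.obj P.obj) = 0 := by
    rw [← CategoryTheory.Functor.map_id, ← Functor.map_smul, hr, Functor.map_zero]
  refine hV ((DerivedCategory.singleFunctor (ModuleCat.{u} Λ) 0).map_injective ?_)
  dsimp only
  rw [Functor.map_smul, CategoryTheory.Functor.map_id, zero_smul, Functor.map_zero, ← e.inv_hom_id,
    ← Category.id_comp e.hom, ← Linear.comp_smul, ← Linear.smul_comp, h, zero_comp, comp_zero]

include e in
/-- If `Ext^i(V, V) = 0` for `i > 0` and `End(V) = R`, and `P` is a strictly perfect resolution of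
`V`, the unit `R ⟶ Hom(P, R ⊗ P)` is a quasi-isomorphism. -/
theorem quasiIso_unit [HasExt.{w} (ModuleCat.{u} Λ)]
    (hext : ∀ i : ℕ, 0 < i → Subsingleton (Abelian.Ext.{w} V V i))
    (hV : Function.Bijective (fun r : R => r • 𝟙 V)) :
    QuasiIso ((tensorHomAdjunction R P.obj.as).unit.app
      ((HomologicalComplex.single _ (.up ℤ) 0).obj (ModuleCat.of R R))) := by
  -- The homothety map R → Hom(P, P) is treated first; it differs from the unit by the isomorphism
  -- induced by R ⊗ P ≅ P.
  have h : QuasiIso (curryHom (R := R) ((tensorAction R Λ).unitIso P.obj.as).hom) := by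
    rw [quasiIso_iff]
    intro n
    by_cases hn : n = 0
    · subst hn
      have hs (x : ((HomologicalComplex.single _ (.up ℤ) 0).obj (ModuleCat.of R R)).X 0) :
          ∃ r : R, (singleObjXSelf (.up ℤ) 0 (ModuleCat.of R R)).inv r = x :=
        ⟨(singleObjXSelf (.up ℤ) 0 (ModuleCat.of R R)).hom x,
          ConcreteCategory.congr_hom (singleObjXSelf (.up ℤ) 0 (ModuleCat.of R R)).hom_inv_id x⟩
      refine quasiIsoAt_of_elements _ (-1) 0 1 rfl rfl (fun x _ hx => ?_) (fun z hz => ?_)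
      -- Injectivity in degree 0: if multiplication by r is a coboundary it is null-homotopic, so r
      -- acts as zero on V.
      · obtain ⟨r, rfl⟩ := hs x
        obtain ⟨y, hy⟩ := hx
        have h₁ : Cochain.ofHom (r • 𝟙 P.obj.as) = δ (-1) 0 y + Cochain.ofHom 0 := by
          rw [Cochain.ofHom_zero, add_zero]
          exact (curryHom_unitIso_apply P.obj.as r).symm.trans hy.symm
        have h₂ := HomotopyCategory.eq_of_homotopy _ _
          ((Cochain.equivHomotopy (r • 𝟙 P.obj.as) 0).symm ⟨y, h₁⟩)
        rw [Functor.map_smul, CategoryTheory.Functor.map_id, Functor.map_zero] at h₂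
        obtain rfl := eq_zero_of_smul_id_eq_zero P e hV.injective r h₂
        exact ⟨0, (map_zero _).trans (map_zero _).symm⟩
      -- Surjectivity in degree 0: a cocycle is an endomorphism of P, and it is homotopic to a
      -- scalar because End(V) consists of scalars.
      · let z' : Cocycle P.obj.as P.obj.as 0 := Cocycle.mk z 1 rfl hz
        obtain ⟨r, hr⟩ := exists_map_eq_smul_id P e hV.surjective
          ((HomotopyCategory.quotient _ _).map z'.homOf)
        have h₁ : (HomotopyCategory.quotient _ (.up ℤ)).map z'.homOf =
            (HomotopyCategory.quotient _ _).map (r • 𝟙 P.obj.as) := by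
          rw [Functor.map_smul, CategoryTheory.Functor.map_id]
          exact hr
        obtain ⟨y, hy⟩ := Cochain.equivHomotopy _ _ (HomotopyCategory.homotopyOfEq _ _ h₁)
        refine ⟨(singleObjXSelf (.up ℤ) 0 (ModuleCat.of R R)).inv r, ?_, y, ?_⟩
        · exact congrArg (fun d => ModuleCat.Hom.hom d _)
            (single_obj_d (.up ℤ) 0 (ModuleCat.of R R) 0 1)
        · refine Eq.trans ?_ (congrArg (· + δ (-1) 0 y) (curryHom_unitIso_apply P.obj.as r).symm)
          rw [Cocycle.cochain_ofHom_homOf_eq_coe, add_comm] at hy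
          exact hy
    · rw [quasiIsoAt_iff_exactAt]
      · exact exactAt_homComplex P e hext n hn
      · exact exactAt_single_obj (.up ℤ) 0 (ModuleCat.of R R) n hn
  have h₁ : (tensorHomAdjunction R P.obj.as).unit.app (𝟙_ (CochainComplex (ModuleCat.{u} R) ℤ)) =
      curryHom (𝟙 _) :=
    ((tensorHomAdjunction R P.obj.as).homEquiv_id _).symm.trans (tensorHomAdjunction_homEquiv _)
  have h₂ : curryHom (R := R) ((tensorAction R Λ).unitIso P.obj.as).hom =
      (tensorHomAdjunction R P.obj.as).unit.app (𝟙_ (CochainComplex (ModuleCat.{u} R) ℤ)) ≫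
        (homFunctor R P.obj.as).map ((tensorAction R Λ).unitIso P.obj.as).hom := by
    rw [h₁]
    exact (congrArg curryHom (Category.id_comp _).symm).trans (curryHom_naturality_right _ _)
  have h₃ : IsIso ((homFunctor R P.obj.as).map ((tensorAction R Λ).unitIso P.obj.as).hom) :=
    inferInstanceAs
      (IsIso ((homFunctor R P.obj.as).mapIso ((tensorAction R Λ).unitIso P.obj.as)).hom)
  exact quasiIso_of_comp_eq h₂.symm h₃ h

end

end Unit
end NCCR

namespace NCCR

/-! ### Dévissage of bounded coherent complexes -/

section Devissage
open HomologicalComplex Pretriangulated DerivedCategory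

variable {A : Type u} [Ring A]

theorem finite_of_finiteCohomology_single {V : ModuleCat.{u} A} (n : ℤ)
    (h : HasFiniteCohomology A ((singleFunctor _ n).obj V)) : Module.Finite A V := by
  have : Module.Finite A ((singleFunctor (ModuleCat.{u} A) n ⋙
    homologyFunctor (ModuleCat.{u} A) n).obj V) := h n
  exact Module.Finite.equiv ((singleFunctorCompHomologyFunctorIso _ n).app V).toLinearEquiv

theorem prop_singleFunctor (P : ObjectProperty (DerivedCategory (ModuleCat.{u} A)))
    [P.IsTriangulated] [P.IsClosedUnderIsomorphisms] {V : ModuleCat.{u} A}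
    (h : P ((singleFunctor _ 0).obj V)) (n : ℤ) : P ((singleFunctor _ n).obj V) :=
  P.prop_of_iso (((singleFunctors (ModuleCat.{u} A)).shiftIso (-n) n 0 (by lia)).app V)
    (P.le_shift (-n) _ h)

/-- Objects with bounded and finitely generated cohomology are iterated extensions of shifts of
finitely generated modules. -/
theorem IsBoundedCoherent.induction [IsNoetherianRing A]
    (P : ObjectProperty (DerivedCategory (ModuleCat.{u} A)))
    [P.IsTriangulated] [P.IsClosedUnderIsomorphisms]
    (hP : ∀ (V : ModuleCat.{u} A) [Module.Finite A V], P ((singleFunctor _ 0).obj V)) :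
    IsBoundedCoherent A ≤ P := by
  rintro X ⟨⟨⟨a, ha⟩, ⟨b, hb⟩⟩, hX⟩
  obtain ⟨n, hn⟩ : ∃ n : ℕ, b ≤ a + n - 1 := ⟨(b - a + 1).toNat, by lia⟩
  have hb' : X.IsLE (a + n - 1) := (isLE_iff _ _).2 fun i hi => (isLE_iff X b).1 hb i (by lia)
  clear hb hn b
  induction n generalizing X a with
  | zero =>
    exact P.prop_of_isZero (TStructure.t.isZero X (a + (0 : ℕ) - 1) a (by lia))
  | succ n ih =>
    -- Truncation at the lowest degree a: Y has cohomology in degree a only, hence is a shifted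
    -- module, and the amplitude of Z is smaller.
    obtain ⟨Y, Z, hY, hZ, f, g, h, hT⟩ := TStructure.t.exists_triangle X a (a + 1) rfl
    have hY' : Y.IsLE a := ⟨hY⟩
    have hZ' : Z.IsGE (a + 1) := ⟨hZ⟩
    have hYa : Y.IsGE a := (isGE_iff _ _).2 fun i hi =>
      (HomologySequence.exact₁ _ hT (i - 1) i).isZero_of_both_zeros
        ((isZero_of_isGE Z (a + 1) (i - 1) (by lia)).eq_of_src _ _)
        ((isZero_of_isGE X a i hi).eq_of_tgt _ _)
    have hZb : Z.IsLE (a + 1 + n - 1) := (isLE_iff _ _).2 fun i hi =>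
      (HomologySequence.exact₃ _ hT i (i + 1)).isZero_of_both_zeros
        ((isZero_of_isLE X (a + (n + 1 : ℕ) - 1) i (by push_cast; lia)).eq_of_src _ _)
        ((isZero_of_isLE Y a (i + 1) (by lia)).eq_of_tgt _ _)
    obtain ⟨V, ⟨e⟩⟩ := exists_iso_singleFunctor_obj_of_isGE_of_isLE Y a
    have hYf : HasFiniteCohomology A Y := fun i => by
      by_cases hi : i = a
      · subst hi
        have : Mono ((homologyFunctor (ModuleCat.{u} A) i).map f) :=
          (HomologySequence.mono_homologyMap_mor₁_iff _ hT (i - 1) i).2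
            ((isZero_of_isGE Z (i + 1) (i - 1) (by lia)).eq_of_src _ _)
        have hXi := hX i
        exact Module.Finite.of_injective ((homologyFunctor (ModuleCat.{u} A) i).map f).hom
          ((ModuleCat.mono_iff_injective _).1 this)
      · have : Subsingleton ((homologyFunctor (ModuleCat.{u} A) i).obj Y) := by
          refine ModuleCat.subsingleton_of_isZero ?_
          by_cases h' : i < a
          · exact isZero_of_isGE Y a i h'
          · exact isZero_of_isLE Y a i (by lia)
        infer_instance
    have hZf : HasFiniteCohomology A Z :=
      (HasFiniteCohomology A).ext_of_isTriangulatedClosed₃ _ hT hYf hX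
    refine P.ext_of_isTriangulatedClosed₂ _ hT ?_ (ih _ hZf (a + 1) hZ' hZb)
    have := finite_of_finiteCohomology_single a ((HasFiniteCohomology A).prop_of_iso e hYf)
    exact P.prop_of_iso e.symm (prop_singleFunctor P (hP V) a)

/-- The kernel of a finite free cover is again finite and has smaller projective dimension; the
module is the third vertex of the resulting triangle. -/
theorem isPerfect_singleFunctor [IsNoetherianRing A] {n : ℕ} (V : ModuleCat.{u} A)
    [Module.Finite A V] (h : HasProjectiveDimensionLE V n) :
    IsPerfect A ((singleFunctor _ 0).obj V) := by
  induction n generalizing V with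
  | zero =>
    have := (IsProjective.iff_projective V).2 ((projective_iff_hasProjectiveDimensionLE_zero _).2 h)
    exact ⟨_, single_isStrictlyPerfect A V, ⟨(singleFunctorIsoCompQ _ 0).app V⟩⟩
  | succ n ih =>
    obtain ⟨m, f, hf⟩ := Module.Finite.exists_fin' A V
    let F : ModuleCat.{u} A := ModuleCat.of A (Fin m → A)
    let S : ShortComplex (ModuleCat.{u} A) := ShortComplex.mk
      (ModuleCat.ofHom (LinearMap.ker f).subtype) (ModuleCat.ofHom f) (by ext x; exact x.2)
    have hS : S.ShortExact :=
      { exact := (ShortComplex.ShortExact.moduleCat_exact_iff_function_exact _).2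
          (LinearMap.exact_subtype_ker_map f)
        mono_f := (ModuleCat.mono_iff_injective _).2 (Submodule.subtype_injective _)
        epi_g := (ModuleCat.epi_iff_surjective _).2 hf }
    have : Module.Projective A S.X₂ := inferInstanceAs (Module.Projective A (Fin m → A))
    have h2 : Projective S.X₂ := (IsProjective.iff_projective _).1 this
    have : Module.Finite A S.X₂ := inferInstanceAs (Module.Finite A (Fin m → A))
    have : Module.Finite A S.X₁ := inferInstanceAs (Module.Finite A (LinearMap.ker f))
    exact (IsPerfect A).ext_of_isTriangulatedClosed₃ _ hS.singleTriangle_distinguished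
      (ih S.X₁ ((hS.hasProjectiveDimensionLT_X₃_iff n h2).1 h))
      ⟨_, single_isStrictlyPerfect A S.X₂, ⟨(singleFunctorIsoCompQ _ 0).app S.X₂⟩⟩

/-- The use of finite global dimension for part (2): it makes strictly perfect models available for
every object of D^b(mod Λ). -/
theorem isPerfect_eq_isBoundedCoherent [IsNoetherianRing A] (h : HasFiniteGlobalDimension A) :
    IsPerfect A = IsBoundedCoherent A := by
  obtain ⟨n, hn⟩ := h
  exact le_antisymm isPerfect_le_isBoundedCoherent
    (IsBoundedCoherent.induction _ fun V _ => isPerfect_singleFunctor V (hn V))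

variable (A) in
/-- The objects of the derived category which are represented by bounded above complexes of
projective modules. -/
def HasBoundedAboveProjective : ObjectProperty (DerivedCategory (ModuleCat.{u} A)) :=
  fun X => ∃ K : CochainComplex (ModuleCat.{u} A) ℤ, (∃ d : ℤ, K.IsStrictlyLE d) ∧
    (∀ n, Module.Projective A (K.X n)) ∧ Nonempty (X ≅ Q.obj K)

instance : (HasBoundedAboveProjective A).IsClosedUnderIsomorphisms where
  of_iso e := by
    rintro ⟨K, hK, hK', ⟨e'⟩⟩
    exact ⟨K, hK, hK', ⟨e.symm ≪≫ e'⟩⟩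

theorem HasBoundedAboveProjective.shift {X : DerivedCategory (ModuleCat.{u} A)}
    (hX : HasBoundedAboveProjective A X) (n : ℤ) : HasBoundedAboveProjective A (X⟦n⟧) := by
  obtain ⟨K, ⟨d, _⟩, hK, ⟨e⟩⟩ := hX
  exact ⟨K⟦n⟧, ⟨d - n, K.isStrictlyLE_shift d n _ (by lia)⟩, fun i => hK (i + n),
    ⟨(shiftFunctor _ n).mapIso e ≪≫ (Q.commShiftIso n).symm.app K⟩⟩

instance : (HasBoundedAboveProjective A).IsTriangulated where
  exists_zero := by
    have hZ : IsZero (ModuleCat.of A PUnit) := ModuleCat.isZero_of_subsingleton _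
    have h := single_isStrictlyPerfect A (ModuleCat.of A PUnit)
    exact ⟨_, Functor.map_isZero Q (Functor.map_isZero
      (HomologicalComplex.single (ModuleCat.{u} A) (.up ℤ) 0) hZ), _, h.2.2, fun n => (h.1 n).2, ⟨Iso.refl _⟩⟩
  isStableUnderShiftBy n := ⟨fun _ hX => hX.shift n⟩
  ext₂' T hT := by
    rintro ⟨K, ⟨d, _⟩, hK, ⟨e₁⟩⟩ ⟨L, ⟨d', _⟩, hL, ⟨e₃⟩⟩
    refine ObjectProperty.le_isoClosure _ _ ?_
    have hL' (n : ℤ) : Projective (L.X n) := (IsProjective.iff_projective _).1 (hL n)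
    have := CochainComplex.isKProjective_of_projective L d'
    let e₁' : T.obj₁⟦(1 : ℤ)⟧ ≅ Q.obj (K⟦(1 : ℤ)⟧) :=
      (shiftFunctor _ (1 : ℤ)).mapIso e₁ ≪≫ (Q.commShiftIso (1 : ℤ)).symm.app K
    let q := quotientCompQhIso (ModuleCat.{u} A)
    obtain ⟨g, hg⟩ := (CochainComplex.IsKProjective.Qh_map_bijective L
      ((HomotopyCategory.quotient _ _).obj (K⟦(1 : ℤ)⟧))).surjective
      (q.hom.app L ≫ (e₃.inv ≫ T.mor₃ ≫ e₁'.hom) ≫ q.inv.app _)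
    obtain ⟨f, rfl⟩ := (HomotopyCategory.quotient _ _).map_surjective g
    have hf : Q.map f = e₃.inv ≫ T.mor₃ ≫ e₁'.hom := by
      rw [← cancel_epi (q.hom.app L), ← cancel_mono (q.inv.app _), Category.assoc, Category.assoc]
      refine Eq.trans ?_ hg
      simp [q]
    let e := Pretriangulated.isoTriangleOfIso₁₂ _ _
      (rot_of_distTriang _ (rot_of_distTriang _ hT)) (mappingCone_triangle_distinguished f) e₃ e₁' (by
        change T.mor₃ ≫ e₁'.hom = e₃.hom ≫ Q.map f
        simp [hf])
    have h2 : HasBoundedAboveProjective A (T.obj₂⟦(1 : ℤ)⟧) := by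
      refine ⟨_, ⟨max d d', ?_⟩, fun n => ?_, ⟨Triangle.π₃.mapIso e⟩⟩
      · rw [CochainComplex.isStrictlyLE_iff]
        intro i hi
        refine (CochainComplex.mappingCone.isZero_X_iff f i).2 ?_
        exact ⟨L.isZero_of_isStrictlyLE d' _ (by lia), K.isZero_of_isStrictlyLE d _ (by lia)⟩
      · have := hL (n + 1)
        have : Module.Projective A ((K⟦(1 : ℤ)⟧).X n) := hK (n + 1)
        have h₂ : Module.Projective A (L.X (n + 1) × (K⟦(1 : ℤ)⟧).X n) := inferInstance
        let e := (homotopyCofiber.XIsoBiprod f n (n + 1) rfl ≪≫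
          ModuleCat.biprodIsoProd _ _).toLinearEquiv.symm
        exact Module.Projective.of_equiv e
    exact (HasBoundedAboveProjective A).prop_of_iso
      ((shiftEquiv _ (1 : ℤ)).unitIso.symm.app T.obj₂) (h2.shift (-1))

/-- Dévissage reduces to a single module, for which a projective resolution serves. No hypothesis of
finite dimension is made, so this applies to R. -/
theorem isBoundedCoherent_le_hasBoundedAboveProjective [IsNoetherianRing A] :
    IsBoundedCoherent A ≤ HasBoundedAboveProjective A :=
  IsBoundedCoherent.induction _ fun V _ => by
    let r := projectiveResolution V
    have : QuasiIso r.π' := inferInstance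
    exact ⟨r.cochainComplex, ⟨0, inferInstance⟩,
      fun n => (IsProjective.iff_projective _).2 (inferInstanceAs (Projective (r.cochainComplex.X n))),
      ⟨(singleFunctorIsoCompQ _ 0).app V ≪≫ (asIso (Q.map r.π')).symm⟩⟩

end Devissage
end NCCR

namespace NCCR

/-! ### Acyclic complexes with terms without higher extensions -/

section ExtVanishing
open HomologicalComplex Abelian

variable {A : Type u} [Ring A]

/-- All higher extensions of `X` by `Y` vanish. -/
def ExtVanishes (X Y : ModuleCat.{u} A) : Prop := ∀ i : ℕ, 0 < i → Subsingleton (Ext X Y i)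

theorem ExtVanishes.of_projective {X Y : ModuleCat.{u} A} (h : Module.Projective A X) :
    ExtVanishes X Y := fun i hi => by
  have : Projective X := (IsProjective.iff_projective X).1 h
  obtain ⟨i, rfl⟩ : ∃ j, i = j + 1 := ⟨i - 1, by lia⟩
  exact subsingleton_of_forall_eq 0 Ext.eq_zero_of_projective

theorem ExtVanishes.of_decomposition {X X₁ X₂ Y : ModuleCat.{u} A} (f₁ : X ⟶ X₁) (g₁ : X₁ ⟶ X)
    (f₂ : X ⟶ X₂) (g₂ : X₂ ⟶ X) (h : f₁ ≫ g₁ + f₂ ≫ g₂ = 𝟙 X)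
    (h₁ : ExtVanishes X₁ Y) (h₂ : ExtVanishes X₂ Y) : ExtVanishes X Y := fun i hi => by
  have := h₁ i hi
  have := h₂ i hi
  refine subsingleton_of_forall_eq 0 fun x => ?_
  rw [← Ext.mk₀_id_comp x, ← h, Ext.mk₀_add, Ext.add_comp, ← Ext.mk₀_comp_mk₀_assoc,
    ← Ext.mk₀_comp_mk₀_assoc, Subsingleton.elim ((Ext.mk₀ g₁).comp x (zero_add i)) 0,
    Subsingleton.elim ((Ext.mk₀ g₂).comp x (zero_add i)) 0, Ext.comp_zero, Ext.comp_zero, add_zero]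

theorem ExtVanishes.mappingCone {K L : CochainComplex (ModuleCat.{u} A) ℤ} (f : K ⟶ L)
    {Y : ModuleCat.{u} A} (hK : ∀ n, ExtVanishes (K.X n) Y) (hL : ∀ n, ExtVanishes (L.X n) Y)
    (n : ℤ) : ExtVanishes ((CochainComplex.mappingCone f).X n) Y :=
  .of_decomposition _ _ _ _ (CochainComplex.mappingCone.id_X f n (n + 1) rfl)
    (hK (n + 1)) (hL n)

variable {K : CochainComplex (ModuleCat.{u} A) ℤ}

theorem exists_of_exactAt (h : ∀ n, K.ExactAt n) {i j k : ℤ} (hij : i + 1 = j) (hjk : j + 1 = k)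
    (x : K.X j) (hx : K.d j k x = 0) : ∃ y, K.d i j y = x :=
  (ShortComplex.moduleCat_exact_iff _).1 ((K.exactAt_iff' i j k
    (by rw [CochainComplex.prev]; lia) (by rw [CochainComplex.next]; lia)).1 (h j)) x hx

theorem shortExact_cycles (h : ∀ n, K.ExactAt n) (n m : ℤ) (hm : n + 1 = m) :
    (ShortComplex.mk (K.iCycles n) (K.toCycles n m) (by
      rw [← cancel_mono (K.iCycles m), Category.assoc, toCycles_i, zero_comp,
        iCycles_d])).ShortExact where
  exact := by
    rw [ShortComplex.moduleCat_exact_iff]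
    intro x hx
    have h0 : K.d n m x = 0 := by
      have := congrArg (K.iCycles m) hx
      rw [map_zero] at this
      exact (ConcreteCategory.congr_hom (K.toCycles_i n m) x).symm.trans this
    obtain ⟨y, hy⟩ := exists_of_exactAt h (i := n - 1) (by lia) hm x h0
    refine ⟨K.toCycles (n - 1) n y, ?_⟩
    exact (ConcreteCategory.congr_hom (K.toCycles_i (n - 1) n) y).trans hy
  mono_f := inferInstance
  epi_g := by
    refine (ModuleCat.epi_iff_surjective _).2 fun z => ?_
    have h0 : K.d m (m + 1) (K.iCycles m z) = 0 :=
      ConcreteCategory.congr_hom (K.iCycles_d m (m + 1)) z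
    obtain ⟨y, hy⟩ := exists_of_exactAt h hm rfl _ h0
    exact ⟨y, (ModuleCat.mono_iff_injective (K.iCycles m)).1 inferInstance
      ((ConcreteCategory.congr_hom (K.toCycles_i n m) y).trans hy)⟩

/-- Descending induction from the top, where the cycles are zero. The sequence 0 → Z^n → K^n →
Z^{n+1} → 0 places Ext^i(Z^n, Y) between Ext^i(K^n, Y) and Ext^{i+1}(Z^{n+1}, Y). -/
theorem ExtVanishes.cycles {Y : ModuleCat.{u} A} (h : ∀ n, K.ExactAt n) (d : ℤ)
    [K.IsStrictlyLE d] (hext : ∀ n, ExtVanishes (K.X n) Y) (n : ℤ) :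
    ExtVanishes (K.cycles n) Y := by
  -- `k` bounds how far n lies below d + 1, the first degree in which the complex must vanish.
  obtain ⟨k, hk⟩ : ∃ k : ℕ, d + 1 - k ≤ n := ⟨(d + 1 - n).toNat, by lia⟩
  induction k generalizing n with
  | zero =>
    refine .of_projective ?_
    have := ModuleCat.subsingleton_of_isZero
      (IsZero.of_mono (K.iCycles n) (K.isZero_of_isStrictlyLE d n (by lia)))
    exact Module.Projective.of_free (R := A) (P := K.cycles n)
  | succ k ih =>
    intro i hi
    have hS := shortExact_cycles h n (n + 1) rfl
    refine subsingleton_of_forall_eq 0 fun x => ?_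
    have := ih (n + 1) (by push_cast at hk; lia) (1 + i) (by lia)
    obtain ⟨x₂, rfl⟩ := Ext.contravariant_sequence_exact₁ hS Y x rfl (Subsingleton.elim _ _)
    have := hext n i hi
    exact (congrArg (fun z => (Ext.mk₀ (K.iCycles n)).comp z (zero_add i))
      (Subsingleton.elim x₂ 0)).trans (Ext.comp_zero ..)

/-- If `K` is acyclic and bounded above, and if the higher extensions of its terms by `Y` vanish,
then `Hom(K, Y)` is acyclic. -/
theorem exists_d_comp_eq {Y : ModuleCat.{u} A} (h : ∀ n, K.ExactAt n) (d : ℤ)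
    [K.IsStrictlyLE d] (hext : ∀ n, ExtVanishes (K.X n) Y) {i j k : ℤ} (hij : i + 1 = j)
    (hjk : j + 1 = k) (χ : K.X j ⟶ Y) (hχ : K.d i j ≫ χ = 0) :
    ∃ χ' : K.X k ⟶ Y, K.d j k ≫ χ' = χ := by
  have h1 := shortExact_cycles h i j hij
  have h2 := shortExact_cycles h j k hjk
  have h3 := shortExact_cycles h k (k + 1) rfl
  have h0 : K.iCycles j ≫ χ = 0 := by
    have : Epi (K.toCycles i j) := h1.epi_g
    rw [← cancel_epi (K.toCycles i j), toCycles_i_assoc, hχ, comp_zero]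
  let ψ : K.cycles k ⟶ Y := h2.gIsCokernel.desc (CokernelCofork.ofπ χ h0)
  have hψ : K.toCycles j k ≫ ψ = χ :=
    h2.gIsCokernel.fac (CokernelCofork.ofπ χ h0) WalkingParallelPair.one
  -- The obstruction to extending ψ from the cycles to the whole term lies in Ext^1 of the next
  -- cycles.
  have := ExtVanishes.cycles h d hext (k + 1) (1 + 0) (by lia)
  obtain ⟨x, hx⟩ := Ext.contravariant_sequence_exact₁ h3 Y (Ext.mk₀ ψ) rfl (Subsingleton.elim _ _)
  obtain ⟨χ', rfl⟩ := (Ext.mk₀_bijective _ _).2 x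
  refine ⟨χ', ?_⟩
  have hx' : K.iCycles k ≫ χ' = ψ := by
    rw [Ext.mk₀_comp_mk₀] at hx
    exact (Ext.mk₀_bijective _ _).1 hx
  rw [← hψ, ← hx', toCycles_i_assoc]

theorem exactAt_mappingCone {K L : CochainComplex (ModuleCat.{u} A) ℤ} (f : K ⟶ L)
    [QuasiIso f] (n : ℤ) : (CochainComplex.mappingCone f).ExactAt n := by
  refine (acyclic_iff_isZero_Q _).2 ?_ n
  exact Pretriangulated.Triangle.isZero₃_of_isIso₁ _
    (DerivedCategory.mappingCone_triangle_distinguished f)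
    (inferInstanceAs (IsIso (DerivedCategory.Q.map f)))

end ExtVanishing

/-! ### The derived dual and naive duals -/

section Dual
open HomologicalComplex Opposite

variable (R : Type u) [CommRing R]

/-- If `f` is a quasi-isomorphism of bounded above complexes whose terms have no higher extensions
by `R`, then its dual is a quasi-isomorphism. -/
theorem quasiIso_dualComplex_map {K L : CochainComplex (ModuleCat.{u} R) ℤ} (f : K ⟶ L)
    [QuasiIso f] (d : ℤ) [K.IsStrictlyLE d] [L.IsStrictlyLE d]
    (hK : ∀ n, ExtVanishes (K.X n) (ModuleCat.of R R))
    (hL : ∀ n, ExtVanishes (L.X n) (ModuleCat.of R R)) :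
    QuasiIso ((dualComplex R).map f.op) := by
  have : (CochainComplex.mappingCone f).IsStrictlyLE d := by
    rw [CochainComplex.isStrictlyLE_iff]
    intro i hi
    refine (CochainComplex.mappingCone.isZero_X_iff f i).2 ?_
    exact ⟨K.isZero_of_isStrictlyLE d _ (by lia), L.isZero_of_isStrictlyLE d _ (by lia)⟩
  -- A pair (φ, ψ) with these two relations is a cocycle on the cone of f with values in R. The cone
  -- is acyclic with terms without higher extensions, so the pair is a coboundary; φ' and ψ' are the
  -- components of a primitive.
  have key {i j k l : ℤ} (hij : i + 1 = j) (hjk : j + 1 = k) (hkl : k + 1 = l)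
      (φ : K.X k ⟶ ModuleCat.of R R) (ψ : L.X j ⟶ ModuleCat.of R R)
      (h₁ : K.d j k ≫ φ = f.f j ≫ ψ) (h₂ : L.d i j ≫ ψ = 0) :
      ∃ (φ' : K.X l ⟶ ModuleCat.of R R) (ψ' : L.X k ⟶ ModuleCat.of R R),
        φ = f.f k ≫ ψ' - K.d k l ≫ φ' ∧ L.d j k ≫ ψ' = ψ := by
    obtain ⟨χ', hχ'⟩ := exists_d_comp_eq (exactAt_mappingCone f) d
      (ExtVanishes.mappingCone f hK hL) hij hjk
      ((CochainComplex.mappingCone.fst f).1.v j k hjk ≫ φ +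
        (CochainComplex.mappingCone.snd f).v j j (add_zero j) ≫ ψ) (by
          rw [CochainComplex.mappingCone.ext_from_iff f j i hij]
          constructor
          · simp [CochainComplex.mappingCone.inl_v_d_assoc f j i k (by lia) (by lia), h₁]
          · simp [h₂])
    refine ⟨(CochainComplex.mappingCone.inl f).v l k (by lia) ≫ χ',
      (CochainComplex.mappingCone.inr f).f k ≫ χ', ?_, ?_⟩
    · have := congrArg ((CochainComplex.mappingCone.inl f).v k j (by lia) ≫ ·) hχ'
      simpa [CochainComplex.mappingCone.inl_v_d_assoc f k j l (by lia) (by lia)] using this.symm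
    · have := congrArg ((CochainComplex.mappingCone.inr f).f j ≫ ·) hχ'
      simpa using this
  rw [quasiIso_iff]
  intro n
  refine quasiIsoAt_of_elements _ (n - 1) n (n + 1) (by lia) rfl ?_ ?_
  · rintro (ψ : L.X (-n) ⟶ ModuleCat.of R R) (hψ : L.d (-(n + 1)) (-n) ≫ ψ = 0)
      ⟨(φ : K.X (-(n - 1)) ⟶ ModuleCat.of R R),
        (hφ : K.d (-n) (-(n - 1)) ≫ φ = f.f (-n) ≫ ψ)⟩
    obtain ⟨-, ψ', -, h⟩ := key (by lia) (by lia) rfl φ ψ hφ hψ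
    exact ⟨ψ', h⟩
  · rintro (φ : K.X (-n) ⟶ ModuleCat.of R R) (hφ : K.d (-(n + 1)) (-n) ≫ φ = 0)
    -- Surjectivity on cohomology is the case ψ = 0: the cocycle φ is then the restriction of ψ' up
    -- to a coboundary.
    obtain ⟨φ', ψ', h, h'⟩ := key (i := -(n + 1) - 1) (l := -(n - 1)) (by lia) (by lia) (by lia)
      φ (0 : L.X (-(n + 1)) ⟶ ModuleCat.of R R) (by rw [hφ, comp_zero]) comp_zero
    exact ⟨ψ', h', (-φ' : K.X (-(n - 1)) ⟶ ModuleCat.of R R), h.trans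
      ((sub_eq_add_neg _ _).trans (congrArg (_ + ·) (Preadditive.comp_neg _ _).symm))⟩

theorem dualComplex_homotopic {K L : CochainComplex (ModuleCat.{u} R) ℤ} (f g : K ⟶ L)
    (h : homotopic (ModuleCat.{u} R) (.up ℤ) f g) :
    (dualComplex R ⋙ HomotopyCategory.quotient _ _).rightOp.map f =
      (dualComplex R ⋙ HomotopyCategory.quotient _ _).rightOp.map g := by
  obtain ⟨h⟩ := h
  exact congrArg Quiver.Hom.op (HomotopyCategory.eq_of_homotopy _ _
    (Functor.mapHomotopy _ (CochainComplex.homotopyOp h)))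

/-- The functor `P ↦ Hom_R(P, R)` on the homotopy category. -/
noncomputable def dualHomotopy : (HomotopyCategory (ModuleCat.{u} R) (.up ℤ))ᵒᵖ ⥤
    HomotopyCategory (ModuleCat.{u} R) (.up ℤ) :=
  Functor.leftOp (CategoryTheory.Quotient.lift _
    (dualComplex R ⋙ HomotopyCategory.quotient _ _).rightOp
    (fun _ _ f g h => dualComplex_homotopic R f g h))

theorem isIso_Qh_dualHomotopy_map {K L : CochainComplex (ModuleCat.{u} R) ℤ} (f : K ⟶ L)
    (hf : IsIso (DerivedCategory.Qh.map ((HomotopyCategory.quotient _ _).map f)))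
    (hK : ∃ d : ℤ, K.IsStrictlyLE d) (hK' : ∀ n, ExtVanishes (K.X n) (ModuleCat.of R R))
    (hL : ∃ d : ℤ, L.IsStrictlyLE d) (hL' : ∀ n, ExtVanishes (L.X n) (ModuleCat.of R R)) :
    IsIso (DerivedCategory.Qh.map
      ((dualHomotopy R).map ((HomotopyCategory.quotient _ _).map f).op)) := by
  obtain ⟨a, ha⟩ := hK
  obtain ⟨b, hb⟩ := hL
  have : K.IsStrictlyLE (max a b) := K.isStrictlyLE_of_le a _ (by lia)
  have : L.IsStrictlyLE (max a b) := L.isStrictlyLE_of_le b _ (by lia)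
  have : QuasiIso f := (DerivedCategory.isIso_Q_map_iff_quasiIso (ModuleCat.{u} R) f).1
    ((NatIso.isIso_map_iff (DerivedCategory.quotientCompQhIso (ModuleCat.{u} R)) f).1 hf)
  have h := quasiIso_dualComplex_map R f (max a b) hK' hL'
  exact (NatIso.isIso_map_iff (DerivedCategory.quotientCompQhIso (ModuleCat.{u} R)) _).2
    ((DerivedCategory.isIso_Q_map_iff_quasiIso (ModuleCat.{u} R) _).2 h)

/-! ### The derived dual -/

/-- Bounded above complexes of projective modules with bounded and finitely generated cohomology,
as objects of the homotopy category. -/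
def homotopyProjective : ObjectProperty (HomotopyCategory (ModuleCat.{u} R) (.up ℤ)) :=
  fun X => (∃ d : ℤ, CochainComplex.IsStrictlyLE X.as d) ∧
    (∀ n, Module.Projective R (X.as.X n)) ∧ IsBoundedCoherent R (DerivedCategory.Qh.obj X)

variable {R} in
theorem homotopyProjective.Qh_map_bijective (X : (homotopyProjective R).FullSubcategory)
    (Y : HomotopyCategory (ModuleCat.{u} R) (.up ℤ)) :
    Function.Bijective (DerivedCategory.Qh.map : (X.obj ⟶ Y) → _) := by
  obtain ⟨X, ⟨d, hd⟩, h, -⟩ := X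
  have (n : ℤ) : Projective (X.as.X n) := (IsProjective.iff_projective _).1 (h n)
  have := CochainComplex.isKProjective_of_projective X.as d
  exact CochainComplex.IsKProjective.Qh_map_bijective X.as Y

/-- The functor from the homotopy category of bounded above complexes of projective modules to the
derived category. -/
noncomputable def realizeProjective : (homotopyProjective R).FullSubcategory ⥤ DbMod R :=
  (IsBoundedCoherent R).lift ((homotopyProjective R).ι ⋙ DerivedCategory.Qh)
    (fun X => X.property.2.2)

instance : (realizeProjective R).Full where
  map_surjective {X Y} f := by
    obtain ⟨g, hg⟩ := (homotopyProjective.Qh_map_bijective X Y.obj).surjective f.hom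
    exact ⟨ObjectProperty.homMk g, by ext; exact hg⟩

instance : (realizeProjective R).Faithful where
  map_injective {X Y} f g h := by
    ext
    exact (homotopyProjective.Qh_map_bijective X Y.obj).injective (congrArg (·.hom) h)

variable [IsNoetherianRing R]

instance : (realizeProjective R).EssSurj where
  mem_essImage X := by
    obtain ⟨K, hd, hK, ⟨e⟩⟩ := isBoundedCoherent_le_hasBoundedAboveProjective X.obj X.property
    let e' := (DerivedCategory.quotientCompQhIso (ModuleCat.{u} R)).app K ≪≫ e.symm
    exact ⟨⟨(HomotopyCategory.quotient _ _).obj K, hd, hK,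
      (IsBoundedCoherent R).prop_of_iso e'.symm X.property⟩,
      ⟨(IsBoundedCoherent R).isoMk e'⟩⟩

instance : (realizeProjective R).IsEquivalence where

/-- The functor `RHom_R(-, R)` on `D^b(mod R)`. -/
noncomputable def derivedDual : (DbMod R)ᵒᵖ ⥤ DerivedCategory (ModuleCat.{u} R) :=
  ((realizeProjective R).asEquivalence.inverse ⋙ (homotopyProjective R).ι).op ⋙
    dualHomotopy R ⋙ DerivedCategory.Qh

/-- Bounded above complexes of projective modules, as objects of the homotopy category. -/
noncomputable def toHomotopyProjective :
    (IsBoundedAboveProjective R).FullSubcategory ⥤ (homotopyProjective R).FullSubcategory :=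
  (homotopyProjective R).lift
    ((IsBoundedAboveProjective R).ι ⋙ ObjectProperty.ι _ ⋙ HomotopyCategory.quotient _ _)
    (fun K => ⟨K.property.1, K.property.2, (IsBoundedCoherent R).prop_of_iso
      ((DerivedCategory.quotientCompQhIso (ModuleCat.{u} R)).symm.app K.obj.obj) K.obj.property⟩)

/-- Resolutions of bounded above complexes of projective modules are given by themselves. -/
noncomputable def resolveProjectiveIso : (IsBoundedAboveProjective R).ι ⋙ DbMod.ofComplex R ⋙
    (realizeProjective R).asEquivalence.inverse ≅ toHomotopyProjective R :=
  Functor.isoWhiskerRight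
    (NatIso.ofComponents (fun K => (IsBoundedCoherent R).isoMk
        ((DerivedCategory.quotientCompQhIso (ModuleCat.{u} R)).symm.app K.obj.obj)) (fun f => by
      ext
      exact (DerivedCategory.quotientCompQhIso (ModuleCat.{u} R)).inv.naturality f.hom.hom) :
      (IsBoundedAboveProjective R).ι ⋙ DbMod.ofComplex R ≅
        toHomotopyProjective R ⋙ realizeProjective R)
      (realizeProjective R).asEquivalence.inverse ≪≫ Functor.associator _ _ _ ≪≫
    Functor.isoWhiskerLeft _ (realizeProjective R).asEquivalence.unitIso.symm ≪≫
    Functor.rightUnitor _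

theorem isDerivedDual_derivedDual : IsDerivedDual R (derivedDual R) := by
  let α : (((IsBoundedAboveProjective R).ι ⋙ DbMod.ofComplex R).op ⋙ derivedDual R) ≅
      (toHomotopyProjective R ⋙ (homotopyProjective R).ι).op ⋙ dualHomotopy R ⋙
        DerivedCategory.Qh :=
    Functor.isoWhiskerRight
      (NatIso.op (Functor.isoWhiskerRight (resolveProjectiveIso R) (homotopyProjective R).ι)).symm
      (dualHomotopy R ⋙ DerivedCategory.Qh)
  let β : (toHomotopyProjective R ⋙ (homotopyProjective R).ι).op ⋙ dualHomotopy R ⋙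
      DerivedCategory.Qh ≅ ((IsBoundedAboveProjective R).ι ⋙ ObjectProperty.ι _).op ⋙
        dualComplex R ⋙ DerivedCategory.Q :=
    Functor.isoWhiskerLeft (((IsBoundedAboveProjective R).ι ⋙ ObjectProperty.ι _).op ⋙
      dualComplex R) (DerivedCategory.quotientCompQhIso (ModuleCat.{u} R))
  exact ⟨α ≪≫ β⟩

section Comparison

variable (X : HomotopyCategory (ModuleCat.{u} R) (.up ℤ))
  (hX : IsBoundedCoherent R (DerivedCategory.Qh.obj X))

/-- A projective resolution of a complex with bounded and finitely generated cohomology. -/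
noncomputable def projectiveReplacement : (homotopyProjective R).FullSubcategory :=
  (realizeProjective R).asEquivalence.inverse.obj ⟨DerivedCategory.Qh.obj X, hX⟩

/-- The augmentation of a projective resolution. -/
noncomputable def augmentation : (projectiveReplacement R X hX).obj ⟶ X :=
  ((homotopyProjective.Qh_map_bijective (projectiveReplacement R X hX) X).surjective
    ((realizeProjective R).asEquivalence.counitIso.hom.app ⟨DerivedCategory.Qh.obj X, hX⟩).hom).choose

theorem Qh_map_augmentation : DerivedCategory.Qh.map (augmentation R X hX) =
    ((realizeProjective R).asEquivalence.counitIso.hom.app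
      ⟨DerivedCategory.Qh.obj X, hX⟩).hom :=
  ((homotopyProjective.Qh_map_bijective (projectiveReplacement R X hX) X).surjective _).choose_spec

instance isIso_Qh_map_augmentation : IsIso (DerivedCategory.Qh.map (augmentation R X hX)) := by
  rw [Qh_map_augmentation]
  exact ((IsBoundedCoherent R).ι.mapIso ((realizeProjective R).asEquivalence.counitIso.app
    ⟨DerivedCategory.Qh.obj X, hX⟩)).isIso_hom

theorem augmentation_naturality {X Y : HomotopyCategory (ModuleCat.{u} R) (.up ℤ)}
    (hX : IsBoundedCoherent R (DerivedCategory.Qh.obj X))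
    (hY : IsBoundedCoherent R (DerivedCategory.Qh.obj Y)) (f : X ⟶ Y) :
    augmentation R X hX ≫ f = ((realizeProjective R).asEquivalence.inverse.map
      (ObjectProperty.homMk (DerivedCategory.Qh.map f) :
        (⟨DerivedCategory.Qh.obj X, hX⟩ : DbMod R) ⟶ ⟨DerivedCategory.Qh.obj Y, hY⟩)).hom ≫
      augmentation R Y hY := by
  refine (homotopyProjective.Qh_map_bijective (projectiveReplacement R X hX) Y).injective ?_
  have h := congrArg (·.hom) ((realizeProjective R).asEquivalence.counitIso.hom.naturality
    (ObjectProperty.homMk (DerivedCategory.Qh.map f) :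
        (⟨DerivedCategory.Qh.obj X, hX⟩ : DbMod R) ⟶ ⟨DerivedCategory.Qh.obj Y, hY⟩))
  refine (Functor.map_comp _ _ _).trans (Eq.trans ?_ (Functor.map_comp _ _ _).symm)
  exact (congrArg (· ≫ DerivedCategory.Qh.map f) (Qh_map_augmentation R X hX)).trans
    (h.symm.trans (congrArg (DerivedCategory.Qh.map _ ≫ ·) (Qh_map_augmentation R Y hY)).symm)

/-- The comparison between the naive dual of a complex and its derived dual. -/
noncomputable def toDerivedDual : DerivedCategory.Qh.obj ((dualHomotopy R).obj (op X)) ⟶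
    (derivedDual R).obj (op ⟨DerivedCategory.Qh.obj X, hX⟩) :=
  DerivedCategory.Qh.map ((dualHomotopy R).map (augmentation R X hX).op)

theorem toDerivedDual_naturality {X Y : HomotopyCategory (ModuleCat.{u} R) (.up ℤ)}
    (hX : IsBoundedCoherent R (DerivedCategory.Qh.obj X))
    (hY : IsBoundedCoherent R (DerivedCategory.Qh.obj Y)) (f : X ⟶ Y) :
    DerivedCategory.Qh.map ((dualHomotopy R).map f.op) ≫ toDerivedDual R X hX =
      toDerivedDual R Y hY ≫ (derivedDual R).map (ObjectProperty.homMk (DerivedCategory.Qh.map f) :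
        (⟨DerivedCategory.Qh.obj X, hX⟩ : DbMod R) ⟶ ⟨DerivedCategory.Qh.obj Y, hY⟩).op := by
  have h := congrArg (fun g => DerivedCategory.Qh.map ((dualHomotopy R).map g.op))
    (augmentation_naturality R hX hY f)
  have h' {X Y Z : HomotopyCategory (ModuleCat.{u} R) (.up ℤ)} (f : X ⟶ Y) (g : Y ⟶ Z) :
      DerivedCategory.Qh.map ((dualHomotopy R).map (f ≫ g).op) =
        DerivedCategory.Qh.map ((dualHomotopy R).map g.op) ≫
          DerivedCategory.Qh.map ((dualHomotopy R).map f.op) := by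
    rw [op_comp, Functor.map_comp, Functor.map_comp]
  exact (h' _ _).symm.trans (h.trans (h' _ _))

/-- The augmentation of a projective resolution is a quasi-isomorphism of bounded above complexes
whose terms have no higher extensions by R, and dualising preserves such quasi-isomorphisms. -/
theorem isIso_toDerivedDual (K : CochainComplex (ModuleCat.{u} R) ℤ)
    (hK : IsBoundedCoherent R (DerivedCategory.Qh.obj ((HomotopyCategory.quotient _ _).obj K)))
    (d : ℤ) [K.IsStrictlyLE d] (h : ∀ n, ExtVanishes (K.X n) (ModuleCat.of R R)) :
    IsIso (toDerivedDual R ((HomotopyCategory.quotient _ _).obj K) hK) := by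
  have hP := (projectiveReplacement R _ hK).property
  obtain ⟨f, hf⟩ := (HomotopyCategory.quotient (ModuleCat.{u} R) (.up ℤ)).map_surjective
    (X := (projectiveReplacement R _ hK).obj.as) (Y := K) (augmentation R _ hK)
  have := isIso_Qh_dualHomotopy_map R f (by rw [hf]; exact isIso_Qh_map_augmentation R _ hK) hP.1
    (fun n => .of_projective (hP.2.1 n)) ⟨d, inferInstance⟩ h
  rw [hf] at this
  exact this

end Comparison

end Dual
end NCCR

namespace NCCR

/-! ### The Hattori-Stallings trace over a symmetric algebra -/

section Trace

attribute [local instance] restrictedModule restrictedModule_isScalarTower algebraLinear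

variable {R : Type u} [CommRing R] {Λ : Type u} [Ring Λ] [Algebra R Λ]

/-- A finite dual basis of a module. -/
structure DualBasis (V : ModuleCat.{u} Λ) where
  n : ℕ
  x : Fin n → V
  ξ : Fin n → V →ₗ[Λ] Λ
  sum_eq (v : V) : ∑ i, ξ i v • x i = v

theorem nonempty_dualBasis (V : ModuleCat.{u} Λ) [Module.Finite Λ V] [Module.Projective Λ V] :
    Nonempty (DualBasis V) := by
  obtain ⟨n, f, g, -, -, h⟩ := Module.Finite.exists_comp_eq_id_of_projective Λ V
  refine ⟨⟨n, fun i => f (Pi.single i 1), fun i => LinearMap.proj i ∘ₗ g, fun v => ?_⟩⟩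
  refine Eq.trans ?_ (LinearMap.congr_fun h v)
  conv_rhs => rw [LinearMap.comp_apply, ← Finset.univ_sum_single (g v), map_sum]
  refine Finset.sum_congr rfl fun i _ => ?_
  rw [← map_smul, ← Pi.single_smul, smul_eq_mul, mul_one]
  rfl

/-- The morphism `v ↦ ξ(v) y`. -/
def rankOne {V W : ModuleCat.{u} Λ} (ξ : V →ₗ[Λ] Λ) (y : W) : V ⟶ W :=
  ModuleCat.ofHom (LinearMap.toSpanSingleton Λ W y ∘ₗ ξ)

theorem rankOne_apply {V W : ModuleCat.{u} Λ} (ξ : V →ₗ[Λ] Λ) (y : W) (v : V) :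
    (rankOne ξ y).hom v = ξ v • y := rfl

theorem rankOne_comp {V W W' : ModuleCat.{u} Λ} (ξ : V →ₗ[Λ] Λ) (y : W) (f : W ⟶ W') :
    rankOne ξ y ≫ f = rankOne ξ (f.hom y) := by
  ext v
  exact map_smul f.hom _ _

theorem hom_smul_apply {V W : ModuleCat.{u} Λ} (r : R) (f : V ⟶ W) (v : V) :
    (r • f).hom v = algebraMap R Λ r • f.hom v := rfl

namespace DualBasis

variable {V W : ModuleCat.{u} Λ} (D : DualBasis V) (E : DualBasis W)

theorem eq_sum_rankOne (f : V ⟶ W) : f = ∑ i, rankOne (D.ξ i) (f.hom (D.x i)) := by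
  ext v
  conv_lhs => rw [← D.sum_eq v, map_sum]
  rw [ModuleCat.hom_sum, LinearMap.sum_apply]
  exact Finset.sum_congr rfl fun i _ => map_smul f.hom _ _

variable (tr : Λ →ₗ[R] R)

/-- The Hattori-Stallings trace. -/
def trace : (V ⟶ V) →ₗ[R] R where
  toFun f := ∑ i, tr (D.ξ i (f.hom (D.x i)))
  map_add' f g := by
    rw [← Finset.sum_add_distrib]
    refine Finset.sum_congr rfl fun i _ => ?_
    rw [← map_add, ← map_add]
    rfl
  map_smul' r f := by
    rw [RingHom.id_apply, Finset.smul_sum]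
    refine Finset.sum_congr rfl fun i _ => ?_
    rw [hom_smul_apply, map_smul, smul_eq_mul, ← Algebra.smul_def, map_smul]

theorem trace_apply (f : V ⟶ V) : D.trace tr f = ∑ i, tr (D.ξ i (f.hom (D.x i))) := rfl

variable {tr} (htr : ∀ x y, tr (x * y) = tr (y * x))
include htr

/-- Expanding v in the dual basis produces the same products in the opposite order, so symmetry of
`tr` is exactly what is needed. -/
theorem trace_rankOne (ξ : V →ₗ[Λ] Λ) (v : V) : D.trace tr (rankOne ξ v) = tr (ξ v) := by
  conv_rhs => rw [← D.sum_eq v, map_sum, map_sum]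
  rw [trace_apply]
  refine Finset.sum_congr rfl fun i _ => ?_
  rw [rankOne_apply, map_smul (D.ξ i), map_smul ξ, smul_eq_mul, smul_eq_mul, htr]

/-- Writing f as a sum of rank one maps reduces to `trace_rankOne` on either side. With f an
identity it shows that the trace does not depend on the dual basis. -/
theorem trace_comp (f : V ⟶ W) (g : W ⟶ V) : D.trace tr (f ≫ g) = E.trace tr (g ≫ f) := by
  conv_lhs => rw [D.eq_sum_rankOne f, Preadditive.sum_comp, map_sum]
  conv_rhs => rw [D.eq_sum_rankOne f, Preadditive.comp_sum, map_sum]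
  refine Finset.sum_congr rfl fun i _ => ?_
  rw [rankOne_comp, trace_rankOne _ htr]
  exact (trace_rankOne E htr (D.ξ i ∘ₗ g.hom) (f.hom (D.x i))).symm

/-- Tested against the rank one maps built from ξ_i and yw, the hypothesis says that tr(ξ_i(g w) y)
vanishes for all y, so every coordinate of g(w) is zero. -/
theorem trace_nondegenerate (hinj : ∀ x, (∀ y, tr (x * y) = 0) → x = 0) (g : W ⟶ V)
    (h : ∀ f : V ⟶ W, D.trace tr (f ≫ g) = 0) : g = 0 := by
  ext w
  rw [← D.sum_eq (g.hom w)]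
  refine Finset.sum_eq_zero fun i _ => ?_
  rw [hinj (D.ξ i (g.hom w)) fun y => ?_, zero_smul]
  have := h (rankOne (D.ξ i) (y • w))
  rw [rankOne_comp, trace_rankOne _ htr, map_smul, map_smul, smul_eq_mul, htr] at this
  exact this

/-- For each basis functional ξ_i and each w, evaluating φ on v ↦ ξ_i(v)yw is a functional of y in
Λ, hence equals tr(a_i(w)y). Uniqueness of a_i(w) makes it Λ-linear in w, and g(w) = Σ a_i(w)x_i is
the required map. -/
theorem exists_trace_eq (hinj : ∀ x, (∀ y, tr (x * y) = 0) → x = 0)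
    (hsurj : ∀ φ : Λ →ₗ[R] R, ∃ x, ∀ y, tr (x * y) = φ y) (φ : (V ⟶ W) →ₗ[R] R) :
    ∃ g : W ⟶ V, ∀ f : V ⟶ W, D.trace tr (f ≫ g) = φ f := by
  have hadd (ξ : V →ₗ[Λ] Λ) (w w' : W) : rankOne ξ (w + w') = rankOne ξ w + rankOne ξ w' := by
    ext v
    exact smul_add _ _ _
  have h (i : Fin D.n) (w : W) : ∃ x, ∀ y, tr (x * y) = φ (rankOne (D.ξ i) (y • w)) :=
    hsurj
      { toFun y := φ (rankOne (D.ξ i) (y • w))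
        map_add' y y' := by rw [add_smul, hadd, map_add]
        map_smul' r y := by
          rw [RingHom.id_apply, ← map_smul]
          congr 1
          ext v
          rw [hom_smul_apply, rankOne_apply, rankOne_apply, Algebra.smul_def, smul_smul, smul_smul,
            smul_smul, ← mul_assoc, ← Algebra.commutes] }
  choose a ha using h
  have hu (x x' : Λ) (h : ∀ y, tr (x * y) = tr (x' * y)) : x = x' :=
    sub_eq_zero.1 (hinj _ fun y => by rw [sub_mul, map_sub, h, sub_self])
  let a' (i : Fin D.n) : W →ₗ[Λ] Λ :=
    { toFun := a i
      map_add' w w' := hu _ _ fun y => by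
        rw [ha, smul_add, hadd, map_add, add_mul, map_add, ha, ha]
      map_smul' c w := hu _ _ fun y => by
        rw [ha, smul_smul, ← ha, ← mul_assoc, htr, RingHom.id_apply, smul_eq_mul, mul_assoc] }
  refine ⟨ModuleCat.ofHom (∑ k, LinearMap.toSpanSingleton Λ V (D.x k) ∘ₗ a' k), fun f => ?_⟩
  have hg (w : W) : (∑ k, LinearMap.toSpanSingleton Λ V (D.x k) ∘ₗ a' k) w =
      ∑ k, a' k w • D.x k := by
    rw [LinearMap.sum_apply]
    rfl
  have h₁ : φ f = ∑ k, tr (a' k (f.hom (D.x k))) := by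
    conv_lhs => rw [D.eq_sum_rankOne f, map_sum]
    refine Finset.sum_congr rfl fun i _ => ?_
    have := ha i (f.hom (D.x i)) 1
    rw [mul_one, one_smul] at this
    exact this.symm
  rw [h₁, trace_apply]
  have h₂ (i : Fin D.n) : tr (D.ξ i ((f ≫ ModuleCat.ofHom (∑ k,
      LinearMap.toSpanSingleton Λ V (D.x k) ∘ₗ a' k)).hom (D.x i))) =
      ∑ k, tr (D.ξ i (D.x k) * a' k (f.hom (D.x i))) := by
    have : (f ≫ ModuleCat.ofHom (∑ k, LinearMap.toSpanSingleton Λ V (D.x k) ∘ₗ a' k)).hom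
      (D.x i) = ∑ k, a' k (f.hom (D.x i)) • D.x k := hg _
    rw [this, map_sum, map_sum]
    refine Finset.sum_congr rfl fun k _ => ?_
    rw [map_smul, smul_eq_mul, htr]
  rw [Finset.sum_congr rfl fun i _ => h₂ i, Finset.sum_comm]
  refine Finset.sum_congr rfl fun k _ => ?_
  rw [← map_sum]
  congr 1
  conv_rhs => rw [← D.sum_eq (D.x k), map_sum, map_sum]
  exact Finset.sum_congr rfl fun i _ => by rw [map_smul, map_smul, smul_eq_mul]

end DualBasis

section ExtVanishing
open Abelian

theorem ExtVanishes.of_sum {A : Type u} [Ring A] {X Y : ModuleCat.{u} A} {ι : Type*}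
    (s : Finset ι) (Z : ι → ModuleCat.{u} A) (f : ∀ i, X ⟶ Z i) (g : ∀ i, Z i ⟶ X)
    (h : ∑ i ∈ s, f i ≫ g i = 𝟙 X) (hZ : ∀ i, ExtVanishes (Z i) Y) : ExtVanishes X Y := by
  intro n hn
  refine subsingleton_of_forall_eq 0 fun x => ?_
  let c : (X ⟶ X) →+ Ext X Y n :=
    { toFun f := (Ext.mk₀ f).comp x (zero_add n)
      map_zero' := by rw [Ext.mk₀_zero, Ext.zero_comp]
      map_add' f g := by rw [Ext.mk₀_add, Ext.add_comp] }
  have hc : c (𝟙 X) = 0 := by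
    rw [← h, map_sum]
    refine Finset.sum_eq_zero fun i _ => ?_
    have := hZ i n hn
    have h0 : (Ext.mk₀ (f i)).comp ((Ext.mk₀ (g i)).comp x (zero_add n)) (zero_add n) = 0 := by
      rw [Subsingleton.elim ((Ext.mk₀ (g i)).comp x (zero_add n)) 0, Ext.comp_zero]
    rw [Ext.mk₀_comp_mk₀_assoc] at h0
    exact h0
  exact (Ext.mk₀_id_comp x).symm.trans hc

/-- Two dual bases exhibit the Hom module as an R-linear summand of a finite power of Λ. -/
theorem ExtVanishes.hom {V W : ModuleCat.{u} Λ} (D : DualBasis V) (E : DualBasis W)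
    {Y : ModuleCat.{u} R} (h : ExtVanishes (ModuleCat.of R Λ) Y) :
    ExtVanishes (ModuleCat.of R (V ⟶ W)) Y := by
  refine .of_sum (Finset.univ ×ˢ Finset.univ) (fun _ => ModuleCat.of R Λ)
    (fun p : Fin D.n × Fin E.n => ModuleCat.ofHom
      { toFun (f : V ⟶ W) := E.ξ p.2 (f.hom (D.x p.1))
        map_add' f g := map_add _ _ _
        map_smul' r f := by
          rw [hom_smul_apply, map_smul, smul_eq_mul, RingHom.id_apply, Algebra.smul_def] })
    (fun p => ModuleCat.ofHom
      { toFun c := (rankOne (D.ξ p.1) (c • E.x p.2) : V ⟶ W)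
        map_add' c c' := by
          ext v
          change D.ξ p.1 v • ((c + c') • E.x p.2) =
            D.ξ p.1 v • (c • E.x p.2) + D.ξ p.1 v • (c' • E.x p.2)
          rw [add_smul, smul_add]
        map_smul' r c := by
          ext v
          rw [RingHom.id_apply, hom_smul_apply, rankOne_apply, rankOne_apply, Algebra.smul_def,
            smul_smul, smul_smul, smul_smul, ← mul_assoc, ← Algebra.commutes] }) ?_ (fun _ => h)
  ext f : 2
  rw [ModuleCat.hom_sum, LinearMap.sum_apply, Finset.sum_product]
  refine Eq.trans (Finset.sum_congr rfl fun i _ => ?_) (D.eq_sum_rankOne f).symm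
  conv_rhs => rw [← E.sum_eq (f.hom (D.x i))]
  ext v
  refine Eq.trans ?_ (Finset.smul_sum (r := D.ξ i v)).symm
  refine (congrArg (fun z : V →ₗ[Λ] W => z v) (ModuleCat.hom_sum _ _)).trans ?_
  rw [LinearMap.sum_apply]
  rfl

end ExtVanishing
end Trace
end NCCR

namespace NCCR

/-! ### Supertraces of cochains -/

section Cochains
open CochainComplex.HomComplex

attribute [local instance] restrictedModule restrictedModule_isScalarTower algebraLinear

variable (R : Type u) [CommRing R] {Λ : Type u} [Ring Λ] [Algebra R Λ]
  {P Q : CochainComplex (ModuleCat.{u} Λ) ℤ}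

/-- A component of a cochain, as a linear map. -/
def componentLinear (n p q : ℤ) (h : p + n = q) : Cochain P Q n →ₗ[R] (P.X p ⟶ Q.X q) where
  toFun z := z.v p q h
  map_add' _ _ := rfl
  map_smul' _ _ := rfl

/-- The cochain with a single component, as a linear map. -/
noncomputable def singleLinear (n p q : ℤ) (h : p + n = q) :
    (P.X p ⟶ Q.X q) →ₗ[R] Cochain P Q n where
  toFun f := Cochain.single f n
  map_add' f g := Cochain.ext _ _ fun p' q' h' => by
    rw [Cochain.add_v]
    by_cases hp : p' = p
    · subst hp
      subst h
      subst h'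
      rw [Cochain.single_v, Cochain.single_v, Cochain.single_v]
    · rw [Cochain.single_v_eq_zero _ _ _ _ _ hp, Cochain.single_v_eq_zero _ _ _ _ _ hp,
        Cochain.single_v_eq_zero _ _ _ _ _ hp, add_zero]
  map_smul' r f := Cochain.ext _ _ fun p' q' h' => by
    rw [RingHom.id_apply, Cochain.smul_v]
    by_cases hp : p' = p
    · subst hp
      subst h
      subst h'
      rw [Cochain.single_v, Cochain.single_v]
    · rw [Cochain.single_v_eq_zero _ _ _ _ _ hp, Cochain.single_v_eq_zero _ _ _ _ _ hp, smul_zero]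

theorem sum_single (a b : ℤ) [P.IsStrictlyGE a] [P.IsStrictlyLE b] (n : ℤ) (z : Cochain P Q n) :
    ∑ p ∈ Finset.Icc a b, singleLinear R n p (p + n) rfl (componentLinear R n p (p + n) rfl z) =
      z := by
  refine Cochain.ext _ _ fun p q h => ?_
  subst h
  have h (s : Finset ℤ) (w : ℤ → Cochain P Q n) : (∑ i ∈ s, w i).v p (p + n) rfl =
      ∑ i ∈ s, (w i).v p (p + n) rfl := by
    induction s using Finset.induction_on with
    | empty => rw [Finset.sum_empty, Finset.sum_empty, Cochain.zero_v]
    | insert i s hi ih => rw [Finset.sum_insert hi, Finset.sum_insert hi, Cochain.add_v, ih]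
  rw [h]
  by_cases hp : p ∈ Finset.Icc a b
  · refine (Finset.sum_eq_single_of_mem p hp fun p' _ hp' => ?_).trans ?_
    · exact Cochain.single_v_eq_zero _ _ _ _ _ hp'.symm
    · exact Cochain.single_v _ _ _
  · refine IsZero.eq_of_src ?_ _ _
    rw [Finset.mem_Icc, not_and_or, not_le, not_le] at hp
    rcases hp with hp | hp
    · exact P.isZero_of_isStrictlyGE a p hp
    · exact P.isZero_of_isStrictlyLE b p hp

theorem homComplex_isStrictlyLE (a b : ℤ) [P.IsStrictlyGE a] [Q.IsStrictlyLE b] :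
    (homComplex R P Q).IsStrictlyLE (b - a) := by
  rw [CochainComplex.isStrictlyLE_iff]
  intro n hn
  have : Subsingleton (Cochain P Q n) := subsingleton_of_forall_eq 0 fun z =>
    Cochain.ext _ _ fun p q h => by
      by_cases hp : p < a
      · exact (P.isZero_of_isStrictlyGE a p hp).eq_of_src _ _
      · exact (Q.isZero_of_isStrictlyLE b q (by lia)).eq_of_tgt _ _
  exact ModuleCat.isZero_of_subsingleton (ModuleCat.of R (Cochain P Q n))

/-- A dual basis of a term of a strictly perfect complex. -/
noncomputable def IsStrictlyPerfect.dualBasis (hP : IsStrictlyPerfect Λ P) (n : ℤ) :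
    DualBasis (P.X n) :=
  have := (hP.1 n).1
  have := (hP.1 n).2
  (nonempty_dualBasis (P.X n)).some

/-- Each term is a finite direct sum of Hom modules between finite projectives, hence an R-summand
of a power of Λ. -/
theorem extVanishes_homComplex (hP : IsStrictlyPerfect Λ P) (hQ : IsStrictlyPerfect Λ Q)
    {Y : ModuleCat.{u} R} (h : ExtVanishes (ModuleCat.of R Λ) Y) (n : ℤ) :
    ExtVanishes ((homComplex R P Q).X n) Y := by
  obtain ⟨a, _⟩ := hP.2.1
  obtain ⟨b, _⟩ := hP.2.2
  have h' : ExtVanishes (ModuleCat.of R (Cochain P Q n)) Y := by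
    refine .of_sum (Finset.Icc a b) (fun p => ModuleCat.of R (P.X p ⟶ Q.X (p + n)))
      (fun p => ModuleCat.ofHom (componentLinear R n p (p + n) rfl))
      (fun p => ModuleCat.ofHom (singleLinear R n p (p + n) rfl)) ?_
      (fun p => .hom (hP.dualBasis p) (hQ.dualBasis (p + n)) h)
    ext z : 2
    rw [ModuleCat.hom_sum, LinearMap.sum_apply]
    exact sum_single R a b n z
  exact h'

variable {R}
variable (tr : Λ →ₗ[R] R) (hP : IsStrictlyPerfect Λ P) (hQ : IsStrictlyPerfect Λ Q)

include hP in
theorem IsStrictlyPerfect.hasFiniteSupport {A : Type*} [Zero A] (c : ℤ → A)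
    (hc : ∀ p, IsZero (P.X p) → c p = 0) : (Function.support c).Finite := by
  obtain ⟨-, ⟨a, _⟩, ⟨b, _⟩⟩ := hP
  refine (Finset.Icc a b).finite_toSet.subset fun p hp => ?_
  rw [Finset.mem_coe]
  by_contra h
  rw [Finset.mem_Icc, not_and_or, not_le, not_le] at h
  refine hp (hc p ?_)
  rcases h with h | h
  · exact P.isZero_of_isStrictlyGE a p h
  · exact P.isZero_of_isStrictlyLE b p h

theorem IsStrictlyPerfect.finite_support_trace (c : ℤ → ℤˣ) (f : ∀ p, P.X p ⟶ P.X p) :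
    (Function.support fun p => c p • (hP.dualBasis p).trace tr (f p)).Finite :=
  hP.hasFiniteSupport _ fun p hp => by rw [hp.eq_of_src (f p) 0, map_zero, smul_zero]

/-- The supertrace of an endomorphism of degree zero of a strictly perfect complex. -/
noncomputable def superTrace : Cochain P P 0 →ₗ[R] R where
  toFun z := ∑ᶠ p : ℤ, p.negOnePow • (hP.dualBasis p).trace tr (z.v p p (add_zero p))
  map_add' z w := by
    rw [← finsum_add_distrib (hP.finite_support_trace tr _ _) (hP.finite_support_trace tr _ _)]
    refine finsum_congr fun p => ?_
    rw [Cochain.add_v, map_add, smul_add]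
  map_smul' r z := by
    rw [RingHom.id_apply, smul_finsum' _ (hP.finite_support_trace tr _ _)]
    refine finsum_congr fun p => ?_
    rw [Cochain.smul_v, map_smul, smul_comm]

theorem superTrace_apply (z : Cochain P P 0) : superTrace tr hP z =
    ∑ᶠ p : ℤ, p.negOnePow • (hP.dualBasis p).trace tr (z.v p p (add_zero p)) := rfl

variable {tr} (htr : ∀ x y, tr (x * y) = tr (y * x))
include htr

/-- Cyclicity of the trace in each degree, after reindexing by p ↦ p + m; the change from (-1)^{p+m}
to (-1)^p is the sign in the formula. -/
theorem superTrace_comp {m n : ℤ} (z : Cochain P Q m) (w : Cochain Q P n) (h : m + n = 0)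
    (h' : n + m = 0) : superTrace tr hQ (w.comp z h') =
      m.negOnePow • superTrace tr hP (z.comp w h) := by
  rw [superTrace_apply, superTrace_apply, smul_finsum' _ (hP.finite_support_trace tr _ _),
    ← finsum_comp_equiv (Equiv.addRight m)]
  refine finsum_congr fun p => ?_
  rw [Equiv.coe_addRight, Cochain.comp_v w z h' (p + m) p (p + m) (by lia) rfl,
    Cochain.comp_v z w h p (p + m) p rfl (by lia), smul_smul, ← Int.negOnePow_add, add_comm m p,
    DualBasis.trace_comp (hQ.dualBasis (p + m)) (hP.dualBasis p) htr]

/-- The sum telescopes. With c(p) the signed trace of d followed by z from degree p to p, cyclicity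
makes the p-th term c(p) - c(p-1), and the support is finite. -/
theorem superTrace_δ (z : Cochain P P (-1)) : superTrace tr hP (δ (-1) 0 z) = 0 := by
  let c (p : ℤ) : R := p.negOnePow • (hP.dualBasis p).trace tr
    (P.d p (p + 1) ≫ z.v (p + 1) p (by lia))
  have hc (p : ℤ) : p.negOnePow • (hP.dualBasis p).trace tr ((δ (-1) 0 z).v p p (add_zero p)) =
      c p + -(c (p - 1)) := by
    obtain ⟨q, rfl⟩ : ∃ q, p = q + 1 := ⟨p - 1, by lia⟩
    rw [δ_v (-1) 0 (by lia) z (q + 1) (q + 1) (add_zero _) q (q + 1 + 1) (by lia) rfl, map_add,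
      DualBasis.trace_comp (hP.dualBasis (q + 1)) (hP.dualBasis q) htr, Int.negOnePow_zero,
      one_smul, smul_add, add_comm]
    have h : q + 1 - 1 = q := by lia
    simp only [h, c, Int.negOnePow_succ, Units.neg_smul]
  rw [superTrace_apply, finsum_congr hc, finsum_add_distrib (hP.finite_support_trace tr _ _),
    finsum_neg_distrib]
  · exact (congrArg (fun x => finsum c + -x)
      (finsum_comp_equiv (Equiv.subRight (1 : ℤ)) (f := c))).trans (add_neg_cancel _)
  refine hP.hasFiniteSupport _ fun p hp => ?_
  have := hc p
  rw [hp.eq_of_src ((δ (-1) 0 z).v p p (add_zero p)) 0, map_zero, smul_zero] at this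
  rw [← add_right_inj (c p), ← this, add_zero]
  have h' : P.d p (p + 1) ≫ z.v (p + 1) p (by lia) = 0 := hp.eq_of_src _ _
  simp only [c, h', map_zero, smul_zero]

/-- The sign in the duality between `Hom(P, Q)` and `Hom(Q, P)`. -/
def dualitySign (n : ℤ) : ℤˣ := (n * (n + 1) / 2).negOnePow

-- This recursion explains the exponent n(n+1)/2: it absorbs the sign of the Leibniz rule, so that
-- the pairing is compatible with the sign-free differential of `dualComplex`.
omit htr in
theorem dualitySign_succ (n : ℤ) : dualitySign (n + 1) = (n + 1).negOnePow * dualitySign n := by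
  rw [dualitySign, dualitySign, ← Int.negOnePow_add]
  congr 1
  have : (n + 1) * (n + 1 + 1) = n * (n + 1) + (n + 1) * 2 := by ring
  rw [this, Int.add_mul_ediv_right _ _ two_ne_zero, add_comm]

theorem superTrace_comp_δ {n : ℤ} (g : Cochain Q P n) (f : Cochain P Q (-(n + 1))) :
    dualitySign n • superTrace tr hP ((δ (-(n + 1)) (-n) f).comp g (neg_add_cancel n)) =
      dualitySign (n + 1) • superTrace tr hP (f.comp (δ n (n + 1) g) (neg_add_cancel (n + 1))) := by
  have h := superTrace_δ hP htr (f.comp g (show -(n + 1) + n = -1 by lia))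
  rw [δ_comp f g (show -(n + 1) + n = -1 by lia) (-n) (n + 1) 0 (by lia) (by lia) rfl, map_add,
    Units.smul_def, map_zsmul, ← Units.smul_def, add_eq_zero_iff_eq_neg] at h
  rw [h, dualitySign_succ, Int.negOnePow_succ, smul_neg, smul_smul, neg_mul, neg_mul,
    Units.neg_smul, neg_neg, mul_comm n.negOnePow, mul_assoc, Int.units_mul_self, mul_one]

end Cochains

/-! ### Perfect pairing between Hom(P, Q) and Hom(Q, P) -/

section Duality
open CochainComplex.HomComplex Opposite

attribute [local instance] restrictedModule restrictedModule_isScalarTower algebraLinear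

variable {R : Type u} [CommRing R] {Λ : Type u} [Ring Λ] [Algebra R Λ]
  {P Q : CochainComplex (ModuleCat.{u} Λ) ℤ}
  {tr : Λ →ₗ[R] R} (htr : ∀ x y, tr (x * y) = tr (y * x)) (hP : IsStrictlyPerfect Λ P)

variable (tr) in
/-- The pairing between `Hom(Q, P)` and `Hom(P, Q)`. -/
noncomputable def dualityPairing (n : ℤ) :
    Cochain Q P n →ₗ[R] (ModuleCat.of R (Cochain P Q (-n)) ⟶ ModuleCat.of R R) where
  toFun g := ModuleCat.ofHom
    { toFun f := dualitySign n • superTrace tr hP (f.comp g (neg_add_cancel n))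
      map_add' f f' := by rw [Cochain.add_comp, map_add, smul_add]
      map_smul' r f := by rw [Cochain.smul_comp, map_smul, smul_comm, RingHom.id_apply] }
  map_add' g g' := by
    ext f
    change dualitySign n • superTrace tr hP (Cochain.comp f (g + g') _) = _
    rw [Cochain.comp_add, map_add, smul_add]
    rfl
  map_smul' r g := by
    ext f
    change dualitySign n • superTrace tr hP (Cochain.comp f (r • g) _) = _
    rw [Cochain.comp_smul, map_smul, smul_comm]
    rfl

theorem dualityPairing_apply (n : ℤ) (g : Cochain Q P n) (f : Cochain P Q (-n)) :
    (dualityPairing tr hP n g).hom f =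
      dualitySign n • superTrace tr hP (f.comp g (neg_add_cancel n)) := rfl

theorem superTrace_single_comp {n p q : ℤ} (h : p + -n = q) (g : Cochain Q P n)
    (f : P.X p ⟶ Q.X q) :
    superTrace tr hP ((Cochain.single f (-n)).comp g (neg_add_cancel n)) =
      p.negOnePow • (hP.dualBasis p).trace tr (f ≫ g.v q p (by lia)) := by
  subst h
  rw [superTrace_apply, finsum_eq_single _ p]
  · rw [Cochain.comp_v _ g (neg_add_cancel n) p (p + -n) p rfl (by lia), Cochain.single_v]
  · intro p' hp'
    rw [Cochain.comp_v _ g (neg_add_cancel n) p' (p' + -n) p' rfl (by lia),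
      Cochain.single_v_eq_zero _ _ _ _ _ hp', zero_comp, map_zero, smul_zero]

include htr

/-- Both halves are componentwise statements about the Hattori-Stallings trace. Boundedness of `P`
lets a functional be recovered from its finitely many components. -/
theorem dualityPairing_bijective (hinj : ∀ x, (∀ y, tr (x * y) = 0) → x = 0)
    (hsurj : ∀ φ : Λ →ₗ[R] R, ∃ x, ∀ y, tr (x * y) = φ y) (n : ℤ) :
    Function.Bijective (dualityPairing (Q := Q) tr hP n) := by
  constructor
  · refine (injective_iff_map_eq_zero _).2 fun g hg => Cochain.ext _ _ fun q p h => ?_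
    have hqp : p + -n = q := by lia
    refine (hP.dualBasis p).trace_nondegenerate htr hinj _ fun f => ?_
    have h₁ : (dualityPairing tr hP n g).hom (Cochain.single f (-n)) = 0 := by rw [hg]; rfl
    rw [dualityPairing_apply, superTrace_single_comp hP hqp, smul_smul, smul_eq_zero_iff_eq] at h₁
    exact h₁
  · intro φ
    -- The scalar is ±1 and undoes the sign with which the component enters the pairing.
    have h (p q : ℤ) (hpq : p + -n = q) : ∃ g : Q.X q ⟶ P.X p, ∀ f : P.X p ⟶ Q.X q,
        (hP.dualBasis p).trace tr (f ≫ g) =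
          (dualitySign n * p.negOnePow) • φ.hom (Cochain.single f (-n)) :=
      (hP.dualBasis p).exists_trace_eq htr hinj hsurj
        ((dualitySign n * p.negOnePow) • φ.hom ∘ₗ singleLinear R (-n) p q hpq)
    choose g hg using h
    refine ⟨Cochain.mk fun q p hqp => g p q (by lia), ?_⟩
    obtain ⟨a, _⟩ := hP.2.1
    obtain ⟨b, _⟩ := hP.2.2
    ext f
    have hf := sum_single R a b (-n) (f : Cochain P Q (-n))
    refine (congrArg _ hf.symm).trans (Eq.trans ?_ (congrArg φ.hom hf))
    rw [map_sum, map_sum]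
    refine Finset.sum_congr rfl fun p _ => ?_
    refine (dualityPairing_apply hP n _ _).trans ?_
    refine (congrArg _ (superTrace_single_comp hP rfl _ _)).trans ?_
    rw [Cochain.mk_v, hg, smul_smul, smul_smul, mul_mul_mul_comm, mul_comm p.negOnePow,
      Int.units_mul_self, one_mul, Int.units_mul_self, one_smul]
    rfl

/-- The duality between `Hom(P, Q)` and `Hom(Q, P)`. -/
noncomputable def dualityHom (Q : CochainComplex (ModuleCat.{u} Λ) ℤ) :
    homComplex R Q P ⟶ (dualComplex R).obj (op (homComplex R P Q)) where
  f n := ModuleCat.ofHom (dualityPairing tr hP n)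
  comm' n m h := by
    obtain rfl : n + 1 = m := h
    ext g : 2
    refine ModuleCat.hom_ext (LinearMap.ext fun f => ?_)
    exact superTrace_comp_δ hP htr g f

theorem isIso_dualityHom (hinj : ∀ x, (∀ y, tr (x * y) = 0) → x = 0)
    (hsurj : ∀ φ : Λ →ₗ[R] R, ∃ x, ∀ y, tr (x * y) = φ y)
    (Q : CochainComplex (ModuleCat.{u} Λ) ℤ) : IsIso (dualityHom htr hP Q) := by
  have (n : ℤ) : IsIso ((dualityHom htr hP Q).f n) :=
    (ConcreteCategory.isIso_iff_bijective _).2 (dualityPairing_bijective htr hP hinj hsurj n)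
  exact HomologicalComplex.Hom.isIso_of_components _

theorem dualityHom_naturality_right {Q' : CochainComplex (ModuleCat.{u} Λ) ℤ} (v : Q ⟶ Q') :
    dualityHom htr hP Q' ≫ (dualComplex R).map ((homFunctor R P).map v).op =
      (homFunctorMap v).app P ≫ dualityHom htr hP Q := by
  ext n g : 3
  refine ModuleCat.hom_ext (LinearMap.ext fun (f : Cochain P Q (-n)) => ?_)
  refine (dualityPairing_apply hP n (g : Cochain Q' P n)
    (f.comp (Cochain.ofHom v) (add_zero _))).trans ?_
  refine (congrArg (fun z => dualitySign n • superTrace tr hP z) ?_).trans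
    (dualityPairing_apply hP n ((Cochain.ofHom v).comp (g : Cochain Q' P n) (zero_add n)) f).symm
  exact Cochain.comp_assoc_of_second_is_zero_cochain _ _ _ _

/-- One side is a supertrace over P', the other over P; they agree because a chain map has degree 0
and may be moved cyclically without sign. -/
theorem dualityHom_naturality_left {P' : CochainComplex (ModuleCat.{u} Λ) ℤ}
    (hP' : IsStrictlyPerfect Λ P') (w : P' ⟶ P) :
    dualityHom htr hP' Q ≫ (dualComplex R).map ((homFunctorMap w).app Q).op =
      (homFunctor R Q).map w ≫ dualityHom htr hP Q := by
  ext n g : 3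
  refine ModuleCat.hom_ext (LinearMap.ext fun (f : Cochain P Q (-n)) => ?_)
  refine (dualityPairing_apply hP' n (g : Cochain Q P' n)
    ((Cochain.ofHom w).comp f (zero_add _))).trans ?_
  refine (congrArg (fun z => dualitySign n • z) ?_).trans
    (dualityPairing_apply hP n ((g : Cochain Q P' n).comp (Cochain.ofHom w) (add_zero n)) f).symm
  have h := superTrace_comp hP' hP htr (Cochain.ofHom w)
    (f.comp (g : Cochain Q P' n) (neg_add_cancel n)) (zero_add 0) (add_zero 0)
  rw [Int.negOnePow_zero, one_smul] at h
  refine Eq.trans (congrArg _ ?_) (h.symm.trans (congrArg _ ?_))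
  · exact Cochain.comp_assoc_of_first_is_zero_cochain _ _ _ _
  · exact Cochain.comp_assoc_of_third_is_zero_cochain _ _ _ _

end Duality
end NCCR

namespace NCCR

/-! ### Relative Serre duality -/

section SerreSquare
open Opposite

variable {R : Type u} [CommRing R] [IsNoetherianRing R]

theorem comp_eq_comp_of_comm {C : Type*} [Category* C] {X X' Y Y' Z W : C} {s : X ⟶ Y} {t : Y ⟶ Z}
    {F : Z ⟶ W} {d : Y ⟶ Y'} {t' : Y' ⟶ W} {β : X ⟶ X'} {s' : X' ⟶ Y'} (h₁ : s ≫ d = β ≫ s')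
    (h₂ : d ≫ t' = t ≫ F) : (s ≫ t) ≫ F = β ≫ s' ≫ t' := by
  rw [Category.assoc, ← h₂, ← Category.assoc, h₁, Category.assoc]

/-- A morphism to the dual of a complex, viewed as a morphism to its derived dual. -/
noncomputable def liftDerivedDual {K N : CochainComplex (ModuleCat.{u} R) ℤ}
    (s : K ⟶ (dualComplex R).obj (op N))
    (hN : IsBoundedCoherent R (DerivedCategory.Qh.obj ((HomotopyCategory.quotient _ _).obj N))) :
    DerivedCategory.Qh.obj ((HomotopyCategory.quotient _ _).obj K) ⟶ (derivedDual R).obj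
      (op ⟨DerivedCategory.Qh.obj ((HomotopyCategory.quotient _ _).obj N), hN⟩) :=
  DerivedCategory.Qh.map ((HomotopyCategory.quotient _ _).map s) ≫
    toDerivedDual R ((HomotopyCategory.quotient _ _).obj N) hN

theorem liftDerivedDual_naturality {K K' N N' : CochainComplex (ModuleCat.{u} R) ℤ}
    (s : K ⟶ (dualComplex R).obj (op N)) (s' : K' ⟶ (dualComplex R).obj (op N'))
    (hN : IsBoundedCoherent R (DerivedCategory.Qh.obj ((HomotopyCategory.quotient _ _).obj N)))
    (hN' : IsBoundedCoherent R (DerivedCategory.Qh.obj ((HomotopyCategory.quotient _ _).obj N')))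
    (β : K ⟶ K') (κ : N' ⟶ N) (h : s ≫ (dualComplex R).map κ.op = β ≫ s') :
    liftDerivedDual s hN ≫ (derivedDual R).map (ObjectProperty.homMk
      (DerivedCategory.Qh.map ((HomotopyCategory.quotient _ _).map κ)) :
        (⟨DerivedCategory.Qh.obj ((HomotopyCategory.quotient _ _).obj N'), hN'⟩ : DbMod R) ⟶
          ⟨DerivedCategory.Qh.obj ((HomotopyCategory.quotient _ _).obj N), hN⟩).op =
      DerivedCategory.Qh.map ((HomotopyCategory.quotient _ _).map β) ≫ liftDerivedDual s' hN' := by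
  have h₁ : DerivedCategory.Qh.map ((HomotopyCategory.quotient _ _).map s) ≫
      DerivedCategory.Qh.map ((HomotopyCategory.quotient _ _).map ((dualComplex R).map κ.op)) =
      DerivedCategory.Qh.map ((HomotopyCategory.quotient _ _).map β) ≫
        DerivedCategory.Qh.map ((HomotopyCategory.quotient _ _).map s') := by
    rw [← Functor.map_comp, ← Functor.map_comp, ← Functor.map_comp, ← Functor.map_comp, h]
  exact comp_eq_comp_of_comm h₁ (toDerivedDual_naturality R hN' hN
    ((HomotopyCategory.quotient _ _).map κ))

theorem isIso_liftDerivedDual {K N : CochainComplex (ModuleCat.{u} R) ℤ}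
    (s : K ⟶ (dualComplex R).obj (op N)) [IsIso s]
    (hN : IsBoundedCoherent R (DerivedCategory.Qh.obj ((HomotopyCategory.quotient _ _).obj N)))
    (d : ℤ) [N.IsStrictlyLE d] (h : ∀ n, ExtVanishes (N.X n) (ModuleCat.of R R)) :
    IsIso (liftDerivedDual s hN) :=
  @IsIso.comp_isIso _ _ _ _ _ _ _ inferInstance (isIso_toDerivedDual R N hN d h)

end SerreSquare

section Serre
open Opposite

attribute [local instance] restrictedModule restrictedModule_isScalarTower algebraLinear

variable {R : Type u} [CommRing R] [IsNoetherianRing R] {Λ : Type u} [Ring Λ] [Algebra R Λ]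
  [Module.Finite R Λ] {tr : Λ →ₗ[R] R} (htr : ∀ x y, tr (x * y) = tr (y * x))

/-- The relative Serre duality morphism. -/
noncomputable def serreHom (P Q : HoPerf Λ) : (((rhomPerf R Λ).obj (op Q)).obj P).obj ⟶
    (derivedDual R).obj (op (((rhomPerf R Λ).obj (op P)).obj Q)) :=
  liftDerivedDual (dualityHom htr P.property Q.obj.as)
    (((rhomPerf R Λ).obj (op P)).obj Q).property

/-- The trace pairing is an isomorphism of complexes onto the naive dual, and the naive dual is the
derived one because the terms of Hom(P, Q) have no higher extensions by R. -/
theorem isIso_serreHom (hinj : ∀ x, (∀ y, tr (x * y) = 0) → x = 0)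
    (hsurj : ∀ φ : Λ →ₗ[R] R, ∃ x, ∀ y, tr (x * y) = φ y)
    (hext : ExtVanishes (ModuleCat.of R Λ) (ModuleCat.of R R)) (P Q : HoPerf Λ) :
    IsIso (serreHom htr P Q) := by
  obtain ⟨a, ha⟩ := P.property.2.1
  obtain ⟨b, hb⟩ := Q.property.2.2
  have : (homComplex R P.obj.as Q.obj.as).IsStrictlyLE (b - a) :=
    homComplex_isStrictlyLE (P := P.obj.as) (Q := Q.obj.as) R a b
  have := isIso_dualityHom htr P.property hinj hsurj Q.obj.as
  exact isIso_liftDerivedDual _ _ (b - a)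
    (fun n => extVanishes_homComplex R P.property Q.property hext n)

theorem serreHom_naturality_left {P P' : HoPerf Λ} (Q : HoPerf Λ) (f : P ⟶ P') :
    serreHom htr P Q ≫ (derivedDual R).map (((rhomPerf R Λ).map f.op).app Q).op =
      (((rhomPerf R Λ).obj (op Q)).map f).hom ≫ serreHom htr P' Q := by
  obtain ⟨w, hw⟩ := (HomotopyCategory.quotient _ _).map_surjective
    (X := P.obj.as) (Y := P'.obj.as) f.hom
  obtain rfl : f = (homotopyPerfect Λ).homMk ((HomotopyCategory.quotient _ _).map w) := by
    ext
    exact hw.symm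
  refine Eq.trans ?_ (liftDerivedDual_naturality (dualityHom htr P.property Q.obj.as)
    (dualityHom htr P'.property Q.obj.as) (((rhomPerf R Λ).obj (op P)).obj Q).property
    (((rhomPerf R Λ).obj (op P')).obj Q).property ((homFunctor R Q.obj.as).map w)
    ((homFunctorMap w).app Q.obj.as)
    (dualityHom_naturality_left htr P'.property P.property w))
  refine congrArg (fun z => serreHom htr P Q ≫ (derivedDual R).map (Quiver.Hom.op z)) ?_
  ext
  exact congrArg DerivedCategory.Qh.map (homHomotopy_map_app R w Q.obj.as)

theorem serreHom_naturality_right (P : HoPerf Λ) {Q Q' : HoPerf Λ} (g : Q ⟶ Q') :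
    serreHom htr P Q' ≫ (derivedDual R).map (((rhomPerf R Λ).obj (op P)).map g).op =
      (((rhomPerf R Λ).map g.op).app P).hom ≫ serreHom htr P Q := by
  obtain ⟨w, hw⟩ := (HomotopyCategory.quotient _ _).map_surjective
    (X := Q.obj.as) (Y := Q'.obj.as) g.hom
  obtain rfl : g = (homotopyPerfect Λ).homMk ((HomotopyCategory.quotient _ _).map w) := by
    ext
    exact hw.symm
  refine (liftDerivedDual_naturality (dualityHom htr P.property Q'.obj.as)
    (dualityHom htr P.property Q.obj.as) (((rhomPerf R Λ).obj (op P)).obj Q').property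
    (((rhomPerf R Λ).obj (op P)).obj Q).property ((homFunctorMap w).app P.obj.as)
    ((homFunctor R P.obj.as).map w) (dualityHom_naturality_right htr P.property w)).trans ?_
  refine congrArg (· ≫ serreHom htr P Q) ?_
  exact (congrArg DerivedCategory.Qh.map (homHomotopy_map_app R w P.obj.as)).symm

end Serre

section Crepant
open Opposite

attribute [local instance] restrictedModule restrictedModule_isScalarTower algebraLinear

theorem comp_inv_eq_inv_comp {C : Type*} [Category* C] {X X' Y Y' : C} {σ : X ⟶ Y} {σ' : X' ⟶ Y'}
    [IsIso σ] [IsIso σ'] {F : Y ⟶ Y'} {β : X ⟶ X'} (h : σ ≫ F = β ≫ σ') :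
    F ≫ (asIso σ').symm.hom = (asIso σ).symm.hom ≫ β := by
  change F ≫ inv σ' = inv σ ≫ β
  rw [IsIso.comp_inv_eq, Category.assoc, ← h, IsIso.inv_hom_id_assoc]

variable {k : Type v} [Field k] {R : Type u} [CommRing R] [IsNoetherianRing R] [Algebra k R]
  {Λ : Type u} [Ring Λ] [IsNoetherianRing Λ] [Algebra k Λ] [Algebra R Λ] [IsScalarTower k R Λ]
  [Module.Finite R Λ] (hΛ : IsPerfect Λ = IsBoundedCoherent Λ)

/-- If `Λ` is a symmetric `R`-algebra without higher extensions by `R`, then the identity is a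
relative Serre functor. -/
theorem isRelativeSerreFunctor_refl {tr : Λ →ₗ[R] R} (htr : ∀ x y, tr (x * y) = tr (y * x))
    (hinj : ∀ x, (∀ y, tr (x * y) = 0) → x = 0)
    (hsurj : ∀ φ : Λ →ₗ[R] R, ∃ x, ∀ y, tr (x * y) = φ y)
    (hext : ExtVanishes (ModuleCat.of R Λ) (ModuleCat.of R R)) :
    (perfModule (k := k) (R := R) hΛ).IsRelativeSerreFunctor
      (CategoryTheory.Equivalence.refl (C := DbMod Λ)) := by
  have hiso := isIso_serreHom htr hinj hsurj hext
  -- The required isomorphism starts at the derived dual, hence is the inverse of the duality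
  -- morphism.
  refine ⟨derivedDual R, isDerivedDual_derivedDual R, fun B C => (@asIso _ _ _ _ (serreHom htr
    ((resolve _ hΛ).functor.obj B) ((resolve _ hΛ).functor.obj C)) (hiso _ _)).symm, ?_, ?_⟩
  · intro B B' C f
    exact @comp_inv_eq_inv_comp _ _ _ _ _ _ _ _ (hiso _ _) (hiso _ _) _ _ (serreHom_naturality_left htr ((resolve _ hΛ).functor.obj C)
      ((resolve _ hΛ).functor.map f))
  · intro B C C' g
    exact @comp_inv_eq_inv_comp _ _ _ _ _ _ _ _ (hiso _ _) (hiso _ _) _ _ (serreHom_naturality_right htr ((resolve _ hΛ).functor.obj B)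
      ((resolve _ hΛ).functor.map g))

end Crepant
end NCCR

namespace NCCR

/-! ### Dimension shifting in the first variable -/

section Abelian
open Abelian

variable {C : Type w} [Category.{v} C] [Abelian C] [HasExt.{v} C] {S : ShortComplex C}

theorem subsingleton_ext_X₁ (hS : S.ShortExact) {Y : C} {i : ℕ}
    (h₂ : Subsingleton (Ext S.X₂ Y i)) (h₃ : Subsingleton (Ext S.X₃ Y (i + 1))) :
    Subsingleton (Ext S.X₁ Y i) := by
  refine subsingleton_of_forall_eq 0 fun x => ?_
  obtain ⟨y, rfl⟩ := Ext.contravariant_sequence_exact₁ hS Y x (add_comm 1 i)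
    (Subsingleton.elim _ _)
  rw [Subsingleton.elim y 0, Ext.comp_zero]

theorem subsingleton_ext_X₂ (hS : S.ShortExact) {Y : C} {i : ℕ}
    (h₁ : Subsingleton (Ext S.X₁ Y i)) (h₃ : Subsingleton (Ext S.X₃ Y i)) :
    Subsingleton (Ext S.X₂ Y i) := by
  refine subsingleton_of_forall_eq 0 fun x => ?_
  obtain ⟨y, rfl⟩ := Ext.contravariant_sequence_exact₂ hS Y x (Subsingleton.elim _ _)
  rw [Subsingleton.elim y 0, Ext.comp_zero]

theorem subsingleton_ext_X₃ (hS : S.ShortExact) {Y : C} {i : ℕ}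
    (h₁ : Subsingleton (Ext S.X₁ Y i)) (h₂ : Subsingleton (Ext S.X₂ Y (i + 1))) :
    Subsingleton (Ext S.X₃ Y (i + 1)) := by
  refine subsingleton_of_forall_eq 0 fun x => ?_
  obtain ⟨y, rfl⟩ := Ext.contravariant_sequence_exact₃ hS Y x (Subsingleton.elim _ _)
    (add_comm 1 i)
  rw [Subsingleton.elim y 0, Ext.comp_zero]

theorem subsingleton_ext_of_iso {X X' Y : C} (e : X ≅ X') {i : ℕ}
    (h : Subsingleton (Ext X Y i)) : Subsingleton (Ext X' Y i) := by
  refine subsingleton_of_forall_eq 0 fun x => ?_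
  have h0 : (Ext.mk₀ e.hom).comp x (zero_add i) = 0 := Subsingleton.elim _ _
  have := congrArg (fun z => (Ext.mk₀ e.inv).comp z (zero_add i)) h0
  simpa [Ext.mk₀_comp_mk₀_assoc] using this

end Abelian

/-! ### Local rings of finite injective dimension -/

section Local

open Abelian IsLocalRing RingTheory.Sequence

variable {A : Type u} [CommRing A] [IsNoetherianRing A] [IsLocalRing A]

/-- The long exact sequence of multiplication by y on X makes y surjective on the finite module
Ext^i(X, Y), which is zero by Nakayama's lemma. -/
theorem subsingleton_ext_of_isSMulRegular {X Y : ModuleCat.{u} A} [Module.Finite A X]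
    [Module.Finite A Y] {y : A} (hy : y ∈ maximalIdeal A) (hX : IsSMulRegular X y) {i : ℕ}
    (h : Subsingleton (Ext (ModuleCat.of A (QuotSMulTop y X)) Y (i + 1))) :
    Subsingleton (Ext X Y i) := by
  have h0 := Submodule.eq_bot_of_le_smul_of_le_jacobson_bot (Ideal.span {y})
    (⊤ : Submodule A (Ext X Y i)) Module.Finite.fg_top (fun x _ => by
      obtain ⟨z, hz⟩ := Ext.contravariant_sequence_exact₁ hX.smulShortComplex_shortExact Y x
        (add_comm 1 i) (Subsingleton.elim (h := h) _ _)
      have hz' : y • z = x := by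
        refine Eq.trans ?_ hz
        have h1 : (X.smulShortComplex y).f = y • 𝟙 X := by
          ext x
          rfl
        have h2 (z : Ext X Y i) : (Ext.mk₀ (y • 𝟙 X)).comp z (zero_add i) = y • z := by
          rw [Ext.mk₀_smul, Ext.smul_comp, Ext.mk₀_id_comp]
        exact (h2 z).symm.trans (congrArg (fun φ => (Ext.mk₀ φ).comp z (zero_add i)) h1.symm)
      rw [← hz']
      exact Submodule.smul_mem_smul (Ideal.mem_span_singleton_self y) trivial)
    ((Ideal.span_singleton_le_iff_mem _).2 (by rwa [jacobson_eq_maximalIdeal _ bot_ne_top]))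
  exact (Submodule.subsingleton_iff A).1 (subsingleton_of_bot_eq_top h0.symm)

theorem subsingleton_ext_of_isWeaklyRegular {Y : ModuleCat.{u} A} [Module.Finite A Y] {i : ℕ}
    (rs : List A) (hrs : ∀ r ∈ rs, r ∈ maximalIdeal A)
    (h : ∀ X : ModuleCat.{u} A, Module.Finite A X → Subsingleton (Ext X Y (i + rs.length)))
    (X : ModuleCat.{u} A) [Module.Finite A X] (hX : IsWeaklyRegular X rs) :
    Subsingleton (Ext X Y i) := by
  induction rs generalizing X i with
  | nil => exact h X inferInstance
  | cons r rs ih =>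
    rw [isWeaklyRegular_cons_iff] at hX
    exact subsingleton_ext_of_isSMulRegular (hrs r List.mem_cons_self) hX.1
      (ih (fun r' h' => hrs r' (List.mem_cons_of_mem _ h'))
        (fun Z hZ => by
          have := h Z hZ
          rwa [List.length_cons, ← add_assoc, add_right_comm] at this)
        (ModuleCat.of A (QuotSMulTop r X)) hX.2)

/-- Dévissage to quotients A/p by primes. If p is not maximal, an element of the maximal ideal
outside p is regular on A/p, and vanishing one degree higher gives the claim. -/
theorem subsingleton_ext_of_residueField {Y : ModuleCat.{u} A} [Module.Finite A Y] {i : ℕ}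
    (h : ∀ X : ModuleCat.{u} A, Module.Finite A X → Subsingleton (Ext X Y (i + 1)))
    (hk : Subsingleton (Ext (ModuleCat.of A (A ⧸ maximalIdeal A)) Y i))
    (X : ModuleCat.{u} A) [hX : Module.Finite A X] : Subsingleton (Ext X Y i) := by
  suffices h0 : ∀ (X : Type u) [AddCommGroup X] [Module A X] (_ : Module.Finite A X),
      Subsingleton (Ext (ModuleCat.of A X) Y i) from h0 X hX
  intro X _ _ hX
  induction hX using IsNoetherianRing.induction_on_isQuotientEquivQuotientPrime A with
  | subsingleton N =>
    have := (ModuleCat.isZero_of_subsingleton (ModuleCat.of A N)).hasProjectiveDimensionLT_zero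
    exact HasProjectiveDimensionLT.subsingleton (ModuleCat.of A N) 0 i (Nat.zero_le i) Y
  | quotient N p e =>
    refine subsingleton_ext_of_iso (X := ModuleCat.of A (A ⧸ p.asIdeal)) e.symm.toModuleIso ?_
    by_cases hp : p.asIdeal = maximalIdeal A
    · rw [hp]
      exact hk
    · obtain ⟨y, hy, hyp⟩ := SetLike.exists_of_lt
        (lt_of_le_of_ne (le_maximalIdeal p.2.ne_top) hp)
      refine subsingleton_ext_of_isSMulRegular hy (fun a b hab => ?_) (h _ inferInstance)
      have h1 : y • (a - b) = 0 := by rw [smul_sub]; exact sub_eq_zero.2 hab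
      have h2 : Ideal.Quotient.mk p.asIdeal y * (a - b) = 0 := h1
      rcases mul_eq_zero.1 h2 with h3 | h3
      · exact absurd (Ideal.Quotient.eq_zero_iff_mem.1 h3) hyp
      · exact sub_eq_zero.1 h3
  | exact N₁ N₂ N₃ f g hf hg hfg h₁ h₃ =>
    exact subsingleton_ext_X₂ (S := ShortComplex.mk (ModuleCat.ofHom f) (ModuleCat.ofHom g)
      (by ext x; exact hfg.apply_apply_eq_zero x))
      { exact := (ShortComplex.ShortExact.moduleCat_exact_iff_function_exact _).2 hfg
        mono_f := (ModuleCat.mono_iff_injective _).2 hf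
        epi_g := (ModuleCat.epi_iff_surjective _).2 hg } h₁ h₃

/-- For a noetherian local ring `A` of finite injective dimension, any nonvanishing `Ext(X, A)`
lies in degree at most the injective dimension, which equals the depth of `A`. -/
theorem exists_depth {n : ℕ} (hA : HasInjectiveDimensionLE (ModuleCat.of A A) n)
    {X : ModuleCat.{u} A} [Module.Finite A X] {i : ℕ}
    (hi : ¬ Subsingleton (Ext X (ModuleCat.of A A) i)) :
    ∃ j, i ≤ j ∧
      (∀ Z : ModuleCat.{u} A, Module.Finite A Z → maximalIdeal A ≤ Module.annihilator A Z →
        ∀ l < j, Subsingleton (Ext Z (ModuleCat.of A A) l)) ∧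
      (j : WithBot ℕ∞) ≤ ringKrullDim A := by
  classical
  let P (r : ℕ) : Prop := ∃ X : ModuleCat.{u} A, Module.Finite A X ∧
    ¬ Subsingleton (Ext X (ModuleCat.of A A) r)
  have hP (r : ℕ) (hr : P r) : r ≤ n := by
    obtain ⟨X, _, hX⟩ := hr
    by_contra hrn
    exact hX (HasInjectiveDimensionLT.subsingleton (ModuleCat.of A A) (n + 1) r (by lia) X)
  -- The largest degree in which some finite module has a nonzero Ext into A.
  let r := Nat.findGreatest P n
  have hPi : P i := ⟨X, inferInstance, hi⟩
  have hr : P r := Nat.findGreatest_spec (hP i hPi) hPi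
  have hr' (l : ℕ) (hl : r < l) (X : ModuleCat.{u} A) (_ : Module.Finite A X) :
      Subsingleton (Ext X (ModuleCat.of A A) l) := by
    by_contra h
    have h' : P l := ⟨X, inferInstance, h⟩
    exact absurd (Nat.le_findGreatest (hP l h') h') (by lia)
  let K := ModuleCat.of A (A ⧸ maximalIdeal A)
  -- In that top degree the residue field already has a nonzero Ext, by the dévissage above.
  have hK : ¬ Subsingleton (Ext K (ModuleCat.of A A) r) := fun h => by
    obtain ⟨X, _, hX⟩ := hr
    exact hX (subsingleton_ext_of_residueField (hr' (r + 1) (by lia)) h X)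
  have hex : ∃ s, ¬ Subsingleton (Ext K (ModuleCat.of A A) s) := ⟨r, hK⟩
  -- The depth of A, as the first nonvanishing degree for the residue field.
  let s := Nat.find hex
  have hs : ¬ Subsingleton (Ext K (ModuleCat.of A A) s) := Nat.find_spec hex
  have hs' (l : ℕ) (hl : l < s) : Subsingleton (Ext K (ModuleCat.of A A) l) :=
    not_not.1 (Nat.find_min hex hl)
  have hsupp : Module.support A (ModuleCat.of A (A ⧸ maximalIdeal A)) =
      PrimeSpectrum.zeroLocus (maximalIdeal A) := by
    rw [Module.support_eq_zeroLocus]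
    congr 1
    exact congrArg _ Ideal.annihilator_quotient
  have htop : maximalIdeal A • (⊤ : Submodule A (ModuleCat.of A A)) < ⊤ :=
    lt_top_iff_ne_top.2 fun h => (maximalIdeal.isMaximal A).ne_top (by
      have h1 : maximalIdeal A • (⊤ : Ideal A) = ⊤ := h
      simpa using h1)
  obtain ⟨rs, hlen, hmem, hreg⟩ := ModuleCat.exists_isRegular_of_exists_subsingleton_ext
    (maximalIdeal A) s (ModuleCat.of A A) htop K hsupp hs'
  -- The quotient by a maximal regular sequence has projective dimension at most s and, as shown
  -- below, nonzero socle.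
  let Q := ModuleCat.of A (A ⧸ Ideal.ofList rs • (⊤ : Submodule A A))
  have hpd : HasProjectiveDimensionLE Q s := by
    rw [← projectiveDimension_le_iff]
    have h1 := ModuleCat.projectiveDimension_quotient_eq_add_length_of_isWeaklyRegular
      (ModuleCat.of A A) rs hreg.toIsWeaklyRegular hmem
    have h2 : projectiveDimension (ModuleCat.of A A) ≤ (0 : ℕ) := by
      rw [projectiveDimension_le_iff]
      have : Projective (ModuleCat.of A A) := (IsProjective.iff_projective _).1
        (inferInstanceAs (Module.Projective A A))
      infer_instance
    refine h1.trans_le ?_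
    rw [hlen]
    exact (add_le_add_left h2 _).trans (by simp)
  have hdim : (s : WithBot ℕ∞) ≤ ringKrullDim A := by
    rw [← ringKrullDim_add_length_eq_ringKrullDim_of_isRegular rs hreg, hlen]
    have : Nontrivial (A ⧸ Ideal.ofList rs) := Ideal.Quotient.nontrivial_iff.2 fun h =>
      hreg.top_ne_smul (by rw [h]; simp)
    have h1 : (0 : WithBot ℕ∞) ≤ ringKrullDim (A ⧸ Ideal.ofList rs) := ringKrullDim_nonneg_of_nontrivial
    simpa using add_le_add_left h1 (s : WithBot ℕ∞)
  -- Without a socle, some element of the maximal ideal would be regular on the quotient; a regular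
  -- sequence of length s + 1 would then force Ext^s of the residue field to vanish.
  have hhom : ¬ Subsingleton (A ⧸ maximalIdeal A →ₗ[A] Q) := fun h => by
    rw [IsSMulRegular.subsingleton_linearMap_iff] at h
    obtain ⟨a, ha, hreg'⟩ := h
    rw [Ideal.annihilator_quotient] at ha
    have hw : IsWeaklyRegular A (rs ++ [a]) := (isWeaklyRegular_append_iff A _ _).2
      ⟨hreg.toIsWeaklyRegular, (isWeaklyRegular_singleton_iff _ a).2 hreg'⟩
    have hm : ∀ r ∈ rs ++ [a], r ∈ maximalIdeal A := by
      intro r hr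
      rcases List.mem_append.1 hr with h | h
      · exact hmem r h
      · rwa [List.mem_singleton.1 h]
    have hreg'' := (IsLocalRing.isRegular_iff_isWeaklyRegular_of_subset_maximalIdeal
      (M := A) hm).2 hw
    exact hs (ModuleCat.subsingleton_ext_of_exists_isRegular (maximalIdeal A) K hsupp.le
      (ModuleCat.of A A) htop (rs ++ [a]) hm hreg'' s (by simp [hlen]))
  -- If r > s, embed the residue field into Q. Ext^r(Q, A) vanishes by projective dimension and
  -- Ext^{r+1} of the cokernel by maximality of r, so Ext^r of the residue field vanishes, a
  -- contradiction.
  have hrs : r ≤ s := by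
    by_contra hlt
    push Not at hlt
    obtain ⟨f, hf⟩ : ∃ f : A ⧸ maximalIdeal A →ₗ[A] Q, f ≠ 0 := by
      by_contra! h
      exact hhom (subsingleton_of_forall_eq 0 h)
    have : IsSimpleModule A (A ⧸ maximalIdeal A) :=
      isSimpleModule_iff_quot_maximal.2 ⟨_, maximalIdeal.isMaximal A, ⟨LinearEquiv.refl _ _⟩⟩
    have hinj : Function.Injective f := (LinearMap.injective_or_eq_zero f).resolve_right hf
    have hmono : Mono (ModuleCat.ofHom f) := (ModuleCat.mono_iff_injective _).2 hinj
    have hse : (ShortComplex.mk (ModuleCat.ofHom f) (cokernel.π (ModuleCat.ofHom f))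
      (cokernel.condition _)).ShortExact :=
      { exact := ShortComplex.exact_cokernel _ }
    have hfin : Module.Finite A ↑(cokernel (ModuleCat.ofHom f)) :=
      Module.Finite.of_surjective (cokernel.π (ModuleCat.ofHom f)).hom
        ((ModuleCat.epi_iff_surjective _).1 inferInstance)
    exact hK (subsingleton_ext_X₁ hse
      (HasProjectiveDimensionLT.subsingleton Q (s + 1) r (by lia) _)
      (hr' (r + 1) (by lia) _ hfin))
  have hirs : i ≤ s := (Nat.le_findGreatest (hP i hPi) hPi).trans hrs
  refine ⟨s, hirs, fun Z hZ hann l hl => ?_, hdim⟩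
  refine ModuleCat.subsingleton_ext_of_exists_isRegular (maximalIdeal A) Z ?_ (ModuleCat.of A A)
    htop rs hmem hreg l (by rwa [hlen])
  rw [Module.support_eq_zeroLocus]
  exact PrimeSpectrum.zeroLocus_anti_mono hann

/-- Maximal Cohen-Macaulay modules over a Gorenstein local ring. -/
theorem extVanishes_of_isWeaklyRegular {n : ℕ} (hA : HasInjectiveDimensionLE (ModuleCat.of A A) n)
    {X : ModuleCat.{u} A} [Module.Finite A X] (rs : List A)
    (hrs : ∀ r ∈ rs, r ∈ maximalIdeal A) (hX : IsWeaklyRegular X rs)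
    (hd : ringKrullDim A = (rs.length : ℕ∞)) : ExtVanishes X (ModuleCat.of A A) := by
  refine fun i hi => subsingleton_ext_of_isWeaklyRegular rs hrs (fun Z hZ => ?_) X hX
  by_contra h
  obtain ⟨j, hij, -, hj⟩ := exists_depth hA h
  rw [hd] at hj
  have : j ≤ rs.length := by exact_mod_cast hj
  lia

/-- Supplies the depth of A itself. If Ext^i(Z, A) were nonzero, the depth would be less than the
length of `rs`, so all Ext into A in the degree of that length would vanish; cutting X down along
`rs` would give Hom(X, A) = 0. -/
theorem subsingleton_ext_of_le_annihilator {n : ℕ}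
    (hA : HasInjectiveDimensionLE (ModuleCat.of A A) n)
    {X : ModuleCat.{u} A} [Module.Finite A X] (rs : List A)
    (hrs : ∀ r ∈ rs, r ∈ maximalIdeal A) (hX : IsWeaklyRegular X rs)
    (h0 : ¬ Subsingleton (Ext X (ModuleCat.of A A) 0)) {Z : ModuleCat.{u} A} [Module.Finite A Z]
    (hZ : maximalIdeal A ≤ Module.annihilator A Z) {i : ℕ} (hi : i < rs.length) :
    Subsingleton (Ext Z (ModuleCat.of A A) i) := by
  by_contra hcon
  refine h0 (subsingleton_ext_of_isWeaklyRegular rs hrs (fun X' hX' => ?_) X hX)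
  by_contra h
  obtain ⟨j, hij, hj, -⟩ := exists_depth hA h
  exact hcon (hj Z inferInstance hZ i (by lia))

end Local

end NCCR

namespace NCCR

/-! ### Localization of Ext and the Gorenstein hypothesis -/

open Abelian

theorem exists_shortExact_free {A : Type u} [Ring A] [IsNoetherianRing A] (X : ModuleCat.{u} A)
    [Module.Finite A X] : ∃ (K F : ModuleCat.{u} A) (f : K ⟶ F) (g : F ⟶ X) (w : f ≫ g = 0),
      (ShortComplex.mk f g w).ShortExact ∧ Module.Finite A K ∧ Module.Finite A F ∧
        Module.Free A F := by
  obtain ⟨n, g, hg⟩ := Module.Finite.exists_fin' A X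
  exact ⟨_, _, _, _, g.shortComplexKer.zero, g.shortExact_shortComplexKer hg,
    inferInstanceAs (Module.Finite A (LinearMap.ker g)),
    inferInstanceAs (Module.Finite A (Fin n → A)), inferInstanceAs (Module.Free A (Fin n → A))⟩

variable {R : Type u} [CommRing R]

section Localization

variable (S : Submonoid R)

theorem localizedModuleMap_apply {X Y : ModuleCat.{u} R} (f : X ⟶ Y) (x : X) :
    (ModuleCat.localizedModuleMap S f).hom (X.localizedModuleMkLinearMap S x) =
      Y.localizedModuleMkLinearMap S (f.hom x) :=
  IsLocalizedModule.map_apply S (X.localizedModuleMkLinearMap S)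
    (Y.localizedModuleMkLinearMap S) f.hom x

theorem localizedModule_hom_ext {X : ModuleCat.{u} R} {Z : ModuleCat.{u} (Localization S)}
    {f g : X.localizedModule S ⟶ Z}
    (h : ∀ x : X, f.hom (X.localizedModuleMkLinearMap S x) =
      g.hom (X.localizedModuleMkLinearMap S x)) : f = g := by
  ext z
  obtain ⟨⟨x, s⟩, hx⟩ := IsLocalizedModule.surj S (X.localizedModuleMkLinearMap S) z
  have hs : IsUnit (algebraMap R (Localization S) s) := IsLocalization.map_units _ s
  refine hs.smul_left_cancel.1 ?_
  rw [← map_smul, ← map_smul, algebraMap_smul]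
  change f.hom (s • z) = g.hom (s • z)
  rw [hx]
  exact h x

instance finite_localizedModule (X : ModuleCat.{u} R) [Module.Finite R X] :
    Module.Finite (Localization S) (X.localizedModule S) :=
  Module.Finite.of_isLocalizedModule S (X.localizedModuleMkLinearMap S)

theorem projective_localizedModule (X : ModuleCat.{u} R) [Module.Projective R X] :
    Module.Projective (Localization S) (X.localizedModule S) :=
  Module.projective_of_isLocalizedModule S (X.localizedModuleMkLinearMap S)

theorem exists_smul_hom_eq_zero {X Y : ModuleCat.{u} R} [Module.Finite R X] (f : X ⟶ Y)
    (hf : ModuleCat.localizedModuleMap S f = 0) : ∃ s ∈ S, s • f = 0 := by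
  obtain ⟨s, hs⟩ := Module.Finite.exists_smul_of_comp_eq_of_isLocalizedModule S
    (Y.localizedModuleMkLinearMap S) f.hom 0 (by
      ext x
      have h1 := localizedModuleMap_apply S f x
      rw [hf] at h1
      exact h1.symm.trans (map_zero (Y.localizedModuleMkLinearMap S)).symm)
  refine ⟨s, s.2, ?_⟩
  ext x
  have h2 := LinearMap.congr_fun hs x
  rw [smul_zero] at h2
  exact h2

/-- Only half of the compatibility of Ext with localization is needed: a class is killed by an
element of S once the localized group is zero. Dimension shifting along a finite free cover leaves
degrees 0 and 1 to treat by hand. -/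
theorem exists_smul_ext_eq_zero [IsNoetherianRing R] {X Y : ModuleCat.{u} R} [Module.Finite R X]
    {i : ℕ} (h : Subsingleton (Ext (X.localizedModule S) (Y.localizedModule S) i))
    (x : Ext X Y i) : ∃ s ∈ S, s • x = 0 := by
  induction i generalizing X with
  | zero =>
    obtain ⟨f, rfl⟩ := (Ext.mk₀_bijective X Y).surjective x
    have h' : Subsingleton (X.localizedModule S ⟶ Y.localizedModule S) :=
      Ext.homEquiv₀.symm.subsingleton
    obtain ⟨s, hs, h0⟩ := exists_smul_hom_eq_zero S f (h'.elim _ _)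
    exact ⟨s, hs, by rw [← Ext.mk₀_smul, h0, Ext.mk₀_zero]⟩
  | succ i ih =>
    obtain ⟨K, F, f, g, w, hse, _, _, _⟩ := exists_shortExact_free X
    have hF : Projective F := (IsProjective.iff_projective F).1
      (Module.Projective.of_free (R := R) (P := F))
    have hF' : Projective (F.localizedModule S) :=
      (IsProjective.iff_projective _).1
        (@projective_localizedModule _ _ S F (Module.Projective.of_free (R := R) (P := F)))
    have hse' : (ShortComplex.mk (ModuleCat.localizedModuleMap S f)
        (ModuleCat.localizedModuleMap S g) _).ShortExact :=
      hse.map_of_exact (ModuleCat.localizedModuleFunctor S)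
    obtain ⟨x, rfl⟩ := Ext.contravariant_sequence_exact₃ hse Y x (Ext.eq_zero_of_projective _)
      (add_comm 1 i)
    cases i with
    | zero =>
      obtain ⟨φ, rfl⟩ := (Ext.mk₀_bijective K Y).surjective x
      obtain ⟨y, hy⟩ := Ext.contravariant_sequence_exact₁ hse' (Y.localizedModule S)
        (Ext.mk₀ (ModuleCat.localizedModuleMap S φ)) rfl (Subsingleton.elim (h := h) _ _)
      obtain ⟨ψ, rfl⟩ := (Ext.mk₀_bijective _ _).surjective y
      have hψ : ModuleCat.localizedModuleMap S f ≫ ψ = ModuleCat.localizedModuleMap S φ := by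
        refine (Ext.mk₀_bijective _ _).injective ?_
        rw [← hy]
        exact (Ext.mk₀_comp_mk₀ _ _).symm
      have hFP : Module.FinitePresentation R F := Module.finitePresentation_of_finite R F
      -- The extension ψ of φ exists over the localization; finite presentation of F clears its
      -- denominators.
      obtain ⟨χ, s, hχ⟩ := Module.FinitePresentation.exists_lift_of_isLocalizedModule S
        (Y.localizedModuleMkLinearMap S)
        ((ψ.hom.restrictScalars R).comp (F.localizedModuleMkLinearMap S))
      -- After localization sφ is the restriction of χ, so a further multiple of sφ extends to F
      -- over R and kills the class.
      obtain ⟨t, ht, h0⟩ := exists_smul_hom_eq_zero S (s.1 • φ - f ≫ ModuleCat.ofHom χ) (by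
        refine localizedModule_hom_ext S fun x => ?_
        rw [localizedModuleMap_apply]
        have h1 := LinearMap.congr_fun hχ (f.hom x)
        have h2 : ψ.hom (F.localizedModuleMkLinearMap S (f.hom x)) =
            Y.localizedModuleMkLinearMap S (φ.hom x) := by
          rw [← localizedModuleMap_apply, ← localizedModuleMap_apply, ← hψ]
          rfl
        change Y.localizedModuleMkLinearMap S (s.1 • φ.hom x - χ (f.hom x)) = 0
        rw [map_sub, map_smul, sub_eq_zero, ← h2]
        exact h1.symm)
      refine ⟨t * s.1, mul_mem ht s.2, ?_⟩
      have h3 : (t * s.1) • φ = f ≫ (t • ModuleCat.ofHom χ) := by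
        rw [smul_sub, sub_eq_zero] at h0
        rw [mul_smul, h0, Linear.comp_smul]
      rw [← Ext.comp_smul, ← Ext.mk₀_smul, h3, ← Ext.mk₀_comp_mk₀]
      exact hse.extClass_comp_assoc _
    | succ i =>
      obtain ⟨s, hs, h0⟩ := ih (subsingleton_ext_X₁ hse'
        (subsingleton_of_forall_eq 0 fun x => Ext.eq_zero_of_projective x) h) x
      exact ⟨s, hs, by rw [← Ext.comp_smul, h0, Ext.comp_zero]⟩

instance isLocalizedModule_of (N : Type u) [AddCommGroup N] [Module R N] :
    IsLocalizedModule S ((ModuleCat.of R N).localizedModuleMkLinearMap S) :=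
  (ModuleCat.of R N).localizedModule_isLocalizedModule S

noncomputable def localizedModuleSelf :
    (ModuleCat.of R R).localizedModule S ≅ ModuleCat.of (Localization S) (Localization S) :=
  (LinearEquiv.extendScalarsOfIsLocalization S (Localization S)
    (IsLocalizedModule.linearEquiv S ((ModuleCat.of R R).localizedModuleMkLinearMap S)
      (Algebra.linearMap R (Localization S)))).toModuleIso

end Localization

theorem eq_zero_of_forall_isMaximal {E : Type w} [AddCommGroup E] [Module R E] (x : E)
    (h : ∀ (m : Ideal R) [m.IsMaximal], ∃ s ∈ m.primeCompl, s • x = 0) : x = 0 := by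
  have h1 : Ideal.span {r : R | r • x = 0} = ⊤ := by
    by_contra hne
    obtain ⟨m, hm, hle⟩ := Ideal.exists_le_maximal _ hne
    obtain ⟨s, hs, h0⟩ := h m
    exact hs (hle (Ideal.subset_span h0))
  have h2 : (Ideal.span {r : R | r • x = 0}) ≤ LinearMap.ker (LinearMap.toSpanSingleton R E x) :=
    Ideal.span_le.2 fun r hr => hr
  have h3 : (1 : R) ∈ LinearMap.ker (LinearMap.toSpanSingleton R E x) := h2 (h1 ▸ trivial)
  simpa using h3

variable [IsNoetherianRing R]

theorem IsGorenstein.localization (hR : IsGorenstein R) (S : Submonoid R) :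
    ∃ n, HasInjectiveDimensionLE (ModuleCat.of (Localization S) (Localization S)) n := by
  obtain ⟨n, hn⟩ := hR
  refine ⟨n, ?_⟩
  have := ModuleCat.localizedModule_hasInjectiveDimensionLE n S (ModuleCat.of R R)
  exact hasInjectiveDimensionLT_of_iso (localizedModuleSelf S) (n + 1)

theorem subsingleton_ext_localizedModule (S : Submonoid R) {X : ModuleCat.{u} R} {i : ℕ}
    (h : Subsingleton (Ext (X.localizedModule S)
      (ModuleCat.of (Localization S) (Localization S)) i)) :
    Subsingleton (Ext (X.localizedModule S) ((ModuleCat.of R R).localizedModule S) i) := by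
  refine subsingleton_of_forall_eq 0 fun x => ?_
  have h0 : x.comp (Ext.mk₀ (localizedModuleSelf S).hom) (add_zero i) = 0 := Subsingleton.elim _ _
  have := congrArg (fun z => z.comp (Ext.mk₀ (localizedModuleSelf S).inv) (add_zero i)) h0
  simpa [Ext.comp_assoc_of_third_deg_zero] using this

/-- Over the localization at p all Ext into the ring vanish above its dimension, which is the height
of p. -/
theorem exists_smul_ext_eq_zero_of_height_lt (hR : IsGorenstein R) (p : Ideal R) [p.IsPrime] {i : ℕ}
    (hi : p.height < i) {X : ModuleCat.{u} R} [Module.Finite R X]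
    (x : Ext X (ModuleCat.of R R) i) : ∃ s ∈ p.primeCompl, s • x = 0 := by
  refine exists_smul_ext_eq_zero p.primeCompl (subsingleton_ext_localizedModule _ ?_) x
  by_contra h
  obtain ⟨n, hn⟩ := hR.localization p.primeCompl
  obtain ⟨j, hij, -, hj⟩ := exists_depth (A := Localization.AtPrime p) hn h
  rw [IsLocalization.AtPrime.ringKrullDim_eq_height p] at hj
  have hj' : (j : ℕ∞) ≤ p.height := by exact_mod_cast hj
  exact absurd (hj'.trans_lt hi) (by simpa using hij)

section MaximalCohenMacaulay

variable {N : Type u} [AddCommGroup N] [Module R N]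

theorem IsMaximalCohenMacaulay.exists_isWeaklyRegular (hN : IsMaximalCohenMacaulay R N)
    (m : Ideal R) [m.IsMaximal] : ∃ rs : List (Localization.AtPrime m),
      (∀ r ∈ rs, r ∈ IsLocalRing.maximalIdeal (Localization.AtPrime m)) ∧
      RingTheory.Sequence.IsWeaklyRegular ((ModuleCat.of R N).localizedModule m.primeCompl) rs ∧
      ringKrullDim (Localization.AtPrime m) = (rs.length : ℕ∞) := by
  obtain ⟨rs, h1, h2, h3⟩ := hN.exists_isRegular m
  exact ⟨rs, h1, ((Shrink.linearEquiv (Localization.AtPrime m)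
    (LocalizedModule m.primeCompl N)).isWeaklyRegular_congr rs).2 h2.toIsWeaklyRegular, h3.symm⟩

/-- At each maximal ideal a regular sequence on N of length equal to the dimension pushes a positive
degree above the last degree in which Ext into the ring can be nonzero. -/
theorem IsMaximalCohenMacaulay.extVanishes (hR : IsGorenstein R)
    (hN : IsMaximalCohenMacaulay R N) :
    ExtVanishes (ModuleCat.of R N) (ModuleCat.of R R) := fun i hi => by
  have := hN.finite
  refine subsingleton_of_forall_eq 0 fun x => eq_zero_of_forall_isMaximal (R := R) x fun m _ =>
    exists_smul_ext_eq_zero m.primeCompl (subsingleton_ext_localizedModule _ ?_) x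
  obtain ⟨n, hn⟩ := hR.localization m.primeCompl
  obtain ⟨rs, h1, h2, h3⟩ := hN.exists_isWeaklyRegular m
  exact extVanishes_of_isWeaklyRegular (A := Localization.AtPrime m) hn rs h1 h2 h3 i hi

/-- The functional `f` survives localization at m, so N_m has nonzero dual. The regular sequence on
N_m then bounds the depth of R_m from below by the height of m. -/
theorem IsMaximalCohenMacaulay.subsingleton_ext_quotient (hR : IsGorenstein R)
    (hN : IsMaximalCohenMacaulay R N) (m : Ideal R) [m.IsMaximal] (f : N →ₗ[R] R)
    (hf : ∀ s ∈ m.primeCompl, s • f ≠ 0) {i : ℕ} (hi : i < m.height) :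
    Subsingleton (Ext (ModuleCat.of R (R ⧸ m)) (ModuleCat.of R R) i) := by
  have := hN.finite
  obtain ⟨n, hn⟩ := hR.localization m.primeCompl
  obtain ⟨rs, h1, h2, h3⟩ := hN.exists_isWeaklyRegular m
  let F := (ModuleCat.of R (R ⧸ m)).localizedModule m.primeCompl
  have hi' : i < rs.length := by
    rw [IsLocalization.AtPrime.ringKrullDim_eq_height m] at h3
    have h4 : m.height = rs.length := by exact_mod_cast h3
    rw [h4] at hi
    exact_mod_cast hi
  have hk (r : R) (hr : r ∈ m) (x : R ⧸ m) : r • x = 0 := by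
    obtain ⟨x, rfl⟩ := Ideal.Quotient.mk_surjective x
    exact Ideal.Quotient.eq_zero_iff_mem.2 (m.mul_mem_right x hr)
  have hF : IsLocalRing.maximalIdeal (Localization.AtPrime m) ≤
      Module.annihilator (Localization.AtPrime m) F := by
    rw [← Localization.AtPrime.map_eq_maximalIdeal, Ideal.map_le_iff_le_comap]
    intro r hr
    refine Module.mem_annihilator.2 fun z => ?_
    obtain ⟨⟨y, s⟩, hy⟩ := IsLocalizedModule.surj m.primeCompl
      ((ModuleCat.of R (R ⧸ m)).localizedModuleMkLinearMap m.primeCompl) z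
    rw [algebraMap_smul]
    have hs : IsUnit (algebraMap R (Localization.AtPrime m) s) := IsLocalization.map_units _ s
    refine hs.smul_left_cancel.1 ?_
    rw [algebraMap_smul, smul_zero, smul_comm]
    refine (congrArg (r • ·) hy).trans ?_
    change r • ((ModuleCat.of R (R ⧸ m)).localizedModuleMkLinearMap m.primeCompl) y = 0
    rw [← map_smul, hk r hr y, map_zero]
  have h5 : Subsingleton (Ext F (ModuleCat.of (Localization.AtPrime m) _) i) :=
    subsingleton_ext_of_le_annihilator (A := Localization.AtPrime m) hn rs h1 h2 (fun h => by
      obtain ⟨s, hs, h0⟩ := exists_smul_ext_eq_zero m.primeCompl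
        (subsingleton_ext_localizedModule _ h) (Ext.mk₀ (ModuleCat.ofHom f))
      rw [← Ext.mk₀_smul] at h0
      exact hf s hs (congrArg ModuleCat.Hom.hom ((Ext.mk₀_eq_zero_iff _).1 h0))) hF hi'
  refine subsingleton_of_forall_eq 0 fun x => ?_
  obtain ⟨s, hs, h0⟩ := exists_smul_ext_eq_zero m.primeCompl
    (subsingleton_ext_localizedModule _ h5) x
  have h6 (r : R) (hr : r ∈ m) : r • x = 0 := by
    have h7 : r • 𝟙 (ModuleCat.of R (R ⧸ m)) = 0 := by
      refine ModuleCat.hom_ext (LinearMap.ext fun x => ?_)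
      exact hk r hr x
    rw [← Ext.mk₀_id_comp x, ← Ext.smul_comp, ← Ext.mk₀_smul, h7, Ext.mk₀_zero, Ext.zero_comp]
  -- The class is killed by m and by s outside m, hence by 1.
  obtain ⟨a, ha⟩ := Ideal.IsMaximal.exists_inv ‹m.IsMaximal› hs
  obtain ⟨b, hb, hab⟩ := ha
  rw [← one_smul R x, ← hab, add_smul, mul_smul, h0, smul_zero, h6 b hb, add_zero]

end MaximalCohenMacaulay

end NCCR

namespace NCCR

/-! ### The trace form of the endomorphism ring of a reflexive module -/

section Trace

open TensorProduct nonZeroDivisors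

/-- The trace is the sum of the eigenvalues, and each eigenvalue satisfies the monic equation of the
matrix. -/
theorem isIntegral_trace_matrix {R L n : Type*} [CommRing R] [Field L] [IsAlgClosed L] [Algebra R L]
    [Fintype n] [DecidableEq n] {N : Matrix n n L} (hN : IsIntegral R N) :
    IsIntegral R N.trace := by
  rw [Matrix.trace_eq_sum_roots_charpoly]
  refine IsIntegral.multiset_sum fun μ hμ => ?_
  obtain ⟨p, hp, h0⟩ := hN
  refine ⟨p, hp, ?_⟩
  have h1 : μ ∈ spectrum L N := Matrix.mem_spectrum_iff_isRoot_charpoly.2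
    (Polynomial.isRoot_of_mem_roots hμ)
  have h2 := spectrum.subset_polynomial_aeval N (p.map (algebraMap R L)) ⟨μ, h1, rfl⟩
  have h3 : Polynomial.aeval N (p.map (algebraMap R L)) = 0 := by
    rw [Polynomial.aeval_map_algebraMap]
    exact h0
  rw [h3] at h2
  have : Nontrivial (Matrix n n L) := by
    by_contra h
    rw [not_nontrivial_iff_subsingleton] at h
    rw [spectrum.of_subsingleton] at h1
    exact h1
  rw [spectrum.zero_eq, Set.mem_singleton_iff] at h2
  rw [← Polynomial.eval_map]
  exact h2

theorem isIntegral_trace_end {R K V : Type*} [CommRing R] [Field K] [Algebra R K] [AddCommGroup V]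
    [Module K V] [Module.Finite K V] [Algebra R (Module.End K V)]
    [IsScalarTower R K (Module.End K V)] {f : Module.End K V} (hf : IsIntegral R f) :
    IsIntegral R (LinearMap.trace K V f) := by
  classical
  let b := Module.finBasis K V
  let ψ : Module.End K V →ₐ[R] Matrix _ _ K := (LinearMap.toMatrixAlgEquiv b).toAlgHom.restrictScalars R
  let L := AlgebraicClosure K
  have h1 : IsIntegral R (algebraMap K L (LinearMap.trace K V f)) := by
    have h2 := isIntegral_trace_matrix ((hf.map ψ).map (IsScalarTower.toAlgHom R K L).mapMatrix)
    rw [LinearMap.trace_eq_matrix_trace K b]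
    convert h2 using 1
    exact AddMonoidHom.map_trace (algebraMap K L) (ψ f)
  exact (isIntegral_algHom_iff (IsScalarTower.toAlgHom R K L) (algebraMap K L).injective).1 h1

variable {R M : Type u} [CommRing R] [IsDomain R] [AddCommGroup M] [Module R M]
  [Module.Finite R M]

/-- The trace is taken over the fraction field. An endomorphism of a finite module is integral over
R, hence so is its trace, which therefore lies in the integrally closed R. -/
theorem exists_trace [IsIntegrallyClosed R] :
    ∃ tr : Module.End R M →ₗ[R] R, (∀ x y, tr (x * y) = tr (y * x)) ∧
      ∀ (φ : M →ₗ[R] R) (m : M), tr (φ.smulRight m) = φ m := by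
  let K := FractionRing R
  let T : Module.End R M →ₗ[R] K :=
    ((LinearMap.trace K (K ⊗[R] M)).restrictScalars R) ∘ₗ
      (Module.End.baseChangeHom R K M).toLinearMap
  have hT (f : Module.End R M) : T f ∈ LinearMap.range (Algebra.linearMap R K) := by
    have h1 : IsIntegral R f := Algebra.IsIntegral.isIntegral f
    have h2 := isIntegral_trace_end (h1.map (Module.End.baseChangeHom R K M))
    exact IsIntegrallyClosed.isIntegral_iff.1 h2
  have hinj : Function.Injective (Algebra.linearMap R K) := IsFractionRing.injective R K
  let tr := (LinearEquiv.ofInjective (Algebra.linearMap R K) hinj).symm.toLinearMap ∘ₗ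
    T.codRestrict _ hT
  have htr (f : Module.End R M) : algebraMap R K (tr f) = T f := by
    have := (LinearEquiv.ofInjective (Algebra.linearMap R K) hinj).apply_symm_apply
      (T.codRestrict _ hT f)
    exact congrArg Subtype.val this
  refine ⟨tr, fun x y => hinj ?_, fun φ m => hinj ?_⟩
  · refine (htr _).trans (Eq.trans ?_ (htr _).symm)
    change LinearMap.trace K _ (Module.End.baseChangeHom R K M (x * y)) =
      LinearMap.trace K _ (Module.End.baseChangeHom R K M (y * x))
    rw [map_mul (Module.End.baseChangeHom R K M), map_mul (Module.End.baseChangeHom R K M),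
      LinearMap.trace_mul_comm]
  · refine (htr _).trans ?_
    have h1 : Module.End.baseChangeHom R K M (φ.smulRight m) =
        (Module.Dual.baseChange K φ).smulRight (1 ⊗ₜ[R] m) := by
      refine TensorProduct.AlgebraTensorModule.ext fun a x => ?_
      change a ⊗ₜ[R] (φ x • m) = (Module.Dual.baseChange K φ (a ⊗ₜ[R] x)) • (1 ⊗ₜ[R] m)
      rw [Module.Dual.baseChange_apply_tmul, TensorProduct.smul_tmul', smul_eq_mul, mul_one,
        TensorProduct.smul_tmul]
    change LinearMap.trace K _ (Module.End.baseChangeHom R K M (φ.smulRight m)) = _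
    rw [h1, LinearMap.trace_smulRight, Module.Dual.baseChange_apply_tmul, Algebra.smul_def, mul_one]
    rfl

variable [IsNoetherianRing R]

/-- M is generically free: an isomorphism of K ⊗ M with K^n and its inverse lift to M after clearing
denominators, and the scalar is the product of the two denominators. -/
theorem exists_smul_eq_sum_smulRight [Module.IsTorsionFree R M] :
    ∃ (a : R) (_ : a ≠ 0) (n : ℕ) (φ : Fin n → M →ₗ[R] R) (m : Fin n → M),
      ∀ x, a • x = ∑ i, φ i x • m i := by
  let K := FractionRing R
  let V := K ⊗[R] M
  let n := Module.finrank K V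
  let b := Module.finBasis K V
  let l : M →ₗ[R] V := TensorProduct.mk R K M 1
  let j : (Fin n → R) →ₗ[R] (Fin n → K) := (Algebra.linearMap R K).compLeft (Fin n)
  have hj : IsLocalizedModule R⁰ j := inferInstanceAs (IsLocalizedModule R⁰
    (LinearMap.pi fun i => (Algebra.linearMap R K) ∘ₗ LinearMap.proj i))
  have hl : IsLocalizedModule R⁰ l := inferInstance
  have : Module.FinitePresentation R M := Module.finitePresentation_of_finite R M
  obtain ⟨h, s, hs⟩ := Module.FinitePresentation.exists_lift_of_isLocalizedModule R⁰ j
    ((b.equivFun.toLinearMap.restrictScalars R) ∘ₗ l)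
  obtain ⟨h', s', hs'⟩ := Module.FinitePresentation.exists_lift_of_isLocalizedModule R⁰ l
    ((b.equivFun.symm.toLinearMap.restrictScalars R) ∘ₗ j)
  have key (x : M) : h' (h x) = (s'.1 * s.1) • x := by
    have h1 : j (h x) = s.1 • b.equivFun (l x) := LinearMap.congr_fun hs x
    have h2 : l (h' (h x)) = s'.1 • b.equivFun.symm (j (h x)) := LinearMap.congr_fun hs' (h x)
    have h3 : b.equivFun.symm (s.1 • b.equivFun (l x)) = s.1 • l x := by
      rw [← algebraMap_smul K s.1 (b.equivFun (l x)), map_smul, LinearEquiv.symm_apply_apply,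
        algebraMap_smul]
    rw [h1, h3, smul_smul, ← map_smul, IsLocalizedModule.eq_iff_exists R⁰ l] at h2
    obtain ⟨c, hc⟩ := h2
    exact smul_right_injective M (nonZeroDivisors.ne_zero c.2) hc
  refine ⟨s'.1 * s.1, mul_ne_zero (nonZeroDivisors.ne_zero s'.2) (nonZeroDivisors.ne_zero s.2), n,
    fun i => LinearMap.proj i ∘ₗ h, fun i => h' (Pi.single i 1), fun x => ?_⟩
  rw [← key]
  conv_lhs => rw [pi_eq_sum_univ' (h x)]
  rw [map_sum]
  refine Finset.sum_congr rfl fun i _ => ?_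
  rw [map_smul]
  rfl

variable [Module.IsReflexive R M]

theorem eq_zero_of_forall_dual_eq_zero {m : M} (h : ∀ φ : M →ₗ[R] R, φ m = 0) : m = 0 := by
  refine (Module.evalEquiv R M).injective (LinearMap.ext fun φ => ?_)
  simpa using h φ

-- On rank one endomorphisms the form is tr(x(φ(-)m)) = φ(xm). Reflexivity gives both nondegeneracy
-- and the representation of functionals; rank one endomorphisms suffice because they span up to a
-- nonzero scalar.
variable (R M) in
theorem exists_symmetrizing_trace [IsIntegrallyClosed R] :
    ∃ tr : Module.End R M →ₗ[R] R, (∀ x y, tr (x * y) = tr (y * x)) ∧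
      (∀ x, (∀ y, tr (x * y) = 0) → x = 0) ∧
      ∀ φ : Module.End R M →ₗ[R] R, ∃ x, ∀ y, tr (x * y) = φ y := by
  obtain ⟨tr, hsymm, htr⟩ := exists_trace (R := R) (M := M)
  have hcomp (x : Module.End R M) (φ : M →ₗ[R] R) (m : M) :
      x * φ.smulRight m = φ.smulRight (x m) := by
    ext z
    exact map_smul x _ _
  refine ⟨tr, hsymm, fun x hx => ?_, fun φ => ?_⟩
  · ext m
    refine eq_zero_of_forall_dual_eq_zero (R := R) fun ψ => ?_
    have := hx (ψ.smulRight m)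
    rwa [hcomp, htr] at this
  -- Restricting φ to rank one endomorphisms gives a map from M to its bidual, that is, an
  -- endomorphism of M.
  · let B : M →ₗ[R] Module.Dual R (Module.Dual R M) := LinearMap.mk₂ R
      (fun m ψ => φ (ψ.smulRight m))
      (fun m m' ψ => by rw [← map_add]; congr 1; ext; exact smul_add _ _ _)
      (fun c m ψ => by rw [← map_smul]; congr 1; ext; exact smul_comm _ _ _)
      (fun m ψ ψ' => by rw [← map_add]; congr 1; ext; exact add_smul _ _ _)
      (fun c m ψ => by rw [← map_smul]; congr 1; ext; exact mul_smul _ _ _)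
    let x : Module.End R M := (Module.evalEquiv R M).symm.toLinearMap ∘ₗ B
    have hx (ψ : M →ₗ[R] R) (m : M) : tr (x * ψ.smulRight m) = φ (ψ.smulRight m) := by
      rw [hcomp, htr]
      exact Module.apply_evalEquiv_symm_apply R M ψ (B m)
    -- A nonzero multiple of every y is a sum of rank one endomorphisms, and R is a domain, so
    -- agreement on those is enough.
    obtain ⟨a, ha, n, ψ, m, hsum⟩ := exists_smul_eq_sum_smulRight (R := R) (M := M)
    refine ⟨x, fun y => mul_left_cancel₀ ha ?_⟩
    have hy : a • y = ∑ i, ((ψ i).comp y).smulRight (m i) := by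
      ext z
      rw [LinearMap.sum_apply]
      exact hsum (y z)
    have h1 : a • tr (x * y) = a • φ y := by
      rw [← map_smul tr, ← map_smul φ, ← mul_smul_comm, hy, Finset.mul_sum, map_sum, map_sum]
      exact Finset.sum_congr rfl fun i _ => hx _ _
    exact h1

/-- Commuting with the rank one maps z ↦ φ(z)m gives φ(x)f(m) = φ(f(x))m, so f is multiplication by
a fraction. The fraction is integral over R because f is, hence lies in R. -/
theorem exists_eq_smul_of_commute [IsIntegrallyClosed R] [Nontrivial M]
    (f : Module.End R M) (hf : ∀ g : Module.End R M, f * g = g * f) : ∃ r : R, f = r • 1 := by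
  obtain ⟨x, hx⟩ := exists_ne (0 : M)
  obtain ⟨φ, hφ⟩ : ∃ φ : M →ₗ[R] R, φ x ≠ 0 := by
    by_contra! h
    exact hx (eq_zero_of_forall_dual_eq_zero h)
  have h1 (m : M) : φ x • f m = φ (f x) • m := by
    have := LinearMap.congr_fun (hf (φ.smulRight m)) x
    have h2 : f (φ x • m) = φ (f x) • m := this
    rwa [map_smul] at h2
  let K := FractionRing R
  let F := Module.End.baseChangeHom R K M
  have hc : algebraMap R K (φ x) ≠ 0 := by
    simpa using hφ
  have h3 : F f = algebraMap K _ (algebraMap R K (φ (f x)) / algebraMap R K (φ x)) := by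
    refine TensorProduct.AlgebraTensorModule.ext fun a m => ?_
    change a ⊗ₜ[R] f m = (algebraMap R K (φ (f x)) / algebraMap R K (φ x)) • (a ⊗ₜ[R] m)
    refine smul_right_injective _ hc ?_
    dsimp only
    rw [smul_smul, mul_div_cancel₀ _ hc, algebraMap_smul, algebraMap_smul, ← TensorProduct.tmul_smul,
      h1, TensorProduct.tmul_smul]
  have h4 : IsIntegral R (F f) :=
    IsIntegral.map F (Algebra.IsIntegral.isIntegral (R := R) f)
  have hinjl : Function.Injective (TensorProduct.mk R K M 1) := fun a b hab => by
    obtain ⟨c, hc⟩ := (IsLocalizedModule.eq_iff_exists R⁰ (TensorProduct.mk R K M 1)).1 hab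
    exact smul_right_injective M (nonZeroDivisors.ne_zero c.2) hc
  have : Nontrivial (K ⊗[R] M) := hinjl.nontrivial
  rw [h3] at h4
  have h5 : IsIntegral R (algebraMap R K (φ (f x)) / algebraMap R K (φ x)) := by
    obtain ⟨p, hp, h0⟩ := h4
    refine ⟨p, hp, (algebraMap K (Module.End K (K ⊗[R] M))).injective ?_⟩
    have hcomp : (algebraMap K (Module.End K (K ⊗[R] M))).comp (algebraMap R K) =
        algebraMap R (Module.End K (K ⊗[R] M)) :=
      RingHom.ext fun r => LinearMap.ext fun v => algebraMap_smul K r v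
    rw [Polynomial.hom_eval₂, map_zero, hcomp]
    exact h0
  obtain ⟨r, hr⟩ := IsIntegrallyClosed.isIntegral_iff.1 h5
  rw [eq_div_iff hc, ← map_mul] at hr
  have h6 : r * φ x = φ (f x) := IsFractionRing.injective R K hr
  refine ⟨r, LinearMap.ext fun m => smul_right_injective M hφ ?_⟩
  change φ x • f m = φ x • r • m
  rw [h1, ← h6, smul_smul, mul_comm]

end Trace

end NCCR

namespace NCCR

/-! ### Comparing extensions by Λ with extensions by R -/

open Abelian

theorem eq_zero_of_extClass_comp {C : Type w} [Category.{v} C] [Abelian C] [HasExt.{v} C]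
    {S : ShortComplex C} (hS : S.ShortExact) {Y : C} {i j : ℕ} (x : Ext S.X₁ Y i)
    (h₂ : Subsingleton (Ext S.X₂ Y i)) (hj : 1 + i = j) (h : hS.extClass.comp x hj = 0) :
    x = 0 := by
  obtain ⟨y, rfl⟩ := Ext.contravariant_sequence_exact₁ hS Y x hj h
  rw [Subsingleton.elim y 0, Ext.comp_zero]

theorem subsingleton_ext_of_projective {A : Type u} [Ring A] {F Y : ModuleCat.{u} A}
    (hF : Module.Projective A F) (i : ℕ) (hi : 0 < i) : Subsingleton (Ext F Y i) :=
  ExtVanishes.of_projective hF i hi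

section Transfer

attribute [local instance] restrictedModule restrictedModule_isScalarTower algebraLinear

variable {R : Type u} [CommRing R] {Λ : Type u} [Ring Λ] [Algebra R Λ]

variable (R) in
/-- The `R`-linear map underlying a morphism of `Λ`-modules. -/
def restrictHom {V W : ModuleCat.{u} Λ} (f : V ⟶ W) : ModuleCat.of R V ⟶ ModuleCat.of R W :=
  ModuleCat.ofHom (f.hom.restrictScalars R)

theorem ExtVanishes.of_dualBasis {W : ModuleCat.{u} Λ} (E : DualBasis W) {Y : ModuleCat.{u} R}
    (h : ExtVanishes (ModuleCat.of R Λ) Y) : ExtVanishes (ModuleCat.of R W) Y := by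
  refine .of_sum Finset.univ (fun _ => ModuleCat.of R Λ)
    (fun i => ModuleCat.ofHom
      { toFun w := E.ξ i w
        map_add' := map_add _
        map_smul' r w := by
          rw [RingHom.id_apply, Algebra.smul_def, ← smul_eq_mul, ← map_smul]
          rfl })
    (fun i => ModuleCat.ofHom
      { toFun c := c • E.x i
        map_add' c c' := add_smul _ _ _
        map_smul' r c := by
          rw [RingHom.id_apply, Algebra.smul_def, mul_smul]
          rfl }) ?_ (fun _ => h)
  ext w
  rw [ModuleCat.hom_sum, LinearMap.sum_apply]
  exact E.sum_eq w

theorem restrictHom_shortExact {S : ShortComplex (ModuleCat.{u} Λ)} (hS : S.ShortExact) :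
    (ShortComplex.mk (restrictHom R S.f) (restrictHom R S.g) (by
      ext x
      exact congrArg (fun φ => φ.hom x) S.zero)).ShortExact where
  exact := (ShortComplex.ShortExact.moduleCat_exact_iff_function_exact _).2
    ((ShortComplex.ShortExact.moduleCat_exact_iff_function_exact S).1 hS.exact)
  mono_f := (ModuleCat.mono_iff_injective _).2 hS.moduleCat_injective_f
  epi_g := (ModuleCat.epi_iff_surjective _).2 hS.moduleCat_surjective_g

variable {tr : Λ →ₗ[R] R} (htr : ∀ x y, tr (x * y) = tr (y * x))
  (hinj : ∀ x, (∀ y, tr (x * y) = 0) → x = 0)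
  (hsurj : ∀ φ : Λ →ₗ[R] R, ∃ x, ∀ y, tr (x * y) = φ y)

variable (Λ) in
/-- The algebra `Λ` as a left module over itself. -/
def regularModule : ModuleCat.{u} Λ := ModuleCat.of Λ Λ

variable (tr) in
/-- The composition with the trace `Λ → R`. -/
def traceHom {W : ModuleCat.{u} Λ} (f : W ⟶ ModuleCat.of Λ Λ) :
    ModuleCat.of R W ⟶ ModuleCat.of R R :=
  ModuleCat.ofHom
    { toFun w := tr (f.hom w)
      map_add' w w' := (congrArg tr (map_add f.hom w w')).trans (map_add tr _ _)
      map_smul' r w := by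
        rw [RingHom.id_apply, ← map_smul]
        congr 1
        rw [Algebra.smul_def]
        exact map_smul f.hom (algebraMap R Λ r) w }

-- Together with the next lemma: composition with the trace identifies Hom_Λ(W, Λ) with Hom_R(W, R),
-- since the form identifies Λ with the coinduced module Hom_R(Λ, R).
include htr hinj in
theorem eq_zero_of_traceHom_eq_zero {W : ModuleCat.{u} Λ} (f : W ⟶ ModuleCat.of Λ Λ)
    (h : traceHom tr f = 0) : f = 0 := by
  ext w
  refine hinj _ fun y => ?_
  rw [htr]
  have h1 : tr (f.hom (y • w)) = 0 := congrArg (fun φ => φ.hom (y • w)) h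
  rwa [map_smul] at h1

include htr hinj hsurj in
theorem exists_traceHom_eq {W : ModuleCat.{u} Λ} (φ : ModuleCat.of R W ⟶ ModuleCat.of R R) :
    ∃ f : W ⟶ regularModule Λ, traceHom tr f = φ := by
  have h (w : W) : ∃ x, ∀ y, tr (x * y) = φ.hom (y • w) := hsurj
    { toFun y := φ.hom (y • w)
      map_add' y y' := by
        have h1 : (y + y') • w = y • w + y' • w := add_smul _ _ _
        exact (congrArg φ.hom h1).trans (map_add φ.hom _ _)
      map_smul' r y := by
        have h1 : (r • y) • w = r • (y • w) := smul_assoc r y w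
        exact (congrArg φ.hom h1).trans (map_smul φ.hom _ _) }
  choose a ha using h
  have hu (x x' : Λ) (h : ∀ y, tr (x * y) = tr (x' * y)) : x = x' :=
    sub_eq_zero.1 (hinj _ fun y => by rw [sub_mul, map_sub, h, sub_self])
  refine ⟨ModuleCat.ofHom
    { toFun := a
      map_add' w w' := hu _ _ fun y => by
        rw [ha, add_mul, map_add, ha, ha, smul_add]
        exact map_add φ.hom _ _
      map_smul' c w := hu _ _ fun y => by
        rw [ha, smul_smul, ← ha, ← mul_assoc, htr, RingHom.id_apply, smul_eq_mul, mul_assoc] }, ?_⟩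
  ext w
  have := ha w 1
  rw [mul_one, one_smul] at this
  exact this

theorem traceHom_smul_sub {W : ModuleCat.{u} Λ} (s : R) (φ ψ : W ⟶ regularModule Λ) :
    traceHom tr (s • φ - ψ) = s • traceHom tr φ - traceHom tr ψ := by
  ext w
  have h (c d : Λ) : tr (algebraMap R Λ s * c - d) = s • tr c - tr d := by
    rw [map_sub, ← Algebra.smul_def, map_smul]
  exact h _ _

variable [IsNoetherianRing Λ]

include htr hinj hsurj in
/-- A map from `Ext_Λ(N, Λ)` to `Ext_R(N, R)` which detects annihilators. -/
theorem exists_ext_trace (hΛ : ExtVanishes (ModuleCat.of R Λ) (ModuleCat.of R R)) {i : ℕ}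
    {N : ModuleCat.{u} Λ} [Module.Finite Λ N] (e : Ext N (regularModule Λ) (i + 1)) :
    ∃ e' : Ext (ModuleCat.of R N) (ModuleCat.of R R) (i + 1), ∀ s : R, s • e' = 0 → s • e = 0 := by
  induction i generalizing N with
  | zero =>
    obtain ⟨K, F, f, g, w, hse, _, _, hfree⟩ := exists_shortExact_free N
    have hse' := restrictHom_shortExact (R := R) hse
    have hF : Projective F := (IsProjective.iff_projective F).1
      (Module.Projective.of_free (R := Λ) (P := F))
    obtain ⟨x, rfl⟩ := Ext.contravariant_sequence_exact₃ hse _ e (Ext.eq_zero_of_projective _)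
      (add_comm 1 0)
    obtain ⟨φ, rfl⟩ := (Ext.mk₀_bijective K _).surjective x
    refine ⟨hse'.extClass.comp (Ext.mk₀ (traceHom tr φ)) (add_comm 1 0), fun s hs => ?_⟩
    rw [← Ext.comp_smul] at hs
    obtain ⟨y, hy⟩ := Ext.contravariant_sequence_exact₁ hse' _ _ (add_comm 1 0) hs
    obtain ⟨ψ, rfl⟩ := (Ext.mk₀_bijective _ _).surjective y
    obtain ⟨χ, rfl⟩ := exists_traceHom_eq (W := F) htr hinj hsurj ψ
    rw [Ext.mk₀_comp_mk₀, ← Ext.mk₀_smul] at hy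
    have h1 : restrictHom R f ≫ traceHom tr χ = s • traceHom tr φ :=
      (Ext.mk₀_bijective _ _).injective hy
    -- The relation holds after composing with the trace, and Λ-linear maps to Λ are determined by
    -- that composite.
    have h2 : s • φ = f ≫ χ := by
      refine sub_eq_zero.1 (eq_zero_of_traceHom_eq_zero htr hinj _ ?_)
      exact (traceHom_smul_sub s φ (f ≫ χ)).trans (sub_eq_zero.2 h1.symm)
    rw [← Ext.comp_smul, ← Ext.mk₀_smul]
    rw [h2, ← Ext.mk₀_comp_mk₀]
    exact hse.extClass_comp_assoc _
  | succ i ih =>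
    obtain ⟨K, F, f, g, w, hse, _, _, hfree⟩ := exists_shortExact_free N
    have hse' := restrictHom_shortExact (R := R) hse
    have hproj := Module.Projective.of_free (R := Λ) (P := F)
    have hF : Projective F := (IsProjective.iff_projective F).1 hproj
    obtain ⟨x, rfl⟩ := Ext.contravariant_sequence_exact₃ hse _ e (Ext.eq_zero_of_projective _)
      (add_comm 1 (i + 1))
    obtain ⟨x', hx'⟩ := ih x
    refine ⟨hse'.extClass.comp x' (add_comm 1 (i + 1)), fun s hs => ?_⟩
    rw [← Ext.comp_smul] at hs ⊢
    -- As an R-module F is a summand of a power of Λ, so its higher Ext into R vanish and the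
    -- connecting map for R is injective; vanishing may thus be tested on the syzygy K.
    rw [hx' s (eq_zero_of_extClass_comp hse' (s • x') (ExtVanishes.of_dualBasis
      (nonempty_dualBasis F).some hΛ (i + 1) (by lia)) _ hs), Ext.comp_zero]

end Transfer

/-! ### Projective dimension tested on finite modules -/

section ProjectiveDimension

variable {A : Type u} [Ring A]

theorem subsingleton_ext_of_sum {X Y : ModuleCat.{u} A} {ι : Type*} (s : Finset ι)
    (Z : ModuleCat.{u} A) (f : ι → (Y ⟶ Z)) (g : ι → (Z ⟶ Y)) (h : ∑ i ∈ s, f i ≫ g i = 𝟙 Y)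
    {n : ℕ} (hZ : Subsingleton (Ext X Z n)) : Subsingleton (Ext X Y n) := by
  refine subsingleton_of_forall_eq 0 fun x => ?_
  let c : (Y ⟶ Y) →+ Ext X Y n :=
    { toFun f := x.comp (Ext.mk₀ f) (add_zero n)
      map_zero' := by rw [Ext.mk₀_zero, Ext.comp_zero]
      map_add' f g := by rw [Ext.mk₀_add, Ext.comp_add] }
  refine (Ext.comp_mk₀_id x).symm.trans ?_
  change c (𝟙 Y) = 0
  rw [← h, map_sum]
  refine Finset.sum_eq_zero fun j _ => ?_
  change x.comp (Ext.mk₀ (f j ≫ g j)) (add_zero n) = 0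
  rw [← Ext.mk₀_comp_mk₀, ← Ext.comp_assoc_of_second_deg_zero, hZ.elim (x.comp _ _) 0,
    Ext.zero_comp]

theorem DualBasis.sum_comp {F : ModuleCat.{u} A} (D : DualBasis F) :
    ∑ i, ModuleCat.ofHom (D.ξ i) ≫ ModuleCat.ofHom (LinearMap.toSpanSingleton A F (D.x i)) =
      𝟙 F := by
  ext v
  rw [ModuleCat.hom_sum, LinearMap.sum_apply]
  exact D.sum_eq v

theorem subsingleton_ext_of_dualBasis {X F : ModuleCat.{u} A} (D : DualBasis F) {n : ℕ}
    (h : Subsingleton (Ext X (ModuleCat.of A A) n)) : Subsingleton (Ext X F n) :=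
  subsingleton_ext_of_sum Finset.univ _ _ _ D.sum_comp h

variable [IsNoetherianRing A]

/-- The kernel of a finite free cover is finite over a noetherian ring, so the hypothesis already
splits the cover. -/
theorem projective_of_subsingleton_ext {P : ModuleCat.{u} A} [Module.Finite A P]
    (h : ∀ Y : ModuleCat.{u} A, Module.Finite A Y → Subsingleton (Ext P Y 1)) :
    Module.Projective A P := by
  obtain ⟨K, F, f, g, w, hse, hK, _, hfree⟩ := exists_shortExact_free P
  have := h K hK
  obtain ⟨y, hy⟩ := Ext.covariant_sequence_exact₃ P hse (Ext.mk₀ (𝟙 P)) (zero_add 1)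
    (Subsingleton.elim _ _)
  obtain ⟨ψ, rfl⟩ := (Ext.mk₀_bijective _ _).surjective y
  rw [Ext.mk₀_comp_mk₀] at hy
  have h1 : ψ ≫ g = 𝟙 P := (Ext.mk₀_bijective _ _).injective hy
  have := Module.Projective.of_free (R := A) (P := F)
  exact Module.Projective.of_split ψ.hom g.hom (congrArg ModuleCat.Hom.hom h1)

/-- Descending induction on the degree, starting beyond the global dimension: Ext^i(X, Y) lies
between Ext^i(X, F) for a finite free cover F of Y and Ext^{i+1} of X into its kernel. -/
theorem subsingleton_ext_of_finiteGlobalDimension (hA : HasFiniteGlobalDimension A)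
    {X : ModuleCat.{u} A} {n : ℕ}
    (h : ∀ i, n ≤ i → 0 < i → Subsingleton (Ext X (ModuleCat.of A A) i)) {i : ℕ} (hn : n ≤ i)
    (hi : 0 < i) (Y : ModuleCat.{u} A) [Module.Finite A Y] : Subsingleton (Ext X Y i) := by
  obtain ⟨g, hg⟩ := hA
  by_cases hig : g < i
  · have := hg X
    exact HasProjectiveDimensionLT.subsingleton X (g + 1) i (by lia) Y
  · obtain ⟨d, hd⟩ : ∃ d, g + 1 = i + d := ⟨g + 1 - i, by lia⟩
    clear hig
    induction d generalizing i Y with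
    | zero =>
      have := hg X
      exact HasProjectiveDimensionLT.subsingleton X (g + 1) i (by lia) Y
    | succ d ih =>
      obtain ⟨K, F, f, g, w, hse, hK, _, hfree⟩ := exists_shortExact_free Y
      have := ih (i := i + 1) (by lia) (by lia) K (by lia)
      refine subsingleton_of_forall_eq 0 fun x => ?_
      obtain ⟨y, rfl⟩ := Ext.covariant_sequence_exact₃ X hse x rfl (Subsingleton.elim _ _)
      have hproj := Module.Projective.of_free (R := A) (P := F)
      have hy : y = 0 := (subsingleton_ext_of_dualBasis (nonempty_dualBasis F).some
        (h i hn hi)).elim _ _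
      rw [hy, Ext.zero_comp]

end ProjectiveDimension

/-! ### Reflexive modules as second syzygies -/

section Reflexive

variable {R M : Type u} [CommRing R] [IsNoetherianRing R] [AddCommGroup M] [Module R M]
  [Module.Finite R M] [Module.IsReflexive R M]

variable (R M) in
/-- A reflexive module is a second syzygy. -/
theorem exists_second_syzygy : ∃ (F I G C : ModuleCat.{u} R) (f : ModuleCat.of R M ⟶ F) (g : F ⟶ I)
    (w : f ≫ g = 0) (f' : I ⟶ G) (g' : G ⟶ C) (w' : f' ≫ g' = 0),
    (ShortComplex.mk f g w).ShortExact ∧ (ShortComplex.mk f' g' w').ShortExact ∧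
      (Module.Finite R F ∧ Module.Projective R F) ∧ (Module.Finite R G ∧ Module.Projective R G) ∧
      Module.Finite R C := by
  have hfin : Module.Finite R (Module.Dual R M) := inferInstance
  -- A finite free presentation of the dual of M is dualised. Then M, being its own bidual, is the
  -- kernel of `D`, and C is the cokernel.
  obtain ⟨b, q, hq⟩ := Module.Finite.exists_fin' R (Module.Dual R M)
  obtain ⟨a, u, hu⟩ := Module.Finite.exists_fin' R (LinearMap.ker q)
  let v : (Fin a → R) →ₗ[R] (Fin b → R) := (LinearMap.ker q).subtype ∘ₗ u
  let D : Module.Dual R (Fin b → R) →ₗ[R] Module.Dual R (Fin a → R) := v.dualMap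
  let j : M →ₗ[R] Module.Dual R (Fin b → R) := q.dualMap ∘ₗ (Module.evalEquiv R M).toLinearMap
  have hj : Function.Injective j :=
    (LinearMap.dualMap_injective_of_surjective hq).comp (Module.evalEquiv R M).injective
  have hex : Function.Exact j D.rangeRestrict := fun φ => by
    constructor
    · intro h
      have h1 : φ ∘ₗ v = 0 := congrArg Subtype.val h
      have h2 : LinearMap.ker q ≤ LinearMap.ker φ := fun x hx => by
        obtain ⟨y, hy⟩ := hu ⟨x, hx⟩
        have h3 := LinearMap.congr_fun h1 y
        have h4 : v y = x := congrArg Subtype.val hy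
        rw [LinearMap.comp_apply, h4] at h3
        exact h3
      let ψ : Module.Dual R (Module.Dual R M) := (LinearMap.ker q).liftQ φ h2 ∘ₗ
        (q.quotKerEquivOfSurjective hq).symm.toLinearMap
      refine ⟨(Module.evalEquiv R M).symm ψ, ?_⟩
      refine LinearMap.ext fun x => ?_
      change (Module.evalEquiv R M ((Module.evalEquiv R M).symm ψ)) (q x) = φ x
      rw [LinearEquiv.apply_symm_apply]
      change (LinearMap.ker q).liftQ φ h2 ((q.quotKerEquivOfSurjective hq).symm (q x)) = φ x
      have h5 : (q.quotKerEquivOfSurjective hq).symm (q x) = Submodule.Quotient.mk x :=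
        (LinearEquiv.symm_apply_eq _).2 rfl
      rw [h5]
      rfl
    · rintro ⟨m, rfl⟩
      refine Subtype.ext (LinearMap.ext fun y => ?_)
      change (Module.evalEquiv R M m) (q (v y)) = 0
      have h1 : q (v y) = 0 := (u y).2
      rw [h1, map_zero]
  refine ⟨.of R (Module.Dual R (Fin b → R)), .of R (LinearMap.range D),
    .of R (Module.Dual R (Fin a → R)), .of R (Module.Dual R (Fin a → R) ⧸ LinearMap.range D),
    ModuleCat.ofHom j, ModuleCat.ofHom D.rangeRestrict, ?_, ModuleCat.ofHom (Submodule.subtype _),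
    ModuleCat.ofHom (Submodule.mkQ _), ?_, ?_, ?_, ⟨?_, ?_⟩, ⟨?_, ?_⟩, ?_⟩
  · refine ModuleCat.hom_ext (LinearMap.ext fun m => ?_)
    exact hex.apply_apply_eq_zero m
  · refine ModuleCat.hom_ext (LinearMap.ext fun x => ?_)
    exact (Submodule.Quotient.mk_eq_zero _).2 x.2
  · exact { exact := (ShortComplex.ShortExact.moduleCat_exact_iff_function_exact _).2 hex
            mono_f := (ModuleCat.mono_iff_injective _).2 hj
            epi_g := (ModuleCat.epi_iff_surjective _).2 D.surjective_rangeRestrict }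
  · exact { exact := (ShortComplex.ShortExact.moduleCat_exact_iff_function_exact _).2
              (LinearMap.exact_subtype_mkQ _)
            mono_f := (ModuleCat.mono_iff_injective _).2 (Submodule.injective_subtype _)
            epi_g := (ModuleCat.epi_iff_surjective _).2 (Submodule.mkQ_surjective _) }
  · exact inferInstanceAs (Module.Finite R (Module.Dual R (Fin b → R)))
  · exact inferInstanceAs (Module.Projective R (Module.Dual R (Fin b → R)))
  · exact inferInstanceAs (Module.Finite R (Module.Dual R (Fin a → R)))
  · exact inferInstanceAs (Module.Projective R (Module.Dual R (Fin a → R)))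
  · exact inferInstanceAs (Module.Finite R (Module.Dual R (Fin a → R) ⧸ LinearMap.range D))

/-- Two connecting maps embed Ext^{i+1}(M, R) into Ext^{i+3}(C, R), since the intermediate terms are
projective. The two degrees gained are the reason for i + 3. -/
theorem exists_smul_ext_reflexive_eq_zero (hR : IsGorenstein R) (p : Ideal R) [p.IsPrime] {i : ℕ}
    (hi : p.height < (i + 3 : ℕ)) (x : Ext (ModuleCat.of R M) (ModuleCat.of R R) (i + 1)) :
    ∃ s ∈ p.primeCompl, s • x = 0 := by
  obtain ⟨F, I, G, C, f, g, w, f', g', w', h₁, h₂, ⟨_, hF⟩, ⟨_, hG⟩, _⟩ := exists_second_syzygy R M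
  obtain ⟨s, hs, h0⟩ := exists_smul_ext_eq_zero_of_height_lt hR p hi
    (h₂.extClass.comp (h₁.extClass.comp x (add_comm 1 (i + 1))) (add_comm 1 (i + 2)))
  refine ⟨s, hs, ?_⟩
  rw [← Ext.comp_smul, ← Ext.comp_smul] at h0
  exact eq_zero_of_extClass_comp h₁ _ (subsingleton_ext_of_projective hF _ (by lia)) _
    (eq_zero_of_extClass_comp h₂ _ (subsingleton_ext_of_projective hG _ (by lia)) _ h0)

end Reflexive

end NCCR

namespace NCCR

/-! ### The depth argument for the first extension group -/

open Abelian

section CovariantSequence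

variable {C : Type w} [Category.{v} C] [Abelian C] [HasExt.{v} C] {S : ShortComplex C}

theorem subsingleton_ext_right_X₃ (hS : S.ShortExact) {X : C} {i : ℕ}
    (h₂ : Subsingleton (Ext X S.X₂ i)) (h₁ : Subsingleton (Ext X S.X₁ (i + 1))) :
    Subsingleton (Ext X S.X₃ i) := by
  refine subsingleton_of_forall_eq 0 fun x => ?_
  obtain ⟨y, rfl⟩ := Ext.covariant_sequence_exact₃ X hS x rfl (Subsingleton.elim _ _)
  rw [Subsingleton.elim y 0, Ext.zero_comp]

theorem subsingleton_ext_right_X₁ (hS : S.ShortExact) {X : C} {i : ℕ}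
    (h₃ : Subsingleton (Ext X S.X₃ i)) (h₂ : Subsingleton (Ext X S.X₂ (i + 1))) :
    Subsingleton (Ext X S.X₁ (i + 1)) := by
  refine subsingleton_of_forall_eq 0 fun x => ?_
  obtain ⟨y, rfl⟩ := Ext.covariant_sequence_exact₁ X hS x (Subsingleton.elim _ _) rfl
  rw [Subsingleton.elim y 0, Ext.zero_comp]

theorem subsingleton_ext_right_X₁_zero (hS : S.ShortExact) {X : C}
    (h₂ : Subsingleton (Ext X S.X₂ 0)) : Subsingleton (Ext X S.X₁ 0) := by
  have := hS.mono_f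
  have h : Subsingleton (X ⟶ S.X₂) := Ext.homEquiv₀.symm.subsingleton
  refine subsingleton_of_forall_eq 0 fun x => ?_
  obtain ⟨φ, rfl⟩ := (Ext.mk₀_bijective X S.X₁).surjective x
  have hφ : φ = 0 := (cancel_mono S.f).1 (h.elim _ _)
  rw [hφ, Ext.mk₀_zero]

end CovariantSequence

attribute [local instance] restrictedModule restrictedModule_isScalarTower algebraLinear

section

variable {R : Type u} [CommRing R] {Λ : Type u} [Ring Λ] [Algebra R Λ]

theorem subsingleton_ext_hom {P W : ModuleCat.{u} Λ} (D : DualBasis P) {X : ModuleCat.{u} R} {i : ℕ}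
    (h : Subsingleton (Ext X (ModuleCat.of R W) i)) :
    Subsingleton (Ext X (ModuleCat.of R (P ⟶ W)) i) := by
  refine subsingleton_ext_of_sum Finset.univ (ModuleCat.of R W)
    (fun j => ModuleCat.ofHom
      { toFun (f : P ⟶ W) := f.hom (D.x j)
        map_add' f g := rfl
        map_smul' r f := rfl })
    (fun j => ModuleCat.ofHom
      { toFun (w : W) := (rankOne (D.ξ j) w : P ⟶ W)
        map_add' w w' := by
          ext v
          exact smul_add _ _ _
        map_smul' r w := by
          ext v
          change D.ξ j v • (algebraMap R Λ r • w) = algebraMap R Λ r • (D.ξ j v • w)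
          rw [smul_smul, smul_smul, Algebra.commutes] }) ?_ h
  ext f : 2
  rw [ModuleCat.hom_sum, LinearMap.sum_apply]
  exact (D.eq_sum_rankOne f).symm

variable [IsNoetherianRing R]

/-- If `Hom(W, W) = R`, the module `Ext¹(W, W)` has no nonzero elements killed by a prime which
is large in the sense of depth. -/
theorem eq_zero_of_smul_eq_zero {W P Q : ModuleCat.{u} Λ} (D : DualBasis P) (E : DualBasis Q)
    {f : Q ⟶ P} {g : P ⟶ W} {w : f ≫ g = 0} (hS : (ShortComplex.mk f g w).ShortExact)
    (hW : Function.Bijective (fun r : R => r • 𝟙 W)) (p : Ideal R)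
    (h₀ : Subsingleton (Ext (ModuleCat.of R (R ⧸ p)) (ModuleCat.of R W) 0))
    (h₁ : Subsingleton (Ext (ModuleCat.of R (R ⧸ p)) (ModuleCat.of R W) 1))
    (h₂ : Subsingleton (Ext (ModuleCat.of R (R ⧸ p)) (ModuleCat.of R R) 2))
    (hP : Projective P) (e : Ext W W 1) (he : ∀ r ∈ p, r • e = 0) : e = 0 := by
  have hepi : Epi g := hS.epi_g
  let Φ : (P ⟶ W) →ₗ[R] (Q ⟶ W) := Linear.leftComp R W f
  let ι : R →ₗ[R] (P ⟶ W) := LinearMap.toSpanSingleton R (P ⟶ W) g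
  have hιg (r : R) : ι r = g ≫ (r • 𝟙 W) := by
    rw [Linear.comp_smul, Category.comp_id]
    rfl
  have hι : Function.Injective ι := fun r r' h => hW.1 (by
    rw [hιg, hιg] at h
    exact (cancel_epi g).1 h)
  -- A map from P vanishing on Q factors through W, and endomorphisms of W are scalars.
  have hex : Function.Exact ι Φ.rangeRestrict := fun h => by
    constructor
    · intro h0
      have h0' : f ≫ h = 0 := congrArg Subtype.val h0
      obtain ⟨r, hr⟩ := hW.2 (hS.gIsCokernel.desc (CokernelCofork.ofπ h h0'))
      refine ⟨r, (hιg r).trans ?_⟩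
      have hr' : r • 𝟙 W = hS.gIsCokernel.desc (CokernelCofork.ofπ h h0') := hr
      rw [hr']
      exact hS.gIsCokernel.fac (CokernelCofork.ofπ h h0') WalkingParallelPair.one
    · rintro ⟨r, rfl⟩
      refine Subtype.ext ?_
      change f ≫ ι r = 0
      rw [hιg, reassoc_of% w, zero_comp]
  have hse₁ : (ShortComplex.mk (ModuleCat.ofHom ι) (ModuleCat.ofHom Φ.rangeRestrict)
      (ModuleCat.hom_ext (LinearMap.ext fun x => hex.apply_apply_eq_zero x))).ShortExact :=
    { exact := (ShortComplex.ShortExact.moduleCat_exact_iff_function_exact _).2 hex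
      mono_f := (ModuleCat.mono_iff_injective _).2 hι
      epi_g := (ModuleCat.epi_iff_surjective _).2 Φ.surjective_rangeRestrict }
  have hse₂ : (ShortComplex.mk (ModuleCat.ofHom (LinearMap.range Φ).subtype)
      (ModuleCat.ofHom (LinearMap.range Φ).mkQ)
      (ModuleCat.hom_ext (LinearMap.ext fun x => (Submodule.Quotient.mk_eq_zero _).2 x.2))).ShortExact :=
    { exact := (ShortComplex.ShortExact.moduleCat_exact_iff_function_exact _).2
        (LinearMap.exact_subtype_mkQ _)
      mono_f := (ModuleCat.mono_iff_injective _).2 (Submodule.injective_subtype _)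
      epi_g := (ModuleCat.epi_iff_surjective _).2 (Submodule.mkQ_surjective _) }
  -- Depth count: depth 3 of R and depth 2 of Hom(P, W) give depth 2 of the image of Φ; with depth 1
  -- of Hom(Q, W) the cokernel gets depth 1.
  have hk : Subsingleton (Ext (ModuleCat.of R (R ⧸ p))
      (ModuleCat.of R ((Q ⟶ W) ⧸ LinearMap.range Φ)) 0) :=
    subsingleton_ext_right_X₃ hse₂ (subsingleton_ext_hom E h₀)
      (subsingleton_ext_right_X₃ hse₁ (subsingleton_ext_hom D h₁) h₂)
  have hk' : Subsingleton (ModuleCat.of R (R ⧸ p) ⟶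
      ModuleCat.of R ((Q ⟶ W) ⧸ LinearMap.range Φ)) := Ext.homEquiv₀.symm.subsingleton
  obtain ⟨x, rfl⟩ := Ext.contravariant_sequence_exact₃ hS W e (Ext.eq_zero_of_projective _)
    (add_comm 1 0)
  obtain ⟨h, rfl⟩ := (Ext.mk₀_bijective Q W).surjective x
  -- The class of h in the cokernel represents e, so it is killed by p and defines a map from R/p,
  -- which must be zero.
  have hker : p ≤ LinearMap.ker (LinearMap.toSpanSingleton R _ ((LinearMap.range Φ).mkQ h)) := by
    intro r hr
    have h3 := he r hr
    rw [← Ext.comp_smul] at h3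
    obtain ⟨y, hy⟩ := Ext.contravariant_sequence_exact₁ hS W _ (add_comm 1 0) h3
    obtain ⟨ψ, rfl⟩ := (Ext.mk₀_bijective P W).surjective y
    rw [← Ext.mk₀_smul, Ext.mk₀_comp_mk₀] at hy
    have h4 : f ≫ ψ = r • h := (Ext.mk₀_bijective _ _).injective hy
    change r • (LinearMap.range Φ).mkQ h = 0
    rw [← map_smul]
    exact (Submodule.Quotient.mk_eq_zero _).2 ⟨ψ, h4⟩
  have h5 : p.liftQ (LinearMap.toSpanSingleton R _ ((LinearMap.range Φ).mkQ h)) hker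
      (Submodule.Quotient.mk 1) = 0 := congrArg (fun φ => φ.hom (Submodule.Quotient.mk 1))
    (hk'.elim (ModuleCat.ofHom (p.liftQ _ hker)) 0)
  rw [Submodule.liftQ_apply, LinearMap.toSpanSingleton_apply, one_smul] at h5
  obtain ⟨ψ, hψ⟩ := (Submodule.Quotient.mk_eq_zero _).1 h5
  have hψ' : f ≫ ψ = h := hψ
  rw [← hψ', ← Ext.mk₀_comp_mk₀]
  exact hS.extClass_comp_assoc _

end

section Reflexive

variable {R M : Type u} [CommRing R] [IsNoetherianRing R] [AddCommGroup M] [Module R M]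
  [Module.Finite R M] [Module.IsReflexive R M]

/-- A second syzygy inherits depth up to 2 from the ring. -/
theorem subsingleton_ext_reflexive {X : ModuleCat.{u} R}
    (h₀ : Subsingleton (Ext X (ModuleCat.of R R) 0))
    (h₁ : Subsingleton (Ext X (ModuleCat.of R R) 1)) :
    Subsingleton (Ext X (ModuleCat.of R M) 0) ∧ Subsingleton (Ext X (ModuleCat.of R M) 1) := by
  obtain ⟨F, I, G, C, f, g, w, f', g', w', hse₁, hse₂, ⟨_, _⟩, ⟨_, _⟩, _⟩ := exists_second_syzygy R M
  obtain ⟨D⟩ := nonempty_dualBasis F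
  obtain ⟨D'⟩ := nonempty_dualBasis G
  exact ⟨subsingleton_ext_right_X₁_zero hse₁ (subsingleton_ext_of_dualBasis D h₀),
    subsingleton_ext_right_X₁ hse₁
      (subsingleton_ext_right_X₁_zero hse₂ (subsingleton_ext_of_dualBasis D' h₀))
      (subsingleton_ext_of_dualBasis D h₁)⟩

variable (R M) in
/-- The module `M`, as a module over its endomorphism ring. -/
def tautologicalModule : ModuleCat.{u} (Module.End R M) := ModuleCat.of (Module.End R M) M

variable (R M) in
/-- The `R`-module underlying the tautological module. -/
def restrictTautologicalModule : ModuleCat.of R (tautologicalModule R M) ≅ ModuleCat.of R M :=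
  LinearEquiv.toModuleIso
    { toFun x := x
      invFun x := x
      map_add' _ _ := rfl
      map_smul' _ _ := rfl
      left_inv _ := rfl
      right_inv _ := rfl }

instance : Module.Finite (Module.End R M) (tautologicalModule R M) := by
  obtain ⟨s, hs⟩ := Module.Finite.fg_top (R := R) (M := M)
  suffices h : ∀ x ∈ Submodule.span R (s : Set M),
      x ∈ Submodule.span (Module.End R M) ((s : Set M) : Set (tautologicalModule R M)) from
    ⟨s, eq_top_iff.2 fun x _ => h x (hs ▸ trivial)⟩
  intro x hx
  induction hx using Submodule.span_induction with
  | mem x h => exact Submodule.subset_span h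
  | zero => exact zero_mem _
  | add x y _ _ h h' => exact add_mem h h'
  | smul r x _ h => exact Submodule.smul_mem _ (algebraMap R (Module.End R M) r) h

/-- A Λ-linear endomorphism of M is an R-linear one commuting with all of Λ, hence a scalar. -/
theorem bijective_smul_id [IsDomain R] [IsIntegrallyClosed R] [Nontrivial M] :
    Function.Bijective (fun r : R => r • 𝟙 (tautologicalModule R M)) := by
  constructor
  · intro r r' h
    obtain ⟨x, hx⟩ := exists_ne (0 : M)
    have h1 : r • x = r' • x := congrArg (fun φ => φ.hom x) h
    exact smul_left_injective R hx h1
  · intro θ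
    let f : Module.End R M :=
      { toFun x := θ.hom x
        map_add' := map_add θ.hom
        map_smul' r x := map_smul θ.hom (algebraMap R (Module.End R M) r) x }
    obtain ⟨r, hr⟩ := exists_eq_smul_of_commute f fun g =>
      LinearMap.ext fun x => map_smul θ.hom g x
    refine ⟨r, ?_⟩
    ext x
    exact (LinearMap.congr_fun hr x).symm

/-- An Azumaya algebra is faithful, so the algebra at the generic point is not zero. -/
theorem IsNCCR.nontrivial [IsDomain R] (h : IsNCCR R (Module.End R M)) : Nontrivial M := by
  by_contra hM
  rw [not_nontrivial_iff_subsingleton] at hM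
  have hz : IsAzumaya (Localization.AtPrime (⊥ : Ideal R))
      (TensorProduct R (Localization.AtPrime (⊥ : Ideal R)) (Module.End R M)) :=
    h.reflexiveAzumaya.azumaya ⊥ (by simp)
  have hs : Subsingleton (TensorProduct R (Localization.AtPrime (⊥ : Ideal R)) (Module.End R M)) :=
    inferInstance
  have h01 : (0 : Localization.AtPrime (⊥ : Ideal R)) = 1 :=
    hz.toFaithfulSMul.eq_of_smul_eq_smul fun x => hs.elim _ _
  exact zero_ne_one h01

variable [IsDomain R] [IsIntegrallyClosed R]

/-- The trace detects the class in Ext_R(M, R), where reflexivity and the Gorenstein property kill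
it locally. -/
theorem IsNCCR.exists_smul_ext_eq_zero (h : IsNCCR R (Module.End R M)) (p : Ideal R) [p.IsPrime]
    {i : ℕ} (hi : p.height < (i + 3 : ℕ)) (e : Ext (tautologicalModule R M)
      (ModuleCat.of (Module.End R M) (Module.End R M)) (i + 1)) : ∃ s ∈ p.primeCompl, s • e = 0 := by
  obtain ⟨tr, htr, hinj, hsurj⟩ := exists_symmetrizing_trace R M
  obtain ⟨e', he'⟩ := exists_ext_trace htr hinj hsurj
    (h.maximalCohenMacaulay.extVanishes h.gorenstein) e
  let ι := restrictTautologicalModule R M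
  obtain ⟨s, hs, h0⟩ := exists_smul_ext_reflexive_eq_zero h.gorenstein p hi
    ((Ext.mk₀ ι.inv).comp e' (zero_add _))
  refine ⟨s, hs, he' s ?_⟩
  rw [← Ext.comp_smul] at h0
  have := congrArg (fun z => (Ext.mk₀ ι.hom).comp z (zero_add _)) h0
  simpa [Ext.mk₀_comp_mk₀_assoc] using this

/-- Degrees at least 2 vanish because M has projective dimension at most 1. In degree 1 an
associated prime is excluded by local projectivity if its height is less than 3, and by depth if its
height is 3. -/
theorem IsNCCR.extVanishes (h : IsNCCR R (Module.End R M)) (hR : ringKrullDim R ≤ 3) :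
    ExtVanishes (tautologicalModule R M) (tautologicalModule R M) := by
  let Λ := Module.End R M
  let V := tautologicalModule R M
  have hM := h.nontrivial
  have hht (p : Ideal R) [p.IsPrime] : p.height ≤ 3 := by
    have h1 : (p.height : WithBot ℕ∞) ≤ ((3 : ℕ∞) : WithBot ℕ∞) :=
      Ideal.height_le_ringKrullDim_of_isPrime.trans hR
    exact WithBot.coe_le_coe.1 h1
  -- Heights are at most 3, and the local vanishing in degree i ≥ 2 needs a height less than i + 2.
  have h2 (i : ℕ) (hi : 2 ≤ i) (_ : 0 < i) : Subsingleton (Ext V (ModuleCat.of Λ Λ) i) := by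
    obtain ⟨j, rfl⟩ : ∃ j, i = (j + 1) + 1 := ⟨i - 2, by lia⟩
    refine subsingleton_of_forall_eq 0 fun e => eq_zero_of_forall_isMaximal (R := R) e fun m _ =>
      h.exists_smul_ext_eq_zero m ((hht m).trans_lt ?_) e
    exact_mod_cast (by lia : 3 < j + 1 + 3)
  have h2' (i : ℕ) (hi : 2 ≤ i) (Y : ModuleCat.{u} Λ) (_ : Module.Finite Λ Y) :
      Subsingleton (Ext V Y i) :=
    subsingleton_ext_of_finiteGlobalDimension h.finiteGlobalDimension h2 hi (by lia) Y
  obtain ⟨Q, P, f, g, w, hS, hQfin, hPfin, hPfree⟩ := exists_shortExact_free V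
  have hPp := Module.Projective.of_free (R := Λ) (P := P)
  have hP : Projective P := (IsProjective.iff_projective P).1 hPp
  -- Projective dimension at most 1: Ext^1(Q, Y) embeds into Ext^2(V, Y) = 0.
  have hQp : Module.Projective Λ Q := projective_of_subsingleton_ext fun Y hY =>
    subsingleton_ext_X₁ hS (subsingleton_ext_of_projective hPp 1 (by lia)) (h2' 2 le_rfl Y hY)
  obtain ⟨D⟩ := nonempty_dualBasis P
  obtain ⟨E⟩ := nonempty_dualBasis Q
  intro i hi
  obtain rfl | hi' : i = 1 ∨ 2 ≤ i := by lia
  swap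
  · exact h2' i hi' V inferInstance
  by_contra hne
  obtain ⟨e₀, he₀⟩ : ∃ e : Ext V V 1, e ≠ 0 := by
    by_contra! h0
    exact hne (subsingleton_of_forall_eq 0 h0)
  obtain ⟨p, hp, -⟩ := exists_le_isAssociatedPrime_of_isNoetherianRing R e₀ he₀
  rw [isAssociatedPrime_iff] at hp
  obtain ⟨hp, e, hpe⟩ := hp
  have hmem (r : R) : r ∈ p ↔ r • e = 0 := by
    rw [hpe, Submodule.mem_colon_singleton, Submodule.mem_bot]
  have he : e ≠ 0 := fun h0 => hp.ne_top ((Ideal.eq_top_iff_one p).2 ((hmem 1).2 (by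
    rw [h0, smul_zero])))
  by_cases hlt : p.height < 3
  -- Q is a summand of a power of Λ and each coordinate of the extension class lies in Ext^1(V, Λ).
  -- The product of the elements killing the coordinates kills the class, and with it e, although it
  -- lies outside p = Ann(e).
  · obtain ⟨s, hs, h0⟩ : ∃ s ∈ p.primeCompl, s • hS.extClass = 0 := by
      choose s hs h0 using fun j => h.exists_smul_ext_eq_zero p (i := 0) (by exact_mod_cast hlt)
        (hS.extClass.comp (Ext.mk₀ (ModuleCat.ofHom (E.ξ j))) (add_zero 1))
      refine ⟨∏ j, s j, prod_mem fun j _ => hs j, ?_⟩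
      let c : (Q ⟶ Q) →+ Ext V Q 1 :=
        { toFun f := (∏ j, s j) • hS.extClass.comp (Ext.mk₀ f) (add_zero 1)
          map_zero' := by rw [Ext.mk₀_zero, Ext.comp_zero, smul_zero]
          map_add' f g := by rw [Ext.mk₀_add, Ext.comp_add, smul_add] }
      rw [← Ext.comp_mk₀_id hS.extClass]
      change c (𝟙 Q) = 0
      rw [← E.sum_comp, map_sum]
      refine Finset.sum_eq_zero fun j hj => ?_
      change (∏ j, s j) • hS.extClass.comp (Ext.mk₀ (ModuleCat.ofHom (E.ξ j) ≫ _)) (add_zero 1) = 0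
      rw [← Ext.mk₀_comp_mk₀, ← Ext.comp_assoc_of_second_deg_zero, ← Ext.smul_comp,
        ← Finset.prod_erase_mul _ _ hj, mul_smul]
      have h1 : s j • hS.extClass.comp (Ext.mk₀ (ModuleCat.ofHom (E.ξ j))) (add_zero 1) = 0 := h0 j
      rw [h1, smul_zero, Ext.zero_comp]
    obtain ⟨x, rfl⟩ := Ext.contravariant_sequence_exact₃ hS V e (Ext.eq_zero_of_projective _)
      (add_comm 1 0)
    exact hs ((hmem s).2 (by rw [← Ext.smul_comp, h0, Ext.zero_comp]))
  · have hpm : p.IsMaximal := by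
      obtain ⟨m, hm, hle⟩ := Ideal.exists_le_maximal p hp.ne_top
      obtain rfl | hlt' := eq_or_lt_of_le hle
      · exact hm
      · have h1 := (Ideal.height_strict_mono_of_isPrime_of_isPrime hlt').trans_le (hht m)
        exact absurd h1 hlt
    obtain ⟨tr, htr, hinj, hsurj⟩ := exists_symmetrizing_trace R M
    -- The trace is the functional required: no nonzero multiple of it vanishes, by nondegeneracy at
    -- 1.
    have hk (i : ℕ) (hi : i < 3) :
        Subsingleton (Ext (ModuleCat.of R (R ⧸ p)) (ModuleCat.of R R) i) := by
      refine h.maximalCohenMacaulay.subsingleton_ext_quotient h.gorenstein p tr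
        (fun s hs h0 => ?_) (lt_of_lt_of_le (by exact_mod_cast hi) (not_lt.1 hlt))
      have hs0 : s ≠ 0 := fun h1 => hs (h1 ▸ p.zero_mem)
      refine one_ne_zero (α := Module.End R M) (hinj 1 fun y => ?_)
      have h1 : s • tr (1 * y) = 0 := LinearMap.congr_fun h0 (1 * y)
      exact (smul_eq_zero.1 h1).resolve_left hs0
    obtain ⟨h₀, h₁⟩ := subsingleton_ext_reflexive (M := M) (hk 0 (by lia)) (hk 1 (by lia))
    have hiso {i : ℕ} (hi : Subsingleton (Ext (ModuleCat.of R (R ⧸ p)) (ModuleCat.of R M) i)) :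
        Subsingleton (Ext (ModuleCat.of R (R ⧸ p)) (ModuleCat.of R V) i) :=
      subsingleton_ext_of_sum {()} (ModuleCat.of R M)
        (fun _ => (restrictTautologicalModule R M).hom)
        (fun _ => (restrictTautologicalModule R M).inv) (by simp) hi
    exact he (eq_zero_of_smul_eq_zero D E hS bijective_smul_id p (hiso h₀) (hiso h₁)
      (hk 2 (by lia)) hP e fun r hr => (hmem r).1 hr)

end Reflexive

end NCCR

namespace NCCR

/-! ### Ext over a finite algebra is controlled by simple modules -/

open Abelian

/-- If every scalar acts as zero on `X` or surjectively on `E`, then the annihilator of `X` is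
maximal. -/
theorem isMaximal_annihilator {C X E : Type*} [CommRing C] [AddCommGroup X] [Module C X]
    [AddCommGroup E] [Module C E] [Module.Finite C E] [Nontrivial X] [Nontrivial E]
    (h : ∀ c : C, (∀ x : X, c • x = 0) ∨ ∀ e : E, ∃ e', c • e' = e) :
    (Module.annihilator C X).IsMaximal := by
  refine Ideal.isMaximal_iff.2 ⟨fun h1 => ?_, fun J c hJ hc hcJ => ?_⟩
  · obtain ⟨x, hx⟩ := exists_ne (0 : X)
    rw [Module.mem_annihilator] at h1
    exact hx ((one_smul C x).symm.trans (h1 x))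
  · rw [Module.mem_annihilator] at hc
    have hc := (h c).resolve_left hc
    obtain ⟨r, hr, hr0⟩ := Submodule.exists_sub_one_mem_and_smul_eq_zero_of_fg_of_le_smul
      (Ideal.span {c}) (⊤ : Submodule C E) Module.Finite.fg_top fun e _ => by
        obtain ⟨e', rfl⟩ := hc e
        exact Submodule.smul_mem_smul (Ideal.mem_span_singleton_self c) trivial
    have hrX : r ∈ Module.annihilator C X := by
      rw [Module.mem_annihilator]
      refine (h r).resolve_right fun h' => ?_
      obtain ⟨e, he⟩ := exists_ne (0 : E)
      obtain ⟨e', rfl⟩ := h' e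
      exact he (hr0 e' trivial)
    have h1 : r - 1 ∈ J := (Ideal.span_singleton_le_iff_mem J).2 hcJ hr
    have := J.sub_mem (hJ hrX) h1
    rwa [sub_sub_cancel] at this

section Submodule

variable {A : Type u} [Ring A]

theorem submodule_zero (X : ModuleCat.{u} A) (J : Submodule A X) :
    ModuleCat.ofHom J.subtype ≫ ModuleCat.ofHom J.mkQ = 0 :=
  ModuleCat.hom_ext (LinearMap.ext fun x => (Submodule.Quotient.mk_eq_zero _).2 x.2)

theorem submodule_shortExact (X : ModuleCat.{u} A) (J : Submodule A X) :
    (ShortComplex.mk (X₂ := X) (ModuleCat.ofHom J.subtype) (ModuleCat.ofHom J.mkQ)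
      (submodule_zero X J)).ShortExact where
  exact := (ShortComplex.ShortExact.moduleCat_exact_iff_function_exact _).2
    (LinearMap.exact_subtype_mkQ J)
  mono_f := (ModuleCat.mono_iff_injective _).2 J.injective_subtype
  epi_g := (ModuleCat.epi_iff_surjective _).2 J.mkQ_surjective

theorem subsingleton_ext_right_of_equiv {L X Y : ModuleCat.{u} A} (e : X ≃ₗ[A] Y) {i : ℕ}
    (h : Subsingleton (Ext L X i)) : Subsingleton (Ext L Y i) :=
  subsingleton_ext_of_sum {()} X (fun _ => ModuleCat.ofHom e.symm.toLinearMap)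
    (fun _ => ModuleCat.ofHom e.toLinearMap) (by
      rw [Finset.sum_singleton]
      exact ModuleCat.hom_ext (LinearMap.ext fun x => e.apply_symm_apply x)) h

theorem subsingleton_ext_right_X₂ {C : Type w} [Category.{v} C] [Abelian C] [HasExt.{v} C]
    {S : ShortComplex C} (hS : S.ShortExact) {X : C} {i : ℕ} (h₁ : Subsingleton (Ext X S.X₁ i))
    (h₃ : Subsingleton (Ext X S.X₃ i)) : Subsingleton (Ext X S.X₂ i) := by
  refine subsingleton_of_forall_eq 0 fun x => ?_
  obtain ⟨y, rfl⟩ := Ext.covariant_sequence_exact₂ X hS x (Subsingleton.elim _ _)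
  rw [Subsingleton.elim y 0, Ext.zero_comp]

theorem subsingleton_ext_of_submodule {L X : ModuleCat.{u} A} (J : Submodule A X) {i : ℕ}
    (h₁ : Subsingleton (Ext L (ModuleCat.of A J) i))
    (h₂ : Subsingleton (Ext L (ModuleCat.of A (X ⧸ J)) i)) : Subsingleton (Ext L X i) :=
  subsingleton_ext_right_X₂ (submodule_shortExact X J) h₁ h₂

theorem subsingleton_ext_of_isFiniteLength {L : ModuleCat.{u} A} {i : ℕ}
    (h : ∀ S : ModuleCat.{u} A, IsSimpleModule A S → Subsingleton (Ext L S i)) {X : Type u}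
    [AddCommGroup X] [Module A X] (hX : IsFiniteLength A X) :
    Subsingleton (Ext L (ModuleCat.of A X) i) := by
  induction hX with
  | @of_subsingleton X =>
    refine subsingleton_of_forall_eq 0 fun x => ?_
    rw [← Ext.comp_mk₀_id x,
      ((ModuleCat.isZero_of_subsingleton _).eq_of_src (𝟙 (ModuleCat.of A X)) 0),
      Ext.mk₀_zero, Ext.comp_zero]
  | @of_simple_quotient X _ _ N _ _ ih =>
    exact subsingleton_ext_of_submodule (X := ModuleCat.of A X) N ih (h (.of A (X ⧸ N)) ‹_›)

/-- Noetherian induction on the submodule divided out: quotients of X/I are quotients of X by larger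
submodules. -/
theorem quotient_induction [IsNoetherianRing A] {Q : ModuleCat.{u} A → Prop}
    (hQ : ∀ X Y : ModuleCat.{u} A, (X ≃ₗ[A] Y) → Q X → Q Y)
    (h : ∀ X : ModuleCat.{u} A, Module.Finite A X →
      (∀ J : Submodule A X, J ≠ ⊥ → Q (ModuleCat.of A (X ⧸ J))) → Q X)
    (X : ModuleCat.{u} A) [Module.Finite A X] : Q X := by
  refine hQ (ModuleCat.of A (X ⧸ (⊥ : Submodule A X))) X
    (Submodule.quotEquivOfEqBot ⊥ rfl) ?_
  refine IsNoetherian.induction (R := A) (M := X) (P := fun I => Q (ModuleCat.of A (X ⧸ I)))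
    (fun I ih => ?_) ⊥
  refine h (ModuleCat.of A (X ⧸ I)) (inferInstanceAs (Module.Finite A (X ⧸ I))) fun J hJ => ?_
  have hle : I ≤ Submodule.comap I.mkQ J := fun x hx => by
    have : I.mkQ x = 0 := (Submodule.Quotient.mk_eq_zero I).2 hx
    rw [Submodule.mem_comap, this]
    exact J.zero_mem
  have hJ' : J = (Submodule.comap I.mkQ J).map I.mkQ :=
    (Submodule.map_comap_eq_of_surjective I.mkQ_surjective J).symm
  refine hQ (ModuleCat.of A (X ⧸ Submodule.comap I.mkQ J)) _ ?_ (ih _ (lt_of_le_of_ne hle ?_))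
  · exact ((Submodule.quotEquivOfEq _ _ hJ').trans
      (Submodule.quotientQuotientEquivQuotient I _ hle)).symm
  · intro h1
    rw [← h1, Submodule.mkQ_map_self] at hJ'
    exact hJ hJ'

end Submodule

section ProjectiveDimension

variable {A : Type u} [Ring A] [IsNoetherianRing A]

/-- Syzygies of a finite module stay finite, so only finite test modules occur in the dimension
shift. -/
theorem hasProjectiveDimensionLE_of_forall_finite {g : ℕ} {L : ModuleCat.{u} A}
    [Module.Finite A L]
    (h : ∀ Y : ModuleCat.{u} A, Module.Finite A Y → Subsingleton (Ext L Y (g + 1))) :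
    HasProjectiveDimensionLE L g := by
  induction g generalizing L with
  | zero =>
    have := (IsProjective.iff_projective L).1 (projective_of_subsingleton_ext h)
    exact inferInstanceAs (HasProjectiveDimensionLT L 1)
  | succ g ih =>
    obtain ⟨K, F, f, p, w, hse, _, _, hfree⟩ := exists_shortExact_free L
    have hproj := Module.Projective.of_free (R := A) (P := F)
    have hF : Projective F := (IsProjective.iff_projective F).1 hproj
    exact (hse.hasProjectiveDimensionLT_X₃_iff g hF).2 (ih fun Y hY => subsingleton_ext_X₁ hse
      (subsingleton_ext_of_projective hproj _ (by lia)) (h Y hY))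

end ProjectiveDimension

section Center

attribute [local instance] restrictedModule restrictedModule_isScalarTower algebraLinear

variable (C : Type u) [CommRing C] [IsNoetherianRing C] {B : Type u} [Ring B] [Algebra C B]
  [Module.Finite C B]

theorem finite_ext (X Y : ModuleCat.{u} B) [Module.Finite B X] [Module.Finite B Y] (i : ℕ) :
    Module.Finite C (Ext X Y i) := by
  have : IsNoetherianRing B := IsNoetherianRing.of_finite C B
  induction i generalizing X with
  | zero =>
    have := finite_hom C X Y
    exact Module.Finite.equiv (Ext.linearEquiv₀ (R := C) (X := X) (Y := Y)).symm
  | succ i ih =>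
    obtain ⟨K, F, f, p, w, hse, _, _, hfree⟩ := exists_shortExact_free X
    have hproj := Module.Projective.of_free (R := B) (P := F)
    have := ih K
    let φ : Ext K Y i →ₗ[C] Ext X Y (i + 1) :=
      { toFun x := hse.extClass.comp x (add_comm 1 i)
        map_add' x y := Ext.comp_add _ _ _ _
        map_smul' c x := Ext.comp_smul _ _ _ _ }
    refine Module.Finite.of_surjective φ fun x => ?_
    obtain ⟨y, hy⟩ := Ext.contravariant_sequence_exact₃ hse Y x
      ((subsingleton_ext_of_projective hproj _ (by lia)).elim _ _) (add_comm 1 i)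
    exact ⟨y, hy⟩

/-- The endomorphism of a module given by a central scalar. -/
def scalarEnd (X : ModuleCat.{u} B) (c : C) : X →ₗ[B] X := (c • 𝟙 X : X ⟶ X).hom

/-- By Schur's lemma a central scalar acts on S as zero or surjectively; Nakayama's lemma does the
rest. -/
theorem isMaximal_annihilator_of_isSimpleModule (S : ModuleCat.{u} B) [IsSimpleModule B S] :
    (Module.annihilator C S).IsMaximal := by
  have : Module.Finite C S := Module.Finite.trans B S
  have := IsSimpleModule.nontrivial B S
  refine isMaximal_annihilator (E := S) fun c => ?_
  rcases (scalarEnd C S c).surjective_or_eq_zero with h | h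
  · exact .inr h
  · exact .inl fun x => LinearMap.congr_fun h x

/-- X is a finite dimensional vector space over the residue field of its annihilator. -/
theorem isFiniteLength_of_isMaximal (X : ModuleCat.{u} B) [Module.Finite B X]
    (h : (Module.annihilator C X).IsMaximal) : IsFiniteLength B X := by
  have : Module.Finite C X := Module.Finite.trans B X
  have : IsNoetherianRing B := IsNoetherianRing.of_finite C B
  let := Ideal.Quotient.field (Module.annihilator C X)
  let : Module (C ⧸ Module.annihilator C X) X := Module.quotientAnnihilator
  have : IsScalarTower C (C ⧸ Module.annihilator C X) X := ⟨fun c d x => by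
    obtain ⟨d, rfl⟩ := Ideal.Quotient.mk_surjective d
    exact mul_smul c d x⟩
  have : Module.Finite (C ⧸ Module.annihilator C X) X := Module.Finite.of_restrictScalars_finite C _ _
  have : IsArtinian C X := isArtinian_of_surjective_algebraMap
    (R := C ⧸ Module.annihilator C X) Ideal.Quotient.mk_surjective
  exact isFiniteLength_iff_isNoetherian_isArtinian.2 ⟨inferInstance, isArtinian_of_tower C this⟩

include C in
/-- A criterion for the vanishing of `Ext` over a finite algebra over a noetherian ring. -/
theorem subsingleton_ext_of_forall_isSimpleModule {L : ModuleCat.{u} B} [Module.Finite B L] {i : ℕ}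
    (h : ∀ S : ModuleCat.{u} B, IsSimpleModule B S → Subsingleton (Ext L S i))
    (X : ModuleCat.{u} B) [Module.Finite B X] : Subsingleton (Ext L X i) := by
  have : IsNoetherianRing B := IsNoetherianRing.of_finite C B
  refine quotient_induction (Q := fun X => Subsingleton (Ext L X i))
    (fun X Y e => subsingleton_ext_right_of_equiv e) (fun X _ ih => ?_) X
  by_contra hE
  rw [not_subsingleton_iff_nontrivial] at hE
  have := finite_ext C L X i
  have hX : Nontrivial X := by
    by_contra hX
    rw [not_nontrivial_iff_subsingleton] at hX
    exact not_subsingleton _ (subsingleton_ext_of_isFiniteLength h (.of_subsingleton (M := X)))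
  -- X is a counterexample all of whose proper quotients satisfy the claim. It will be shown that a
  -- central scalar not killing X is surjective on Ext^i(L, X); then the annihilator of X is
  -- maximal, X has finite length, and the simple case applies.
  refine not_subsingleton _ (subsingleton_ext_of_isFiniteLength h (isFiniteLength_of_isMaximal C X
    (isMaximal_annihilator (E := Ext L X i) fun c => or_iff_not_imp_left.2 fun hc => ?_)))
  have hr : LinearMap.range (scalarEnd C X c) ≠ ⊥ := fun h0 => hc fun x =>
    LinearMap.congr_fun (LinearMap.range_eq_bot.1 h0) x
  -- Otherwise the image of c is a proper quotient of X, and X is an extension of X/cX by it, both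
  -- with vanishing Ext.
  have hker : LinearMap.ker (scalarEnd C X c) = ⊥ := by
    by_contra hk
    exact not_subsingleton _ (subsingleton_ext_of_submodule (LinearMap.range (scalarEnd C X c))
      (subsingleton_ext_right_of_equiv (scalarEnd C X c).quotKerEquivRange (ih _ hk)) (ih _ hr))
  let e := LinearEquiv.ofInjective (scalarEnd C X c) (LinearMap.ker_eq_bot.1 hker)
  intro x
  -- As Ext^i(L, X/cX) = 0, every class comes from cX, which is isomorphic to X by multiplication by
  -- c; so the class is c times another one.
  obtain ⟨y, hy⟩ := Ext.covariant_sequence_exact₂ L (submodule_shortExact X _) x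
    ((ih _ hr).elim _ _)
  refine ⟨y.comp (Ext.mk₀ (ModuleCat.ofHom e.symm.toLinearMap)) (add_zero i), ?_⟩
  have he : ModuleCat.ofHom e.symm.toLinearMap ≫ (c • 𝟙 X) =
      ModuleCat.ofHom (LinearMap.range (scalarEnd C X c)).subtype :=
    ModuleCat.hom_ext (LinearMap.ext fun z => congrArg Subtype.val (e.apply_symm_apply z))
  have h2 := congrArg (fun φ => y.comp (Ext.mk₀ φ) (add_zero i)) he
  have h3 := h2.trans hy
  rw [← Ext.mk₀_comp_mk₀, ← Ext.comp_assoc_of_second_deg_zero, Ext.mk₀_smul, Ext.comp_smul,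
    Ext.comp_mk₀_id] at h3
  exact h3

end Center

end NCCR

namespace NCCR

open Abelian
open scoped TensorProduct

/-! ### Bimodules of linear maps and coinduction -/

section Bimodule

variable (k : Type v) [Field k] {Λ : Type u} [Ring Λ] [Algebra k Λ]

/-- The underlying vector space of a module over an algebra. -/
abbrev scalarModule (V : ModuleCat.{u} Λ) : Module k V := Module.restrictScalars k Λ V

attribute [local instance] scalarModule

theorem scalarModule_isScalarTower (V : ModuleCat.{u} Λ) : IsScalarTower k Λ V :=
  IsScalarTower.restrictScalars k Λ V

attribute [local instance] scalarModule_isScalarTower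

/-- The left action on the linear maps between two modules. -/
noncomputable def leftAction (X Y : ModuleCat.{u} Λ) : Λ →ₐ[k] Module.End k (X →ₗ[k] Y) :=
  AlgHom.ofLinearMap
    { toFun a := LinearMap.compRight k (Algebra.lsmul k k Y a)
      map_add' a b := by ext; simp
      map_smul' c a := by ext; simp }
    (by ext; simp) (fun a b => by ext; simp)

/-- The right action on the linear maps between two modules. -/
noncomputable def rightAction (X Y : ModuleCat.{u} Λ) : Λᵐᵒᵖ →ₐ[k] Module.End k (X →ₗ[k] Y) :=
  AlgHom.ofLinearMap
    { toFun b := LinearMap.lcomp k Y (Algebra.lsmul k k X b.unop)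
      map_add' a b := by ext; simp
      map_smul' c a := by ext; simp }
    (by ext; simp) (fun a b => by ext; simp)

theorem commute_leftAction_rightAction (X Y : ModuleCat.{u} Λ) (a : Λ) (b : Λᵐᵒᵖ) :
    Commute (leftAction k X Y a) (rightAction k X Y b) :=
  LinearMap.ext fun _ => rfl

/-- The vector space of linear maps between two modules as a bimodule. -/
noncomputable def homBimodule (X Y : ModuleCat.{u} Λ) : ModuleCat.{u} (Λ ⊗[k] Λᵐᵒᵖ) :=
  letI : Module (Λ ⊗[k] Λᵐᵒᵖ) (X →ₗ[k] Y) :=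
    Module.compHom _ (Algebra.TensorProduct.lift (leftAction k X Y) (rightAction k X Y)
      (commute_leftAction_rightAction k X Y)).toRingHom
  ModuleCat.of _ (X →ₗ[k] Y)

variable {k}

theorem homBimodule_smul (X Y : ModuleCat.{u} Λ) (a b : Λ) (ψ : X →ₗ[k] Y) (x : X) :
    (show X →ₗ[k] Y from (a ⊗ₜ[k] MulOpposite.op b) • (show homBimodule k X Y from ψ)) x =
      a • ψ (b • x) := by
  exact congrArg (fun φ : Module.End k (X →ₗ[k] Y) => φ ψ x)
    (Algebra.TensorProduct.lift_tmul (leftAction k X Y) (rightAction k X Y)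
      (commute_leftAction_rightAction k X Y) a (MulOpposite.op b))

/-- An additive map which commutes with the actions of pure tensors is a map of bimodules. -/
def bimoduleHom {S T : ModuleCat.{u} (Λ ⊗[k] Λᵐᵒᵖ)} (f : S →+ T)
    (h : ∀ (a b : Λ) (s : S), f ((a ⊗ₜ[k] MulOpposite.op b) • s) =
      (a ⊗ₜ[k] MulOpposite.op b) • f s) : S ⟶ T :=
  ModuleCat.ofHom
    { toFun := f
      map_add' := map_add f
      map_smul' z s := by
        induction z using TensorProduct.induction_on with
        | zero =>
          have h0 := h 0 0 s
          rw [TensorProduct.zero_tmul] at h0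
          exact h0
        | tmul a b => exact h a b.unop s
        | add z w hz hw => rw [add_smul, map_add, hz, hw, RingHom.id_apply, RingHom.id_apply,
            RingHom.id_apply, add_smul] }

variable (k) in
/-- Composition with a morphism of modules. -/
noncomputable def homBimoduleMap {X X' : ModuleCat.{u} Λ} (f : X ⟶ X') (Y : ModuleCat.{u} Λ) :
    homBimodule k X' Y ⟶ homBimodule k X Y :=
  bimoduleHom (LinearMap.lcomp k Y (f.hom.restrictScalars k)).toAddMonoidHom fun a b ψ => by
    refine LinearMap.ext fun x => ?_
    refine (homBimodule_smul X' Y a b ψ (f.hom x)).trans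
      (Eq.trans ?_ (homBimodule_smul X Y a b _ x).symm)
    rw [← map_smul]
    rfl

/-- Over a field every short exact sequence splits linearly, so Hom_k(-, Y) is exact. -/
theorem homBimodule_shortExact {S : ShortComplex (ModuleCat.{u} Λ)} (hS : S.ShortExact)
    (Y : ModuleCat.{u} Λ) :
    (ShortComplex.mk (homBimoduleMap k S.g Y) (homBimoduleMap k S.f Y) (by
      refine ModuleCat.hom_ext (LinearMap.ext fun ψ => LinearMap.ext fun x => ?_)
      have h : S.g.hom (S.f.hom x) = 0 := congrArg (fun φ => φ.hom x) S.zero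
      exact (congrArg (show S.X₃ →ₗ[k] Y from ψ) h).trans (map_zero _))).ShortExact where
  exact := by
    refine (ShortComplex.ShortExact.moduleCat_exact_iff_function_exact _).2 fun ψ => ⟨fun h => ?_, ?_⟩
    · obtain ⟨s, hs⟩ := LinearMap.exists_rightInverse_of_surjective (S.g.hom.restrictScalars k)
        (LinearMap.range_eq_top.2 hS.moduleCat_surjective_g)
      refine ⟨(show S.X₂ →ₗ[k] Y from ψ) ∘ₗ s, LinearMap.ext fun x => ?_⟩
      change (show S.X₂ →ₗ[k] Y from ψ) (s (S.g.hom x)) = (show S.X₂ →ₗ[k] Y from ψ) x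
      rw [← sub_eq_zero, ← map_sub]
      obtain ⟨y, hy⟩ := ((ShortComplex.ShortExact.moduleCat_exact_iff_function_exact S).1 hS.exact
        (s (S.g.hom x) - x)).1 (by
          rw [map_sub, sub_eq_zero]
          exact LinearMap.congr_fun hs (S.g.hom x))
      rw [← hy]
      exact LinearMap.congr_fun h y
    · rintro ⟨φ, rfl⟩
      refine LinearMap.ext fun x => ?_
      have h : S.g.hom (S.f.hom x) = 0 := congrArg (fun φ => φ.hom x) S.zero
      exact (congrArg (show S.X₃ →ₗ[k] Y from φ) h).trans (map_zero _)
  mono_f := by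
    refine (ModuleCat.mono_iff_injective _).2 fun φ ψ h => LinearMap.ext fun x => ?_
    obtain ⟨x, rfl⟩ := hS.moduleCat_surjective_g x
    exact LinearMap.congr_fun h x
  epi_g := by
    refine (ModuleCat.epi_iff_surjective _).2 fun φ => ?_
    obtain ⟨r, hr⟩ := LinearMap.exists_leftInverse_of_injective (S.f.hom.restrictScalars k)
      (LinearMap.ker_eq_bot.2 hS.moduleCat_injective_f)
    refine ⟨(show S.X₁ →ₗ[k] Y from φ) ∘ₗ r, LinearMap.ext fun x => ?_⟩
    exact congrArg (show S.X₁ →ₗ[k] Y from φ) (LinearMap.congr_fun hr x)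

variable (k Λ) in
/-- The restriction of a bimodule to a left module. -/
noncomputable def leftRestriction : ModuleCat.{u} (Λ ⊗[k] Λᵐᵒᵖ) ⥤ ModuleCat.{u} Λ :=
  ModuleCat.restrictScalars (Algebra.TensorProduct.includeLeft : Λ →ₐ[k] Λ ⊗[k] Λᵐᵒᵖ).toRingHom

/-- The enveloping algebra is free as a left Λ-module, k being a field. -/
theorem leftRestriction_projective (F : ModuleCat.{u} (Λ ⊗[k] Λᵐᵒᵖ))
    [Module.Free (Λ ⊗[k] Λᵐᵒᵖ) F] : Projective ((leftRestriction k Λ).obj F) := by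
  let b := Module.Free.chooseBasis (Λ ⊗[k] Λᵐᵒᵖ) F
  let e : (Module.Free.ChooseBasisIndex (Λ ⊗[k] Λᵐᵒᵖ) F →₀ Λ ⊗[k] Λᵐᵒᵖ) ≃ₗ[Λ]
      (leftRestriction k Λ).obj F :=
    { toFun x := b.repr.symm x
      invFun y := b.repr y
      left_inv x := b.repr.apply_symm_apply x
      right_inv y := b.repr.symm_apply_apply y
      map_add' x y := map_add b.repr.symm x y
      map_smul' a x := by
        have h : a • x = (a ⊗ₜ[k] (1 : Λᵐᵒᵖ)) • x := Finsupp.ext fun i => by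
          rw [Finsupp.smul_apply, Finsupp.smul_apply, smul_eq_mul, ← one_mul (x i),
            ← smul_mul_assoc, one_mul, Algebra.TensorProduct.one_def, TensorProduct.smul_tmul',
            smul_eq_mul, mul_one]
        exact (congrArg b.repr.symm h).trans (map_smul b.repr.symm _ x) }
  exact (IsProjective.iff_projective ((leftRestriction k Λ).obj F)).1 (Module.Projective.of_equiv e)

theorem leftRestriction_hom_smul {T : ModuleCat.{u} (Λ ⊗[k] Λᵐᵒᵖ)} {Y : ModuleCat.{u} Λ}
    (f : (leftRestriction k Λ).obj T ⟶ Y) (a : Λ) (t : T) :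
    f.hom ((a ⊗ₜ[k] (1 : Λᵐᵒᵖ)) • t : T) = a • f.hom t :=
  f.hom.map_smul a t

/-- The linear map `Λ → Y` given by a morphism of left modules `T → Y` and an element of `T`. -/
noncomputable def coinducedMap {T : ModuleCat.{u} (Λ ⊗[k] Λᵐᵒᵖ)} {Y : ModuleCat.{u} Λ}
    (f : (leftRestriction k Λ).obj T ⟶ Y) (t : T) : regularModule Λ →ₗ[k] Y where
  toFun b := f.hom ((1 ⊗ₜ[k] MulOpposite.op (show Λ from b) : Λ ⊗[k] Λᵐᵒᵖ) • t : T)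
  map_add' b c := by
    refine Eq.trans (congrArg f.hom ?_) (map_add f.hom _ _)
    exact (congrArg (· • t) (TensorProduct.tmul_add 1 (MulOpposite.op (show Λ from b))
      (MulOpposite.op (show Λ from c)))).trans (add_smul _ _ t)
  map_smul' r b := by
    refine Eq.trans (congrArg f.hom ?_) (leftRestriction_hom_smul f (algebraMap k Λ r)
      ((1 ⊗ₜ[k] MulOpposite.op (show Λ from b) : Λ ⊗[k] Λᵐᵒᵖ) • t))
    refine (congrArg (· • t) ?_).trans (mul_smul _ _ t)
    rw [Algebra.TensorProduct.tmul_mul_tmul, mul_one, one_mul, Algebra.algebraMap_eq_smul_one,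
      TensorProduct.smul_tmul]
    congr 2
    exact (Algebra.smul_def r (show Λ from b)).symm

/-- The morphism to `Hom_k(Λ, Y)` given by a morphism of left modules to `Y`. -/
noncomputable def coinducedHom {T : ModuleCat.{u} (Λ ⊗[k] Λᵐᵒᵖ)} {Y : ModuleCat.{u} Λ}
    (f : (leftRestriction k Λ).obj T ⟶ Y) : T ⟶ homBimodule k (regularModule Λ) Y :=
  bimoduleHom
    { toFun := coinducedMap f
      map_zero' := LinearMap.ext fun b => (congrArg f.hom (smul_zero (A := T) _)).trans (map_zero f.hom)
      map_add' t t' := LinearMap.ext fun b =>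
        (congrArg f.hom (smul_add (A := T) _ t t')).trans (map_add f.hom _ _) } fun a b t => by
    refine LinearMap.ext fun c => ?_
    refine Eq.trans ?_ (homBimodule_smul _ Y a b (coinducedMap f t) c).symm
    refine Eq.trans ?_ (leftRestriction_hom_smul f a
      ((1 ⊗ₜ[k] MulOpposite.op (b * (show Λ from c)) : Λ ⊗[k] Λᵐᵒᵖ) • t))
    refine congrArg f.hom ((smul_smul _ _ t).trans (Eq.trans (congrArg (· • t) ?_)
      (smul_smul _ _ t).symm))
    rw [Algebra.TensorProduct.tmul_mul_tmul, Algebra.TensorProduct.tmul_mul_tmul, mul_one, one_mul,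
      one_mul]
    rfl

/-- The map is recovered from its values at 1. This is the coinduction adjunction between bimodule
maps to Hom_k(Λ, Y) and left module maps to Y. -/
theorem exists_coinducedHom_eq {T : ModuleCat.{u} (Λ ⊗[k] Λᵐᵒᵖ)} {Y : ModuleCat.{u} Λ}
    (φ : T ⟶ homBimodule k (regularModule Λ) Y) :
    ∃ f : (leftRestriction k Λ).obj T ⟶ Y, φ = coinducedHom f := by
  have h (a b : Λ) (c : regularModule Λ) (t : T) : (show regularModule Λ →ₗ[k] Y from
      φ.hom ((a ⊗ₜ[k] MulOpposite.op b) • t)) c =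
        a • (show regularModule Λ →ₗ[k] Y from φ.hom t) (b • c) :=
    (LinearMap.congr_fun (f := (show regularModule Λ →ₗ[k] Y from
      φ.hom ((a ⊗ₜ[k] MulOpposite.op b) • t))) (map_smul φ.hom _ t) c).trans
      (homBimodule_smul (regularModule Λ) Y a b (show regularModule Λ →ₗ[k] Y from φ.hom t) c)
  refine ⟨ModuleCat.ofHom (X := (leftRestriction k Λ).obj T) (Y := Y)
    { toFun t := (show regularModule Λ →ₗ[k] Y from φ.hom (show T from t)) (1 : Λ)
      map_add' t t' := LinearMap.congr_fun (f := (show regularModule Λ →ₗ[k] Y from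
        φ.hom (t + t'))) (map_add φ.hom t t') (1 : Λ)
      map_smul' a t := by
        exact (h a 1 (1 : Λ) t).trans (congrArg (fun c : regularModule Λ =>
          a • (show regularModule Λ →ₗ[k] Y from φ.hom (show T from t)) c) (mul_one (1 : Λ))) }, ModuleCat.hom_ext (LinearMap.ext fun t => LinearMap.ext fun b => ?_)⟩
  refine Eq.trans ?_ ((one_smul Λ _).symm.trans (h 1 b (1 : Λ) t).symm)
  exact congrArg (show regularModule Λ →ₗ[k] Y from φ.hom t) (mul_one (show Λ from b)).symm

instance : (leftRestriction k Λ).Additive :=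
  inferInstanceAs (ModuleCat.restrictScalars _).Additive

theorem leftRestriction_shortExact {S : ShortComplex (ModuleCat.{u} (Λ ⊗[k] Λᵐᵒᵖ))}
    (hS : S.ShortExact) : (S.map (leftRestriction k Λ)).ShortExact where
  exact := (ShortComplex.ShortExact.moduleCat_exact_iff_function_exact _).2
    ((ShortComplex.ShortExact.moduleCat_exact_iff_function_exact S).1 hS.exact)
  mono_f := (ModuleCat.mono_iff_injective _).2 hS.moduleCat_injective_f
  epi_g := (ModuleCat.epi_iff_surjective _).2 hS.moduleCat_surjective_g

variable [IsNoetherianRing (Λ ⊗[k] Λᵐᵒᵖ)]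

/-- By coinduction this is an Ext over Λ out of T, which is projective as a left module. -/
theorem subsingleton_ext_homBimodule_regularModule {T : ModuleCat.{u} (Λ ⊗[k] Λᵐᵒᵖ)}
    [Module.Finite (Λ ⊗[k] Λᵐᵒᵖ) T] (hT : Projective ((leftRestriction k Λ).obj T))
    (Y : ModuleCat.{u} Λ) (i : ℕ) :
    Subsingleton (Ext T (homBimodule k (regularModule Λ) Y) (i + 1)) := by
  obtain ⟨K, F, f, g, w, hse, _, _, hfree⟩ := exists_shortExact_free T
  have hproj := Module.Projective.of_free (R := Λ ⊗[k] Λᵐᵒᵖ) (P := F)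
  have hse' := leftRestriction_shortExact hse
  have : Projective ((ShortComplex.mk f g w).map (leftRestriction k Λ)).X₃ := hT
  let σ := hse'.splittingOfProjective
  cases i with
  | zero =>
    refine subsingleton_of_forall_eq 0 fun x => ?_
    obtain ⟨y, rfl⟩ := Ext.contravariant_sequence_exact₃ hse _ x
      ((subsingleton_ext_of_projective hproj _ (by lia)).elim _ _) (add_comm 1 0)
    obtain ⟨φ, rfl⟩ := (Ext.mk₀_bijective K _).surjective y
    obtain ⟨φ', rfl⟩ := exists_coinducedHom_eq φ
    -- The free cover of T splits over Λ, so φ' extends to F along the left linear retraction, and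
    -- its coinduced map extends as well.
    have h : coinducedHom φ' = f ≫ coinducedHom (σ.r ≫ φ') := by
      refine ModuleCat.hom_ext (LinearMap.ext fun t => LinearMap.ext fun b => ?_)
      have h1 (t : K) : σ.r.hom (f.hom t) = t := congrArg (fun ψ => ψ.hom t) σ.f_r
      have h2 := h1 ((1 ⊗ₜ[k] MulOpposite.op (show Λ from b) : Λ ⊗[k] Λᵐᵒᵖ) • t)
      refine congrArg φ'.hom (h2.symm.trans (congrArg σ.r.hom (map_smul f.hom _ t)))
    rw [h, ← Ext.mk₀_comp_mk₀]
    exact hse.extClass_comp_assoc _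
  | succ i =>
    have hF : Projective ((leftRestriction k Λ).obj F) := leftRestriction_projective F
    have hK : Projective ((leftRestriction k Λ).obj K) :=
      Retract.projective (Y := (leftRestriction k Λ).obj F) ⟨(leftRestriction k Λ).map f, σ.r, σ.f_r⟩
    exact subsingleton_ext_X₃ hse (subsingleton_ext_homBimodule_regularModule hK Y i)
      (subsingleton_ext_of_projective hproj _ (by lia))

/-- A projective resolution of X becomes a coresolution of Hom_k(X, Y) by summands of powers of
Hom_k(Λ, Y), which are acyclic for T; its length bounds the degrees. -/
theorem subsingleton_ext_homBimodule [IsNoetherianRing Λ] {T : ModuleCat.{u} (Λ ⊗[k] Λᵐᵒᵖ)}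
    [Module.Finite (Λ ⊗[k] Λᵐᵒᵖ) T] (hT : Projective ((leftRestriction k Λ).obj T))
    (Y : ModuleCat.{u} Λ) {n : ℕ} (X : ModuleCat.{u} Λ) [Module.Finite Λ X]
    [hX : HasProjectiveDimensionLE X n] {i : ℕ} (hi : n < i) :
    Subsingleton (Ext T (homBimodule k X Y) i) := by
  obtain ⟨i, rfl⟩ : ∃ j, i = j + 1 := ⟨i - 1, by lia⟩
  have hp (X : ModuleCat.{u} Λ) [Module.Finite Λ X] (hX : Projective X) (i : ℕ) :
      Subsingleton (Ext T (homBimodule k X Y) (i + 1)) := by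
    have := (IsProjective.iff_projective X).2 hX
    obtain ⟨D⟩ := nonempty_dualBasis X
    refine subsingleton_ext_of_sum Finset.univ (homBimodule k (regularModule Λ) Y)
      (fun j => homBimoduleMap k (show regularModule Λ ⟶ X from ModuleCat.ofHom
        (LinearMap.toSpanSingleton Λ X (D.x j))) Y)
      (fun j => homBimoduleMap k (show X ⟶ regularModule Λ from ModuleCat.ofHom (D.ξ j)) Y) ?_
      (subsingleton_ext_homBimodule_regularModule hT Y i)
    refine ModuleCat.hom_ext (LinearMap.ext fun ψ => LinearMap.ext fun x => ?_)
    have h := congrArg (show X →ₗ[k] Y from ψ) (D.sum_eq x)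
    rw [ModuleCat.hom_sum, LinearMap.sum_apply]
    refine Eq.trans ?_ h
    exact (LinearMap.sum_apply (M := X) (M₂ := Y) (R := k) _ _ x).trans
      (map_sum (show X →ₗ[k] Y from ψ) _ _).symm
  induction n generalizing X i with
  | zero => exact hp X (projective_iff_hasProjectiveDimensionLT_one.2 hX) i
  | succ n ih =>
    obtain ⟨i, rfl⟩ : ∃ j, i = j + 1 := ⟨i - 1, by lia⟩
    obtain ⟨K, F, f, g, w, hse, _, _, hfree⟩ := exists_shortExact_free X
    have hF : Projective F := (IsProjective.iff_projective F).1
      (Module.Projective.of_free (R := Λ) (P := F))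
    have : HasProjectiveDimensionLE K n := (hse.hasProjectiveDimensionLT_X₃_iff n hF).1 hX
    exact subsingleton_ext_right_X₁ (homBimodule_shortExact hse Y) (ih K i (by lia)) (hp F hF _)

end Bimodule

end NCCR

namespace NCCR

open Abelian
open scoped TensorProduct

/-! ### Simple bimodules over an algebraically closed field -/

section SimpleBimodule

variable {k : Type v} [Field k] {Λ : Type u} [Ring Λ] [Algebra k Λ]

attribute [local instance] scalarModule scalarModule_isScalarTower

/-- The right multiplication by an element on a bimodule. -/
def rightMul (S : ModuleCat.{u} (Λ ⊗[k] Λᵐᵒᵖ)) (b : Λ) :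
    (leftRestriction k Λ).obj S →ₗ[Λ] (leftRestriction k Λ).obj S where
  toFun s := ((1 ⊗ₜ[k] MulOpposite.op b : Λ ⊗[k] Λᵐᵒᵖ) • (show S from s) : S)
  map_add' s t := smul_add (A := S) _ s t
  map_smul' a s := by
    refine (smul_smul (α := S) _ _ s).trans (Eq.trans ?_ (smul_smul (α := S) _ _ s).symm)
    refine congrArg (· • (show S from s)) ?_
    change _ = (a ⊗ₜ[k] (1 : Λᵐᵒᵖ)) * _
    rw [Algebra.TensorProduct.tmul_mul_tmul]
    change (1 ⊗ₜ[k] MulOpposite.op b) * (a ⊗ₜ[k] (1 : Λᵐᵒᵖ)) = _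
    rw [Algebra.TensorProduct.tmul_mul_tmul, one_mul, one_mul, mul_one, mul_one]

theorem rightMul_mul (S : ModuleCat.{u} (Λ ⊗[k] Λᵐᵒᵖ)) (b c : Λ) (s : S) :
    rightMul S (b * c) s = rightMul S c (rightMul S b s) := by
  have h : (1 ⊗ₜ[k] MulOpposite.op (b * c) : Λ ⊗[k] Λᵐᵒᵖ) =
      (1 ⊗ₜ[k] MulOpposite.op c) * (1 ⊗ₜ[k] MulOpposite.op b) := by
    rw [Algebra.TensorProduct.tmul_mul_tmul, one_mul]
    rfl
  exact (congrArg (fun z : Λ ⊗[k] Λᵐᵒᵖ => (z • s : S)) h).trans (mul_smul _ _ s)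

theorem rightMul_add (S : ModuleCat.{u} (Λ ⊗[k] Λᵐᵒᵖ)) (b c : Λ) (s : S) :
    rightMul S (b + c) s = rightMul S b s + rightMul S c s :=
  (congrArg (fun z : Λ ⊗[k] Λᵐᵒᵖ => (z • s : S)) (TensorProduct.tmul_add (R := k) (1 : Λ)
    (MulOpposite.op b) (MulOpposite.op c))).trans (add_smul _ _ s)

/-- The left module of morphisms from a bimodule to a left module. -/
noncomputable def leftHom (S : ModuleCat.{u} (Λ ⊗[k] Λᵐᵒᵖ)) (Y : ModuleCat.{u} Λ) :
    ModuleCat.{u} Λ :=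
  letI : SMul Λ ((leftRestriction k Λ).obj S →ₗ[Λ] Y) := ⟨fun b φ => φ ∘ₗ rightMul S b⟩
  letI : Module Λ ((leftRestriction k Λ).obj S →ₗ[Λ] Y) := Module.ofMinimalAxioms
    (fun _ _ _ => rfl)
    (fun b c φ => LinearMap.ext fun s => (congrArg φ (rightMul_add S b c s)).trans (map_add φ _ _))
    (fun b c φ => LinearMap.ext fun s => congrArg φ (rightMul_mul S b c s))
    (fun φ => LinearMap.ext fun s => congrArg φ (one_smul (Λ ⊗[k] Λᵐᵒᵖ) (show S from s)))
  ModuleCat.of Λ ((leftRestriction k Λ).obj S →ₗ[Λ] Y)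

theorem algebraMap_smul_leftHom (S : ModuleCat.{u} (Λ ⊗[k] Λᵐᵒᵖ)) (Y : ModuleCat.{u} Λ) (c : k)
    (φ : (leftRestriction k Λ).obj S →ₗ[Λ] Y) (s : S) :
    (show (leftRestriction k Λ).obj S →ₗ[Λ] Y from c • (show leftHom S Y from φ)) s =
      c • φ s := by
  refine Eq.trans ?_ (φ.map_smul (algebraMap k Λ c) s)
  refine congrArg φ (congrArg (fun z : Λ ⊗[k] Λᵐᵒᵖ => (z • s : S)) ?_)
  change 1 ⊗ₜ[k] algebraMap k Λᵐᵒᵖ c = algebraMap k Λ c ⊗ₜ[k] 1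
  rw [Algebra.algebraMap_eq_smul_one, Algebra.algebraMap_eq_smul_one, TensorProduct.smul_tmul]

/-- The evaluation map from a bimodule to the bidual with respect to a left module. -/
noncomputable def evalBimodule (S : ModuleCat.{u} (Λ ⊗[k] Λᵐᵒᵖ)) (Y : ModuleCat.{u} Λ) :
    S ⟶ homBimodule k (leftHom S Y) Y :=
  bimoduleHom
    { toFun s := (show leftHom S Y →ₗ[k] Y from
        { toFun φ := (show (leftRestriction k Λ).obj S →ₗ[Λ] Y from φ) s
          map_add' φ ψ := rfl
          map_smul' c φ := algebraMap_smul_leftHom S Y c φ s })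
      map_zero' := LinearMap.ext fun φ =>
        map_zero (show (leftRestriction k Λ).obj S →ₗ[Λ] Y from φ)
      map_add' s t := LinearMap.ext fun φ =>
        map_add (show (leftRestriction k Λ).obj S →ₗ[Λ] Y from φ) s t } fun a b s => by
    refine LinearMap.ext fun φ => ?_
    refine Eq.trans ?_ (homBimodule_smul (leftHom S Y) Y a b _ φ).symm
    refine Eq.trans (congrArg (show (leftRestriction k Λ).obj S →ₗ[Λ] Y from φ) ?_)
      ((show (leftRestriction k Λ).obj S →ₗ[Λ] Y from φ).map_smul a (rightMul S b s))
    refine Eq.trans (congrArg (· • s) ?_) (mul_smul (a ⊗ₜ[k] (1 : Λᵐᵒᵖ)) _ s)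
    rw [Algebra.TensorProduct.tmul_mul_tmul, mul_one, one_mul]

/-- Linearly independent morphisms to a simple module are jointly surjective. -/
theorem surjective_pi_of_linearIndependent [IsAlgClosed k] {V Y : ModuleCat.{u} Λ}
    [IsSimpleModule Λ Y] [Module.Finite k Y] {ι : Type*} [Fintype ι] (f : ι → (V →ₗ[Λ] Y))
    (hf : ∀ c : ι → k, (∀ v, ∑ i, c i • f i v = 0) → c = 0) :
    Function.Surjective (LinearMap.pi f) := by
  classical
  rw [← LinearMap.range_eq_top]
  have : Module.Finite Λ (ι → Y) := inferInstance
  refine (eq_top_or_exists_le_coatom _).resolve_right ?_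
  -- A maximal submodule P containing the image has simple quotient. Some coordinate copy of Y maps
  -- isomorphically to it, which produces a Λ-linear form l from Y^ι to Y vanishing on the image.
  rintro ⟨P, hP, hle⟩
  have := isSimpleModule_iff_isCoatom.2 hP
  obtain ⟨i, hi⟩ : ∃ i, P.mkQ ∘ₗ LinearMap.single Λ (fun _ => Y) i ≠ 0 := by
    by_contra! h
    have h0 : P.mkQ = 0 := LinearMap.pi_ext' h
    have := IsSimpleModule.nontrivial Λ ((ι → Y) ⧸ P)
    obtain ⟨z, hz⟩ := exists_ne (0 : (ι → Y) ⧸ P)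
    obtain ⟨y, rfl⟩ := P.mkQ_surjective z
    exact hz (LinearMap.congr_fun h0 y)
  let e := LinearEquiv.ofBijective _ (LinearMap.bijective_of_ne_zero hi)
  let l : (ι → Y) →ₗ[Λ] Y := e.symm.toLinearMap ∘ₗ P.mkQ
  have hl (v : V) : l (LinearMap.pi f v) = 0 := by
    have : P.mkQ (LinearMap.pi f v) = 0 := (Submodule.Quotient.mk_eq_zero P).2 (hle ⟨v, rfl⟩)
    rw [LinearMap.comp_apply, this, map_zero]
  -- By Schur's lemma over the algebraically closed field, l is a k-linear combination of the
  -- coordinates; independence forces all its coefficients to be zero.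
  choose c hc using fun j => (IsSimpleModule.algebraMap_end_bijective_of_isAlgClosed k).surjective
    (l ∘ₗ LinearMap.single Λ (fun _ => Y) j)
  have hsum (y : ι → Y) : l y = ∑ j, c j • y j := by
    conv_lhs => rw [← LinearMap.sum_single_apply (φ := fun _ => (Y : Type u)) y, map_sum]
    exact Finset.sum_congr rfl fun j _ => (LinearMap.congr_fun (hc j) (y j)).symm
  have h0 := hf c fun v => (hsum _).symm.trans (hl v)
  refine hi (LinearMap.ext fun y => e.symm.injective ?_)
  have h1 := LinearMap.congr_fun (hc i) y
  rw [h0] at h1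
  exact h1.symm.trans ((zero_smul k y).trans (map_zero e.symm).symm)

/-- A finite dimensional simple bimodule is a bimodule of linear maps. -/
theorem exists_linearEquiv_homBimodule [IsAlgClosed k] (S : ModuleCat.{u} (Λ ⊗[k] Λᵐᵒᵖ))
    [IsSimpleModule (Λ ⊗[k] Λᵐᵒᵖ) S] (hS : Module.Finite k ((leftRestriction k Λ).obj S)) :
    ∃ X Y : ModuleCat.{u} Λ, Module.Finite Λ X ∧
      Nonempty (homBimodule k X Y ≃ₗ[Λ ⊗[k] Λᵐᵒᵖ] S) := by
  have : IsNoetherian Λ ((leftRestriction k Λ).obj S) := isNoetherian_of_tower k inferInstance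
  have hnt := IsSimpleModule.nontrivial (Λ ⊗[k] Λᵐᵒᵖ) S
  have : Nontrivial ((leftRestriction k Λ).obj S) := hnt
  obtain ⟨N, hN⟩ := IsCoatomic.exists_coatom (Submodule Λ ((leftRestriction k Λ).obj S))
  -- A simple quotient of S as a left module; X will be the space of left linear maps from S to Y.
  let Y : ModuleCat.{u} Λ := ModuleCat.of Λ ((leftRestriction k Λ).obj S ⧸ N)
  let q : (leftRestriction k Λ).obj S →ₗ[Λ] Y := N.mkQ
  have : IsSimpleModule Λ Y := isSimpleModule_iff_isCoatom.2 hN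
  have : Module.Finite k Y := Module.Finite.of_surjective (q.restrictScalars k) N.mkQ_surjective
  have hX : Module.Finite k (leftHom S Y) := by
    let i : leftHom S Y →ₗ[k] ((leftRestriction k Λ).obj S →ₗ[k] Y) :=
      { toFun φ := (show (leftRestriction k Λ).obj S →ₗ[Λ] Y from φ).restrictScalars k
        map_add' φ ψ := rfl
        map_smul' c φ := LinearMap.ext fun s => algebraMap_smul_leftHom S Y c φ s }
    exact Module.Finite.of_injective i fun φ ψ h => LinearMap.ext fun s => LinearMap.congr_fun h s
  refine ⟨leftHom S Y, Y, Module.Finite.of_restrictScalars_finite k Λ _,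
    ⟨(LinearEquiv.ofBijective (evalBimodule S Y).hom ⟨?_, fun ψ => ?_⟩).symm⟩⟩
  -- S is simple and evaluation at the quotient map q is not zero.
  · refine (LinearMap.injective_or_eq_zero _).resolve_right fun h => hN.1 (eq_top_iff.2 fun s _ => ?_)
    refine (Submodule.Quotient.mk_eq_zero N).1 ?_
    exact LinearMap.congr_fun (f := (show leftHom S Y →ₗ[k] Y from (evalBimodule S Y).hom s))
      (LinearMap.congr_fun h s) q
  -- Surjectivity is the density statement applied to a basis of the left linear maps.
  · let b := Module.finBasis k (leftHom S Y)
    obtain ⟨s, hs⟩ := surjective_pi_of_linearIndependent (k := k)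
      (fun i => (show (leftRestriction k Λ).obj S →ₗ[Λ] Y from b i)) (fun c hc => by
        have h0 : ∑ i, c i • b i = 0 := by
          refine LinearMap.ext fun s => Eq.trans ?_ (hc s)
          have h1 := map_sum (show leftHom S Y →ₗ[k] Y from (evalBimodule S Y).hom s)
            (fun i => c i • b i) Finset.univ
          exact h1.trans (Finset.sum_congr rfl fun i _ => algebraMap_smul_leftHom S Y _ _ s)
        exact funext (Fintype.linearIndependent_iff.1 b.linearIndependent c h0))
      (fun i => (show leftHom S Y →ₗ[k] Y from ψ) (b i))
    refine ⟨s, b.ext (f₁ := (show leftHom S Y →ₗ[k] Y from (evalBimodule S Y).hom s)) fun i => ?_⟩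
    exact congrFun hs i

end SimpleBimodule

end NCCR

namespace NCCR

open Abelian
open scoped TensorProduct

/-! ### The enveloping algebra over R ⊗ R, and smoothness -/

section EnvelopingAlgebra

variable (k : Type v) [Field k] (R Λ : Type u) [CommRing R] [Algebra k R] [Ring Λ]
  [Algebra k Λ] [Algebra R Λ] [IsScalarTower k R Λ]

/-- The enveloping algebra of an `R`-algebra as an algebra over `R ⊗ R`. -/
noncomputable abbrev envelopingAlgebra : Algebra (R ⊗[k] R) (Λ ⊗[k] Λᵐᵒᵖ) :=
  (Algebra.TensorProduct.map (IsScalarTower.toAlgHom k R Λ)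
    (IsScalarTower.toAlgHom k R Λᵐᵒᵖ)).toRingHom.toAlgebra' fun c x => by
      change Algebra.TensorProduct.map (IsScalarTower.toAlgHom k R Λ)
        (IsScalarTower.toAlgHom k R Λᵐᵒᵖ) c * x = x * Algebra.TensorProduct.map
          (IsScalarTower.toAlgHom k R Λ) (IsScalarTower.toAlgHom k R Λᵐᵒᵖ) c
      induction c using TensorProduct.induction_on with
      | zero => rw [map_zero, zero_mul, mul_zero]
      | add c d hc hd => rw [map_add, add_mul, mul_add, hc, hd]
      | tmul r s =>
        induction x using TensorProduct.induction_on with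
        | zero => rw [zero_mul, mul_zero]
        | add x y hx hy => rw [add_mul, mul_add, hx, hy]
        | tmul a b =>
          rw [Algebra.TensorProduct.map_tmul, Algebra.TensorProduct.tmul_mul_tmul,
            Algebra.TensorProduct.tmul_mul_tmul]
          exact congrArg₂ (· ⊗ₜ[k] ·) (Algebra.commutes r a) (Algebra.commutes s b)

attribute [local instance] envelopingAlgebra

theorem tmul_smul_tmul (r s : R) (a : Λ) (b : Λᵐᵒᵖ) :
    (r ⊗ₜ[k] s) • (a ⊗ₜ[k] b) = (r • a) ⊗ₜ[k] (s • b) := by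
  rw [Algebra.smul_def, Algebra.smul_def r, Algebra.smul_def s]
  exact Algebra.TensorProduct.tmul_mul_tmul _ _ _ _

instance finite_envelopingAlgebra [Module.Finite R Λ] :
    Module.Finite (R ⊗[k] R) (Λ ⊗[k] Λᵐᵒᵖ) := by
  obtain ⟨s, hs⟩ := Module.Finite.fg_top (R := R) (M := Λ)
  obtain ⟨t, ht⟩ := Module.Finite.fg_top (R := R) (M := Λᵐᵒᵖ)
  refine ⟨(Submodule.fg_def).2 ⟨Set.image2 (fun a b => a ⊗ₜ[k] b) s t,
    s.finite_toSet.image2 _ t.finite_toSet, eq_top_iff.2 fun x _ => ?_⟩⟩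
  induction x using TensorProduct.induction_on with
  | zero => exact zero_mem _
  | add x y hx hy => exact add_mem (hx trivial) (hy trivial)
  | tmul a b =>
    have ha : a ∈ Submodule.span R (s : Set Λ) := hs ▸ trivial
    have hb : b ∈ Submodule.span R (t : Set Λᵐᵒᵖ) := ht ▸ trivial
    induction ha using Submodule.span_induction with
    | zero => rw [TensorProduct.zero_tmul]; exact zero_mem _
    | add x y _ _ hx hy => rw [TensorProduct.add_tmul]; exact add_mem (hx trivial) (hy trivial)
    | smul r x _ hx =>
      have h := tmul_smul_tmul k R Λ r 1 x b
      rw [one_smul] at h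
      exact h ▸ Submodule.smul_mem _ _ (hx trivial)
    | mem a ha =>
      induction hb using Submodule.span_induction with
      | zero => rw [TensorProduct.tmul_zero]; exact zero_mem _
      | add x y _ _ hx hy => rw [TensorProduct.tmul_add]; exact add_mem (hx trivial) (hy trivial)
      | smul r x _ hx =>
        have h := tmul_smul_tmul k R Λ 1 r a x
        rw [one_smul] at h
        exact h ▸ Submodule.smul_mem _ _ (hx trivial)
      | mem b hb => exact Submodule.subset_span ⟨a, ha, b, hb, rfl⟩

theorem finiteType_tensorProduct [Algebra.FiniteType k R] : Algebra.FiniteType k (R ⊗[k] R) :=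
  Algebra.FiniteType.trans (S := R) ‹_› inferInstance

attribute [local instance] restrictedModule restrictedModule_isScalarTower

-- S is finite over R ⊗ R with maximal annihilator, and by the Nullstellensatz the residue field is
-- finite over k.
attribute [local instance] scalarModule scalarModule_isScalarTower in
theorem finite_of_isSimpleModule [Algebra.FiniteType k R] [Module.Finite R Λ]
    (S : ModuleCat.{u} (Λ ⊗[k] Λᵐᵒᵖ)) [IsSimpleModule (Λ ⊗[k] Λᵐᵒᵖ) S] :
    Module.Finite k ((leftRestriction k Λ).obj S) := by
  have := finiteType_tensorProduct k R
  have : IsNoetherianRing (R ⊗[k] R) := Algebra.FiniteType.isNoetherianRing k _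
  have hm := isMaximal_annihilator_of_isSimpleModule (R ⊗[k] R) S
  let := Ideal.Quotient.field (Module.annihilator (R ⊗[k] R) S)
  have : Module.Finite k (R ⊗[k] R ⧸ Module.annihilator (R ⊗[k] R) S) :=
    finite_of_finite_type_of_isJacobsonRing _ _
  have : Module.Finite (R ⊗[k] R) S := Module.Finite.trans (Λ ⊗[k] Λᵐᵒᵖ) S
  let : Module (R ⊗[k] R ⧸ Module.annihilator (R ⊗[k] R) S) S := Module.quotientAnnihilator
  have : IsScalarTower (R ⊗[k] R) (R ⊗[k] R ⧸ Module.annihilator (R ⊗[k] R) S) S :=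
    ⟨fun c d x => by
      obtain ⟨d, rfl⟩ := Ideal.Quotient.mk_surjective d
      exact mul_smul c d x⟩
  have : Module.Finite (R ⊗[k] R ⧸ Module.annihilator (R ⊗[k] R) S) S :=
    Module.Finite.of_restrictScalars_finite (R ⊗[k] R) _ _
  let : Module k S := Module.compHom S (algebraMap k (R ⊗[k] R ⧸ Module.annihilator (R ⊗[k] R) S))
  have : IsScalarTower k (R ⊗[k] R ⧸ Module.annihilator (R ⊗[k] R) S) S := .of_compHom ..
  have hfin : Module.Finite k S :=
    Module.Finite.trans (R ⊗[k] R ⧸ Module.annihilator (R ⊗[k] R) S) S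
  -- The k-structure through the residue field of R ⊗ R is compared with the one through the left
  -- action of Λ.
  let i : S →ₗ[k] (leftRestriction k Λ).obj S :=
    { toFun s := s
      map_add' s t := rfl
      map_smul' c s := by
        exact congrArg (fun z : Λ ⊗[k] Λᵐᵒᵖ => (z • s : S)) (AlgHom.commutes
          (Algebra.TensorProduct.map (IsScalarTower.toAlgHom k R Λ)
            (IsScalarTower.toAlgHom k R Λᵐᵒᵖ)) c) }
  exact Module.Finite.of_surjective i fun s => ⟨s, rfl⟩

end EnvelopingAlgebra

/-- The algebra `Λ` as a bimodule over itself. -/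
noncomputable def regularBimodule (k : Type v) [Field k] (Λ : Type u) [Ring Λ] [Algebra k Λ] :
    ModuleCat.{u} (Λ ⊗[k] Λᵐᵒᵖ) :=
  letI : Module (Λ ⊗[k] Λᵐᵒᵖ) Λ := TensorProduct.Algebra.module
  ModuleCat.of _ Λ

section

variable (k : Type v) [Field k] (Λ : Type u) [Ring Λ] [Algebra k Λ]

theorem tmul_smul_regularBimodule (a b x : Λ) :
    (a ⊗ₜ[k] MulOpposite.op b) • (show regularBimodule k Λ from x) = a * (x * b) :=
  TensorProduct.Algebra.smul_def a (MulOpposite.op b) x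

instance : Module.Finite (Λ ⊗[k] Λᵐᵒᵖ) (regularBimodule k Λ) :=
  Module.Finite.of_surjective (LinearMap.toSpanSingleton (Λ ⊗[k] Λᵐᵒᵖ) (regularBimodule k Λ)
    (1 : Λ)) fun (a : Λ) => ⟨a ⊗ₜ[k] MulOpposite.op 1,
      (tmul_smul_regularBimodule k Λ a 1 1).trans (by rw [mul_one, mul_one])⟩

theorem projective_leftRestriction_regularBimodule :
    Projective ((leftRestriction k Λ).obj (regularBimodule k Λ)) := by
  let e : Λ ≃ₗ[Λ] (leftRestriction k Λ).obj (regularBimodule k Λ) :=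
    { toFun a := a
      invFun a := a
      left_inv a := rfl
      right_inv a := rfl
      map_add' a b := rfl
      map_smul' a b := ((tmul_smul_regularBimodule k Λ a 1 b).trans (by rw [mul_one]; rfl)).symm }
  exact (IsProjective.iff_projective ((leftRestriction k Λ).obj (regularBimodule k Λ))).1
    (Module.Projective.of_equiv e)

end

attribute [local instance] envelopingAlgebra in
/-- A finite algebra of finite global dimension over a finitely generated commutative algebra over
an algebraically closed field is smooth. -/
theorem isSmoothAlgebra {k : Type v} [Field k] [IsAlgClosed k] (R : Type u) {Λ : Type u}
    [CommRing R] [Algebra k R] [Algebra.FiniteType k R] [Ring Λ] [Algebra k Λ] [Algebra R Λ]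
    [IsScalarTower k R Λ] [Module.Finite R Λ] (h : HasFiniteGlobalDimension Λ) :
    IsSmoothAlgebra k Λ := by
  obtain ⟨g, hg⟩ := h
  have := finiteType_tensorProduct k R
  have : IsNoetherianRing (R ⊗[k] R) := Algebra.FiniteType.isNoetherianRing k _
  have : IsNoetherianRing R := Algebra.FiniteType.isNoetherianRing k _
  have : IsNoetherianRing (Λ ⊗[k] Λᵐᵒᵖ) := IsNoetherianRing.of_finite (R ⊗[k] R) _
  have : IsNoetherianRing Λ := IsNoetherianRing.of_finite R _
  refine isPerfect_singleFunctor (regularBimodule k Λ) (hasProjectiveDimensionLE_of_forall_finite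
    (g := g) fun Y _ => subsingleton_ext_of_forall_isSimpleModule (R ⊗[k] R) (fun S _ => ?_) Y)
  -- The simple bimodule is Hom_k(X, Z), and X has projective dimension at most g, so the Ext in
  -- degree g + 1 vanishes.
  obtain ⟨X, Z, _, ⟨e⟩⟩ := exists_linearEquiv_homBimodule S (finite_of_isSimpleModule k R Λ S)
  have := hg X
  exact subsingleton_ext_right_of_equiv e (subsingleton_ext_homBimodule
    (projective_leftRestriction_regularBimodule k Λ) Z X (Nat.lt_succ_self g))

end NCCR

namespace NCCR

/-! ### Assembly of the resolution -/

section Main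

variable {R : Type u} [CommRing R] [IsNoetherianRing R] {Λ : Type u} [Ring Λ] [IsNoetherianRing Λ]
  [Algebra R Λ] [Module.Finite R Λ] (hΛ : IsPerfect Λ = IsBoundedCoherent Λ)

theorem isBoundedCoherent_Q_single (V : ModuleCat.{u} Λ) [Module.Finite Λ V] :
    ((IsBoundedCoherent Λ).inverseImage (DerivedCategory.Q (C := ModuleCat.{u} Λ)))
      ((HomologicalComplex.single _ (.up ℤ) 0).obj V) :=
  isBoundedCoherent_Q_obj _ 0 0 fun n => by
    by_cases hn : n = 0
    · subst hn
      exact Module.Finite.equiv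
        (HomologicalComplex.singleObjXSelf (.up ℤ) 0 V).symm.toLinearEquiv
    · have := ModuleCat.subsingleton_of_isZero
        (HomologicalComplex.isZero_single_obj_X (.up ℤ) 0 V n hn)
      infer_instance

attribute [local instance] restrictedModule restrictedModule_isScalarTower algebraLinear

theorem quasiIso_unit_resolve (V : ModuleCat.{u} Λ)
    (hV : ((IsBoundedCoherent Λ).inverseImage (DerivedCategory.Q (C := ModuleCat.{u} Λ)))
      ((HomologicalComplex.single _ (.up ℤ) 0).obj V))
    (hext : ExtVanishes V V) (hbij : Function.Bijective (fun r : R => r • 𝟙 V)) :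
    QuasiIso ((tensorHomAdjunction R ((resolve _ hΛ).functor.obj
      ((DbMod.ofComplex Λ).obj ⟨_, hV⟩)).obj.as).unit.app
        ((HomologicalComplex.single _ (.up ℤ) 0).obj (ModuleCat.of R R))) :=
  quasiIso_unit _ (resolutionIso hΛ ⟨_, hV⟩ ≪≫
    (DerivedCategory.quotientCompQhIso (ModuleCat.{u} Λ)).app _ ≪≫
      ((DerivedCategory.singleFunctorIsoCompQ (ModuleCat.{u} Λ) 0).app V).symm) hext hbij

include hΛ in
/-- The strongly crepant categorical resolution given by a symmetric algebra of finite global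
dimension and a module with endomorphism ring `R`. -/
theorem exists_stronglyCrepantCategoricalResolution {k : Type v} [Field k] [Algebra k R]
    [Algebra k Λ] [IsScalarTower k R Λ] (hsm : IsSmoothAlgebra k Λ) {tr : Λ →ₗ[R] R}
    (htr : ∀ x y, tr (x * y) = tr (y * x)) (hinj : ∀ x, (∀ y, tr (x * y) = 0) → x = 0)
    (hsurj : ∀ φ : Λ →ₗ[R] R, ∃ x, ∀ y, tr (x * y) = φ y)
    (hCM : ExtVanishes (ModuleCat.of R Λ) (ModuleCat.of R R)) (V : ModuleCat.{u} Λ)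
    [Module.Finite Λ V] (hext : ExtVanishes V V)
    (hbij : Function.Bijective (fun r : R => r • 𝟙 V)) :
    ∃ S : StronglyCrepantCategoricalResolution k R (DbMod Λ),
      S.toCategoricalResolution.IsDerivedTensor V ∧ S.toPerfModule.IsDerivedTensor := by
  have hV := isBoundedCoherent_Q_single V
  exact ⟨{ categoricalResolution hΛ hsm ((DbMod.ofComplex Λ).obj ⟨_, hV⟩)
      (quasiIso_unit_resolve hΛ V hV hext hbij), perfModule hΛ with
      crepant := isRelativeSerreFunctor_refl hΛ htr hinj hsurj hCM
      pullbackLeftLinear := leftLinearTensorRight hΛ _ },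
    isDerivedTensor_tensorRightDbMod hΛ V hV, perfModule_isDerivedTensor hΛ⟩

end Main

end NCCR

theorem mainTheorem4 {R M : Type u} [CommRing R] [IsDomain R] [IsNoetherianRing R]
    [IsIntegrallyClosed R] [AddCommGroup M] [Module R M] [Module.Finite R M]
    [Module.IsReflexive R M] (hΛ : NCCR.IsNCCR R (Module.End R M)) (hR : ringKrullDim R ≤ 3) :
    (∀ i : ℕ, 0 < i → Subsingleton (Abelian.Ext (ModuleCat.of (Module.End R M) M)
      (ModuleCat.of (Module.End R M) M) i)) ∧
    ∀ (k : Type v) [Field k] [IsAlgClosed k] [CharZero k] [Algebra k R] [Algebra.FiniteType k R]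
      [Module k M] [IsScalarTower k R M],
      ∃ S : NCCR.StronglyCrepantCategoricalResolution k R (NCCR.DbMod (Module.End R M)),
        S.toCategoricalResolution.IsDerivedTensor (ModuleCat.of (Module.End R M) M) ∧
        S.toPerfModule.IsDerivedTensor := by
  refine ⟨hΛ.extVanishes hR, fun k _ _ _ _ _ _ _ => ?_⟩
  have := hΛ.nontrivial
  obtain ⟨tr, htr, hinj, hsurj⟩ := NCCR.exists_symmetrizing_trace R M
  exact NCCR.exists_stronglyCrepantCategoricalResolution
    (NCCR.isPerfect_eq_isBoundedCoherent hΛ.finiteGlobalDimension)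
    (NCCR.isSmoothAlgebra R hΛ.finiteGlobalDimension) htr hinj hsurj
    (hΛ.maximalCohenMacaulay.extVanishes hΛ.gorenstein) (NCCR.tautologicalModule R M)
    (hΛ.extVanishes hR) NCCR.bijective_smul_id
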